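/- Let $K$ be a field of characteristic $0$; gradings are homological, over $\mathbb Z$, and the Koszul sign rule is used. **Operads and algebras.** Let $P=P(E,R)$ be the binary quadratic operad over $K$ generated by an $\mathbb S_2$-representation $E$ placed in degree $0$, with relations an $\mathbb S_3$-subrepresentation $R$ of the arity $3$ part of the free operad on $E$ (so $P(0)=0$, $P(1)=K$, and $P$ is concentrated in degree $0$). Let $P^{¡}=C(sE,s^2R)$ be its Koszul dual cooperad; $P^{¡}(n)$ is concentrated in degree $n-1$. Assume that $P$ is Koszul: the Koszul complex $(P\circ_\kappa P^{¡})(n)$ is acyclic for every $n\ge 2$. Let $A$ be a dg $P$-algebra. * The operadic filtration of $A$ is $F^nA=\mathrm{Image}(P(n)\otimes A^{\otimes n}\to A)$, $n\ge 1$. It is a descending filtration by subcomplexes. * $A$ is *nilpotent* if in each homological degree its operadic filtration is bounded below: for every $k$ there is an $n\geq 1$ with $F^nA\cap A_k=0$. * The completion of $A$ is the chain complex $A^\wedge=\varprojlim_n A/F^nA$ (the limit is taken in each degree). * $\mathrm QA$ is the bar-cobar resolution of $A$: the free graded $P$-algebra $P(P^{¡}(A))$, whose differential is the derivation given on the generators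 $P^{¡}(A)$ by the sum of the differential of the bar construction $P^{¡}(A)$ and the map $P^{¡}(A)\to P(P^{¡}(A))$ induced by the decomposition of $P^{¡}$ and the canonical twisting morphism $\kappa\colon P^{¡}\to P$. * $A$ is *homotopy complete* if the canonical map $\mathrm QA\to(\mathrm QA)^\wedge$ is a quasi-isomorphism. **Theorem.** 1. Let $P$ be a Koszul operad as above and $A$ a dg $P$-algebra. Then $A$ is homotopy complete in each of the following cases: (a) $A$ is concentrated in nonnegative degrees and nilpotent; (b) $A$ is concentrated in strictly positive degrees; (c) $A$ is concentrated in strictly negative degrees. 2. Let $\mathfrak g$ be a dg Lie algebra over $K$, with lower central series $L^1\mathfrak g=\mathfrak g$, $L^{n+1}\mathfrak g=[\mathfrak g,L^n\mathfrak g]$. Suppose that either (i) $\mathfrak g$ is nilpotent, i.e. for every $k$ there is an $n\ge1$ with $L^n\mathfrak g\cap\mathfrak g_k=0$, and concentrated in nonnegative homological degrees, or (ii) $\mathfrak g$ is concentrated in strictly negative homological degrees. Then $\mathfrak g$ is homotopy complete, as an algebra over the Lie operad. -/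

import Mathlib

open scoped TensorProduct DirectSum

universe u v w w'

noncomputable section

namespace Koszul

section Graded

/-- The Koszul sign `(-1)^n`. -/
def ksign (K : Type u) [Field K] (n : ℤ) : K := ((n.negOnePow : ℤ) : K)

variable {K : Type u} [Field K]

theorem ksign_add (m n : ℤ) : ksign K (m + n) = ksign K m * ksign K n := by
  simp [ksign, Int.negOnePow_add]

theorem ksign_sq (n : ℤ) : ksign K n * ksign K n = 1 := by
  rw [← ksign_add, ksign, Int.negOnePow_even _ ⟨n, rfl⟩]; simp

theorem ksign_eq (n : ℤ) : ksign K n = 1 ∨ ksign K n = -1 := by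
  rcases Int.even_or_odd n with h | h
  · left; rw [ksign, Int.negOnePow_even _ h]; simp
  · right; rw [ksign, Int.negOnePow_odd _ h]; simp

theorem ksign_zero : ksign K 0 = 1 := by simp [ksign]

theorem ksign_one : ksign K 1 = -1 := by simp [ksign]

theorem ksign_neg (n : ℤ) : ksign K (-n) = ksign K n := by
  simp [ksign, Int.negOnePow_neg]

theorem ksign_sub_one (n : ℤ) : ksign K (n - 1) = -ksign K n := by
  rw [sub_eq_add_neg, ksign_add, ksign_neg, ksign_one]; ring

theorem ksign_mul_sub_one (m n : ℤ) : ksign K (m * (n - 1)) = ksign K (m * n) * ksign K m := by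
  rw [show m * (n - 1) = m * n + -m by ring, ksign_add, ksign_neg]

/-- A `ℤ`-graded `K`-vector space (homological grading). -/
structure GMod (K : Type u) [Field K] where
  carrier : Type w
  [addCommGroup : AddCommGroup carrier]
  [module : Module K carrier]
  gr : ℤ → Submodule K carrier
  internal : DirectSum.IsInternal gr

attribute [instance] GMod.addCommGroup GMod.module

instance : CoeSort (GMod.{u, w} K) (Type w) := ⟨GMod.carrier⟩

/-- A criterion for a family of subspaces to be a grading. -/
theorem isInternal_of_components {V : Type w} [AddCommGroup V] [Module K V]
    (gr : ℤ → Submodule K V) (δ : V →ₗ[K] (ℤ →₀ V))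
    (h1 : ∀ k, ∀ x ∈ gr k, δ x = Finsupp.single k x) (h2 : ⨆ k, gr k = ⊤) :
    DirectSum.IsInternal gr := by
  constructor
  · rw [← AddMonoidHom.ker_eq_bot_iff, eq_bot_iff]
    intro x hx
    have hx' : DirectSum.coeLinearMap gr x = 0 := hx
    have key : ∀ y : ⨁ i, gr i, ∀ k, δ (DirectSum.coeLinearMap gr y) k = (y k : V) := by
      intro y k
      induction y using DirectSum.induction_on with
      | zero => simp
      | of i a =>
        rw [DirectSum.coeLinearMap_of, h1 i _ a.2, DirectSum.coe_of_apply, Finsupp.single_apply]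
        split_ifs <;> simp
      | add a b ha hb => simp [ha, hb]
    refine DFinsupp.ext fun k => Subtype.ext ?_
    rw [← key x k, hx']; simp
  · have : LinearMap.range (DirectSum.coeLinearMap gr) = ⊤ := by
      rw [DirectSum.range_coeLinearMap, h2]
    exact LinearMap.range_eq_top.1 this

namespace GMod

variable (V : GMod.{u, w} K)

def decomp : V ≃ₗ[K] ⨁ i, V.gr i :=
  (LinearEquiv.ofBijective (DirectSum.coeLinearMap V.gr) V.internal).symm

theorem decomp_of_mem {i : ℤ} {x : V} (hx : x ∈ V.gr i) :
    V.decomp x = DirectSum.of (fun i => V.gr i) i ⟨x, hx⟩ := by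
  rw [decomp, LinearEquiv.symm_apply_eq]
  exact (DirectSum.coeLinearMap_of V.gr i ⟨x, hx⟩).symm

/-- The linear map out of a graded space glued from linear maps on the graded pieces. -/
def glue {N : Type w'} [AddCommGroup N] [Module K N] (f : ∀ i, V.gr i →ₗ[K] N) : V →ₗ[K] N :=
  (DirectSum.toModule K ℤ N f) ∘ₗ V.decomp.toLinearMap

theorem glue_of_mem {N : Type w'} [AddCommGroup N] [Module K N] (f : ∀ i, V.gr i →ₗ[K] N)
    {i : ℤ} {x : V} (hx : x ∈ V.gr i) : V.glue f x = f i ⟨x, hx⟩ := by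
  simp only [glue, LinearMap.comp_apply, LinearEquiv.coe_coe, V.decomp_of_mem hx]
  exact DirectSum.toModule_lof K i _

theorem iSup_gr : ⨆ i, V.gr i = ⊤ := V.internal.submodule_iSup_eq_top

theorem induction_homog {p : V → Prop} (h : ∀ i, ∀ x ∈ V.gr i, p x)
    (hadd : ∀ x y, p x → p y → p (x + y)) (x : V) : p x := by
  have hx : x ∈ ⨆ i, V.gr i := by rw [V.iSup_gr]; trivial
  exact Submodule.iSup_induction _ (motive := p) hx h (h 0 0 (zero_mem _)) hadd

theorem ext_homog {N : Type w'} [AddCommGroup N] [Module K N] {f g : V →ₗ[K] N}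
    (h : ∀ i, ∀ x ∈ V.gr i, f x = g x) : f = g := by
  ext x
  induction x using V.induction_homog with
  | h i x hx => exact h i x hx
  | hadd x y hx hy => simp [hx, hy]

theorem eq_zero_of_mem {i j : ℤ} (hij : i ≠ j) {x : V} (hi : x ∈ V.gr i) (hj : x ∈ V.gr j) :
    x = 0 := by
  have := V.internal.submodule_iSupIndep.pairwiseDisjoint hij
  exact (Submodule.disjoint_def.1 this) x hi hj

/-- The parity operator, `x ↦ (-1)^|x| x`. -/
def parity : V →ₗ[K] V := V.glue fun i => ksign K i • (V.gr i).subtype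

theorem parity_of_mem {i : ℤ} {x : V} (hx : x ∈ V.gr i) : V.parity x = ksign K i • x := by
  simp [parity, V.glue_of_mem _ hx]

theorem parity_parity (x : V) : V.parity (V.parity x) = x := by
  induction x using V.induction_homog with
  | h i x hx =>
    rw [V.parity_of_mem hx, map_smul, V.parity_of_mem hx, smul_smul, ksign_sq, one_smul]
  | hadd x y hx hy => simp [hx, hy]

theorem parity_mem {i : ℤ} {x : V} (hx : x ∈ V.gr i) : V.parity x ∈ V.gr i := by
  rw [V.parity_of_mem hx]; exact Submodule.smul_mem _ _ hx

theorem parity_anticomm (f : V →ₗ[K] V) (hf : ∀ i, ∀ x ∈ V.gr i, f x ∈ V.gr (i - 1)) (x : V) :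
    V.parity (f x) = -f (V.parity x) := by
  induction x using V.induction_homog with
  | h i x hx =>
    rw [V.parity_of_mem hx, V.parity_of_mem (hf i x hx), map_smul, ksign_sub_one, neg_smul]
  | hadd x y hx hy => simp [hx, hy]; abel

/-- A graded vector space concentrated in degree `0`. -/
def inDegreeZero (K : Type u) [Field K] (V : Type w) [AddCommGroup V] [Module K V] : GMod K where
  carrier := V
  gr := fun i => if i = 0 then ⊤ else ⊥
  internal := by
    refine isInternal_of_components _ (Finsupp.lsingle 0) ?_ ?_
    · intro k x hx
      by_cases hk : k = 0
      · subst hk; rfl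
      · simp only [hk, if_false, Submodule.mem_bot] at hx
        simp [hx]
    · exact eq_top_iff.2 (le_iSup_of_le 0 (by simp))

end GMod

end Graded

section Quadratic

/-- Binary quadratic data `(E, R)` in homological degree `0`. `E` is the `S₂`-module of generating
binary operations (`τ` is the action of the transposition), and `R` is an `S₃`-submodule of the
arity three part of the free operad on `E`. The latter is `(E ⊗ E)³`: the three copies of `e ⊗ e'`
are the operations `e(e'(x,y),z)`, `e(e'(y,z),x)` and `e(e'(z,x),y)`. The two closure conditions
on `R` are stability under the `3`-cycle and under the transposition of `x` and `y`.
The data present the operad `P(E,R)`, the quotient of the free operad on `E` by `(R)`. -/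
structure QuadData (K : Type u) [Field K] where
  E : Type v
  [addCommGroup : AddCommGroup E]
  [module : Module K E]
  τ : E →ₗ[K] E
  τ_τ : ∀ e, τ (τ e) = e
  R : Submodule K (Fin 3 → E ⊗[K] E)
  R_rot : ∀ r ∈ R, (fun t => r (t + 1)) ∈ R
  R_swap : ∀ r ∈ R, ![τ.lTensor E (r 0), τ.lTensor E (r 2), τ.lTensor E (r 1)] ∈ R

attribute [instance] QuadData.addCommGroup QuadData.module

variable {K : Type u} [Field K]

/-- The same generating operations, without relations: its operad is the free operad on `E`. -/
abbrev QuadData.magma (Q : QuadData.{u, v} K) : QuadData.{u, v} K where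
  E := Q.E
  τ := Q.τ
  τ_τ := Q.τ_τ
  R := ⊥
  R_rot := by
    intro r hr
    rw [Submodule.mem_bot] at hr ⊢
    subst hr; rfl
  R_swap := by
    intro r hr
    rw [Submodule.mem_bot] at hr ⊢
    subst hr
    funext t
    fin_cases t <;> simp

/-- `tri μ x y z (e ⊗ e') = e(e'(x,y),z)`. -/
def tri {E : Type v} [AddCommGroup E] [Module K E] {N : Type w} [AddCommGroup N] [Module K N]
    (μ : E →ₗ[K] N →ₗ[K] N →ₗ[K] N) (x y z : N) : E ⊗[K] E →ₗ[K] N :=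
  TensorProduct.lift (LinearMap.mk₂ K (fun e e' => μ e (μ e' x y) z)
    (by simp) (by simp) (by simp) (by simp))

@[simp] theorem tri_tmul {E : Type v} [AddCommGroup E] [Module K E] {N : Type w} [AddCommGroup N]
    [Module K N] (μ : E →ₗ[K] N →ₗ[K] N →ₗ[K] N) (x y z : N) (e e' : E) :
    tri μ x y z (e ⊗ₜ e') = μ e (μ e' x y) z := rfl

/-- `μ` makes the graded module `(N, gr)` an algebra over `(E, R)`, where the generating operations
are placed in degree `s`: Koszul signs are those of permuting the arguments, all operations being
kept to the left of all arguments. For `s = 0` these are the graded algebras over `P(E,R)`. -/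
structure IsAlg (Q : QuadData.{u, v} K) (s : ℤ) {N : Type w} [AddCommGroup N] [Module K N]
    (gr : ℤ → Submodule K N) (μ : Q.E →ₗ[K] N →ₗ[K] N →ₗ[K] N) : Prop where
  mem : ∀ e i j, ∀ x ∈ gr i, ∀ y ∈ gr j, μ e x y ∈ gr (s + i + j)
  symm : ∀ e i j, ∀ x ∈ gr i, ∀ y ∈ gr j, μ (Q.τ e) x y = ksign K (i * j) • μ e y x
  rel : ∀ r ∈ Q.R, ∀ i j k, ∀ x ∈ gr i, ∀ y ∈ gr j, ∀ z ∈ gr k,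
    tri μ x y z (r 0) + ksign K (i * (j + k)) • tri μ y z x (r 1)
      + ksign K (k * (i + j)) • tri μ z x y (r 2) = 0

/-- Formal binary tree monomials: leaves are decorated by homogeneous elements of `V`, vertices by
elements of `E`. -/
inductive Term (E : Type v) (V : GMod.{u, w} K) : Type (max v w)
  | leaf (i : ℤ) (x : V.gr i) : Term E V
  | node (e : E) (l r : Term E V) : Term E V

namespace Term

variable {E : Type v} {V : GMod.{u, w} K}

/-- The degree of a tree monomial whose vertices have degree `s`. -/
def deg (s : ℤ) : Term E V → ℤ
  | leaf i _ => i
  | node _ l r => s + deg s l + deg s r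

end Term

/-- Grafting of two linear combinations of tree monomials along a vertex `e`. -/
def graft {E : Type v} {V : GMod.{u, w} K} (e : E) :
    (Term E V →₀ K) →ₗ[K] (Term E V →₀ K) →ₗ[K] (Term E V →₀ K) :=
  Finsupp.lsum K fun l => (LinearMap.toSpanSingleton K _
    (Finsupp.lmapDomain K K fun r => Term.node e l r))

@[simp] theorem graft_single {E : Type v} {V : GMod.{u, w} K} (e : E) (l r : Term E V) (a b : K) :
    graft e (Finsupp.single l a) (Finsupp.single r b) = Finsupp.single (Term.node e l r) (a * b) := by
  simp [graft]

/-- The tree monomials `e(e'(x,y),z)`, for a formal combination of pairs `(e,e')`. -/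
def triTerm {E : Type v} {V : GMod.{u, w} K} (x y z : Term E V) :
    ((E × E) →₀ K) →ₗ[K] (Term E V →₀ K) :=
  Finsupp.lmapDomain K K fun p => Term.node p.1 (Term.node p.2 x y) z

/-- The tensor in `E ⊗ E` represented by a formal combination of pairs `(e,e')`. -/
def pairTensor (K : Type u) [Field K] (E : Type v) [AddCommGroup E] [Module K E] :
    ((E × E) →₀ K) →ₗ[K] E ⊗[K] E :=
  Finsupp.linearCombination K fun p => p.1 ⊗ₜ[K] p.2

/-- The relations of the free algebra over `(E, R)` with operations in degree `s`: multilinearity,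
equivariance, the relations in `R`, and all their consequences under grafting. -/
inductive Relator (Q : QuadData.{u, v} K) (s : ℤ) (V : GMod.{u, w} K) : (Term Q.E V →₀ K) → Prop
  | leaf_add (i : ℤ) (x y : V.gr i) : Relator Q s V
      (Finsupp.single (Term.leaf i (x + y)) 1 - Finsupp.single (Term.leaf i x) 1
        - Finsupp.single (Term.leaf i y) 1)
  | leaf_smul (i : ℤ) (c : K) (x : V.gr i) : Relator Q s V
      (Finsupp.single (Term.leaf i (c • x)) 1 - c • Finsupp.single (Term.leaf i x) 1)
  | node_add (e e' : Q.E) (l r : Term Q.E V) : Relator Q s V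
      (Finsupp.single (Term.node (e + e') l r) 1 - Finsupp.single (Term.node e l r) 1
        - Finsupp.single (Term.node e' l r) 1)
  | node_smul (c : K) (e : Q.E) (l r : Term Q.E V) : Relator Q s V
      (Finsupp.single (Term.node (c • e) l r) 1 - c • Finsupp.single (Term.node e l r) 1)
  | symm (e : Q.E) (l r : Term Q.E V) : Relator Q s V
      (Finsupp.single (Term.node (Q.τ e) l r) 1
        - ksign K (l.deg s * r.deg s) • Finsupp.single (Term.node e r l) 1)
  | rel (ρ : Fin 3 → (Q.E × Q.E) →₀ K) (hρ : (fun t => pairTensor K Q.E (ρ t)) ∈ Q.R)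
      (x y z : Term Q.E V) : Relator Q s V
      (triTerm x y z (ρ 0) + ksign K (x.deg s * (y.deg s + z.deg s)) • triTerm y z x (ρ 1)
        + ksign K (z.deg s * (x.deg s + y.deg s)) • triTerm z x y (ρ 2))
  | left (e : Q.E) (a : Term Q.E V →₀ K) (r : Term Q.E V) (h : Relator Q s V a) :
      Relator Q s V (graft e a (Finsupp.single r 1))
  | right (e : Q.E) (l : Term Q.E V) (a : Term Q.E V →₀ K) (h : Relator Q s V a) :
      Relator Q s V (graft e (Finsupp.single l 1) a)

variable (Q : QuadData.{u, v} K) (s : ℤ) (V : GMod.{u, w} K)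

def relations : Submodule K (Term Q.E V →₀ K) := Submodule.span K {a | Relator Q s V a}

/-- The underlying space of the free `(E,R)`-algebra on `V`, operations having degree `s`. -/
abbrev FreeCarrier : Type (max u v w) := (Term Q.E V →₀ K) ⧸ relations Q s V

namespace Free

variable {Q s V}

theorem supported_graft (e : Q.E) {k l : ℤ} {a b : Term Q.E V →₀ K}
    (ha : a ∈ Finsupp.supported K K {t | Term.deg s t = k})
    (hb : b ∈ Finsupp.supported K K {t | Term.deg s t = l}) :
    graft e a b ∈ Finsupp.supported K K {t : Term Q.E V | Term.deg s t = s + k + l} := by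
  rw [Finsupp.supported_eq_span_single] at ha hb
  induction ha using Submodule.span_induction with
  | mem a ha =>
    obtain ⟨t, ht, rfl⟩ := ha
    induction hb using Submodule.span_induction with
    | mem b hb =>
      obtain ⟨t', ht', rfl⟩ := hb
      rw [graft_single]
      refine Finsupp.single_mem_supported K _ ?_
      simp only [Set.mem_ofPred_eq] at ht ht' ⊢
      simp [Term.deg, ht, ht']
    | zero => simp
    | add b c _ _ hb hc => rw [map_add]; exact add_mem hb hc
    | smul c b _ hb => rw [map_smul]; exact Submodule.smul_mem _ _ hb
  | zero => simp
  | add a c _ _ ha hc => rw [map_add, LinearMap.add_apply]; exact add_mem ha hc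
  | smul c a _ ha => rw [map_smul, LinearMap.smul_apply]; exact Submodule.smul_mem _ _ ha

theorem supported_triTerm (x y z : Term Q.E V) (ρ : (Q.E × Q.E) →₀ K) :
    triTerm x y z ρ ∈ Finsupp.supported K K
      {t : Term Q.E V | t.deg s = s + s + x.deg s + y.deg s + z.deg s} := by
  induction ρ using Finsupp.induction_linear with
  | zero => simp
  | add a b ha hb => rw [map_add]; exact add_mem ha hb
  | single p c =>
    simp only [triTerm, Finsupp.lmapDomain_apply, Finsupp.mapDomain_single]
    refine Finsupp.single_mem_supported K _ ?_
    simp only [Set.mem_ofPred_eq, Term.deg]; ring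

theorem relator_homogeneous {a : Term Q.E V →₀ K} (h : Relator Q s V a) :
    ∃ k, a ∈ Finsupp.supported K K {t : Term Q.E V | t.deg s = k} := by
  have S : ∀ (t : Term Q.E V) (k : ℤ), t.deg s = k → Finsupp.single t (1 : K) ∈
      Finsupp.supported K K {t : Term Q.E V | t.deg s = k} :=
    fun t k h => Finsupp.single_mem_supported K _ h
  induction h with
  | leaf_add i x y =>
    exact ⟨i, sub_mem (sub_mem (S _ _ rfl) (S _ _ rfl)) (S _ _ rfl)⟩
  | leaf_smul i c x =>
    exact ⟨i, sub_mem (S _ _ rfl) (Submodule.smul_mem _ _ (S _ _ rfl))⟩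
  | node_add e e' l r =>
    exact ⟨_, sub_mem (sub_mem (S _ _ rfl) (S _ _ rfl)) (S _ _ rfl)⟩
  | node_smul c e l r =>
    exact ⟨_, sub_mem (S _ _ rfl) (Submodule.smul_mem _ _ (S _ _ rfl))⟩
  | symm e l r =>
    exact ⟨_, sub_mem (S _ _ rfl) (Submodule.smul_mem _ _ (S _ _ (by simp [Term.deg]; ring)))⟩
  | rel ρ hρ x y z =>
    refine ⟨_, add_mem (add_mem (supported_triTerm x y z _) (Submodule.smul_mem _ _ ?_))
      (Submodule.smul_mem _ _ ?_)⟩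
    · convert supported_triTerm (s := s) y z x (ρ 1) using 4; ring_nf
    · convert supported_triTerm (s := s) z x y (ρ 2) using 4; ring_nf
  | left e a r h ih =>
    obtain ⟨k, hk⟩ := ih
    exact ⟨_, supported_graft e hk (S r _ rfl)⟩
  | right e l a h ih =>
    obtain ⟨k, hk⟩ := ih
    exact ⟨_, supported_graft e (S l _ rfl) hk⟩

/-- The class of a tree monomial. -/
def mk (t : Term Q.E V) : FreeCarrier Q s V :=
  (relations Q s V).mkQ (Finsupp.single t 1)

theorem ext_mk {N : Type w'} [AddCommGroup N] [Module K N] {f g : FreeCarrier Q s V →ₗ[K] N}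
    (h : ∀ t, f (mk t) = g (mk t)) : f = g := by
  refine Submodule.linearMap_qext _ (Finsupp.lhom_ext' fun t => LinearMap.ext_ring ?_)
  exact h t

theorem relations_le {N : Type w'} [AddCommGroup N] [Module K N] (f : Term Q.E V → N)
    (h : ∀ a, Relator Q s V a → Finsupp.linearCombination K f a = 0) :
    relations Q s V ≤ LinearMap.ker (Finsupp.linearCombination K f) :=
  Submodule.span_le.2 h

/-- Linear maps out of the free algebra, from their values on tree monomials. -/
def out {N : Type w'} [AddCommGroup N] [Module K N] (f : Term Q.E V → N)
    (h : ∀ a, Relator Q s V a → Finsupp.linearCombination K f a = 0) :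
    FreeCarrier Q s V →ₗ[K] N :=
  (relations Q s V).liftQ (Finsupp.linearCombination K f) (relations_le f h)

theorem out_mk {N : Type w'} [AddCommGroup N] [Module K N] (f : Term Q.E V → N)
    (h : ∀ a, Relator Q s V a → Finsupp.linearCombination K f a = 0) (t : Term Q.E V) :
    out (s := s) f h (mk t) = f t := by
  rw [out, mk, Submodule.mkQ_apply, Submodule.liftQ_apply, Finsupp.linearCombination_single,
    one_smul]

theorem mkQ_relator {a : Term Q.E V →₀ K} (h : Relator Q s V a) :
    (relations Q s V).mkQ a = 0 := by
  rw [Submodule.mkQ_apply, Submodule.Quotient.mk_eq_zero]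
  exact Submodule.subset_span h

theorem linearCombination_mk (a : Term Q.E V →₀ K) :
    Finsupp.linearCombination K (mk (s := s)) a = (relations Q s V).mkQ a := by
  induction a using Finsupp.induction_linear with
  | zero => simp
  | add a b ha hb => rw [map_add, map_add, ha, hb]
  | single t c =>
    rw [Finsupp.linearCombination_single, mk, ← map_smul, Finsupp.smul_single, smul_eq_mul, mul_one]

/-- The homogeneous part of degree `k`. -/
def gr (k : ℤ) : Submodule K (FreeCarrier Q s V) :=
  Submodule.span K {x | ∃ t : Term Q.E V, t.deg s = k ∧ mk t = x}

theorem mk_mem (t : Term Q.E V) : mk t ∈ gr (s := s) (t.deg s) :=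
  Submodule.subset_span ⟨t, rfl, rfl⟩

theorem linearCombination_single_of_supported {k : ℤ} {a : Term Q.E V →₀ K}
    (ha : a ∈ Finsupp.supported K K {t : Term Q.E V | t.deg s = k}) :
    Finsupp.linearCombination K
      (fun t : Term Q.E V => Finsupp.single (t.deg s) (mk (s := s) t)) a
      = Finsupp.single k ((relations Q s V).mkQ a) := by
  rw [Finsupp.supported_eq_span_single] at ha
  induction ha using Submodule.span_induction with
  | mem a ha =>
    obtain ⟨t, ht, rfl⟩ := ha
    simp only [Set.mem_ofPred_eq] at ht
    simp [ht, mk]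
  | zero => simp
  | add b c _ _ hb hc => rw [map_add, hb, hc, map_add, Finsupp.single_add]
  | smul c b _ hb => rw [map_smul, hb, map_smul, Finsupp.smul_single]

theorem internal : DirectSum.IsInternal (gr (Q := Q) (s := s) (V := V)) := by
  refine isInternal_of_components _
    (out (fun t => Finsupp.single (t.deg s) (mk t)) ?_) ?_ ?_
  · intro a ha
    obtain ⟨k, hk⟩ := relator_homogeneous ha
    rw [linearCombination_single_of_supported hk, mkQ_relator ha, Finsupp.single_zero]
  · intro k x hx
    induction hx using Submodule.span_induction with
    | mem x hx =>
      obtain ⟨t, ht, rfl⟩ := hx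
      rw [out_mk, ht]
    | zero => simp
    | add x y _ _ hx hy => rw [map_add, hx, hy, Finsupp.single_add]
    | smul c x _ hx => rw [map_smul, hx, Finsupp.smul_single]
  · rw [eq_top_iff]
    intro x _
    obtain ⟨a, rfl⟩ := (relations Q s V).mkQ_surjective x
    induction a using Finsupp.induction_linear with
    | zero => simp
    | add a b ha hb => rw [map_add]; exact add_mem (ha trivial) (hb trivial)
    | single t c =>
      have : (relations Q s V).mkQ (Finsupp.single t c) = c • mk t := by
        rw [mk, ← map_smul, Finsupp.smul_single, smul_eq_mul, mul_one]
      rw [this]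
      exact Submodule.smul_mem _ _ (Submodule.mem_iSup_of_mem _ (mk_mem t))

end Free

/-- The free graded `(E,R)`-algebra on the graded space `V`, operations having degree `s`. For
`s = 0` this is the free graded `P(E,R)`-algebra, `P(V) = ⨁ₙ P(n) ⊗_{Sₙ} V^{⊗ n}`. -/
abbrev Free : GMod.{u, max u v w} K where
  carrier := FreeCarrier Q s V
  gr := Free.gr
  internal := Free.internal

end Quadratic

section FreeAlgebra

variable {K : Type u} [Field K] {Q : QuadData.{u, v} K} {s : ℤ} {V : GMod.{u, w} K}

namespace Free

theorem mkQ_single (t : Term Q.E V) (c : K) :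
    (relations Q s V).mkQ (Finsupp.single t c) = c • mk t := by
  rw [mk, ← map_smul, Finsupp.smul_single, smul_eq_mul, mul_one]

theorem node_aux_right (e : Q.E) (l : Term Q.E V) (a : Term Q.E V →₀ K) :
    Finsupp.linearCombination K (fun r => mk (s := s) (Term.node e l r)) a =
      (relations Q s V).mkQ (graft e (Finsupp.single l 1) a) := by
  induction a using Finsupp.induction_linear with
  | zero => simp
  | add a b ha hb => rw [map_add, ha, hb, map_add, map_add]
  | single t c => rw [graft_single, Finsupp.linearCombination_single, mkQ_single, one_mul]

theorem node_aux_left (e : Q.E) (r : Term Q.E V) (a : Term Q.E V →₀ K) :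
    Finsupp.linearCombination K (fun l => mk (s := s) (Term.node e l r)) a =
      (relations Q s V).mkQ (graft e a (Finsupp.single r 1)) := by
  induction a using Finsupp.induction_linear with
  | zero => simp
  | add a b ha hb => rw [map_add, ha, hb, map_add, LinearMap.add_apply, map_add]
  | single t c => rw [graft_single, Finsupp.linearCombination_single, mkQ_single, mul_one]

/-- Grafting a fixed tree monomial on the left. -/
def nodeLeft (e : Q.E) (l : Term Q.E V) : Free Q s V →ₗ[K] Free Q s V :=
  out (fun r => mk (Term.node e l r)) fun a ha => by
    rw [node_aux_right, mkQ_relator (Relator.right e l a ha)]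

theorem nodeLeft_mk (e : Q.E) (l r : Term Q.E V) :
    nodeLeft (s := s) e l (mk r) = mk (Term.node e l r) := out_mk _ _ _

theorem nodeLeft_sum (e : Q.E) (r : Term Q.E V) (a : Term Q.E V →₀ K) :
    Finsupp.linearCombination K (nodeLeft (s := s) e) a (mk r) =
      Finsupp.linearCombination K (fun l => mk (s := s) (Term.node e l r)) a := by
  induction a using Finsupp.induction_linear with
  | zero => simp
  | add a b ha hb => rw [map_add, LinearMap.add_apply, ha, hb, map_add]
  | single t c =>
    rw [Finsupp.linearCombination_single, Finsupp.linearCombination_single, LinearMap.smul_apply,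
      nodeLeft_mk]

/-- Grafting along a fixed vertex. -/
def nodeAt (e : Q.E) : Free Q s V →ₗ[K] Free Q s V →ₗ[K] Free Q s V :=
  out (fun l => nodeLeft e l) fun a ha => by
    refine ext_mk fun r => ?_
    rw [nodeLeft_sum, node_aux_left, mkQ_relator (Relator.left e a r ha)]; rfl

theorem nodeAt_mk (e : Q.E) (l r : Term Q.E V) :
    nodeAt (s := s) e (mk l) (mk r) = mk (Term.node e l r) := by
  rw [nodeAt, out_mk, nodeLeft_mk]

/-- The generating operations of the free algebra. -/
def node : Q.E →ₗ[K] Free Q s V →ₗ[K] Free Q s V →ₗ[K] Free Q s V where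
  toFun e := nodeAt e
  map_add' e e' := by
    refine ext_mk fun l => ext_mk fun r => ?_
    rw [LinearMap.add_apply, LinearMap.add_apply, nodeAt_mk, nodeAt_mk, nodeAt_mk, ← sub_eq_zero,
      ← sub_sub]
    have := mkQ_relator (Relator.node_add (s := s) e e' l r)
    rwa [map_sub, map_sub] at this
  map_smul' c e := by
    refine ext_mk fun l => ext_mk fun r => ?_
    rw [LinearMap.smul_apply, LinearMap.smul_apply, nodeAt_mk, RingHom.id_apply, nodeAt_mk,
      ← sub_eq_zero]
    have := mkQ_relator (Relator.node_smul (s := s) c e l r)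
    rwa [map_sub, map_smul] at this

theorem node_mk (e : Q.E) (l r : Term Q.E V) :
    node (s := s) e (mk l) (mk r) = mk (Term.node e l r) := nodeAt_mk e l r

/-- The inclusion of the homogeneous generators of degree `i`. -/
def leaf (i : ℤ) : V.gr i →ₗ[K] Free Q s V where
  toFun x := mk (Term.leaf i x)
  map_add' x y := by
    rw [← sub_eq_zero, ← sub_sub]
    have := mkQ_relator (Q := Q) (Relator.leaf_add (s := s) i x y)
    rwa [map_sub, map_sub] at this
  map_smul' c x := by
    rw [← sub_eq_zero]
    have := mkQ_relator (Q := Q) (Relator.leaf_smul (s := s) i c x)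
    rwa [map_sub, map_smul] at this

/-- The inclusion of the generators. -/
def ι : V →ₗ[K] Free Q s V := V.glue leaf

theorem ι_of_mem {i : ℤ} {x : V} (hx : x ∈ V.gr i) :
    ι (Q := Q) (s := s) x = mk (Term.leaf i ⟨x, hx⟩) := V.glue_of_mem _ hx

theorem ι_mem {i : ℤ} {x : V} (hx : x ∈ V.gr i) : ι (Q := Q) x ∈ (Free Q s V).gr i := by
  rw [ι_of_mem hx]; exact mk_mem (s := s) (Term.leaf i ⟨x, hx⟩)

/-- The free algebra is generated by `V`. -/
theorem induction_on {p : Free Q s V → Prop} (hι : ∀ i, ∀ x ∈ V.gr i, p (ι x))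
    (hnode : ∀ e, ∀ i j, ∀ x ∈ (Free Q s V).gr i, ∀ y ∈ (Free Q s V).gr j,
      p x → p y → p (node e x y))
    (hadd : ∀ x y, p x → p y → p (x + y)) (hsmul : ∀ (c : K) x, p x → p (c • x))
    (x : Free Q s V) : p x := by
  have hmk : ∀ t : Term Q.E V, p (mk t) := by
    intro t
    induction t with
    | leaf i x =>
      have := hι i x.1 x.2
      rwa [ι_of_mem x.2] at this
    | node e l r hl hr =>
      rw [← node_mk]
      exact hnode e _ _ _ (mk_mem l) _ (mk_mem r) hl hr
  obtain ⟨a, rfl⟩ := (relations Q s V).mkQ_surjective x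
  induction a using Finsupp.induction_linear with
  | zero =>
    have := hsmul 0 _ (hι 0 0 (zero_mem _))
    rw [zero_smul] at this
    rwa [map_zero]
  | add a b ha hb => rw [map_add]; exact hadd _ _ ha hb
  | single t c => rw [mkQ_single]; exact hsmul _ _ (hmk t)

theorem ext {N : Type w'} [AddCommGroup N] [Module K N] {f g : Free Q s V →ₗ[K] N}
    (hι : ∀ i, ∀ x ∈ V.gr i, f (ι x) = g (ι x))
    (hnode : ∀ e, ∀ i j, ∀ x ∈ (Free Q s V).gr i, ∀ y ∈ (Free Q s V).gr j,
      f x = g x → f y = g y → f (node e x y) = g (node e x y)) : f = g := by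
  refine LinearMap.ext fun x => ?_
  induction x using induction_on with
  | hι i x hx => exact hι i x hx
  | hnode e i j x hx y hy h1 h2 => exact hnode e i j x hx y hy h1 h2
  | hadd x y hx hy => rw [map_add, map_add, hx, hy]
  | hsmul c x hx => rw [map_smul, map_smul, hx]

theorem node_mem (e : Q.E) {i j : ℤ} {x y : Free Q s V} (hx : x ∈ (Free Q s V).gr i)
    (hy : y ∈ (Free Q s V).gr j) : node e x y ∈ (Free Q s V).gr (s + i + j) := by
  induction hx using Submodule.span_induction with
  | mem x hx =>
    obtain ⟨t, rfl, rfl⟩ := hx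
    induction hy using Submodule.span_induction with
    | mem y hy =>
      obtain ⟨t', rfl, rfl⟩ := hy
      rw [node_mk]
      exact mk_mem (Term.node e t t')
    | zero => rw [map_zero]; exact zero_mem _
    | add y y' _ _ h h' => rw [map_add]; exact add_mem h h'
    | smul c y _ h => rw [map_smul]; exact Submodule.smul_mem _ _ h
  | zero => rw [map_zero]; exact zero_mem _
  | add x x' _ _ h h' => rw [map_add, LinearMap.add_apply]; exact add_mem h h'
  | smul c x _ h => rw [map_smul, LinearMap.smul_apply]; exact Submodule.smul_mem _ _ h

/-- To prove a linear identity for homogeneous elements, check it on tree monomials. -/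
theorem gr_induction {i : ℤ} {p : (x : Free Q s V) → x ∈ (Free Q s V).gr i → Prop}
    (hmk : ∀ (t : Term Q.E V) (ht : t.deg s = i), p (mk t) (ht ▸ mk_mem t))
    (h0 : p 0 (zero_mem _))
    (hadd : ∀ x y hx hy, p x hx → p y hy → p (x + y) (add_mem hx hy))
    (hsmul : ∀ (c : K) x hx, p x hx → p (c • x) (Submodule.smul_mem _ c hx))
    {x : Free Q s V} (hx : x ∈ (Free Q s V).gr i) : p x hx := by
  induction hx using Submodule.span_induction with
  | mem x hx => obtain ⟨t, ht, rfl⟩ := hx; exact hmk t ht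
  | zero => exact h0
  | add x y hx hy h h' => exact hadd x y hx hy h h'
  | smul c x hx h => exact hsmul c x hx h

theorem node_symm (e : Q.E) {i j : ℤ} {x y : Free Q s V} (hx : x ∈ (Free Q s V).gr i)
    (hy : y ∈ (Free Q s V).gr j) : node (Q.τ e) x y = ksign K (i * j) • node e y x := by
  induction hx using gr_induction with
  | hmk t ht =>
    induction hy using gr_induction with
    | hmk t' ht' =>
      subst ht ht'
      rw [node_mk, node_mk, ← sub_eq_zero]
      have := mkQ_relator (Relator.symm (s := s) e t t')
      rwa [map_sub, map_smul] at this
    | h0 => simp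
    | hadd y y' _ _ h h' => rw [map_add, h, h', map_add, LinearMap.add_apply, smul_add]
    | hsmul c y _ h => rw [map_smul, h, map_smul, LinearMap.smul_apply, smul_comm]
  | h0 => simp
  | hadd x x' _ _ h h' => rw [map_add, LinearMap.add_apply, h, h', map_add, smul_add]
  | hsmul c x _ h => rw [map_smul, LinearMap.smul_apply, h, map_smul, smul_comm]

theorem exists_pairTensor {E : Type v} [AddCommGroup E] [Module K E] (r : E ⊗[K] E) :
    ∃ ρ, pairTensor K E ρ = r := by
  induction r using TensorProduct.induction_on with
  | zero => exact ⟨0, map_zero _⟩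
  | tmul e e' => exact ⟨Finsupp.single (e, e') 1, by simp [pairTensor]⟩
  | add a b ha hb =>
    obtain ⟨ρ, rfl⟩ := ha
    obtain ⟨ρ', rfl⟩ := hb
    exact ⟨ρ + ρ', map_add _ _ _⟩

theorem tri_pairTensor (ρ : (Q.E × Q.E) →₀ K) (x y z : Term Q.E V) :
    tri (node (s := s)) (mk x) (mk y) (mk z) (pairTensor K Q.E ρ)
      = (relations Q s V).mkQ (triTerm x y z ρ) := by
  induction ρ using Finsupp.induction_linear with
  | zero => simp
  | add a b ha hb => rw [map_add, map_add, ha, hb, map_add, map_add]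
  | single p c =>
    rw [pairTensor, Finsupp.linearCombination_single, map_smul, tri_tmul, node_mk, node_mk,
      triTerm, Finsupp.lmapDomain_apply, Finsupp.mapDomain_single, mkQ_single]

end Free

section tri

variable {E : Type v} [AddCommGroup E] [Module K E] {N : Type w} [AddCommGroup N] [Module K N]
  (μ : E →ₗ[K] N →ₗ[K] N →ₗ[K] N)

theorem tri_add_left (x x' y z : N) (r : E ⊗[K] E) :
    tri μ (x + x') y z r = tri μ x y z r + tri μ x' y z r := by
  induction r using TensorProduct.induction_on with
  | zero => simp
  | tmul e e' => simp
  | add a b ha hb => rw [map_add, ha, hb, map_add, map_add]; abel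

theorem tri_add_mid (x y y' z : N) (r : E ⊗[K] E) :
    tri μ x (y + y') z r = tri μ x y z r + tri μ x y' z r := by
  induction r using TensorProduct.induction_on with
  | zero => simp
  | tmul e e' => simp
  | add a b ha hb => rw [map_add, ha, hb, map_add, map_add]; abel

theorem tri_add_right (x y z z' : N) (r : E ⊗[K] E) :
    tri μ x y (z + z') r = tri μ x y z r + tri μ x y z' r := by
  induction r using TensorProduct.induction_on with
  | zero => simp
  | tmul e e' => simp
  | add a b ha hb => rw [map_add, ha, hb, map_add, map_add]; abel

theorem tri_smul_left (c : K) (x y z : N) (r : E ⊗[K] E) :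
    tri μ (c • x) y z r = c • tri μ x y z r := by
  induction r using TensorProduct.induction_on with
  | zero => simp
  | tmul e e' => simp
  | add a b ha hb => rw [map_add, ha, hb, map_add, smul_add]

theorem tri_smul_mid (c : K) (x y z : N) (r : E ⊗[K] E) :
    tri μ x (c • y) z r = c • tri μ x y z r := by
  induction r using TensorProduct.induction_on with
  | zero => simp
  | tmul e e' => simp
  | add a b ha hb => rw [map_add, ha, hb, map_add, smul_add]

theorem tri_smul_right (c : K) (x y z : N) (r : E ⊗[K] E) :
    tri μ x y (c • z) r = c • tri μ x y z r := by
  induction r using TensorProduct.induction_on with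
  | zero => simp
  | tmul e e' => simp
  | add a b ha hb => rw [map_add, ha, hb, map_add, smul_add]

end tri

namespace Free

theorem node_rel (r : Fin 3 → Q.E ⊗[K] Q.E) (hr : r ∈ Q.R) {i j k : ℤ} {x y z : Free Q s V}
    (hx : x ∈ (Free Q s V).gr i) (hy : y ∈ (Free Q s V).gr j) (hz : z ∈ (Free Q s V).gr k) :
    tri node x y z (r 0) + ksign K (i * (j + k)) • tri node y z x (r 1)
      + ksign K (k * (i + j)) • tri node z x y (r 2) = 0 := by
  induction hx using gr_induction with
  | hmk t ht =>
    induction hy using gr_induction with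
    | hmk t' ht' =>
      induction hz using gr_induction with
      | hmk t'' ht'' =>
        subst ht ht' ht''
        choose ρ hρ using fun n => exists_pairTensor (r n)
        rw [← hρ 0, ← hρ 1, ← hρ 2, tri_pairTensor, tri_pairTensor, tri_pairTensor]
        have := mkQ_relator (Relator.rel (s := s) ρ (by rwa [funext hρ]) t t' t'')
        rwa [map_add, map_add, map_smul, map_smul] at this
      | h0 =>
        have h1 := tri_smul_right (node (Q := Q) (s := s) (V := V)) 0 (mk t) (mk t') 0 (r 0)
        have h2 := tri_smul_mid (node (Q := Q) (s := s) (V := V)) 0 (mk t') 0 (mk t) (r 1)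
        have h3 := tri_smul_left (node (Q := Q) (s := s) (V := V)) 0 0 (mk t) (mk t') (r 2)
        rw [zero_smul, zero_smul] at h1 h2 h3
        rw [h1, h2, h3]; simp
      | hadd a b _ _ ha hb =>
        rw [tri_add_left, tri_add_mid, tri_add_right]
        linear_combination (norm := module) ha + hb
      | hsmul c a _ ha =>
        rw [tri_smul_left, tri_smul_mid, tri_smul_right]
        linear_combination (norm := module) c • ha
    | h0 =>
      have h1 := tri_smul_mid (node (Q := Q) (s := s) (V := V)) 0 (mk t) 0 z (r 0)
      have h2 := tri_smul_left (node (Q := Q) (s := s) (V := V)) 0 0 z (mk t) (r 1)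
      have h3 := tri_smul_right (node (Q := Q) (s := s) (V := V)) 0 z (mk t) 0 (r 2)
      rw [zero_smul, zero_smul] at h1 h2 h3
      rw [h1, h2, h3]; simp
    | hadd a b _ _ ha hb =>
      rw [tri_add_left, tri_add_mid, tri_add_right]
      linear_combination (norm := module) ha + hb
    | hsmul c a _ ha =>
      rw [tri_smul_left, tri_smul_mid, tri_smul_right]
      linear_combination (norm := module) c • ha
  | h0 =>
    have h1 := tri_smul_left (node (Q := Q) (s := s) (V := V)) 0 0 y z (r 0)
    have h2 := tri_smul_right (node (Q := Q) (s := s) (V := V)) 0 y z 0 (r 1)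
    have h3 := tri_smul_mid (node (Q := Q) (s := s) (V := V)) 0 z 0 y (r 2)
    rw [zero_smul, zero_smul] at h1 h2 h3
    rw [h1, h2, h3]; simp
  | hadd a b _ _ ha hb =>
    rw [tri_add_left, tri_add_mid, tri_add_right]
    linear_combination (norm := module) ha + hb
  | hsmul c a _ ha =>
    rw [tri_smul_left, tri_smul_mid, tri_smul_right]
    linear_combination (norm := module) c • ha

theorem isAlg : IsAlg Q s (Free Q s V).gr (node (Q := Q) (s := s) (V := V)) where
  mem e _ _ _ hx _ hy := node_mem e hx hy
  symm e _ _ _ hx _ hy := node_symm e hx hy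
  rel r hr _ _ _ _ hx _ hy _ hz := node_rel r hr hx hy hz

section Lift

variable {N : Type w'} [AddCommGroup N] [Module K N] {gr : ℤ → Submodule K N}
  {μ : Q.E →ₗ[K] N →ₗ[K] N →ₗ[K] N}

def treeEval (μ : Q.E →ₗ[K] N →ₗ[K] N →ₗ[K] N) (f : V →ₗ[K] N) : Term Q.E V → N
  | Term.leaf _ x => f x
  | Term.node e l r => μ e (treeEval μ f l) (treeEval μ f r)

theorem treeEval_mem (h : IsAlg Q s gr μ) (f : V →ₗ[K] N) (hf : ∀ i, ∀ x ∈ V.gr i, f x ∈ gr i) :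
    ∀ t : Term Q.E V, treeEval μ f t ∈ gr (t.deg s)
  | Term.leaf i x => hf i x x.2
  | Term.node e l r => h.mem e _ _ _ (treeEval_mem h f hf l) _ (treeEval_mem h f hf r)

theorem treeEval_graft (f : V →ₗ[K] N) (e : Q.E) (a b : Term Q.E V →₀ K) :
    Finsupp.linearCombination K (treeEval μ f) (graft e a b) =
      μ e (Finsupp.linearCombination K (treeEval μ f) a)
        (Finsupp.linearCombination K (treeEval μ f) b) := by
  induction a using Finsupp.induction_linear with
  | zero => simp
  | add a a' h h' => simp only [map_add, LinearMap.add_apply, h, h']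
  | single t c =>
    induction b using Finsupp.induction_linear with
    | zero => simp
    | add b b' h h' => simp only [map_add, h, h']
    | single t' c' =>
      simp only [graft_single, Finsupp.linearCombination_single, treeEval, map_smul,
        LinearMap.smul_apply, smul_smul]
      rw [mul_comm]

theorem treeEval_triTerm (f : V →ₗ[K] N) (x y z : Term Q.E V) (ρ : (Q.E × Q.E) →₀ K) :
    Finsupp.linearCombination K (treeEval μ f) (triTerm x y z ρ) =
      tri μ (treeEval μ f x) (treeEval μ f y) (treeEval μ f z) (pairTensor K Q.E ρ) := by
  induction ρ using Finsupp.induction_linear with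
  | zero => simp
  | add a b ha hb => simp only [map_add, ha, hb]
  | single p c =>
    rw [pairTensor, Finsupp.linearCombination_single, map_smul, tri_tmul,
      triTerm, Finsupp.lmapDomain_apply, Finsupp.mapDomain_single,
      Finsupp.linearCombination_single]
    rfl

theorem treeEval_relator (h : IsAlg Q s gr μ) (f : V →ₗ[K] N)
    (hf : ∀ i, ∀ x ∈ V.gr i, f x ∈ gr i) (a : Term Q.E V →₀ K) (ha : Relator Q s V a) :
    Finsupp.linearCombination K (treeEval μ f) a = 0 := by
  induction ha with
  | leaf_add i x y => simp [treeEval]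
  | leaf_smul i c x => simp [treeEval]
  | node_add e e' l r => simp [treeEval]
  | node_smul c e l r => simp [treeEval]
  | symm e l r =>
    simp only [map_sub, map_smul, Finsupp.linearCombination_single, one_smul, treeEval]
    rw [h.symm e _ _ _ (treeEval_mem h f hf l) _ (treeEval_mem h f hf r), sub_self]
  | rel ρ hρ x y z =>
    simp only [map_add, map_smul, treeEval_triTerm]
    exact h.rel _ hρ _ _ _ _ (treeEval_mem h f hf x) _ (treeEval_mem h f hf y) _
      (treeEval_mem h f hf z)
  | left e a r _ ih => rw [treeEval_graft, ih, map_zero, LinearMap.zero_apply]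
  | right e l a _ ih => rw [treeEval_graft, ih, map_zero]

/-- The universal property of the free algebra: the algebra map extending a degree `0` map. -/
def lift (h : IsAlg Q s gr μ) (f : V →ₗ[K] N) (hf : ∀ i, ∀ x ∈ V.gr i, f x ∈ gr i) :
    Free Q s V →ₗ[K] N :=
  out (treeEval μ f) (treeEval_relator h f hf)

variable (h : IsAlg Q s gr μ) (f : V →ₗ[K] N) (hf : ∀ i, ∀ x ∈ V.gr i, f x ∈ gr i)

theorem lift_ι (x : V) : lift h f hf (ι x) = f x := by
  induction x using V.induction_homog with
  | h i x hx => rw [ι_of_mem hx, lift, out_mk]; rfl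
  | hadd x y hx hy => simp only [map_add, hx, hy]

theorem lift_mem {i : ℤ} {x : Free Q s V} (hx : x ∈ (Free Q s V).gr i) :
    lift h f hf x ∈ gr i := by
  induction hx using gr_induction with
  | hmk t ht => subst ht; rw [lift, out_mk]; exact treeEval_mem h f hf t
  | h0 => rw [map_zero]; exact zero_mem _
  | hadd x y _ _ hx hy => rw [map_add]; exact add_mem hx hy
  | hsmul c x _ hx => rw [map_smul]; exact Submodule.smul_mem _ _ hx

theorem lift_node (e : Q.E) (x y : Free Q s V) :
    lift h f hf (node e x y) = μ e (lift h f hf x) (lift h f hf y) := by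
  have : (node (s := s) (V := V) e).compr₂ (lift h f hf)
      = (μ e).compl₁₂ (lift h f hf) (lift h f hf) := by
    refine ext_mk fun l => ext_mk fun r => ?_
    change lift h f hf (node e (mk l) (mk r)) = μ e (lift h f hf (mk l)) (lift h f hf (mk r))
    rw [node_mk, lift, out_mk, out_mk, out_mk]
    rfl
  exact LinearMap.congr_fun₂ this x y

end Lift

end Free

end FreeAlgebra

section Derivations

variable {K : Type u} [Field K]

/-- Bundling of a trilinear map. -/
def trilinear {E : Type v} {N : Type w} {P : Type w'} [AddCommGroup E] [Module K E]
    [AddCommGroup N] [Module K N] [AddCommGroup P] [Module K P] (c : E → N → N → P)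
    (h1 : ∀ e e' x y, c (e + e') x y = c e x y + c e' x y)
    (h2 : ∀ (a : K) e x y, c (a • e) x y = a • c e x y)
    (h3 : ∀ e x x' y, c e (x + x') y = c e x y + c e x' y)
    (h4 : ∀ (a : K) e x y, c e (a • x) y = a • c e x y)
    (h5 : ∀ e x y y', c e x (y + y') = c e x y + c e x y')
    (h6 : ∀ (a : K) e x y, c e x (a • y) = a • c e x y) :
    E →ₗ[K] N →ₗ[K] N →ₗ[K] P where
  toFun e := LinearMap.mk₂ K (c e) (h3 e) (fun a x y => h4 a e x y) (h5 e) (fun a x y => h6 a e x y)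
  map_add' e e' := by ext x y; exact h1 e e' x y
  map_smul' a e := by ext x y; exact h2 a e x y

variable {Q : QuadData.{u, v} K} {s : ℤ} {V : GMod.{u, w} K}

namespace Free

theorem parity_ι (x : V) : (Free Q s V).parity (ι x) = ι (V.parity x) := by
  induction x using V.induction_homog with
  | h i x hx =>
    rw [V.parity_of_mem hx, (Free Q s V).parity_of_mem (ι_mem hx), map_smul]
  | hadd x y hx hy => simp only [map_add, hx, hy]

theorem parity_node (e : Q.E) (x y : Free Q s V) : (Free Q s V).parity (node e x y) =
    ksign K s • node e ((Free Q s V).parity x) ((Free Q s V).parity y) := by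
  induction x using (Free Q s V).induction_homog with
  | h i x hx =>
    induction y using (Free Q s V).induction_homog with
    | h j y hy =>
      rw [(Free Q s V).parity_of_mem hx, (Free Q s V).parity_of_mem hy,
        (Free Q s V).parity_of_mem (node_mem e hx hy), map_smul, map_smul, LinearMap.smul_apply,
        ksign_add, ksign_add]
      module
    | hadd y y' h h' => simp only [map_add, smul_add, h, h']
  | hadd x x' h h' => simp only [map_add, LinearMap.add_apply, smul_add, h, h']

section Der

/-- The operations on `F ⊕ εF` used to extend odd derivations. -/
def dualOp : Q.E →ₗ[K] (Free Q 0 V × Free Q 0 V) →ₗ[K] (Free Q 0 V × Free Q 0 V) →ₗ[K]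
    (Free Q 0 V × Free Q 0 V) :=
  trilinear (fun e x y => (node e x.1 y.1,
      node e x.2 y.1 + node e ((Free Q 0 V).parity x.1) y.2))
    (fun e e' x y => by
      ext1 <;> simp only [Prod.fst_add, Prod.snd_add, map_add, LinearMap.add_apply]; abel)
    (fun a e x y => by
      ext1 <;> simp only [Prod.smul_fst, Prod.smul_snd, map_smul, LinearMap.smul_apply, smul_add])
    (fun e x x' y => by
      ext1 <;> simp only [Prod.fst_add, Prod.snd_add, map_add, LinearMap.add_apply]; abel)
    (fun a e x y => by
      ext1 <;> simp only [Prod.smul_fst, Prod.smul_snd, map_smul, LinearMap.smul_apply, smul_add])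
    (fun e x y y' => by
      ext1 <;> simp only [Prod.fst_add, Prod.snd_add, map_add]; abel)
    (fun a e x y => by
      ext1 <;> simp only [Prod.smul_fst, Prod.smul_snd, map_smul, smul_add])

theorem dualOp_apply (e : Q.E) (x y : Free Q 0 V × Free Q 0 V) : dualOp e x y = (node e x.1 y.1,
    node e x.2 y.1 + node e ((Free Q 0 V).parity x.1) y.2) := rfl

theorem tri_dualOp (x y z : Free Q 0 V × Free Q 0 V) (r : Q.E ⊗[K] Q.E) :
    tri dualOp x y z r = (tri node x.1 y.1 z.1 r, tri node x.2 y.1 z.1 r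
      + tri node ((Free Q 0 V).parity x.1) y.2 z.1 r
      + tri node ((Free Q 0 V).parity x.1) ((Free Q 0 V).parity y.1) z.2 r) := by
  induction r using TensorProduct.induction_on with
  | zero => rw [map_zero, map_zero, map_zero, map_zero, map_zero, add_zero, add_zero]; rfl
  | tmul e e' =>
    rw [tri_tmul, dualOp_apply, dualOp_apply, tri_tmul, tri_tmul, tri_tmul, tri_tmul]
    ext1
    · rfl
    · simp only
      rw [map_add, LinearMap.add_apply, parity_node, ksign_zero, one_smul]
  | add a b ha hb =>
    rw [map_add, ha, hb, Prod.mk_add_mk, map_add, map_add, map_add, map_add]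
    ext1
    · rfl
    · simp only; abel

theorem rel_aux {N : Type w} [AddCommGroup N] [Module K N] {a b c p q : K}
    {x1 x2 x3 y1 y2 y3 z1 z2 z3 : N} (ha : a = 1 ∨ a = -1) (hb : b = 1 ∨ b = -1)
    (hc : c = 1 ∨ c = -1) (h1 : x1 + (p * (b * c)) • y1 + (q * c) • z1 = 0)
    (h2 : x2 + (p * a) • y2 + (q * c) • z2 = 0) (h3 : x3 + (p * a) • y3 + (q * (a * b)) • z3 = 0) :
    x1 + a • x2 + b • a • x3 + p • (y2 + b • y3 + c • b • y1) + q • (z3 + c • z1 + a • c • z2) = 0 := by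
  rcases ha with rfl | rfl <;> rcases hb with rfl | rfl <;> rcases hc with rfl | rfl
  · linear_combination (norm := module) h1 + h2 + h3
  · linear_combination (norm := module) h1 + h2 + h3
  · linear_combination (norm := module) h1 + h2 - h3
  · linear_combination (norm := module) h1 + h2 - h3
  · linear_combination (norm := module) h1 - h2 - h3
  · linear_combination (norm := module) h1 - h2 - h3
  · linear_combination (norm := module) h1 - h2 + h3
  · linear_combination (norm := module) h1 - h2 + h3

theorem dualOp_isAlg : IsAlg Q 0
    (fun k => ((Free Q 0 V).gr k).prod ((Free Q 0 V).gr (k - 1))) (dualOp (Q := Q) (V := V)) where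
  mem e i j x hx y hy := by
    refine ⟨node_mem e hx.1 hy.1, add_mem ?_ ?_⟩
    · have := node_mem e hx.2 hy.1
      convert this using 2; ring
    · have := node_mem e ((Free Q 0 V).parity_mem hx.1) hy.2
      convert this using 2; ring
  symm e i j x hx y hy := by
    rw [dualOp_apply, dualOp_apply, Prod.smul_mk, node_symm e hx.1 hy.1, node_symm e hx.2 hy.1,
      node_symm e ((Free Q 0 V).parity_mem hx.1) hy.2, (Free Q 0 V).parity_of_mem hx.1,
      (Free Q 0 V).parity_of_mem hy.1, mul_comm (i - 1) j, ksign_mul_sub_one, ksign_mul_sub_one,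
      mul_comm j i]
    ext1
    · rfl
    · simp only [map_smul, LinearMap.smul_apply]
      have := ksign_sq (K := K) i
      linear_combination (norm := module) this • ksign K (i * j) • node e y.2 x.1
  rel r hr i j k x hx y hy z hz := by
    rw [tri_dualOp, tri_dualOp, tri_dualOp]
    simp only [(Free Q 0 V).parity_of_mem hx.1, (Free Q 0 V).parity_of_mem hy.1,
      (Free Q 0 V).parity_of_mem hz.1, tri_smul_left, tri_smul_mid]
    have h0 := node_rel r hr hx.1 hy.1 hz.1
    have h1 := node_rel r hr hx.2 hy.1 hz.1
    have h2 := node_rel r hr hx.1 hy.2 hz.1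
    have h3 := node_rel r hr hx.1 hy.1 hz.2
    have e1 : ksign K ((i - 1) * (j + k)) = ksign K (i * (j + k)) * (ksign K j * ksign K k) := by
      rw [mul_comm, ksign_mul_sub_one, ksign_add, mul_comm (_ + _) _, mul_comm]
    have e2 : ksign K (k * (i - 1 + j)) = ksign K (k * (i + j)) * ksign K k := by
      rw [show i - 1 + j = i + j - 1 by ring, ksign_mul_sub_one]
    have e3 : ksign K (i * (j - 1 + k)) = ksign K (i * (j + k)) * ksign K i := by
      rw [show j - 1 + k = j + k - 1 by ring, ksign_mul_sub_one]
    have e4 : ksign K (k * (i + (j - 1))) = ksign K (k * (i + j)) * ksign K k := by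
      rw [show i + (j - 1) = i + j - 1 by ring, ksign_mul_sub_one]
    have e5 : ksign K (i * (j + (k - 1))) = ksign K (i * (j + k)) * ksign K i := by
      rw [show j + (k - 1) = j + k - 1 by ring, ksign_mul_sub_one]
    have e6 : ksign K ((k - 1) * (i + j)) = ksign K (k * (i + j)) * (ksign K i * ksign K j) := by
      rw [mul_comm, ksign_mul_sub_one, ksign_add, mul_comm (_ + _) _, mul_comm]
    rw [e1, e2] at h1
    rw [e3, e4] at h2
    rw [e5, e6] at h3
    ext1
    · exact h0
    · exact rel_aux (ksign_eq i) (ksign_eq j) (ksign_eq k) h1 h2 h3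

variable (f : V →ₗ[K] Free Q 0 V) (hf : ∀ i, ∀ x ∈ V.gr i, f x ∈ (Free Q 0 V).gr (i - 1))

theorem der_aux (f : V →ₗ[K] Free Q 0 V)
    (hf : ∀ i, ∀ x ∈ V.gr i, f x ∈ (Free Q 0 V).gr (i - 1)) : ∀ i, ∀ x ∈ V.gr i, (ι (Q := Q) (s := 0) : V →ₗ[K] _).prod f x ∈
    ((Free Q 0 V).gr i).prod ((Free Q 0 V).gr (i - 1)) :=
  fun i x hx => ⟨ι_mem hx, hf i x hx⟩

def derPair : Free Q 0 V →ₗ[K] (Free Q 0 V × Free Q 0 V) :=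
  lift dualOp_isAlg ((ι (Q := Q) (s := 0)).prod f) (der_aux f hf)

theorem derPair_ι (x : V) : derPair f hf (ι x) = (ι x, f x) := lift_ι ..

theorem derPair_node (e : Q.E) (x y : Free Q 0 V) :
    derPair f hf (node e x y) = dualOp e (derPair f hf x) (derPair f hf y) := lift_node ..

theorem derPair_fst (x : Free Q 0 V) : (derPair f hf x).1 = x := by
  have : (LinearMap.fst K _ _) ∘ₗ derPair f hf = LinearMap.id := by
    refine ext ?_ ?_
    · intro i x hx
      exact congrArg Prod.fst (derPair_ι f hf x)
    · intro e i j x _ y _ h1 h2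
      have h1' : (derPair f hf x).1 = x := h1
      have h2' : (derPair f hf y).1 = y := h2
      have h := congrArg Prod.fst (derPair_node f hf e x y)
      rw [dualOp_apply, h1', h2'] at h
      exact h
  exact LinearMap.congr_fun this x

/-- The unique derivation of degree `-1` of the free algebra extending `f`. -/
def der : Free Q 0 V →ₗ[K] Free Q 0 V := (LinearMap.snd K _ _) ∘ₗ derPair f hf

theorem der_ι (x : V) : der f hf (ι x) = f x := by
  exact congrArg Prod.snd (derPair_ι f hf x)

theorem der_node (e : Q.E) (x y : Free Q 0 V) : der f hf (node e x y) =
    node e (der f hf x) y + node e ((Free Q 0 V).parity x) (der f hf y) := by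
  have h := congrArg Prod.snd (derPair_node f hf e x y)
  rw [dualOp_apply, derPair_fst, derPair_fst] at h
  exact h

theorem der_mem {i : ℤ} {x : Free Q 0 V} (hx : x ∈ (Free Q 0 V).gr i) :
    der f hf x ∈ (Free Q 0 V).gr (i - 1) :=
  (lift_mem dualOp_isAlg _ (der_aux f hf) hx).2

theorem der_parity (x : Free Q 0 V) :
    (Free Q 0 V).parity (der f hf x) = -der f hf ((Free Q 0 V).parity x) :=
  (Free Q 0 V).parity_anticomm _ (fun _ _ hx => der_mem f hf hx) x

/-- The composite of derivations satisfies the second order Leibniz rule. -/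
theorem der_der_node (g : V →ₗ[K] Free Q 0 V)
    (hg : ∀ i, ∀ x ∈ V.gr i, g x ∈ (Free Q 0 V).gr (i - 1)) (e : Q.E) (x y : Free Q 0 V) :
    der f hf (der g hg (node e x y)) = node e (der f hf (der g hg x)) y
      - node e (der g hg ((Free Q 0 V).parity x)) (der f hf y)
      + node e (der f hf ((Free Q 0 V).parity x)) (der g hg y)
      + node e x (der f hf (der g hg y)) := by
  rw [der_node, map_add, der_node, der_node, GMod.parity_parity, der_parity]
  simp only [map_neg, LinearMap.neg_apply]
  abel

end Der

section Para

/-! Recursion on tree monomials for free algebras without relations, operations of degree `1`. -/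

variable {N : Type w'} [AddCommGroup N] [Module K N] (grN : ℤ → Submodule K N)

/-- Data for defining a degree `-1` map on the free algebra without relations. -/
structure Step (Q : QuadData.{u, v} K) (V : GMod.{u, w} K) (grN : ℤ → Submodule K N) where
  c : Q.E →ₗ[K] (Free Q.magma 1 V × N) →ₗ[K] (Free Q.magma 1 V × N) →ₗ[K] N
  mem : ∀ e i j, ∀ x ∈ ((Free Q.magma 1 V).gr i).prod (grN (i - 1)),
    ∀ y ∈ ((Free Q.magma 1 V).gr j).prod (grN (j - 1)), c e x y ∈ grN (i + j)
  symm : ∀ e i j, ∀ x ∈ ((Free Q.magma 1 V).gr i).prod (grN (i - 1)),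
    ∀ y ∈ ((Free Q.magma 1 V).gr j).prod (grN (j - 1)),
    c (Q.τ e) x y = ksign K (i * j) • c e y x

variable {grN} (S : Step Q V grN)

def stepOp : Q.magma.E →ₗ[K] (Free Q.magma 1 V × N) →ₗ[K] (Free Q.magma 1 V × N) →ₗ[K]
    (Free Q.magma 1 V × N) :=
  trilinear (fun e x y => (node (Q := Q.magma) e x.1 y.1, S.c e x y))
    (fun e e' x y => by
      ext1 <;> simp only [Prod.fst_add, Prod.snd_add, map_add, LinearMap.add_apply])
    (fun a e x y => by
      ext1 <;> simp only [Prod.smul_fst, Prod.smul_snd, map_smul, LinearMap.smul_apply])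
    (fun e x x' y => by
      ext1 <;> simp only [Prod.fst_add, Prod.snd_add, map_add, LinearMap.add_apply])
    (fun a e x y => by
      ext1 <;> simp only [Prod.smul_fst, Prod.smul_snd, map_smul, LinearMap.smul_apply])
    (fun e x y y' => by
      ext1 <;> simp only [Prod.fst_add, Prod.snd_add, map_add])
    (fun a e x y => by
      ext1 <;> simp only [Prod.smul_fst, Prod.smul_snd, map_smul])

theorem stepOp_apply (e : Q.E) (x y : Free Q.magma 1 V × N) :
    stepOp S e x y = (node (Q := Q.magma) e x.1 y.1, S.c e x y) := rfl

theorem isAlg_magma {N : Type w'} [AddCommGroup N] [Module K N] {gr : ℤ → Submodule K N} {s : ℤ}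
    {μ : Q.magma.E →ₗ[K] N →ₗ[K] N →ₗ[K] N}
    (mem : ∀ e i j, ∀ x ∈ gr i, ∀ y ∈ gr j, μ e x y ∈ gr (s + i + j))
    (symm : ∀ e i j, ∀ x ∈ gr i, ∀ y ∈ gr j, μ (Q.magma.τ e) x y = ksign K (i * j) • μ e y x) :
    IsAlg Q.magma s gr μ where
  mem := mem
  symm := symm
  rel r hr i j k x _ y _ z _ := by
    have : r = 0 := hr
    subst this
    simp only [Pi.zero_apply, map_zero, smul_zero, add_zero]

theorem stepOp_isAlg : IsAlg Q.magma 1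
    (fun k => ((Free Q.magma 1 V).gr k).prod (grN (k - 1))) (stepOp S) := by
  refine isAlg_magma ?_ ?_
  · intro e i j x hx y hy
    refine ⟨node_mem (Q := Q.magma) e hx.1 hy.1, ?_⟩
    have := S.mem e i j x hx y hy
    have h : (1 + i + j - 1 : ℤ) = i + j := by ring
    change S.c e x y ∈ grN (1 + i + j - 1)
    rwa [h]
  · intro e i j x hx y hy
    exact Prod.ext (node_symm (Q := Q.magma) e hx.1 hy.1) (S.symm e i j x hx y hy)

variable (f : V →ₗ[K] N) (hf : ∀ i, ∀ x ∈ V.gr i, f x ∈ grN (i - 1))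

theorem para_aux (f : V →ₗ[K] N) (hf : ∀ i, ∀ x ∈ V.gr i, f x ∈ grN (i - 1)) : ∀ i, ∀ x ∈ V.gr i, (ι (Q := Q.magma) (s := 1) : V →ₗ[K] _).prod f x ∈
    ((Free Q.magma 1 V).gr i).prod (grN (i - 1)) :=
  fun i x hx => ⟨ι_mem hx, hf i x hx⟩

def paraPair : Free Q.magma 1 V →ₗ[K] (Free Q.magma 1 V × N) :=
  lift (stepOp_isAlg S) ((ι (Q := Q.magma) (s := 1)).prod f) (para_aux f hf)

theorem paraPair_ι (x : V) : paraPair S f hf (ι x) = (ι x, f x) := lift_ι ..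

theorem paraPair_node (e : Q.E) (x y : Free Q.magma 1 V) :
    paraPair S f hf (node (Q := Q.magma) e x y) =
      stepOp S e (paraPair S f hf x) (paraPair S f hf y) := lift_node ..

theorem paraPair_fst (x : Free Q.magma 1 V) : (paraPair S f hf x).1 = x := by
  have : (LinearMap.fst K _ _) ∘ₗ paraPair S f hf = LinearMap.id := by
    refine ext ?_ ?_
    · intro i x hx
      exact congrArg Prod.fst (paraPair_ι S f hf x)
    · intro e i j x _ y _ h1 h2
      have h1' : (paraPair S f hf x).1 = x := h1
      have h2' : (paraPair S f hf y).1 = y := h2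
      have h := congrArg Prod.fst (paraPair_node S f hf e x y)
      change _ = node (Q := Q.magma) e (paraPair S f hf x).1 (paraPair S f hf y).1 at h
      rw [h1', h2'] at h
      exact h
  exact LinearMap.congr_fun this x

/-- The linear map defined by recursion on tree monomials. -/
def para : Free Q.magma 1 V →ₗ[K] N := (LinearMap.snd K _ _) ∘ₗ paraPair S f hf

theorem para_ι (x : V) : para S f hf (ι x) = f x := by
  exact congrArg Prod.snd (paraPair_ι S f hf x)

theorem para_node (e : Q.E) (x y : Free Q.magma 1 V) : para S f hf (node (Q := Q.magma) e x y) =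
    S.c e (x, para S f hf x) (y, para S f hf y) := by
  have h := paraPair_node S f hf e x y
  have hp : ∀ z, paraPair S f hf z = (z, para S f hf z) :=
    fun z => Prod.ext (paraPair_fst S f hf z) rfl
  rw [hp, hp, hp, stepOp_apply] at h
  exact (Prod.ext_iff.1 h).2

theorem para_mem {i : ℤ} {x : Free Q.magma 1 V} (hx : x ∈ (Free Q.magma 1 V).gr i) :
    para S f hf x ∈ grN (i - 1) :=
  (lift_mem (stepOp_isAlg S) _ (para_aux f hf) hx).2

end Para

end Free

end Derivations

section KoszulDual

variable {K : Type u} [Field K] (Q : QuadData.{u, v} K) (V : GMod.{u, w} K)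

open Free

/-- `T(sE)(V)`: the binary tree tensors with leaves in `V` and vertices in `sE`, where `s` is the
suspension; the underlying space of the cofree conilpotent coalgebra on `V` over the cofree
cooperad on `sE`. -/
abbrev Tree : GMod.{u, max u v w} K := Free Q.magma 1 V

variable {V}

/-- The tree with root vertex `s e` and the subtrees `x`, `y`. -/
def Tree.node : Q.E →ₗ[K] Tree Q V →ₗ[K] Tree Q V →ₗ[K] Tree Q V := Free.node (Q := Q.magma)

/-- The tree reduced to a leaf. -/
abbrev Tree.leaf : V →ₗ[K] Tree Q V := Free.ι

variable (V)

def cutStep : Step Q V (Free Q 0 (Tree Q V)).gr where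
  c := trilinear (fun e x y => Free.node e (ι x.1) (ι y.1))
    (fun e e' x y => by simp only [map_add, LinearMap.add_apply])
    (fun a e x y => by simp only [map_smul, LinearMap.smul_apply])
    (fun e x x' y => by simp only [Prod.fst_add, map_add, LinearMap.add_apply])
    (fun a e x y => by simp only [Prod.smul_fst, map_smul, LinearMap.smul_apply])
    (fun e x y y' => by simp only [Prod.fst_add, map_add])
    (fun a e x y => by simp only [Prod.smul_fst, map_smul])
  mem e i j x hx y hy := by
    have := node_mem (s := 0) e (ι_mem (Q := Q) (s := 0) hx.1) (ι_mem (Q := Q) (s := 0) hy.1)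
    rwa [zero_add] at this
  symm e i j x hx y hy :=
    node_symm (s := 0) e (ι_mem (Q := Q) (s := 0) hx.1) (ι_mem (Q := Q) (s := 0) hy.1)

/-- Cutting a tree at its root vertex and desuspending that vertex:
`(s e)(x, y) ↦ e(x, y) ∈ P(T(sE)(V))`; leaves are sent to `0`. -/
def cut : Tree Q V →ₗ[K] Free Q 0 (Tree Q V) :=
  para (cutStep Q V) 0 (fun _ _ _ => zero_mem _)

variable {V}

theorem cut_leaf (x : V) : cut Q V (Tree.leaf Q x) = 0 := para_ι ..

theorem cut_node (e : Q.E) (x y : Tree Q V) :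
    cut Q V (Tree.node Q e x y) = Free.node e (ι x) (ι y) := para_node ..

theorem cut_mem : ∀ i, ∀ x ∈ (Tree Q V).gr i, cut Q V x ∈ (Free Q 0 (Tree Q V)).gr (i - 1) :=
  fun _ _ hx => para_mem (cutStep Q V) 0 (fun _ _ _ => zero_mem _) hx

variable (V)

/-- Cutting at the root vertex and at one vertex adjacent to it (the signed sum over the two edges
at the root), the resulting ternary operation being taken in `P(3) = T(E)(3)/R`. It lands in the
part `P(3) ⊗_{S₃} T(sE)(V)^{⊗ 3}` of the free `P`-algebra on `T(sE)(V)`. -/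
def cutTwice : Tree Q V →ₗ[K] Free Q 0 (Tree Q V) :=
  der (cut Q V) (cut_mem Q) ∘ₗ cut Q V

/-- The elements of degree `i` of the Koszul dual, built from trees of height at most `h`: an
element of positive height is a sum of trees `(s e)(x, y)` with `x`, `y` in the Koszul dual, whose
components along the pairs of adjacent vertices at the root lie in `s²R`. -/
def dualHeight : ℕ → ℤ → Submodule K (Tree Q V)
  | 0, i => (V.gr i).map (Tree.leaf Q)
  | h + 1, i => (V.gr i).map (Tree.leaf Q) ⊔
      (Submodule.span K {t | ∃ e p q, ∃ x ∈ dualHeight h p, ∃ y ∈ dualHeight h q,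
        1 + p + q = i ∧ t = Tree.node Q e x y} ⊓ LinearMap.ker (cutTwice Q V))

/-- The degree `i` part of the Koszul dual, as a subspace of the tree tensors. -/
def dualPart (i : ℤ) : Submodule K (Tree Q V) := ⨆ h, dualHeight Q V h i

variable {Q V}

theorem dualHeight_le_gr (h : ℕ) : ∀ i, dualHeight Q V h i ≤ (Tree Q V).gr i := by
  induction h with
  | zero =>
    rintro i _ ⟨x, hx, rfl⟩
    exact ι_mem hx
  | succ h ih =>
    intro i
    rw [dualHeight]
    refine sup_le ?_ (inf_le_left.trans (Submodule.span_le.2 ?_))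
    · rintro _ ⟨x, hx, rfl⟩
      exact ι_mem hx
    · rintro _ ⟨e, p, q, x, hx, y, hy, rfl, rfl⟩
      exact node_mem (Q := Q.magma) e (ih p hx) (ih q hy)

theorem dualHeight_succ (h : ℕ) : ∀ i, dualHeight Q V h i ≤ dualHeight Q V (h + 1) i := by
  induction h with
  | zero => intro i; rw [dualHeight, dualHeight]; exact le_sup_left
  | succ h ih =>
    intro i
    rw [dualHeight, dualHeight]
    refine sup_le_sup_left (inf_le_inf_right _ (Submodule.span_mono ?_)) _
    rintro _ ⟨e, p, q, x, hx, y, hy, rfl, rfl⟩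
    exact ⟨e, p, q, x, ih p hx, y, ih q hy, rfl, rfl⟩

theorem dualPart_le_gr (i : ℤ) : dualPart Q V i ≤ (Tree Q V).gr i :=
  iSup_le fun h => dualHeight_le_gr h i

theorem mem_dualPart {i : ℤ} {x : Tree Q V} :
    x ∈ dualPart Q V i ↔ ∃ h, x ∈ dualHeight Q V h i :=
  Submodule.mem_iSup_of_directed _
    (Monotone.directed_le (monotone_nat_of_le_succ fun h => dualHeight_succ h i))

theorem leaf_mem_dualPart {i : ℤ} {x : V} (hx : x ∈ V.gr i) :
    Tree.leaf Q x ∈ dualPart Q V i :=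
  mem_dualPart.2 ⟨0, x, hx, rfl⟩

/-- The sums of trees `(s e)(x, y)` of total degree `i`, with `x` and `y` in the Koszul dual. -/
def nodeSpan (Q : QuadData.{u, v} K) (V : GMod.{u, w} K) (i : ℤ) : Submodule K (Tree Q V) :=
  Submodule.span K {t | ∃ e p q, ∃ x ∈ dualPart Q V p, ∃ y ∈ dualPart Q V q,
    1 + p + q = i ∧ t = Tree.node Q e x y}

theorem dualPart_le (i : ℤ) : dualPart Q V i ≤
    (V.gr i).map (Tree.leaf Q) ⊔ (nodeSpan Q V i ⊓ LinearMap.ker (cutTwice Q V)) := by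
  refine iSup_le fun h => ?_
  cases h with
  | zero => exact le_sup_left
  | succ h =>
    rw [dualHeight]
    refine sup_le_sup_left (inf_le_inf_right _ (Submodule.span_mono ?_)) _
    rintro _ ⟨e, p, q, x, hx, y, hy, rfl, rfl⟩
    exact ⟨e, p, q, x, mem_dualPart.2 ⟨h, hx⟩, y, mem_dualPart.2 ⟨h, hy⟩, rfl, rfl⟩

theorem nodeSpan_inf_le (i : ℤ) :
    nodeSpan Q V i ⊓ LinearMap.ker (cutTwice Q V) ≤ dualPart Q V i := by
  have key : ∀ t ∈ nodeSpan Q V i, ∃ h, t ∈ Submodule.span K {t | ∃ e p q,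
      ∃ x ∈ dualHeight Q V h p, ∃ y ∈ dualHeight Q V h q, 1 + p + q = i ∧ t = Tree.node Q e x y} := by
    have mono : ∀ i, Monotone fun h => dualHeight Q V h i :=
      fun i => monotone_nat_of_le_succ fun h => dualHeight_succ h i
    have mono' : Monotone fun h => Submodule.span K {t | ∃ e p q,
        ∃ x ∈ dualHeight Q V h p, ∃ y ∈ dualHeight Q V h q,
        1 + p + q = i ∧ t = Tree.node Q e x y} := by
      intro h h' hh
      refine Submodule.span_mono ?_
      rintro _ ⟨e, p, q, x, hx, y, hy, rfl, rfl⟩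
      exact ⟨e, p, q, x, mono p hh hx, y, mono q hh hy, rfl, rfl⟩
    intro t ht
    induction ht using Submodule.span_induction with
    | mem t ht =>
      obtain ⟨e, p, q, x, hx, y, hy, rfl, rfl⟩ := ht
      obtain ⟨h, hx⟩ := mem_dualPart.1 hx
      obtain ⟨h', hy⟩ := mem_dualPart.1 hy
      exact ⟨max h h', Submodule.subset_span ⟨e, p, q, x, mono p (le_max_left h h') hx, y,
        mono q (le_max_right h h') hy, rfl, rfl⟩⟩
    | zero => exact ⟨0, zero_mem _⟩
    | add a b _ _ ha hb =>
      obtain ⟨h, ha⟩ := ha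
      obtain ⟨h', hb⟩ := hb
      exact ⟨max h h', add_mem (mono' (le_max_left h h') ha) (mono' (le_max_right h h') hb)⟩
    | smul c a _ ha =>
      obtain ⟨h, ha⟩ := ha
      exact ⟨h, Submodule.smul_mem _ _ ha⟩
  rintro t ⟨ht, ht'⟩
  obtain ⟨h, hh⟩ := key t ht
  exact mem_dualPart.2 ⟨h + 1, by rw [dualHeight]; exact Submodule.mem_sup_right ⟨hh, ht'⟩⟩

variable (Q V)

/-- The total space of the Koszul dual, inside the tree tensors. -/
def dualTotal : Submodule K (Tree Q V) := ⨆ i, dualPart Q V i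

/-- `P^¡(V)`: the cofree conilpotent coalgebra on `V` over the Koszul dual cooperad
`P^¡ = C(sE, s²R)`. It consists of the tree tensors in `T(sE)(V)` all of whose components along
pairs of adjacent vertices lie in `s²R`. -/
def Dual : GMod.{u, max u v w} K where
  carrier := dualTotal Q V
  gr := fun i => (dualPart Q V i).comap (dualTotal Q V).subtype
  internal := by
    have hle : ∀ i, dualPart Q V i ≤ dualTotal Q V := fun i => le_iSup _ i
    rw [DirectSum.isInternal_submodule_iff_iSupIndep_and_iSup_eq_top]
    constructor
    · have h1 : iSupIndep (dualPart Q V) :=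
        (Tree Q V).internal.submodule_iSupIndep.mono dualPart_le_gr
      refine iSupIndep_def.2 fun i => ?_
      have h2 := iSupIndep_def.1 h1 i
      rw [Submodule.disjoint_def] at h2 ⊢
      intro x hx hx'
      refine Subtype.ext (h2 x hx ?_)
      have : Submodule.map (dualTotal Q V).subtype
          (⨆ j, ⨆ (_ : j ≠ i), (dualPart Q V j).comap (dualTotal Q V).subtype) ≤
          ⨆ j, ⨆ (_ : j ≠ i), dualPart Q V j := by
        simp only [Submodule.map_iSup]
        exact iSup₂_mono fun j _ => Submodule.map_comap_le _ _
      exact this ⟨x, hx', rfl⟩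
    · refine Submodule.map_injective_of_injective (dualTotal Q V).injective_subtype ?_
      rw [Submodule.map_iSup, Submodule.map_top, Submodule.range_subtype]
      conv_rhs => rw [dualTotal]
      refine iSup_congr fun i => ?_
      rw [Submodule.map_comap_subtype, inf_eq_right.2 (hle i)]

variable {Q V}

/-- The inclusion `P^¡(V) ⊆ T(sE)(V)`. -/
def Dual.incl : Dual Q V →ₗ[K] Tree Q V := (dualTotal Q V).subtype

theorem Dual.mem_gr {i : ℤ} {x : Dual Q V} : x ∈ (Dual Q V).gr i ↔ Dual.incl x ∈ dualPart Q V i :=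
  Iff.rfl

theorem Dual.incl_injective : Function.Injective (Dual.incl (Q := Q) (V := V)) :=
  Subtype.val_injective

theorem mem_dualTotal {i : ℤ} {x : Tree Q V} (hx : x ∈ dualPart Q V i) : x ∈ dualTotal Q V :=
  Submodule.mem_iSup_of_mem i hx

theorem Dual.exists_incl {i : ℤ} {x : Tree Q V} (hx : x ∈ dualPart Q V i) :
    ∃ w ∈ (Dual Q V).gr i, Dual.incl w = x :=
  ⟨⟨x, mem_dualTotal hx⟩, hx, rfl⟩

/-- `P^¡(V)` is a graded direct summand of the tree tensors. -/
theorem Dual.exists_retraction : ∃ ρ : Tree Q V →ₗ[K] Dual Q V,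
    (∀ i, ∀ x ∈ (Tree Q V).gr i, ρ x ∈ (Dual Q V).gr i) ∧ ∀ w, ρ (Dual.incl w) = w := by
  have h : ∀ i, ∃ g : (Tree Q V).gr i →ₗ[K] (Dual Q V).gr i,
      ∀ w (hw : w ∈ (Dual Q V).gr i), g ⟨Dual.incl w, dualPart_le_gr i hw⟩ = ⟨w, hw⟩ := by
    intro i
    let j : (Dual Q V).gr i →ₗ[K] (Tree Q V).gr i :=
      (Dual.incl ∘ₗ ((Dual Q V).gr i).subtype).codRestrict _ fun w => dualPart_le_gr i w.2
    obtain ⟨g, hg⟩ := j.exists_leftInverse_of_injective (by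
      rw [LinearMap.ker_eq_bot]
      intro a b hab
      have hab' : (j a).1 = (j b).1 := congrArg Subtype.val hab
      exact Subtype.ext (Dual.incl_injective hab'))
    exact ⟨g, fun w hw => LinearMap.congr_fun hg ⟨w, hw⟩⟩
  choose g hg using h
  have hmem : ∀ i, ∀ x (hx : x ∈ (Tree Q V).gr i),
      (Tree Q V).glue (fun i => ((Dual Q V).gr i).subtype ∘ₗ g i) x = g i ⟨x, hx⟩ :=
    fun i x hx => (Tree Q V).glue_of_mem _ hx
  refine ⟨(Tree Q V).glue fun i => ((Dual Q V).gr i).subtype ∘ₗ g i, ?_, ?_⟩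
  · intro i x hx
    rw [hmem i x hx]
    exact (g i ⟨x, hx⟩).2
  · intro w
    induction w using (Dual Q V).induction_homog with
    | h i w hw =>
      exact (hmem i (Dual.incl w) (dualPart_le_gr i hw)).trans (congrArg Subtype.val (hg i w hw))
    | hadd x y hx hy => rw [map_add, map_add, hx, hy]

end KoszulDual

section KoszulComplex

variable {K : Type u} [Field K] {Q : QuadData.{u, v} K} {V : GMod.{u, w} K}

open Free

/-- A graded projection of the tree tensors onto the Koszul dual. -/
def Dual.retraction (Q : QuadData.{u, v} K) (V : GMod.{u, w} K) : Tree Q V →ₗ[K] Dual Q V :=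
  Classical.choose Dual.exists_retraction

theorem Dual.retraction_mem : ∀ i, ∀ x ∈ (Tree Q V).gr i,
    Dual.retraction Q V x ∈ (Dual Q V).gr i :=
  (Classical.choose_spec Dual.exists_retraction).1

theorem Dual.retraction_incl (x : Dual Q V) : Dual.retraction Q V (Dual.incl x) = x :=
  (Classical.choose_spec Dual.exists_retraction).2 x

theorem retractFree_aux : ∀ i, ∀ x ∈ (Tree Q V).gr i,
    (ι ∘ₗ Dual.retraction Q V : Tree Q V →ₗ[K] Free Q 0 (Dual Q V)) x ∈
      (Free Q 0 (Dual Q V)).gr i :=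
  fun i x hx => ι_mem (Dual.retraction_mem i x hx)

/-- The map of free `P`-algebras induced by the projection onto the Koszul dual. -/
def retractFree (Q : QuadData.{u, v} K) (V : GMod.{u, w} K) :
    Free Q 0 (Tree Q V) →ₗ[K] Free Q 0 (Dual Q V) :=
  lift Free.isAlg (ι ∘ₗ Dual.retraction Q V) retractFree_aux

theorem retractFree_ι (x : Tree Q V) :
    retractFree Q V (ι x) = ι (Dual.retraction Q V x) := lift_ι ..

theorem retractFree_node (e : Q.E) (x y : Free Q 0 (Tree Q V)) :
    retractFree Q V (node e x y) = node e (retractFree Q V x) (retractFree Q V y) := lift_node ..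

theorem retractFree_mem {i : ℤ} {x : Free Q 0 (Tree Q V)} (hx : x ∈ (Free Q 0 (Tree Q V)).gr i) :
    retractFree Q V x ∈ (Free Q 0 (Dual Q V)).gr i := lift_mem _ _ retractFree_aux hx

/-- The map `P^¡(V) → P(P^¡(V))` of degree `-1` which is the binary part of the decomposition of
the cofree coalgebra, followed by the desuspension `sE → E` and a sign: an element
`∑ (s e)(x, y)` with `x, y ∈ P^¡(V)` is sent to `-∑ e(x, y)` (see `cobar_node`; in particular the
chosen projection plays no role), and elements of `V` are sent to `0`. -/
def cobar (Q : QuadData.{u, v} K) (V : GMod.{u, w} K) : Dual Q V →ₗ[K] Free Q 0 (Dual Q V) :=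
  -(retractFree Q V ∘ₗ cut Q V ∘ₗ Dual.incl)

theorem cobar_mem : ∀ i, ∀ x ∈ (Dual Q V).gr i,
    cobar Q V x ∈ (Free Q 0 (Dual Q V)).gr (i - 1) := by
  intro i x hx
  refine neg_mem (retractFree_mem (cut_mem Q i _ (dualPart_le_gr i hx)))

theorem cobar_eq (x : Dual Q V) : cobar Q V x = -retractFree Q V (cut Q V (Dual.incl x)) := rfl

theorem retractFree_cut_node (e : Q.E) (x y : Dual Q V) :
    retractFree Q V (cut Q V (Tree.node Q e (Dual.incl x) (Dual.incl y))) =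
      node e (ι x) (ι y) := by
  rw [cut_node, retractFree_node, retractFree_ι, retractFree_ι, Dual.retraction_incl,
    Dual.retraction_incl]

theorem cobar_node {J : Type*} (s : Finset J) (e : J → Q.E) (x y : J → Dual Q V) (w : Dual Q V)
    (hw : Dual.incl w = ∑ j ∈ s, Tree.node Q (e j) (Dual.incl (x j)) (Dual.incl (y j))) :
    cobar Q V w = -∑ j ∈ s, node (e j) (ι (x j)) (ι (y j)) := by
  rw [cobar_eq, hw, map_sum, map_sum]
  exact congrArg _ (Finset.sum_congr rfl fun j _ => retractFree_cut_node (e j) (x j) (y j))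

theorem cobar_leaf (w : Dual Q V) (x : V) (hw : Dual.incl w = Tree.leaf Q x) :
    cobar Q V w = 0 := by
  rw [cobar_eq, hw, cut_leaf, map_zero, neg_zero]

/-- The differential `d_κ` of the Koszul complex `P ∘_κ P^¡`, evaluated on `V`: the derivation of
the free `P`-algebra `P(P^¡(V))` extending `cobar`. -/
def koszulD (Q : QuadData.{u, v} K) (V : GMod.{u, w} K) :
    Free Q 0 (Dual Q V) →ₗ[K] Free Q 0 (Dual Q V) :=
  der (cobar Q V) cobar_mem

end KoszulComplex

section Arity

variable {K : Type u} [Field K] (Q : QuadData.{u, v} K) (n : ℕ)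

open Free

/-- `Kⁿ` in degree `0`. -/
abbrev std (K : Type u) [Field K] (n : ℕ) : GMod.{u, u} K := GMod.inDegreeZero K (Fin n → K)

/-- Tree monomials in `T(sE)(Kⁿ)` in which the basis vectors labelled by `S` appear as leaves, each
exactly once, and no other leaves. -/
inductive TreeMonomial : Finset (Fin n) → Tree Q (std K n) → Prop
  | leaf (i : Fin n) : TreeMonomial {i} (Tree.leaf Q (V := std K n) (Pi.single i (1 : K)))
  | node (e : Q.E) (S T : Finset (Fin n)) (h : Disjoint S T) (x y : Tree Q (std K n))
      (hx : TreeMonomial S x) (hy : TreeMonomial T y) : TreeMonomial (S ∪ T) (Tree.node Q e x y)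

/-- `P^¡(S)` for a finite set `S ⊆ {1, …, n}`: the part of `P^¡(Kⁿ)` which is multilinear in the
basis vectors labelled by `S`. -/
def dualArity (S : Finset (Fin n)) : Submodule K (Dual Q (std K n)) :=
  (Submodule.span K {x | TreeMonomial Q n S x}).comap Dual.incl

/-- The monomials `p(c₁, …, c_k)` with `p ∈ P(k)` a composite of generators and
`c_j ∈ P^¡(S_j)`, where `S = S₁ ⊔ … ⊔ S_k`. -/
inductive KoszulMonomial : Finset (Fin n) → Free Q 0 (Dual Q (std K n)) → Prop
  | gen (S : Finset (Fin n)) (c : Dual Q (std K n)) (hc : c ∈ dualArity Q n S) :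
      KoszulMonomial S (ι c)
  | node (e : Q.E) (S T : Finset (Fin n)) (h : Disjoint S T) (x y : Free Q 0 (Dual Q (std K n)))
      (hx : KoszulMonomial S x) (hy : KoszulMonomial T y) :
      KoszulMonomial (S ∪ T) (Free.node e x y)

/-- `(P ∘ P^¡)(n)`, as the multilinear part of `P(P^¡(Kⁿ))`. -/
def koszulArity : Submodule K (Free Q 0 (Dual Q (std K n))) :=
  Submodule.span K {x | KoszulMonomial Q n Finset.univ x}

/-- The operad `P(E,R)` is Koszul: the Koszul complex `P ∘_κ P^¡` is acyclic in every arity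
`n ≥ 2` (in arity one it is `K`). -/
def QuadData.IsKoszul : Prop :=
  ∀ n, 2 ≤ n → ∀ x ∈ koszulArity Q n, koszulD Q (std K n) x = 0 →
    ∃ y ∈ koszulArity Q n, koszulD Q (std K n) y = x

end Arity

section BarCobar

variable {K : Type u} [Field K]

open Free

/-- A dg algebra over the operad `P(E,R)`: a chain complex with an action of the generating
operations which is compatible with the differential, the Koszul sign rule, and the relations. -/
structure DGAlg (Q : QuadData.{u, v} K) extends GMod.{u, w} K where
  μ : Q.E →ₗ[K] carrier →ₗ[K] carrier →ₗ[K] carrier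
  isAlg : IsAlg Q 0 gr μ
  d : carrier →ₗ[K] carrier
  d_mem : ∀ i, ∀ x ∈ gr i, d x ∈ gr (i - 1)
  d_d : ∀ x, d (d x) = 0
  leibniz : ∀ e i, ∀ x ∈ gr i, ∀ y, d (μ e x y) = μ e (d x) y + ksign K i • μ e x (d y)

instance (Q : QuadData.{u, v} K) : CoeSort (DGAlg.{u, v, w} Q) (Type w) := ⟨fun A => A.carrier⟩

variable {Q : QuadData.{u, v} K} (A : DGAlg.{u, v, w} Q)

theorem DGAlg.d_μ (e : Q.E) (x y : A) :
    A.d (A.μ e x y) = A.μ e (A.d x) y + A.μ e (A.parity x) (A.d y) := by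
  induction x using A.toGMod.induction_homog with
  | h i x hx => rw [A.leibniz e i x hx, A.parity_of_mem hx, map_smul, LinearMap.smul_apply]
  | hadd x x' h h' => simp only [map_add, LinearMap.add_apply, h, h']; abel

section Proj

variable (V : GMod.{u, w} K)

theorem proj_isAlg : IsAlg Q.magma 1 V.gr (0 : Q.E →ₗ[K] V →ₗ[K] V →ₗ[K] V) :=
  isAlg_magma (fun _ _ _ _ _ _ _ => zero_mem _) (fun _ _ _ _ _ _ _ => by simp)

/-- The projection of the tree tensors onto the trees with one leaf. -/
def proj (Q : QuadData.{u, v} K) : Tree Q V →ₗ[K] V :=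
  lift (proj_isAlg V) LinearMap.id (fun _ _ hx => hx)

variable {V}

theorem proj_leaf (x : V) : proj V Q (Tree.leaf Q x) = x := lift_ι ..

theorem proj_node (e : Q.E) (x y : Tree Q V) : proj V Q (Tree.node Q e x y) = 0 := lift_node ..

theorem proj_mem : ∀ i, ∀ x ∈ (Tree Q V).gr i, proj V Q x ∈ V.gr i :=
  fun _ _ hx => lift_mem (proj_isAlg V) _ (fun _ _ hx => hx) hx

theorem proj_parity (x : Tree Q V) : proj V Q ((Tree Q V).parity x) = V.parity (proj V Q x) := by
  induction x using (Tree Q V).induction_homog with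
  | h i x hx => rw [(Tree Q V).parity_of_mem hx, map_smul, V.parity_of_mem (proj_mem i x hx)]
  | hadd x y hx hy => simp only [map_add, hx, hy]

end Proj

def barStep : Step Q A.toGMod (Tree Q A.toGMod).gr where
  c := trilinear (fun e x y => -Tree.node Q e x.2 y.1
      - Tree.node Q e ((Tree Q A.toGMod).parity x.1) y.2
      + Tree.leaf Q (V := A.toGMod) (A.μ e (proj A.toGMod Q x.1) (proj A.toGMod Q y.1)))
    (fun e e' x y => by simp only [map_add, LinearMap.add_apply]; abel)
    (fun a e x y => by
      simp only [map_smul, LinearMap.smul_apply]; module)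
    (fun e x x' y => by
      simp only [Prod.fst_add, Prod.snd_add, map_add, LinearMap.add_apply]; abel)
    (fun a e x y => by
      simp only [Prod.smul_fst, Prod.smul_snd, map_smul, LinearMap.smul_apply]; module)
    (fun e x y y' => by simp only [Prod.fst_add, Prod.snd_add, map_add]; abel)
    (fun a e x y => by simp only [Prod.smul_fst, Prod.smul_snd, map_smul]; module)
  mem e i j x hx y hy := by
    refine add_mem (sub_mem (neg_mem ?_) ?_) ?_
    · have := node_mem (Q := Q.magma) e hx.2 hy.1
      rwa [show 1 + (i - 1) + j = i + j by ring] at this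
    · have := node_mem (Q := Q.magma) e ((Tree Q A.toGMod).parity_mem hx.1) hy.2
      rwa [show 1 + i + (j - 1) = i + j by ring] at this
    · have := A.isAlg.mem e i j _ (proj_mem i _ hx.1) _ (proj_mem j _ hy.1)
      rw [zero_add] at this
      exact ι_mem this
  symm e i j x hx y hy := by
    have n1 : Tree.node Q (Q.τ e) x.2 y.1 = ksign K ((i - 1) * j) • Tree.node Q e y.1 x.2 :=
      node_symm (Q := Q.magma) e hx.2 hy.1
    have n2 : Tree.node Q (Q.τ e) ((Tree Q A.toGMod).parity x.1) y.2 = ksign K (i * (j - 1)) •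
        Tree.node Q e y.2 ((Tree Q A.toGMod).parity x.1) :=
      node_symm (Q := Q.magma) e ((Tree Q A.toGMod).parity_mem hx.1) hy.2
    have n3 := A.isAlg.symm e i j _ (proj_mem i _ hx.1) _ (proj_mem j _ hy.1)
    change -Tree.node Q (Q.τ e) x.2 y.1 - Tree.node Q (Q.τ e) ((Tree Q A.toGMod).parity x.1) y.2
      + Tree.leaf Q (V := A.toGMod) (A.μ (Q.τ e) (proj A.toGMod Q x.1) (proj A.toGMod Q y.1)) =
      ksign K (i * j) • (-Tree.node Q e y.2 x.1
        - Tree.node Q e ((Tree Q A.toGMod).parity y.1) x.2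
        + Tree.leaf Q (V := A.toGMod) (A.μ e (proj A.toGMod Q y.1) (proj A.toGMod Q x.1)))
    rw [n1, n2, n3, (Tree Q A.toGMod).parity_of_mem hx.1, (Tree Q A.toGMod).parity_of_mem hy.1,
      mul_comm (i - 1) j, ksign_mul_sub_one, ksign_mul_sub_one, mul_comm j i, map_smul, map_smul,
      map_smul, LinearMap.smul_apply]
    have := ksign_sq (K := K) i
    linear_combination (norm := module) -this • ksign K (i * j) • Tree.node Q e y.2 x.1

theorem barD_aux : ∀ i, ∀ x ∈ A.gr i,
    (Tree.leaf Q (V := A.toGMod) ∘ₗ A.d) x ∈ (Tree Q A.toGMod).gr (i - 1) :=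
  fun i x hx => ι_mem (A.d_mem i x hx)

/-- The bar differential on the tree tensors `T(sE)(A)`: it applies the differential of `A` to the
leaves, and replaces a vertex `(s e)(a, b)` whose two inputs are leaves by the leaf `e(a, b)`, all
with Koszul signs (see `treeD_leaf` and `treeD_node`). -/
def treeD : Tree Q A.toGMod →ₗ[K] Tree Q A.toGMod :=
  para (barStep A) (Tree.leaf Q (V := A.toGMod) ∘ₗ A.d) (barD_aux A)

theorem treeD_leaf (a : A) : treeD A (Tree.leaf Q a) = Tree.leaf Q (A.d a) := para_ι ..

theorem treeD_node (e : Q.E) (x y : Tree Q A.toGMod) : treeD A (Tree.node Q e x y) =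
    -Tree.node Q e (treeD A x) y - Tree.node Q e ((Tree Q A.toGMod).parity x) (treeD A y)
      + Tree.leaf Q (V := A.toGMod) (A.μ e (proj A.toGMod Q x) (proj A.toGMod Q y)) :=
  para_node ..

theorem treeD_mem : ∀ i, ∀ x ∈ (Tree Q A.toGMod).gr i, treeD A x ∈ (Tree Q A.toGMod).gr (i - 1) :=
  fun _ _ hx => para_mem (barStep A) _ (barD_aux A) hx

/-- Linear induction on tree tensors. -/
theorem tree_ext {V : GMod.{u, w} K} {N : Type w'} [AddCommGroup N] [Module K N]
    {f g : Tree Q V →ₗ[K] N} (h1 : ∀ x : V, f (Tree.leaf Q x) = g (Tree.leaf Q x))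
    (h2 : ∀ e, ∀ x y : Tree Q V, f (Tree.node Q e x y) = g (Tree.node Q e x y)) : f = g :=
  Free.ext (fun _ x _ => h1 x) (fun e _ _ x _ y _ _ _ => h2 e x y)

/-- The derivation of `P(T(sE)(A))` induced by the bar differential. -/
def treeDFree : Free Q 0 (Tree Q A.toGMod) →ₗ[K] Free Q 0 (Tree Q A.toGMod) :=
  der (ι ∘ₗ treeD A) (fun i x hx => ι_mem (treeD_mem A i x hx))

theorem treeDFree_ι (x : Tree Q A.toGMod) : treeDFree A (ι x) = ι (treeD A x) := der_ι ..

theorem treeDFree_node (e : Q.E) (x y : Free Q 0 (Tree Q A.toGMod)) :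
    treeDFree A (node e x y) = node e (treeDFree A x) y
      + node e ((Free Q 0 (Tree Q A.toGMod)).parity x) (treeDFree A y) := der_node ..

theorem cut_treeD (x : Tree Q A.toGMod) :
    cut Q A.toGMod (treeD A x) = -treeDFree A (cut Q A.toGMod x) := by
  have : cut Q A.toGMod ∘ₗ treeD A = -(treeDFree A ∘ₗ cut Q A.toGMod) := by
    refine tree_ext ?_ ?_
    · intro x
      have h : cut Q A.toGMod (treeD A (Tree.leaf Q x)) =
          -treeDFree A (cut Q A.toGMod (Tree.leaf Q x)) := by
        rw [treeD_leaf, cut_leaf, cut_leaf, map_zero, neg_zero]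
      exact h
    · intro e x y
      have h : cut Q A.toGMod (treeD A (Tree.node Q e x y)) =
          -treeDFree A (cut Q A.toGMod (Tree.node Q e x y)) := by
        rw [treeD_node, map_add, map_sub, map_neg, cut_node, cut_node, cut_node, cut_leaf,
          treeDFree_node, treeDFree_ι, treeDFree_ι, parity_ι, add_zero, neg_add, sub_eq_add_neg]
      exact h
  exact LinearMap.congr_fun this x

theorem der_cut_treeDFree (x : Free Q 0 (Tree Q A.toGMod)) :
    der (cut Q A.toGMod) (cut_mem Q) (treeDFree A x)
      + treeDFree A (der (cut Q A.toGMod) (cut_mem Q) x) = 0 := by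
  induction x using Free.induction_on with
  | hι i x hx => rw [treeDFree_ι, der_ι, der_ι, cut_treeD]; abel
  | hnode e i j x hx y hy h1 h2 =>
    have e1 := eq_neg_of_add_eq_zero_left h1
    have e2 := eq_neg_of_add_eq_zero_left h2
    rw [treeDFree] at e1 e2 ⊢
    rw [der_der_node, der_der_node, e1, e2]
    simp only [map_neg, LinearMap.neg_apply]
    abel
  | hadd x y h1 h2 =>
    rw [map_add, map_add, map_add, map_add, add_add_add_comm, h1, h2, add_zero]
  | hsmul c x h => rw [map_smul, map_smul, map_smul, map_smul, ← smul_add, h, smul_zero]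

theorem cutTwice_leaf {V : GMod.{u, w} K} (x : V) : cutTwice Q V (Tree.leaf Q x) = 0 := by
  rw [cutTwice, LinearMap.comp_apply, cut_leaf, map_zero]

theorem cutTwice_treeD (x : Tree Q A.toGMod) :
    cutTwice Q A.toGMod (treeD A x) = treeDFree A (cutTwice Q A.toGMod x) := by
  have h := eq_neg_of_add_eq_zero_left (der_cut_treeDFree A (cut Q A.toGMod x))
  rw [cutTwice, LinearMap.comp_apply, LinearMap.comp_apply, cut_treeD, map_neg, h, neg_neg]

theorem parity_mem_dualPart {V : GMod.{u, w} K} {i : ℤ} {x : Tree Q V} (hx : x ∈ dualPart Q V i) :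
    (Tree Q V).parity x ∈ dualPart Q V i := by
  rw [(Tree Q V).parity_of_mem (dualPart_le_gr i hx)]
  exact Submodule.smul_mem _ _ hx

/-- The Koszul dual is stable under the bar differential. -/
theorem treeD_mem_dualPart (i : ℤ) {x : Tree Q A.toGMod} (hx : x ∈ dualPart Q A.toGMod i) :
    treeD A x ∈ dualPart Q A.toGMod (i - 1) := by
  obtain ⟨h, hh⟩ := mem_dualPart.1 hx
  clear hx
  have hleaf : ∀ i, ∀ a ∈ A.gr i, treeD A (Tree.leaf Q a) ∈ dualPart Q A.toGMod (i - 1) := by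
    intro i a ha
    rw [treeD_leaf]
    exact leaf_mem_dualPart (A.d_mem i a ha)
  induction h generalizing i x with
  | zero =>
    obtain ⟨a, ha, rfl⟩ := hh
    exact hleaf i a ha
  | succ h ih =>
    rw [dualHeight] at hh
    obtain ⟨_, ⟨a, ha, rfl⟩, t, ⟨ht, ht'⟩, rfl⟩ := Submodule.mem_sup.1 hh
    rw [map_add]
    refine add_mem (hleaf i a ha) ?_
    have key : ∃ n ∈ nodeSpan Q A.toGMod (i - 1), ∃ b ∈ A.gr (i - 1),
        treeD A t = n + Tree.leaf Q b := by
      clear ht' hh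
      induction ht using Submodule.span_induction with
      | mem t ht =>
        obtain ⟨e, p, q, x, hx, y, hy, rfl, rfl⟩ := ht
        have hx' : x ∈ dualPart Q A.toGMod p := mem_dualPart.2 ⟨h, hx⟩
        have hy' : y ∈ dualPart Q A.toGMod q := mem_dualPart.2 ⟨h, hy⟩
        refine ⟨_, sub_mem (neg_mem (Submodule.subset_span ⟨e, p - 1, q, _, ih p hx, y, hy',
          by ring, rfl⟩)) (Submodule.subset_span ⟨e, p, q - 1, _, parity_mem_dualPart hx', _,
          ih q hy, by ring, rfl⟩), _, ?_, treeD_node A e x y⟩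
        have := A.isAlg.mem e p q _ (proj_mem p _ (dualPart_le_gr p hx')) _
          (proj_mem q _ (dualPart_le_gr q hy'))
        rwa [show 0 + p + q = 1 + p + q - 1 by ring] at this
      | zero => exact ⟨0, zero_mem _, 0, zero_mem _, by simp⟩
      | add t t' _ _ h1 h2 =>
        obtain ⟨n, hn, b, hb, h1⟩ := h1
        obtain ⟨n', hn', b', hb', h2⟩ := h2
        exact ⟨n + n', add_mem hn hn', b + b', add_mem hb hb', by
          rw [map_add, h1, h2, map_add]; abel⟩
      | smul c t _ h1 =>
        obtain ⟨n, hn, b, hb, h1⟩ := h1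
        exact ⟨c • n, Submodule.smul_mem _ _ hn, c • b, Submodule.smul_mem _ _ hb, by
          rw [map_smul, h1, map_smul, smul_add]⟩
    obtain ⟨n, hn, b, hb, hnb⟩ := key
    have h0 : cutTwice Q A.toGMod (treeD A t) = 0 := by
      rw [cutTwice_treeD, LinearMap.mem_ker.1 ht', map_zero]
    rw [hnb, map_add, cutTwice_leaf, add_zero] at h0
    rw [hnb]
    exact add_mem (nodeSpan_inf_le _ ⟨hn, h0⟩) (leaf_mem_dualPart hb)

/-- Evaluation of `P(T(sE)(A))` in `A`, through the projection onto the trees with one leaf. -/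
def evalTree : Free Q 0 (Tree Q A.toGMod) →ₗ[K] A :=
  lift A.isAlg (proj A.toGMod Q) proj_mem

theorem evalTree_ι (x : Tree Q A.toGMod) : evalTree A (ι x) = proj A.toGMod Q x := lift_ι ..

theorem evalTree_node (e : Q.E) (x y : Free Q 0 (Tree Q A.toGMod)) :
    evalTree A (node e x y) = A.μ e (evalTree A x) (evalTree A y) := lift_node ..

theorem proj_treeD (x : Tree Q A.toGMod) : proj A.toGMod Q (treeD A x) =
    A.d (proj A.toGMod Q x) + evalTree A (cut Q A.toGMod x) := by
  have : proj A.toGMod Q ∘ₗ treeD A = A.d ∘ₗ proj A.toGMod Q + evalTree A ∘ₗ cut Q A.toGMod := by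
    refine tree_ext ?_ ?_
    · intro x
      have h : proj A.toGMod Q (treeD A (Tree.leaf Q x)) = A.d (proj A.toGMod Q (Tree.leaf Q x)) +
          evalTree A (cut Q A.toGMod (Tree.leaf Q x)) := by
        rw [treeD_leaf, cut_leaf, map_zero, add_zero, proj_leaf, proj_leaf]
      exact h
    · intro e x y
      have h : proj A.toGMod Q (treeD A (Tree.node Q e x y)) =
          A.d (proj A.toGMod Q (Tree.node Q e x y)) +
          evalTree A (cut Q A.toGMod (Tree.node Q e x y)) := by
        rw [treeD_node, map_add, map_sub, map_neg, proj_node, proj_node, proj_node, proj_leaf,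
          cut_node, evalTree_node, evalTree_ι, evalTree_ι, map_zero, neg_zero, sub_zero]
      exact h
  exact LinearMap.congr_fun this x

theorem treeD_treeD_node (e : Q.E) (x y : Tree Q A.toGMod) :
    treeD A (treeD A (Tree.node Q e x y)) = Tree.node Q e (treeD A (treeD A x)) y
      + Tree.node Q e x (treeD A (treeD A y))
      - Tree.leaf Q (V := A.toGMod) (evalTree A (cutTwice Q A.toGMod (Tree.node Q e x y))) := by
  have hp := (Tree Q A.toGMod).parity_anticomm (treeD A) (treeD_mem A)
  rw [cutTwice, LinearMap.comp_apply, cut_node, der_node, der_ι, der_ι, parity_ι, map_add,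
    evalTree_node, evalTree_node, evalTree_ι, evalTree_ι, treeD_node, map_add, map_sub, map_neg,
    treeD_node, treeD_node, treeD_leaf, DGAlg.d_μ, proj_treeD, proj_treeD, proj_parity, hp,
    GMod.parity_parity]
  simp only [map_add, map_neg, LinearMap.add_apply, LinearMap.neg_apply]
  abel

/-- The bar differential squares to zero on the Koszul dual. -/
theorem treeD_treeD (i : ℤ) {x : Tree Q A.toGMod} (hx : x ∈ dualPart Q A.toGMod i) :
    treeD A (treeD A x) = 0 := by
  obtain ⟨h, hh⟩ := mem_dualPart.1 hx
  clear hx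
  have hleaf : ∀ a : A, treeD A (treeD A (Tree.leaf Q a)) = 0 := by
    intro a
    rw [treeD_leaf, treeD_leaf, A.d_d, map_zero]
  induction h generalizing i x with
  | zero =>
    obtain ⟨a, ha, rfl⟩ := hh
    exact hleaf a
  | succ h ih =>
    rw [dualHeight] at hh
    obtain ⟨_, ⟨a, ha, rfl⟩, t, ⟨ht, ht'⟩, rfl⟩ := Submodule.mem_sup.1 hh
    rw [map_add, map_add, hleaf, zero_add]
    have key : treeD A (treeD A t) =
        -Tree.leaf Q (V := A.toGMod) (evalTree A (cutTwice Q A.toGMod t)) := by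
      clear ht' hh
      induction ht using Submodule.span_induction with
      | mem t ht =>
        obtain ⟨e, p, q, x, hx, y, hy, rfl, rfl⟩ := ht
        rw [treeD_treeD_node, ih p hx, ih q hy, map_zero, map_zero, LinearMap.zero_apply]
        abel
      | zero => simp
      | add t t' _ _ h1 h2 => simp only [map_add, h1, h2, neg_add]
      | smul c t _ h1 => simp only [map_smul, h1, smul_neg]
    rw [key, LinearMap.mem_ker.1 ht', map_zero, map_zero, neg_zero]

theorem treeD_mem_dualTotal (x : Tree Q A.toGMod) (hx : x ∈ dualTotal Q A.toGMod) :
    treeD A x ∈ dualTotal Q A.toGMod := by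
  refine Submodule.iSup_induction _ (motive := fun x => treeD A x ∈ dualTotal Q A.toGMod) hx ?_ ?_ ?_
  · exact fun i x hx => mem_dualTotal (treeD_mem_dualPart A i hx)
  · rw [map_zero]; exact zero_mem _
  · intro x y h1 h2; rw [map_add]; exact add_mem h1 h2

/-- The bar construction `B_κ A`: the bar differential on `P^¡(A)`. -/
def barD : Dual Q A.toGMod →ₗ[K] Dual Q A.toGMod :=
  (treeD A).restrict (treeD_mem_dualTotal A)

theorem incl_barD (x : Dual Q A.toGMod) : Dual.incl (barD A x) = treeD A (Dual.incl x) := rfl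

theorem barD_mem : ∀ i, ∀ x ∈ (Dual Q A.toGMod).gr i, barD A x ∈ (Dual Q A.toGMod).gr (i - 1) :=
  fun i _ hx => treeD_mem_dualPart A i hx

theorem barD_barD (x : Dual Q A.toGMod) : barD A (barD A x) = 0 := by
  induction x using (Dual Q A.toGMod).induction_homog with
  | h i x hx => exact Dual.incl_injective (treeD_treeD A i hx)
  | hadd x y hx hy => rw [map_add, map_add, hx, hy, add_zero]

end BarCobar

section BarCobarResolution

variable {K : Type u} [Field K] {Q : QuadData.{u, v} K}

open Free

section Generic

variable {V : GMod.{u, w} K}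

theorem der_add_apply (f g : V →ₗ[K] Free Q 0 V)
    (hf : ∀ i, ∀ x ∈ V.gr i, f x ∈ (Free Q 0 V).gr (i - 1))
    (hg : ∀ i, ∀ x ∈ V.gr i, g x ∈ (Free Q 0 V).gr (i - 1))
    (hfg : ∀ i, ∀ x ∈ V.gr i, (f + g) x ∈ (Free Q 0 V).gr (i - 1)) (x : Free Q 0 V) :
    der (f + g) hfg x = der f hf x + der g hg x := by
  induction x using Free.induction_on with
  | hι i x hx => rw [der_ι, der_ι, der_ι]; rfl
  | hnode e i j x hx y hy h1 h2 =>
    rw [der_node, der_node, der_node, h1, h2, map_add, map_add, LinearMap.add_apply]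
    exact add_add_add_comm _ _ _ _
  | hadd x y h1 h2 =>
    rw [map_add, map_add, map_add, h1, h2]
    exact add_add_add_comm _ _ _ _
  | hsmul c x h => rw [map_smul, map_smul, map_smul, h, smul_add]

theorem der_der_eq_zero (f : V →ₗ[K] Free Q 0 V)
    (hf : ∀ i, ∀ x ∈ V.gr i, f x ∈ (Free Q 0 V).gr (i - 1))
    (h : ∀ x : V, der f hf (f x) = 0) (x : Free Q 0 V) : der f hf (der f hf x) = 0 := by
  induction x using Free.induction_on with
  | hι i x hx => rw [der_ι, h]
  | hnode e i j x hx y hy h1 h2 =>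
    rw [der_der_node, h1, h2, map_zero, map_zero, LinearMap.zero_apply, add_zero, zero_sub,
      neg_add_cancel]
  | hadd x y h1 h2 => rw [map_add, map_add, h1, h2, add_zero]
  | hsmul c x h => rw [map_smul, map_smul, h, smul_zero]

/-- Two linear maps agree on the Koszul dual when they agree on leaves and on trees with both
branches in the Koszul dual. -/
theorem dual_ext {N : Type w'} [AddCommGroup N] [Module K N] (F G : Tree Q V →ₗ[K] N)
    (h1 : ∀ x : V, F (Tree.leaf Q x) = G (Tree.leaf Q x))
    (h2 : ∀ e p, ∀ x ∈ (Dual Q V).gr p, ∀ y : Dual Q V,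
      F (Tree.node Q e (Dual.incl x) (Dual.incl y)) = G (Tree.node Q e (Dual.incl x) (Dual.incl y)))
    (w : Dual Q V) : F (Dual.incl w) = G (Dual.incl w) := by
  induction w using (Dual Q V).induction_homog with
  | h i w hw =>
    obtain ⟨_, ⟨a, _, rfl⟩, t, ⟨ht, ht'⟩, hsum⟩ := Submodule.mem_sup.1 (dualPart_le i hw)
    have key : F t = G t := by
      clear hsum ht'
      induction ht using Submodule.span_induction with
      | mem t ht =>
        obtain ⟨e, p, q, x, hx, y, hy, _, rfl⟩ := ht
        obtain ⟨x', hx', rfl⟩ := Dual.exists_incl hx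
        obtain ⟨y', _, rfl⟩ := Dual.exists_incl hy
        exact h2 e p x' hx' y'
      | zero => rw [map_zero, map_zero]
      | add t t' _ _ h1 h2 => rw [map_add, map_add, h1, h2]
      | smul c t _ h1 => rw [map_smul, map_smul, h1]
    have hs : Tree.leaf Q a + t = Dual.incl w := hsum
    rw [← hs, map_add, map_add, h1, key]
  | hadd x y hx hy => rw [map_add, map_add, map_add, hx, hy]

theorem cutTwice_incl (w : Dual Q V) : cutTwice Q V (Dual.incl w) = 0 := by
  induction w using (Dual Q V).induction_homog with
  | h i w hw =>
    obtain ⟨_, ⟨a, _, rfl⟩, t, ⟨_, ht⟩, hsum⟩ := Submodule.mem_sup.1 (dualPart_le i hw)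
    have hs : Tree.leaf Q a + t = Dual.incl w := hsum
    rw [← hs, map_add, cutTwice_leaf, LinearMap.mem_ker.1 ht, add_zero]
  | hadd x y hx hy => rw [map_add, map_add, hx, hy, add_zero]

theorem retraction_parity (x : Dual Q V) :
    Dual.retraction Q V ((Tree Q V).parity (Dual.incl x)) = (Dual Q V).parity x := by
  induction x using (Dual Q V).induction_homog with
  | h i x hx =>
    have hx' : Dual.incl x ∈ (Tree Q V).gr i := dualPart_le_gr i hx
    rw [(Tree Q V).parity_of_mem hx', (Dual Q V).parity_of_mem hx, map_smul, Dual.retraction_incl]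
  | hadd x y hx hy => rw [map_add, map_add, map_add, map_add, hx, hy]

theorem koszulD_retractFree (w : Dual Q V) :
    koszulD Q V (retractFree Q V (cut Q V (Dual.incl w))) = 0 := by
  have h := dual_ext (koszulD Q V ∘ₗ retractFree Q V ∘ₗ cut Q V)
    (-(retractFree Q V ∘ₗ cutTwice Q V)) ?_ ?_ w
  · have h' : koszulD Q V (retractFree Q V (cut Q V (Dual.incl w))) =
        -retractFree Q V (cutTwice Q V (Dual.incl w)) := h
    rw [h', cutTwice_incl, map_zero, neg_zero]
  · intro x
    have h' : koszulD Q V (retractFree Q V (cut Q V (Tree.leaf Q x))) =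
        -retractFree Q V (cutTwice Q V (Tree.leaf Q x)) := by
      rw [cutTwice_leaf, cut_leaf, map_zero, map_zero, neg_zero]
    exact h'
  · intro e p x hx y
    have h' : koszulD Q V (retractFree Q V (cut Q V (Tree.node Q e (Dual.incl x) (Dual.incl y)))) =
        -retractFree Q V (cutTwice Q V (Tree.node Q e (Dual.incl x) (Dual.incl y))) := by
      rw [retractFree_cut_node, cutTwice, LinearMap.comp_apply, cut_node, koszulD, der_node,
        der_node, der_ι, der_ι, der_ι, der_ι, parity_ι, parity_ι, map_add, retractFree_node,
        retractFree_node, retractFree_ι, retractFree_ι, retraction_parity, Dual.retraction_incl,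
        cobar_eq, cobar_eq, map_neg, map_neg, LinearMap.neg_apply, neg_add]
    exact h'

/-- The differential of the Koszul complex squares to zero. -/
theorem koszulD_koszulD (x : Free Q 0 (Dual Q V)) : koszulD Q V (koszulD Q V x) = 0 := by
  refine der_der_eq_zero _ _ (fun w => ?_) x
  have h := koszulD_retractFree w
  rw [cobar_eq, map_neg, neg_eq_zero]
  exact h

end Generic

variable (A : DGAlg.{u, v, w} Q)

theorem barFree_aux : ∀ i, ∀ x ∈ (Dual Q A.toGMod).gr i,
    (ι ∘ₗ barD A : Dual Q A.toGMod →ₗ[K] Free Q 0 (Dual Q A.toGMod)) x ∈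
      (Free Q 0 (Dual Q A.toGMod)).gr (i - 1) :=
  fun i x hx => ι_mem (barD_mem A i x hx)

/-- The derivation of `P(P^¡(A))` extending the bar differential of `P^¡(A)`. -/
def barFree : Free Q 0 (Dual Q A.toGMod) →ₗ[K] Free Q 0 (Dual Q A.toGMod) :=
  der (ι ∘ₗ barD A) (barFree_aux A)

theorem retractFree_treeDFree (w : Dual Q A.toGMod) :
    retractFree Q A.toGMod (treeDFree A (cut Q A.toGMod (Dual.incl w))) =
      barFree A (retractFree Q A.toGMod (cut Q A.toGMod (Dual.incl w))) := by
  refine dual_ext (retractFree Q A.toGMod ∘ₗ treeDFree A ∘ₗ cut Q A.toGMod)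
    (barFree A ∘ₗ retractFree Q A.toGMod ∘ₗ cut Q A.toGMod) ?_ ?_ w
  · intro x
    have h : retractFree Q A.toGMod (treeDFree A (cut Q A.toGMod (Tree.leaf Q x))) =
        barFree A (retractFree Q A.toGMod (cut Q A.toGMod (Tree.leaf Q x))) := by
      rw [cut_leaf, map_zero, map_zero, map_zero]
    exact h
  · intro e p x hx y
    have hb : ∀ z : Dual Q A.toGMod, barFree A (ι z) = ι (barD A z) := fun z => der_ι ..
    have h : retractFree Q A.toGMod (treeDFree A (cut Q A.toGMod
        (Tree.node Q e (Dual.incl x) (Dual.incl y)))) = barFree A (retractFree Q A.toGMod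
          (cut Q A.toGMod (Tree.node Q e (Dual.incl x) (Dual.incl y)))) := by
      rw [retractFree_cut_node, cut_node, treeDFree_node, treeDFree_ι, treeDFree_ι, parity_ι,
        map_add, retractFree_node, retractFree_node, retractFree_ι, retractFree_ι, retractFree_ι,
        retractFree_ι, retraction_parity, ← incl_barD, ← incl_barD, Dual.retraction_incl,
        Dual.retraction_incl, Dual.retraction_incl, barFree, der_node, der_ι,
        der_ι, parity_ι]
      rfl
    exact h

/-- The restriction of the differential of `QA` to the generators `P^¡(A)`. -/
def twist : Dual Q A.toGMod →ₗ[K] Free Q 0 (Dual Q A.toGMod) :=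
  ι ∘ₗ barD A + cobar Q A.toGMod

theorem twist_mem : ∀ i, ∀ x ∈ (Dual Q A.toGMod).gr i,
    twist A x ∈ (Free Q 0 (Dual Q A.toGMod)).gr (i - 1) :=
  fun i x hx => add_mem (barFree_aux A i x hx) (cobar_mem i x hx)

theorem der_twist (x : Free Q 0 (Dual Q A.toGMod)) :
    der (twist A) (twist_mem A) x = barFree A x + koszulD Q A.toGMod x :=
  der_add_apply _ _ _ _ _ x

theorem twist_twist (w : Dual Q A.toGMod) : der (twist A) (twist_mem A) (twist A w) = 0 := by
  have h1 : twist A w = ι (barD A w) + cobar Q A.toGMod w := rfl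
  have h2 : barFree A (ι (barD A w)) = 0 := by
    rw [barFree, der_ι, LinearMap.comp_apply, barD_barD, map_zero]
  have h3 : koszulD Q A.toGMod (ι (barD A w)) = -barFree A (cobar Q A.toGMod w) := by
    rw [koszulD, der_ι, cobar_eq, cobar_eq, incl_barD, cut_treeD, map_neg, map_neg, neg_neg,
      neg_neg, retractFree_treeDFree]
  have h4 : koszulD Q A.toGMod (cobar Q A.toGMod w) = 0 := by
    rw [cobar_eq, map_neg, koszulD_retractFree, neg_zero]
  rw [der_twist, h1, map_add, map_add, h2, h3, h4, zero_add, add_zero, add_neg_cancel]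

/-- The bar-cobar resolution `QA = Ω_κ B_κ A`: the free `P`-algebra on `P^¡(A)`, with the sum of
the derivation induced by the differential of the bar construction and of the differential of the
Koszul complex. -/
def barCobar : DGAlg.{u, v, max u v w} Q where
  toGMod := Free Q 0 (Dual Q A.toGMod)
  μ := Free.node
  isAlg := Free.isAlg
  d := der (twist A) (twist_mem A)
  d_mem := fun _ _ hx => der_mem _ _ hx
  d_d := der_der_eq_zero _ _ (twist_twist A)
  leibniz := by
    intro e i x hx y
    rw [der_node, (Free Q 0 (Dual Q A.toGMod)).parity_of_mem hx, map_smul, LinearMap.smul_apply]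

end BarCobarResolution
section Completion

variable {K : Type u} [Field K] {Q : QuadData.{u, v} K} (A : DGAlg.{u, v, w} Q)

open CategoryTheory

namespace DGAlg

/-- The values of composites of generating operations with `n` inputs, that is, of operations
which span `P(n)`. -/
inductive IsMonomial : ℕ → A → Prop
  | one (a : A) : IsMonomial 1 a
  | node (e : Q.E) (m n : ℕ) (a b : A) (ha : IsMonomial m a) (hb : IsMonomial n b) :
      IsMonomial (m + n) (A.μ e a b)

/-- The operadic filtration `FⁿA = Image(P(n) ⊗ A^{⊗ n} → A)`, for `n ≥ 1`. -/
def opFilt (n : ℕ) : Submodule K A := Submodule.span K {a | A.IsMonomial n a}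

variable {A}

theorem IsMonomial.pos {n : ℕ} {a : A} (h : A.IsMonomial n a) : 1 ≤ n := by
  induction h with
  | one a => exact le_rfl
  | node e p q a b _ _ iha ihb => omega

theorem IsMonomial.mono {n : ℕ} {a : A} (h : A.IsMonomial n a) :
    ∀ m, 1 ≤ m → m ≤ n → A.IsMonomial m a := by
  induction h with
  | one a =>
    intro m h1 h2
    obtain rfl : m = 1 := le_antisymm h2 h1
    exact .one a
  | node e p q a b ha hb iha ihb =>
    intro m h1 h2
    rcases Nat.eq_or_lt_of_le h1 with h | h
    · rw [← h]; exact .one _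
    · have hp := ha.pos
      have hq := hb.pos
      have := IsMonomial.node e _ _ a b (iha (min p (m - 1)) (by omega) (by omega))
        (ihb (m - min p (m - 1)) (by omega) (by omega))
      rwa [show min p (m - 1) + (m - min p (m - 1)) = m by omega] at this

theorem opFilt_anti {m n : ℕ} (h1 : 1 ≤ m) (h2 : m ≤ n) : A.opFilt n ≤ A.opFilt m :=
  Submodule.span_mono fun _ h => IsMonomial.mono h m h1 h2

theorem μ_mem_opFilt (e : Q.E) {m n : ℕ} {a b : A} (ha : a ∈ A.opFilt m) (hb : b ∈ A.opFilt n) :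
    A.μ e a b ∈ A.opFilt (m + n) := by
  induction ha using Submodule.span_induction with
  | mem a ha =>
    induction hb using Submodule.span_induction with
    | mem b hb => exact Submodule.subset_span (.node e m n a b ha hb)
    | zero => rw [map_zero]; exact zero_mem _
    | add b b' _ _ h h' => rw [map_add]; exact add_mem h h'
    | smul c b _ h => rw [map_smul]; exact Submodule.smul_mem _ _ h
  | zero => rw [map_zero, LinearMap.zero_apply]; exact zero_mem _
  | add a a' _ _ h h' => rw [map_add, LinearMap.add_apply]; exact add_mem h h'
  | smul c a _ h => rw [map_smul, LinearMap.smul_apply]; exact Submodule.smul_mem _ _ h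

theorem parity_μ (e : Q.E) (x y : A) : A.parity (A.μ e x y) = A.μ e (A.parity x) (A.parity y) := by
  induction x using A.toGMod.induction_homog with
  | h i x hx =>
    induction y using A.toGMod.induction_homog with
    | h j y hy =>
      rw [A.parity_of_mem hx, A.parity_of_mem hy, A.parity_of_mem (A.isAlg.mem e i j x hx y hy),
        map_smul, map_smul, LinearMap.smul_apply, smul_smul, zero_add, ksign_add, mul_comm]
    | hadd y y' h h' => rw [map_add, map_add, map_add, map_add, h, h']
  | hadd x x' h h' =>
    rw [map_add, map_add, map_add, LinearMap.add_apply, map_add, LinearMap.add_apply, h, h']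

theorem parity_monomial {n : ℕ} {a : A} (h : A.IsMonomial n a) : A.IsMonomial n (A.parity a) := by
  induction h with
  | one a => exact .one _
  | node e m n a b ha hb iha ihb => rw [parity_μ]; exact .node e m n _ _ iha ihb

theorem d_mem_opFilt {n : ℕ} {a : A} (h : a ∈ A.opFilt n) : A.d a ∈ A.opFilt n := by
  have key : ∀ {n : ℕ} {a : A}, A.IsMonomial n a → A.d a ∈ A.opFilt n := by
    intro n a h
    induction h with
    | one a => exact Submodule.subset_span (.one _)
    | node e m n a b ha hb iha ihb =>
      rw [d_μ]
      exact add_mem (μ_mem_opFilt e iha (Submodule.subset_span hb))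
        (μ_mem_opFilt e (Submodule.subset_span (parity_monomial ha)) ihb)
  induction h using Submodule.span_induction with
  | mem a h => exact key h
  | zero => rw [map_zero]; exact zero_mem _
  | add b b' _ _ h h' => rw [map_add]; exact add_mem h h'
  | smul c b _ h => rw [map_smul]; exact Submodule.smul_mem _ _ h

variable (A)

/-- `A` is nilpotent: in each homological degree, the operadic filtration is bounded below. -/
def IsNilpotent : Prop := ∀ k, ∃ n ≥ 1, ∀ a ∈ A.opFilt n, a ∈ A.gr k → a = 0

/-- The differential `A_{k+1} → A_k`. -/
def dPart (k : ℤ) : A.gr (k + 1) →ₗ[K] A.gr k :=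
  A.d.restrict fun x hx => by
    have := A.d_mem _ x hx
    rwa [add_sub_cancel_right] at this

theorem dPart_dPart (k : ℤ) (x : A.gr (k + 1 + 1)) : A.dPart k (A.dPart (k + 1) x) = 0 :=
  Subtype.ext (A.d_d x)

/-- The underlying chain complex of `A`. -/
def complex : ChainComplex (ModuleCat.{w} K) ℤ :=
  ChainComplex.of (fun k => ModuleCat.of K (A.gr k)) (fun k => ModuleCat.ofHom (A.dPart k))
    (fun k => ModuleCat.hom_ext (LinearMap.ext fun x => A.dPart_dPart k x))

theorem complex_d (k : ℤ) : A.complex.d (k + 1) k = ModuleCat.ofHom (A.dPart k) :=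
  ChainComplex.of_d (fun k => ModuleCat.of K (A.gr k)) (fun k => ModuleCat.ofHom (A.dPart k)) k

/-- `F^{n+1}A ∩ A_k`. -/
def filtPart (n : ℕ) (k : ℤ) : Submodule K (A.gr k) := (A.opFilt (n + 1)).comap (A.gr k).subtype

theorem filtPart_anti (n : ℕ) (k : ℤ) : A.filtPart (n + 1) k ≤ A.filtPart n k :=
  Submodule.comap_mono (opFilt_anti (by omega) (by omega))

theorem filtPart_d (n : ℕ) (k : ℤ) :
    A.filtPart n (k + 1) ≤ (A.filtPart n k).comap (A.dPart k) :=
  fun _ hx => d_mem_opFilt hx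

/-- The degree `k` part of the completion `lim A/FⁿA`: the compatible families of elements of
`A_k / (F^{n+1}A ∩ A_k)`, `n ≥ 0`. -/
def completionPart (k : ℤ) : Submodule K (∀ n, A.gr k ⧸ A.filtPart n k) where
  carrier := {c | ∀ n, Submodule.factor (A.filtPart_anti n k) (c (n + 1)) = c n}
  add_mem' := by
    intro a b ha hb n
    rw [Pi.add_apply, Pi.add_apply, map_add, ha n, hb n]
  zero_mem' := fun n => map_zero _
  smul_mem' := by
    intro c a ha n
    rw [Pi.smul_apply, Pi.smul_apply, map_smul, ha n]

/-- The differential induced on `A/F^{n+1}A`. -/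
def dQuot (n : ℕ) (k : ℤ) :
    (A.gr (k + 1) ⧸ A.filtPart n (k + 1)) →ₗ[K] (A.gr k ⧸ A.filtPart n k) :=
  Submodule.mapQ _ _ (A.dPart k) (A.filtPart_d n k)

/-- The differential of the completion. -/
def dCompletion (k : ℤ) : A.completionPart (k + 1) →ₗ[K] A.completionPart k :=
  (LinearMap.pi fun n => A.dQuot n k ∘ₗ LinearMap.proj n).restrict (by
    intro c hc n
    have h := hc n
    have key : ∀ x, Submodule.factor (A.filtPart_anti n k) (A.dQuot (n + 1) k x) =
        A.dQuot n k (Submodule.factor (A.filtPart_anti n (k + 1)) x) := by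
      intro x
      induction x using Submodule.Quotient.induction_on with
      | H x => rfl
    exact (key _).trans (congrArg _ h))

theorem dCompletion_dCompletion (k : ℤ) (c : A.completionPart (k + 1 + 1)) :
    A.dCompletion k (A.dCompletion (k + 1) c) = 0 := by
  refine Subtype.ext (funext fun n => ?_)
  have key : ∀ x, A.dQuot n k (A.dQuot n (k + 1) x) = 0 := by
    intro x
    induction x using Submodule.Quotient.induction_on with
    | H x =>
      have h : A.dQuot n k (A.dQuot n (k + 1) (Submodule.Quotient.mk x)) =
          Submodule.Quotient.mk (A.dPart k (A.dPart (k + 1) x)) := rfl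
      rw [h, dPart_dPart, Submodule.Quotient.mk_zero]
  exact key _

/-- The completion `A^ = lim A/FⁿA`, as a chain complex. -/
def completion : ChainComplex (ModuleCat.{w} K) ℤ :=
  ChainComplex.of (fun k => ModuleCat.of K (A.completionPart k))
    (fun k => ModuleCat.ofHom (A.dCompletion k))
    (fun k => ModuleCat.hom_ext (LinearMap.ext fun x => A.dCompletion_dCompletion k x))

theorem completion_d (k : ℤ) :
    A.completion.d (k + 1) k = ModuleCat.ofHom (A.dCompletion k) :=
  ChainComplex.of_d (fun k => ModuleCat.of K (A.completionPart k))
    (fun k => ModuleCat.ofHom (A.dCompletion k)) k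

/-- The map `A_k → (A^)_k`. -/
def toCompletionPart (k : ℤ) : A.gr k →ₗ[K] A.completionPart k :=
  (LinearMap.pi fun n => (A.filtPart n k).mkQ).codRestrict _ (fun _ _ => rfl)

/-- The canonical chain map `A → A^`. -/
def toCompletion : A.complex ⟶ A.completion :=
  ChainComplex.ofHom (fun k => ModuleCat.ofHom (A.toCompletionPart k))
    (fun k => by
      rw [complex_d, completion_d]
      exact ModuleCat.hom_ext (LinearMap.ext fun x => rfl))

/-- `A` is homotopy complete: for `QA` the bar-cobar resolution of `A`, the map from `QA` to its
completion is a quasi-isomorphism. -/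
def HomotopyComplete : Prop := QuasiIso (toCompletion (barCobar A))

end DGAlg

/-- Concentrated in degrees `≥ 0`. -/
def GMod.IsNonneg (V : GMod.{u, w} K) : Prop := ∀ i < 0, V.gr i = ⊥

/-- Concentrated in degrees `> 0`. -/
def GMod.IsStrictlyPositive (V : GMod.{u, w} K) : Prop := ∀ i ≤ 0, V.gr i = ⊥

/-- Concentrated in degrees `< 0`. -/
def GMod.IsStrictlyNegative (V : GMod.{u, w} K) : Prop := ∀ i ≥ 0, V.gr i = ⊥

end Completion

section Lie

/-- The quadratic data of the Lie operad: an antisymmetric bracket subject to the Jacobi identity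
`[[x,y],z] + [[y,z],x] + [[z,x],y] = 0`. -/
abbrev lieData (K : Type u) [Field K] : QuadData.{u, u} K where
  E := K
  τ := -LinearMap.id
  τ_τ := fun e => neg_neg e
  R := Submodule.span K {fun _ => 1 ⊗ₜ 1}
  R_rot := by
    intro r hr
    obtain ⟨c, rfl⟩ := Submodule.mem_span_singleton.1 hr
    exact hr
  R_swap := by
    intro r hr
    obtain ⟨c, rfl⟩ := Submodule.mem_span_singleton.1 hr
    refine Submodule.mem_span_singleton.2 ⟨-c, ?_⟩
    funext t
    fin_cases t <;> simp

/-- A dg Lie algebra, with homological grading. -/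
structure DGLie (K : Type u) [Field K] extends GMod.{u, w} K where
  bracket : carrier →ₗ[K] carrier →ₗ[K] carrier
  bracket_mem : ∀ i j, ∀ x ∈ gr i, ∀ y ∈ gr j, bracket x y ∈ gr (i + j)
  antisymm : ∀ i j, ∀ x ∈ gr i, ∀ y ∈ gr j, bracket x y = -(ksign K (i * j) • bracket y x)
  jacobi : ∀ i j, ∀ x ∈ gr i, ∀ y ∈ gr j, ∀ z,
    bracket x (bracket y z) = bracket (bracket x y) z + ksign K (i * j) • bracket y (bracket x z)
  d : carrier →ₗ[K] carrier
  d_mem : ∀ i, ∀ x ∈ gr i, d x ∈ gr (i - 1)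
  d_d : ∀ x, d (d x) = 0
  leibniz : ∀ i, ∀ x ∈ gr i, ∀ y, d (bracket x y) = bracket (d x) y + ksign K i • bracket x (d y)

namespace DGLie

variable {K : Type u} [Field K] (g : DGLie.{u, w} K)

instance : CoeSort (DGLie.{u, w} K) (Type w) := ⟨fun g => g.carrier⟩

theorem jacobi_cyclic {i j k : ℤ} {x y z : g} (hx : x ∈ g.gr i) (hy : y ∈ g.gr j)
    (hz : z ∈ g.gr k) : g.bracket (g.bracket x y) z
      + ksign K (i * (j + k)) • g.bracket (g.bracket y z) x
      + ksign K (k * (i + j)) • g.bracket (g.bracket z x) y = 0 := by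
  have h := g.jacobi i j x hx y hy z
  have h1 := g.antisymm i (j + k) x hx _ (g.bracket_mem j k y hy z hz)
  have h2 := g.antisymm j (i + k) y hy _ (g.bracket_mem i k x hx z hz)
  have h3 := g.antisymm i k x hx z hz
  rw [h1, h2, h3] at h
  have s1 : ksign K (i * j) * ksign K (j * (i + k)) * ksign K (i * k) = ksign K (k * (i + j)) := by
    rw [mul_add, ksign_add, mul_add, ksign_add, mul_comm j i, mul_comm j k, mul_comm k i]
    linear_combination (ksign K (k * j) * ksign K (i * k)) * ksign_sq (K := K) (i * j)
  rw [← s1]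
  simp only [map_neg, map_smul, LinearMap.neg_apply, LinearMap.smul_apply] at h
  linear_combination (norm := module) -h

/-- A dg Lie algebra as a dg algebra over the Lie operad. -/
def toDGAlg : DGAlg.{u, u, w} (lieData K) where
  toGMod := g.toGMod
  μ := LinearMap.toSpanSingleton K _ g.bracket
  isAlg := by
    have hμ : ∀ (e : K) (x y : g),
        LinearMap.toSpanSingleton K _ g.bracket e x y = e • g.bracket x y := fun _ _ _ => rfl
    refine ⟨?_, ?_, ?_⟩
    · intro e i j x hx y hy
      rw [zero_add]
      exact Submodule.smul_mem _ (e : K) (g.bracket_mem i j x hx y hy)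
    · intro e i j x hx y hy
      have h : (-e : K) • g.bracket x y = ksign K (i * j) • (e : K) • g.bracket y x := by
        rw [g.antisymm i j x hx y hy, neg_smul, smul_neg, neg_neg, smul_comm]
      exact h
    · intro r hr i j k x hx y hy z hz
      obtain ⟨c, rfl⟩ := Submodule.mem_span_singleton.1 hr
      have h1 : ∀ x y z : g, tri (E := K) (LinearMap.toSpanSingleton K _ g.bracket) x y z
          (c • (1 ⊗ₜ[K] 1)) = c • g.bracket (g.bracket x y) z := by
        intro x y z
        rw [map_smul, tri_tmul, hμ, hμ, one_smul, one_smul]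
      have h2 : c • g.bracket (g.bracket x y) z
          + ksign K (i * (j + k)) • c • g.bracket (g.bracket y z) x
          + ksign K (k * (i + j)) • c • g.bracket (g.bracket z x) y = 0 := by
        rw [smul_comm _ c, smul_comm _ c, ← smul_add, ← smul_add, g.jacobi_cyclic hx hy hz,
          smul_zero]
      rw [← h1, ← h1, ← h1] at h2
      exact h2
  d := g.d
  d_mem := g.d_mem
  d_d := g.d_d
  leibniz := by
    intro e i x hx y
    have h : g.d ((e : K) • g.bracket x y) =
        (e : K) • g.bracket (g.d x) y + ksign K i • (e : K) • g.bracket x (g.d y) := by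
      rw [map_smul, g.leibniz i x hx y, smul_add, smul_comm]
    exact h

/-- The lower central series `L¹g = g`, `Lⁿ⁺¹g = [g, Lⁿg]`, indexed from zero: `lcs n = Lⁿ⁺¹g`. -/
def lcs : ℕ → Submodule K g
  | 0 => ⊤
  | n + 1 => Submodule.span K {z | ∃ x, ∃ y ∈ lcs n, z = g.bracket x y}

/-- `g` is nilpotent: in each homological degree, the lower central series is bounded below. -/
def IsNilpotent : Prop := ∀ k, ∃ n, ∀ x ∈ g.lcs n, x ∈ g.gr k → x = 0

/-- `g` is homotopy complete, as an algebra over the Lie operad. -/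
def HomotopyComplete : Prop := g.toDGAlg.HomotopyComplete

end DGLie

end Lie
end Koszul

end

/-! Write `F^n` for the operadic filtration of `QA = P(P^¡(A))`. The map from `QA` to its completion
is a quasi-isomorphism once the homology of the `F^n` is pro-zero in each degree
(`DGAlg.ProAcyclic`): for all `k` and `n` there is `n'` such that every cycle of degree `k` in
`F^{n'}` bounds an element of `F^n`. This is a telescoping argument (`DGAlg.ProAcyclic.quasiIso`).

If `A` lies in strictly positive or strictly negative degrees, so does `P^¡(A)`, and a product of
`n` generators of `QA` has degree at least `n`, or at most `-n`. In a given degree `F^n` then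
vanishes for large `n`.

If `A` is nonnegative and nilpotent, choose a homogeneous basis of `A` adapted to its operadic
filtration, and split `QA` by multidegree, that is, by the number of occurrences of each basis
letter. Let a letter of degree `δ` have suspended degree `δ + 1`. A product of `r` elements of
`P^¡(A)` of total degree `k` has suspended degree `k + r`; hence in degree `k` the subspace `F^n`
consists of the multidegrees of suspended degree at least `k + n`. The differential is the sum of a
Koszul part, which preserves multidegrees, and a bar part, which lowers the suspended degree by one
and does not lower the weight, the sum of the filtration levels of the letters. The Koszul part is
acyclic in multidegrees with at least two letters (`exists_koszulD_eq`). So the components of top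
suspended degree of a cycle are Koszul cycles and can be removed by subtracting a boundary
(`exists_step`). Repeating this pushes the cycle down to suspended degree `k + n` with no loss of
weight. There the number and the degrees of the letters are bounded, so by nilpotence weights are at
most some `C`; but a cycle in `F^{C+1}` starts with weight at least `C + 1`. Nothing is left
(`exists_boundary`, `proAcyclic_barCobar`).

Koszulness is a statement on multilinear parts over `K^n`. It is carried to a multidegree `μ` by
polarization, with square-zero graded commuting variables `θ_i` that absorb the degrees of the
letters, and by restitution back. The composite is multiplication by the number of permutations
preserving the labelling of the letters, which is invertible in characteristic zero.

For Lie algebras it remains to prove that the Lie operad is Koszul (`isKoszul_lieData`). The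
multilinear part of its Koszul dual on a set `S` is a line spanned by an explicit `lieDual K S`.
Fixing a letter `x0`, the Koszul complex has as a basis the left normed brackets of such elements
whose innermost entry contains `x0`. On these the differential is explicit, and merging a lone
`{x0}` with the next entry is a contracting homotopy (`homotopy`). Independence of the brackets is
seen in associative words (`br_injOn`). Finally `opFilt_le_lcs` compares the operadic filtration
with the lower central series. -/

noncomputable section

namespace Koszul

set_option linter.unusedSectionVars false

/-! ### Koszul signs and parity. -/

section Sign

variable {K : Type u} [Field K]

theorem ksign_congr {m n : ℤ} (h : Even (m - n)) : ksign K m = ksign K n := by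
  have : ksign K m = ksign K (m - n) * ksign K n := by rw [← ksign_add, sub_add_cancel]
  rw [this, ksign, Int.negOnePow_even _ h]; simp

theorem ksign_of_even {m : ℤ} (h : Even m) : ksign K m = 1 := by
  rw [ksign, Int.negOnePow_even _ h]; simp

theorem ksign_of_odd {m : ℤ} (h : ¬Even m) : ksign K m = -1 := by
  rw [ksign, Int.negOnePow_odd _ (Int.not_even_iff_odd.1 h)]; simp

end Sign

/-! ### Algebras with coefficients in a twisted commutative monoid algebra. -/

section Coefficients

variable {K : Type u} [Field K]

/-- The power `par ^ m` of an involution. -/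
def parZ {N : Type w} [AddCommGroup N] [Module K N] (par : N →ₗ[K] N) (m : ℤ) : N →ₗ[K] N :=
  if Even m then LinearMap.id else par

section parZ

variable {N : Type w} [AddCommGroup N] [Module K N] (par : N →ₗ[K] N)

theorem parZ_zero (x : N) : parZ par 0 x = x := by simp [parZ]

theorem parZ_of_mem {gr : ℤ → Submodule K N} (h : ∀ i, ∀ x ∈ gr i, par x = ksign K i • x)
    (m i : ℤ) {x : N} (hx : x ∈ gr i) : parZ par m x = ksign K (m * i) • x := by
  rw [parZ]
  split_ifs with hm
  · rw [ksign_of_even (hm.mul_right i), one_smul]; rfl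
  · rw [h i x hx]
    congr 1
    refine ksign_congr ?_
    obtain ⟨c, rfl⟩ := Int.not_even_iff_odd.1 hm
    exact ⟨-(c * i), by ring⟩

theorem parZ_mem {gr : ℤ → Submodule K N} (h : ∀ i, ∀ x ∈ gr i, par x = ksign K i • x)
    (m i : ℤ) {x : N} (hx : x ∈ gr i) : parZ par m x ∈ gr i := by
  rw [parZ_of_mem par h m i hx]; exact Submodule.smul_mem _ _ hx

theorem parZ_neg_parZ (h : ∀ x, par (par x) = x) (m : ℤ) (x : N) :
    parZ par (-m) (parZ par m x) = x := by
  by_cases hm : Even m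
  · simp [parZ, hm]
  · simp [parZ, hm, h]

theorem parZ_comm {P : Type w'} [AddCommGroup P] [Module K P] (par' : P →ₗ[K] P) (g : N →ₗ[K] P)
    (h : ∀ x, g (par x) = par' (g x)) (m : ℤ) (x : N) :
    g (parZ par m x) = parZ par' m (g x) := by
  rw [parZ, parZ]; split_ifs
  · rfl
  · exact h x

theorem parZ_anticomm (g : N →ₗ[K] N) (h : ∀ x, g (par x) = -par (g x)) (m : ℤ) (x : N) :
    g (parZ par m x) = ksign K m • parZ par m (g x) := by
  rw [parZ]; split_ifs with hm
  · rw [ksign_of_even hm, one_smul]; rfl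
  · rw [ksign_of_odd hm, neg_one_smul]; exact h x

end parZ

/-- A twisted graded commutative monoid algebra `⨁_b K b`, with `b b' = σ b b' (b + b')`. -/
structure Coef (K : Type u) [Field K] (B : Type*) [AddCommMonoid B] where
  deg : B →+ ℤ
  σ : B → B → K
  assoc : ∀ a b c, σ a b * σ (a + b) c = σ b c * σ a (b + c)
  comm : ∀ a b, σ a b = ksign K (deg a * deg b) * σ b a

/-- The (untwisted) commutative monoid algebra, in degree zero. -/
def Coef.triv (K : Type u) [Field K] (B : Type*) [AddCommMonoid B] : Coef K B where
  deg := 0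
  σ _ _ := 1
  assoc _ _ _ := rfl
  comm _ _ := by simp [ksign_zero]

theorem bilin_ext {B B' : Type*} {N : Type w} [AddCommGroup N] [Module K N]
    {N' : Type*} [AddCommGroup N'] [Module K N'] {P : Type w'} [AddCommGroup P] [Module K P]
    {f g : (B →₀ N) →ₗ[K] (B' →₀ N') →ₗ[K] P}
    (h : ∀ b m b' m', f (Finsupp.single b m) (Finsupp.single b' m') =
      g (Finsupp.single b m) (Finsupp.single b' m')) : f = g := by
  refine Finsupp.lhom_ext fun b m => Finsupp.lhom_ext fun b' m' => h b m b' m'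

variable {B : Type*} [AddCommMonoid B] (C : Coef K B)

section cmul

variable {E : Type v} [AddCommGroup E] [Module K E] {N : Type w} [AddCommGroup N] [Module K N]
  (par : N →ₗ[K] N) (μ : E →ₗ[K] N →ₗ[K] N →ₗ[K] N)

/-- Moving the coefficient `b` past the second argument costs a Koszul sign. Expressing it through a
power of the parity operator keeps the pairing bilinear on all of `N`, homogeneous or not. -/
def cpair (e : E) (b b' : B) : N →ₗ[K] N →ₗ[K] (B →₀ N) :=
  C.σ b b' • ((μ e).compl₂ (parZ par (C.deg b))).compr₂ (Finsupp.lsingle (b + b'))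

def cmulAt (e : E) : (B →₀ N) →ₗ[K] (B →₀ N) →ₗ[K] (B →₀ N) :=
  Finsupp.lsum K fun b => (Finsupp.lsum K fun b' => (cpair C par μ e b b').flip).flip

theorem cmulAt_single (e : E) (b b' : B) (m m' : N) :
    cmulAt C par μ e (Finsupp.single b m) (Finsupp.single b' m') =
      Finsupp.single (b + b') (C.σ b b' • μ e m (parZ par (C.deg b) m')) := by
  simp [cmulAt, cpair, LinearMap.compr₂_apply, Finsupp.smul_single]

/-- The extension of operations to coefficients:
`e(x ⊗ b, y ⊗ b') = (-1)^{|b||y|} e(x, y) ⊗ b b'`. -/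
def cmul : E →ₗ[K] (B →₀ N) →ₗ[K] (B →₀ N) →ₗ[K] (B →₀ N) where
  toFun e := cmulAt C par μ e
  map_add' e e' := by
    refine bilin_ext fun b m b' m' => ?_
    rw [LinearMap.add_apply, LinearMap.add_apply, cmulAt_single, cmulAt_single, cmulAt_single,
      map_add, LinearMap.add_apply, LinearMap.add_apply, smul_add, Finsupp.single_add]
  map_smul' c e := by
    refine bilin_ext fun b m b' m' => ?_
    rw [RingHom.id_apply, LinearMap.smul_apply, LinearMap.smul_apply, cmulAt_single,
      cmulAt_single, map_smul, LinearMap.smul_apply, LinearMap.smul_apply, smul_comm,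
      Finsupp.smul_single]

theorem cmul_single (e : E) (b b' : B) (m m' : N) :
    cmul C par μ e (Finsupp.single b m) (Finsupp.single b' m') =
      Finsupp.single (b + b') (C.σ b b' • μ e m (parZ par (C.deg b) m')) :=
  cmulAt_single ..

/-- Coefficientwise membership in a product. -/
theorem cmul_mem (S T U : B → Submodule K N) (e : E)
    (h : ∀ b b', C.σ b b' ≠ 0 → ∀ m ∈ S b, ∀ m' ∈ T b',
      μ e m (parZ par (C.deg b) m') ∈ U (b + b'))
    {x y : B →₀ N} (hx : ∀ b, x b ∈ S b) (hy : ∀ b, y b ∈ T b) (b : B) :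
    cmul C par μ e x y b ∈ U b := by
  classical
  rw [← x.sum_single, ← y.sum_single, Finsupp.sum, Finsupp.sum, map_sum, Finsupp.finsetSum_apply]
  refine Submodule.sum_mem _ fun j _ => ?_
  rw [map_sum, LinearMap.sum_apply, Finsupp.finsetSum_apply]
  refine Submodule.sum_mem _ fun i _ => ?_
  rw [cmul_single, Finsupp.single_apply]
  split_ifs with hij
  · subst hij
    -- Pairs with vanishing structure constant contribute nothing. For the square-zero variables
    -- used in polarization this discards all pairs of multidegrees with a common index, which is
    -- how disjointness of supports is obtained.
    by_cases h0 : C.σ i j = 0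
    · rw [h0, zero_smul]; exact zero_mem _
    · exact Submodule.smul_mem _ _ (h i j h0 _ (hx i) _ (hy j))
  · exact zero_mem _

end cmul

/-- A graded algebra over `(E, R)`, with an operator `x ↦ (-1)^{|x|} x`. -/
structure GAlg (Q : QuadData.{u, v} K) (s : ℤ) where
  carrier : Type w
  [addCommGroup : AddCommGroup carrier]
  [module : Module K carrier]
  gr : ℤ → Submodule K carrier
  par : carrier →ₗ[K] carrier
  par_of_mem : ∀ i, ∀ x ∈ gr i, par x = ksign K i • x
  μ : Q.E →ₗ[K] carrier →ₗ[K] carrier →ₗ[K] carrier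
  isAlg : IsAlg Q s gr μ

attribute [instance] GAlg.addCommGroup GAlg.module

instance (Q : QuadData.{u, v} K) (s : ℤ) : CoeSort (GAlg.{u, v, w} Q s) (Type w) :=
  ⟨fun A => A.carrier⟩

variable {Q : QuadData.{u, v} K} {s : ℤ}

/-- The free algebra with its parity operator. -/
def freeAlg (Q : QuadData.{u, v} K) (s : ℤ) (V : GMod.{u, w} K) : GAlg Q s where
  carrier := Free Q s V
  gr := (Free Q s V).gr
  par := (Free Q s V).parity
  par_of_mem _ _ hx := (Free Q s V).parity_of_mem hx
  μ := Free.node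
  isAlg := Free.isAlg

/-- The grading on `N ⊗ ⨁_b K b`. -/
def extGr {N : Type w} [AddCommGroup N] [Module K N] (gr : ℤ → Submodule K N) (k : ℤ) :
    Submodule K (B →₀ N) :=
  ⨅ b, (gr (k - C.deg b)).comap (Finsupp.lapply b)

section extGr

variable {N : Type w} [AddCommGroup N] [Module K N] {gr : ℤ → Submodule K N}

variable {C}

theorem mem_extGr {k : ℤ} {x : B →₀ N} : x ∈ extGr C gr k ↔ ∀ b, x b ∈ gr (k - C.deg b) := by
  simp [extGr]

theorem single_mem_extGr {k : ℤ} {b : B} {m : N} (h : m ∈ gr (k - C.deg b)) :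
    Finsupp.single b m ∈ extGr C gr k := by
  classical
  refine mem_extGr.2 fun b' => ?_
  rw [Finsupp.single_apply]
  split_ifs with hb
  · rwa [← hb]
  · exact zero_mem _

theorem extGr_induction {k : ℤ} {p : (B →₀ N) → Prop} (h0 : p 0)
    (hadd : ∀ x y, p x → p y → p (x + y))
    (hs : ∀ b, ∀ m ∈ gr (k - C.deg b), p (Finsupp.single b m)) {x : B →₀ N}
    (hx : x ∈ extGr C gr k) : p x := by
  rw [← x.sum_single, Finsupp.sum]
  exact Finset.sum_induction _ p hadd h0 fun b _ => hs b _ (mem_extGr.1 hx b)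

end extGr

/-- The parity operator on `N ⊗ ⨁_b K b`. -/
def extPar {N : Type w} [AddCommGroup N] [Module K N] (par : N →ₗ[K] N) :
    (B →₀ N) →ₗ[K] (B →₀ N) :=
  Finsupp.lsum K fun b => ksign K (C.deg b) • (Finsupp.lsingle b ∘ₗ par)

theorem extPar_single {N : Type w} [AddCommGroup N] [Module K N] (par : N →ₗ[K] N) (b : B)
    (m : N) : extPar C par (Finsupp.single b m) =
      Finsupp.single b (ksign K (C.deg b) • par m) := by
  simp [extPar, Finsupp.smul_single]

section extAlg

variable (A : GAlg.{u, v, w} Q s)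

theorem tri_cmul_single (b1 b2 b3 : B) (m1 m2 m3 : A) (r : Q.E ⊗[K] Q.E) :
    tri (cmul C A.par A.μ) (Finsupp.single b1 m1) (Finsupp.single b2 m2) (Finsupp.single b3 m3) r =
      Finsupp.single (b1 + b2 + b3) ((C.σ b1 b2 * C.σ (b1 + b2) b3) •
        tri A.μ m1 (parZ A.par (C.deg b1) m2) (parZ A.par (C.deg (b1 + b2)) m3) r) := by
  induction r using TensorProduct.induction_on with
  | zero => simp
  | tmul e e' =>
    rw [tri_tmul, tri_tmul, cmul_single, cmul_single, map_smul, LinearMap.smul_apply, smul_smul,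
      mul_comm]
  | add a b ha hb => rw [map_add, map_add, ha, hb, smul_add, Finsupp.single_add]

/-- The tensor product of an algebra with a graded commutative algebra is again an algebra of the
same type: associativity and commutativity of the coefficients bring the three terms of a relation
to one common coefficient, and the leftover signs are those of the relation in `A`. By linearity
everything is checked on monomials. -/
theorem extAlg_isAlg : IsAlg Q s (extGr C A.gr) (cmul C A.par A.μ) where
  mem e i j x hx y hy := by
    refine mem_extGr.2 fun b => ?_
    refine cmul_mem C A.par A.μ (fun b => A.gr (i - C.deg b)) (fun b => A.gr (j - C.deg b))
      (fun b => A.gr (s + i + j - C.deg b)) e ?_ (mem_extGr.1 hx) (mem_extGr.1 hy) b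
    intro b b' _ m hm m' hm'
    have := A.isAlg.mem e _ _ _ hm _ (parZ_mem A.par A.par_of_mem (C.deg b) _ hm')
    rwa [show s + (i - C.deg b) + (j - C.deg b') = s + i + j - C.deg (b + b') by
      rw [map_add]; ring] at this
  symm e i j x hx y hy := by
    refine extGr_induction (p := fun x => cmul C A.par A.μ (Q.τ e) x y =
      ksign K (i * j) • cmul C A.par A.μ e y x) (by simp) ?_ ?_ hx
    · intro x x' h h'
      rw [map_add, map_add, LinearMap.add_apply, h, h', smul_add]
    · intro b m hm
      refine extGr_induction (p := fun y => cmul C A.par A.μ (Q.τ e) (Finsupp.single b m) y =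
        ksign K (i * j) • cmul C A.par A.μ e y (Finsupp.single b m)) (by simp) ?_ ?_ hy
      · intro y y' h h'
        rw [map_add, map_add, LinearMap.add_apply, h, h', smul_add]
      · intro b' m' hm'
        rw [cmul_single, cmul_single, parZ_of_mem A.par A.par_of_mem _ _ hm,
          parZ_of_mem A.par A.par_of_mem _ _ hm', map_smul, map_smul, A.isAlg.symm e _ _ m hm m' hm',
          C.comm b b', add_comm b' b, Finsupp.smul_single]
        simp only [smul_smul]
        have h1 : C.σ b b' = ksign K (C.deg b * C.deg b') * C.σ b' b := C.comm b b'
        have key : ksign K (C.deg b * C.deg b') * (ksign K (C.deg b * (j - C.deg b')) *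
            ksign K ((i - C.deg b) * (j - C.deg b'))) =
            ksign K (i * j) * ksign K (C.deg b' * (i - C.deg b)) := by
          simp only [← ksign_add]
          exact ksign_congr ⟨C.deg b * C.deg b' - i * C.deg b', by ring⟩
        congr 2
        linear_combination C.σ b' b * key
  rel r hr i j k x hx y hy z hz := by
    have t1 := fun y z => tri_smul_left (cmul C A.par A.μ) 0 0 y z
    have t2 := fun x z => tri_smul_mid (cmul C A.par A.μ) 0 x 0 z
    have t3 := fun x y => tri_smul_right (cmul C A.par A.μ) 0 x y 0
    simp only [zero_smul] at t1 t2 t3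
    refine extGr_induction (p := fun x => tri (cmul C A.par A.μ) x y z (r 0)
      + ksign K (i * (j + k)) • tri (cmul C A.par A.μ) y z x (r 1)
      + ksign K (k * (i + j)) • tri (cmul C A.par A.μ) z x y (r 2) = 0)
      (by simp only [t1, t2, t3, smul_zero, add_zero]) ?_ ?_ hx
    · intro x x' h h'
      rw [tri_add_left, tri_add_mid, tri_add_right]
      linear_combination (norm := module) h + h'
    intro b1 m1 h1
    refine extGr_induction (p := fun y => tri (cmul C A.par A.μ) (Finsupp.single b1 m1) y z (r 0)
      + ksign K (i * (j + k)) • tri (cmul C A.par A.μ) y z (Finsupp.single b1 m1) (r 1)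
      + ksign K (k * (i + j)) • tri (cmul C A.par A.μ) z (Finsupp.single b1 m1) y (r 2) = 0)
      (by simp only [t1, t2, t3, smul_zero, add_zero]) ?_ ?_ hy
    · intro x x' h h'
      rw [tri_add_left, tri_add_mid, tri_add_right]
      linear_combination (norm := module) h + h'
    intro b2 m2 h2
    refine extGr_induction (p := fun z =>
      tri (cmul C A.par A.μ) (Finsupp.single b1 m1) (Finsupp.single b2 m2) z (r 0)
      + ksign K (i * (j + k)) •
        tri (cmul C A.par A.μ) (Finsupp.single b2 m2) z (Finsupp.single b1 m1) (r 1)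
      + ksign K (k * (i + j)) •
        tri (cmul C A.par A.μ) z (Finsupp.single b1 m1) (Finsupp.single b2 m2) (r 2) = 0)
      (by simp only [t1, t2, t3, smul_zero, add_zero]) ?_ ?_ hz
    · intro x x' h h'
      rw [tri_add_left, tri_add_mid, tri_add_right]
      linear_combination (norm := module) h + h'
    intro b3 m3 h3
    have hrel := A.isAlg.rel r hr _ _ _ m1 h1 m2 h2 m3 h3
    have p := fun (b : B) => parZ_of_mem A.par A.par_of_mem (C.deg b)
    rw [tri_cmul_single, tri_cmul_single, tri_cmul_single, p _ _ h1, p _ _ h2, p _ _ h3, p _ _ h3,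
      p _ _ h1, p _ _ h2, show b2 + b3 + b1 = b1 + b2 + b3 by abel,
      show b3 + b1 + b2 = b1 + b2 + b3 by abel]
    simp only [tri_smul_mid, tri_smul_right, Finsupp.smul_single, ← Finsupp.single_add]
    rw [Finsupp.single_eq_zero]
    -- The coefficients of both cyclic rotations are a sign times the coefficient of the first term,
    -- so only signs remain to be matched.
    have s1 : C.σ b2 b3 * C.σ (b2 + b3) b1 =
        ksign K (C.deg b1 * C.deg (b2 + b3)) * (C.σ b1 b2 * C.σ (b1 + b2) b3) := by
      rw [C.comm (b2 + b3) b1, C.assoc b1 b2 b3, mul_comm (C.deg b1)]; ring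
    have s2 : C.σ b3 b1 * C.σ (b3 + b1) b2 =
        ksign K (C.deg b3 * C.deg (b1 + b2)) * (C.σ b1 b2 * C.σ (b1 + b2) b3) := by
      rw [C.assoc b3 b1 b2, C.comm b3 (b1 + b2)]; ring
    rw [s1, s2]
    simp only [map_add, smul_smul] at hrel ⊢
    have key1 : ksign K (i * (j + k)) * ksign K (C.deg b1 * (C.deg b2 + C.deg b3)) *
        (ksign K (C.deg b2 * (k - C.deg b3)) * ksign K ((C.deg b2 + C.deg b3) * (i - C.deg b1))) =
        ksign K (C.deg b1 * (j - C.deg b2)) * ksign K ((C.deg b1 + C.deg b2) * (k - C.deg b3)) *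
        ksign K ((i - C.deg b1) * (j - C.deg b2 + (k - C.deg b3))) := by
      simp only [← ksign_add]
      exact ksign_congr ⟨C.deg b2 * i + C.deg b3 * i, by ring⟩
    have key2 : ksign K (k * (i + j)) * ksign K (C.deg b3 * (C.deg b1 + C.deg b2)) *
        (ksign K (C.deg b3 * (i - C.deg b1)) * ksign K ((C.deg b3 + C.deg b1) * (j - C.deg b2))) =
        ksign K (C.deg b1 * (j - C.deg b2)) * ksign K ((C.deg b1 + C.deg b2) * (k - C.deg b3)) *
        ksign K ((k - C.deg b3) * (i - C.deg b1 + (j - C.deg b2))) := by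
      simp only [← ksign_add]
      exact ksign_congr ⟨C.deg b3 * i + C.deg b3 * j, by ring⟩
    have hrel' := congrArg (fun t => (C.σ b1 b2 * C.σ (b1 + b2) b3 *
      (ksign K (C.deg b1 * (j - C.deg b2)) * ksign K ((C.deg b1 + C.deg b2) * (k - C.deg b3)))) • t)
      hrel
    simp only [smul_add, smul_zero, smul_smul] at hrel'
    rw [← hrel']
    congr 1
    · congr 1
      · congr 1; ring
      · congr 1; linear_combination (C.σ b1 b2 * C.σ (b1 + b2) b3) * key1
    · congr 1; linear_combination (C.σ b1 b2 * C.σ (b1 + b2) b3) * key2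

end extAlg

end Coefficients

/-! ### Maps of free algebras with coefficients. -/

section CoefficientFunctor

variable {K : Type u} [Field K]

/-- A linear map applied coefficientwise. -/
def cmap {N : Type*} {P : Type*} [AddCommGroup N] [Module K N] [AddCommGroup P] [Module K P]
    (B : Type*) (g : N →ₗ[K] P) : (B →₀ N) →ₗ[K] (B →₀ P) :=
  Finsupp.mapRange.linearMap g

section cmap

variable {N : Type*} {P : Type*} {P' : Type*} [AddCommGroup N] [Module K N] [AddCommGroup P]
  [Module K P] [AddCommGroup P'] [Module K P'] {B : Type*}

@[simp] theorem cmap_single (g : N →ₗ[K] P) (b : B) (m : N) :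
    cmap B g (Finsupp.single b m) = Finsupp.single b (g m) := by
  simp [cmap]

@[simp] theorem cmap_apply (g : N →ₗ[K] P) (x : B →₀ N) (b : B) : cmap B g x b = g (x b) := rfl

theorem cmap_cmap (g : P →ₗ[K] P') (g' : N →ₗ[K] P) (x : B →₀ N) :
    cmap B g (cmap B g' x) = cmap B (g ∘ₗ g') x := Finsupp.ext fun _ => rfl

theorem cmap_injective {g : N →ₗ[K] P} (hg : Function.Injective g) :
    Function.Injective (cmap B g) :=
  fun _ _ h => Finsupp.ext fun b => hg (DFunLike.congr_fun h b)

end cmap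

theorem parity_hom (V : GMod.{u, w} K) {N : Type w'} [AddCommGroup N] [Module K N]
    {gr : ℤ → Submodule K N} {par : N →ₗ[K] N} (hpar : ∀ i, ∀ x ∈ gr i, par x = ksign K i • x)
    (g : V →ₗ[K] N) (hg : ∀ i, ∀ x ∈ V.gr i, g x ∈ gr i) (x : V) :
    g (V.parity x) = par (g x) := by
  induction x using V.induction_homog with
  | h i x hx => rw [V.parity_of_mem hx, map_smul, hpar i _ (hg i x hx)]
  | hadd x y hx hy => rw [map_add, map_add, map_add, map_add, hx, hy]

variable {B : Type*} [AddCommMonoid B] (C : Coef K B)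

section cmul

variable {E : Type v} [AddCommGroup E] [Module K E] {N : Type w} [AddCommGroup N] [Module K N]
  {P : Type w'} [AddCommGroup P] [Module K P]
  {par : N →ₗ[K] N} {μ : E →ₗ[K] N →ₗ[K] N →ₗ[K] N}
  {par' : P →ₗ[K] P} {μ' : E →ₗ[K] P →ₗ[K] P →ₗ[K] P}

/-- The map applied to a product may differ from the one applied to the factors: for cutting trees
these are `cut` and the inclusion of generators. -/
theorem cmap_cmul (g g' : N →ₗ[K] P) (e : E) (h : ∀ x y, g (μ e x y) = μ' e (g' x) (g' y))
    (hp : ∀ x, g' (par x) = par' (g' x)) (x y : B →₀ N) :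
    cmap B g (cmul C par μ e x y) = cmul C par' μ' e (cmap B g' x) (cmap B g' y) := by
  have : (cmul C par μ e).compr₂ (cmap B g) =
      (cmul C par' μ' e).compl₁₂ (cmap B g') (cmap B g') := by
    refine bilin_ext fun b m b' m' => ?_
    rw [LinearMap.compr₂_apply, LinearMap.compl₁₂_apply, cmul_single, cmap_single, cmap_single,
      cmap_single, cmul_single, map_smul, h, parZ_comm par par' g' hp]
  exact LinearMap.congr_fun₂ this x y

/-- An odd derivation applied coefficientwise stays a derivation. Passing it over the coefficient
`b` gives the sign `(-1)^{|b|}`, which is the one built into `extPar`. -/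
theorem cmap_cmul_derivation (D : N →ₗ[K] N) (e : E)
    (h : ∀ x y, D (μ e x y) = μ e (D x) y + μ e (par x) (D y))
    (hp : ∀ x, D (par x) = -par (D x)) (x y : B →₀ N) :
    cmap B D (cmul C par μ e x y) =
      cmul C par μ e (cmap B D x) y + cmul C par μ e (extPar C par x) (cmap B D y) := by
  have : (cmul C par μ e).compr₂ (cmap B D) =
      (cmul C par μ e).compl₁₂ (cmap B D) LinearMap.id +
        (cmul C par μ e).compl₁₂ (extPar C par) (cmap B D) := by
    refine bilin_ext fun b m b' m' => ?_
    rw [LinearMap.add_apply, LinearMap.add_apply, LinearMap.compr₂_apply, LinearMap.compl₁₂_apply,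
      LinearMap.compl₁₂_apply, cmul_single, cmap_single, cmap_single, cmap_single, extPar_single,
      LinearMap.id_apply, cmul_single, cmul_single, map_smul, h, smul_add, Finsupp.single_add,
      parZ_anticomm par D hp, map_smul, map_smul, LinearMap.smul_apply]
  exact LinearMap.congr_fun₂ this x y

end cmul

variable {Q : QuadData.{u, v} K} {s : ℤ}

theorem extPar_of_mem (A : GAlg.{u, v, w} Q s) (i : ℤ) {x : B →₀ A} (hx : x ∈ extGr C A.gr i) :
    extPar C A.par x = ksign K i • x := by
  refine extGr_induction (p := fun x => extPar C A.par x = ksign K i • x) (by simp) ?_ ?_ hx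
  · intro x y h h'
    rw [map_add, h, h', smul_add]
  · intro b m hm
    rw [extPar_single, A.par_of_mem _ _ hm, smul_smul, ← ksign_add, Finsupp.smul_single,
      add_sub_cancel]

variable {V : GMod.{u, w} K} {W : GMod.{u, w'} K}

open Free

theorem free_hom_ext {N : Type*} [AddCommGroup N] [Module K N] {μ : Q.E →ₗ[K] N →ₗ[K] N →ₗ[K] N}
    {f g : Free Q s V →ₗ[K] N} (hf : ∀ e x y, f (node e x y) = μ e (f x) (f y))
    (hg : ∀ e x y, g (node e x y) = μ e (g x) (g y)) (h : ∀ x, f (ι x) = g (ι x)) : f = g := by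
  refine Free.ext (fun _ x _ => h x) fun e i j x _ y _ h1 h2 => ?_
  rw [hf, hg, h1, h2]

variable (f : V →ₗ[K] (B →₀ W)) (hf : ∀ i, ∀ x ∈ V.gr i, f x ∈ extGr C W.gr i)

theorem fmap_aux (Q : QuadData.{u, v} K) (s : ℤ) {C : Coef K B} {f : V →ₗ[K] (B →₀ W)}
    (hf : ∀ i, ∀ x ∈ V.gr i, f x ∈ extGr C W.gr i) :
    ∀ i, ∀ x ∈ V.gr i, (cmap B (ι (Q := Q) (s := s)) ∘ₗ f) x ∈ extGr C (Free Q s W).gr i :=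
  fun i x hx => mem_extGr.2 fun b => ι_mem (mem_extGr.1 (hf i x hx) b)

/-- The map of free algebras with coefficients induced by a map of graded spaces with
coefficients. -/
def fmap (Q : QuadData.{u, v} K) (s : ℤ) : Free Q s V →ₗ[K] (B →₀ Free Q s W) :=
  lift (extAlg_isAlg C (freeAlg Q s W)) (cmap B (ι (Q := Q) (s := s)) ∘ₗ f) (fmap_aux Q s hf)

theorem fmap_ι (x : V) : fmap C f hf Q s (ι x) = cmap B ι (f x) := lift_ι ..

theorem fmap_node (e : Q.E) (x y : Free Q s V) : fmap C f hf Q s (node e x y) =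
    cmul C (Free Q s W).parity node e (fmap C f hf Q s x) (fmap C f hf Q s y) := lift_node ..

theorem fmap_mem {i : ℤ} {x : Free Q s V} (hx : x ∈ (Free Q s V).gr i) :
    fmap C f hf Q s x ∈ extGr C (Free Q s W).gr i :=
  lift_mem (extAlg_isAlg C (freeAlg Q s W)) _ (fmap_aux Q s hf) hx

theorem fmap_parity (x : Free Q s V) : fmap C f hf Q s ((Free Q s V).parity x) =
    extPar C (Free Q s W).parity (fmap C f hf Q s x) :=
  parity_hom (Free Q s V) (fun i _ hx => extPar_of_mem C (freeAlg Q s W) i hx) _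
    (fun _ _ hx => fmap_mem C f hf hx) x

/-- Both sides are derivations along the multiplicative map `fmap`, so it suffices that they agree
on generators. -/
theorem fmap_der (g : V →ₗ[K] Free Q 0 V) (hg : ∀ i, ∀ x ∈ V.gr i, g x ∈ (Free Q 0 V).gr (i - 1))
    (g' : W →ₗ[K] Free Q 0 W) (hg' : ∀ i, ∀ x ∈ W.gr i, g' x ∈ (Free Q 0 W).gr (i - 1))
    (h : ∀ x, fmap C f hf Q 0 (g x) = cmap B g' (f x)) (x : Free Q 0 V) :
    fmap C f hf Q 0 (der g hg x) = cmap B (der g' hg') (fmap C f hf Q 0 x) := by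
  have : fmap C f hf Q 0 ∘ₗ der g hg = cmap B (der g' hg') ∘ₗ fmap C f hf Q 0 := by
    refine Free.ext ?_ ?_
    · intro i x _
      rw [LinearMap.comp_apply, LinearMap.comp_apply, der_ι, h, fmap_ι, cmap_cmap]
      congr 2
      exact LinearMap.ext fun y => (der_ι g' hg' y).symm
    · intro e i j x _ y _ h1 h2
      rw [LinearMap.comp_apply, LinearMap.comp_apply] at *
      rw [der_node, map_add, fmap_node, fmap_node, fmap_parity, h1, h2, fmap_node,
        cmap_cmul_derivation]
      · intro x y
        exact der_node g' hg' e x y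
      · intro x
        rw [der_parity, neg_neg]
  exact LinearMap.congr_fun this x

end CoefficientFunctor

/-! ### Functoriality of the Koszul dual and of the Koszul complex, with coefficients. -/

section DualFunctor

variable {K : Type u} [Field K] {B : Type*} [AddCommMonoid B] (C : Coef K B)
  {Q : QuadData.{u, v} K} {V : GMod.{u, w} K} {W : GMod.{u, w'} K}
  (f : V →ₗ[K] (B →₀ W)) (hf : ∀ i, ∀ x ∈ V.gr i, f x ∈ extGr C W.gr i)

open Free

/-- The functoriality of tree tensors, with coefficients. -/
def treeMap (Q : QuadData.{u, v} K) : Tree Q V →ₗ[K] (B →₀ Tree Q W) := fmap C f hf Q.magma 1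

theorem treeMap_leaf (x : V) : treeMap C f hf Q (Tree.leaf Q x) = cmap B (Tree.leaf Q) (f x) :=
  fmap_ι ..

theorem treeMap_node (e : Q.E) (x y : Tree Q V) : treeMap C f hf Q (Tree.node Q e x y) =
    cmul C (Tree Q W).parity (Tree.node Q) e (treeMap C f hf Q x) (treeMap C f hf Q y) :=
  fmap_node (Q := Q.magma) ..

theorem treeMap_mem : ∀ i, ∀ x ∈ (Tree Q V).gr i,
    treeMap C f hf Q x ∈ extGr C (Tree Q W).gr i :=
  fun _ _ hx => fmap_mem (Q := Q.magma) C f hf hx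

theorem fmap_cut (x : Tree Q V) :
    fmap C (treeMap C f hf Q) (treeMap_mem C f hf) Q 0 (cut Q V x) =
      cmap B (cut Q W) (treeMap C f hf Q x) := by
  have : fmap C (treeMap C f hf Q) (treeMap_mem C f hf) Q 0 ∘ₗ cut Q V =
      cmap B (cut Q W) ∘ₗ treeMap C f hf Q := by
    refine tree_ext ?_ ?_
    · intro x
      rw [LinearMap.comp_apply, LinearMap.comp_apply, cut_leaf, treeMap_leaf, cmap_cmap, map_zero]
      refine Finsupp.ext fun b => ?_
      exact (cut_leaf (Q := Q) (V := W) (f x b)).symm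
    · intro e x y
      rw [LinearMap.comp_apply, LinearMap.comp_apply, cut_node, treeMap_node, fmap_node, fmap_ι,
        fmap_ι]
      refine (cmap_cmul C (cut Q W) ι e (fun x y => cut_node (Q := Q) e x y) (fun x => ?_) _ _).symm
      exact (parity_ι x).symm
  exact LinearMap.congr_fun this x

theorem fmap_cutTwice (x : Tree Q V) :
    fmap C (treeMap C f hf Q) (treeMap_mem C f hf) Q 0 (cutTwice Q V x) =
      cmap B (cutTwice Q W) (treeMap C f hf Q x) := by
  rw [cutTwice, LinearMap.comp_apply, fmap_der C _ _ (cut Q V) (cut_mem Q) (cut Q W) (cut_mem Q)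
    (fmap_cut C f hf), fmap_cut, cmap_cmap]
  rfl

/-- The Koszul dual is cut out, height by height, by the kernel of `cutTwice`; since `cutTwice`
commutes with maps of generators (`fmap_cutTwice`), the kernel condition is preserved. -/
theorem treeMap_mem_dualPart {i : ℤ} {x : Tree Q V} (hx : x ∈ dualPart Q V i) (b : B) :
    treeMap C f hf Q x b ∈ dualPart Q W (i - C.deg b) := by
  obtain ⟨h, hh⟩ := mem_dualPart.1 hx
  clear hx
  have hleaf : ∀ i, ∀ a ∈ V.gr i, ∀ b,
      treeMap C f hf Q (Tree.leaf Q a) b ∈ dualPart Q W (i - C.deg b) := by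
    intro i a ha b
    rw [treeMap_leaf]
    exact leaf_mem_dualPart (mem_extGr.1 (hf i a ha) b)
  induction h generalizing i x b with
  | zero =>
    obtain ⟨a, ha, rfl⟩ := hh
    exact hleaf i a ha b
  | succ h ih =>
    rw [dualHeight] at hh
    obtain ⟨_, ⟨a, ha, rfl⟩, t, ⟨ht, ht'⟩, rfl⟩ := Submodule.mem_sup.1 hh
    rw [map_add]
    refine add_mem (hleaf i a ha b) (nodeSpan_inf_le _ ⟨?_, ?_⟩)
    · clear ht' hh
      induction ht using Submodule.span_induction with
      | mem t ht =>
        obtain ⟨e, p, q, x, hx, y, hy, rfl, rfl⟩ := ht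
        rw [treeMap_node]
        refine cmul_mem C _ _ (fun b => dualPart Q W (p - C.deg b))
          (fun b => dualPart Q W (q - C.deg b)) (fun b => nodeSpan Q W (1 + p + q - C.deg b)) e ?_
          (fun b => ih b hx) (fun b => ih b hy) b
        intro b b' _ m hm m' hm'
        refine Submodule.subset_span ⟨e, _, q - C.deg b', m, hm, _, ?_, ?_, rfl⟩
        · rw [parZ_of_mem _ (fun _ _ hx => (Tree Q W).parity_of_mem hx) _ _
            (dualPart_le_gr _ hm')]
          exact Submodule.smul_mem _ _ hm'
        · rw [map_add]; ring
      | zero => rw [map_zero]; exact zero_mem _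
      | add x y _ _ hx hy => rw [map_add]; exact add_mem hx hy
      | smul c x _ hx => rw [map_smul]; exact Submodule.smul_mem _ _ hx
    · have := fmap_cutTwice C f hf t
      rw [LinearMap.mem_ker.1 ht', map_zero] at this
      exact (DFunLike.congr_fun this b).symm

/-- The functoriality of `P^¡(V)`, with coefficients. -/
def dualMap (Q : QuadData.{u, v} K) : Dual Q V →ₗ[K] (B →₀ Dual Q W) :=
  cmap B (Dual.retraction Q W) ∘ₗ treeMap C f hf Q ∘ₗ Dual.incl

/-- Tree maps preserve the Koszul dual, so the retraction in the definition of `dualMap` acts as the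
identity on the elements it meets, and the choice of projection is irrelevant. -/
theorem incl_dualMap (x : Dual Q V) :
    cmap B Dual.incl (dualMap C f hf Q x) = treeMap C f hf Q (Dual.incl x) := by
  induction x using (Dual Q V).induction_homog with
  | h i x hx =>
    refine Finsupp.ext fun b => ?_
    obtain ⟨w, _, hw⟩ := Dual.exists_incl (treeMap_mem_dualPart C f hf hx b)
    have h : dualMap C f hf Q x b = Dual.retraction Q W (treeMap C f hf Q (Dual.incl x) b) := rfl
    have hw' : Dual.incl w = treeMap C f hf Q (Dual.incl x) b := hw
    rw [cmap_apply, h, ← hw', Dual.retraction_incl]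
  | hadd x y hx hy => simp only [map_add, hx, hy]

theorem dualMap_mem : ∀ i, ∀ x ∈ (Dual Q V).gr i,
    dualMap C f hf Q x ∈ extGr C (Dual Q W).gr i := by
  intro i x hx
  refine mem_extGr.2 fun b => Dual.mem_gr.2 ?_
  have := DFunLike.congr_fun (incl_dualMap C f hf x) b
  rw [cmap_apply] at this
  rw [this]
  exact treeMap_mem_dualPart C f hf hx b

theorem incl_parity (x : Dual Q V) : Dual.incl ((Dual Q V).parity x) =
    (Tree Q V).parity (Dual.incl x) :=
  parity_hom _ (fun _ _ hx => (Tree Q V).parity_of_mem hx) _ (fun i _ hx => dualPart_le_gr i hx) x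

/-- The functoriality of `P(P^¡(V))`, with coefficients. -/
def koszulMap (Q : QuadData.{u, v} K) :
    Free Q 0 (Dual Q V) →ₗ[K] (B →₀ Free Q 0 (Dual Q W)) :=
  fmap C (dualMap C f hf Q) (dualMap_mem C f hf) Q 0

theorem koszulMap_ι (x : Dual Q V) :
    koszulMap C f hf Q (ι x) = cmap B ι (dualMap C f hf Q x) := fmap_ι ..

theorem koszulMap_node (e : Q.E) (x y : Free Q 0 (Dual Q V)) : koszulMap C f hf Q (node e x y) =
    cmul C (Free Q 0 (Dual Q W)).parity node e (koszulMap C f hf Q x) (koszulMap C f hf Q y) :=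
  fmap_node ..

theorem koszulMap_mem {i : ℤ} {x : Free Q 0 (Dual Q V)} (hx : x ∈ (Free Q 0 (Dual Q V)).gr i) :
    koszulMap C f hf Q x ∈ extGr C (Free Q 0 (Dual Q W)).gr i := fmap_mem C _ _ hx

theorem cmul_retractFree_cut (e : Q.E) (x y : B →₀ Dual Q W) :
    cmap B (retractFree Q W ∘ₗ cut Q W)
      (cmul C (Tree Q W).parity (Tree.node Q) e (cmap B Dual.incl x) (cmap B Dual.incl y)) =
      cmul C (Free Q 0 (Dual Q W)).parity node e (cmap B ι x) (cmap B ι y) := by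
  have : ((cmul C (Tree Q W).parity (Tree.node Q) e).compl₁₂ (cmap B Dual.incl)
      (cmap B Dual.incl)).compr₂ (cmap B (retractFree Q W ∘ₗ cut Q W)) =
      (cmul C (Free Q 0 (Dual Q W)).parity node e).compl₁₂ (cmap B ι) (cmap B ι) := by
    refine bilin_ext fun b m b' m' => ?_
    rw [LinearMap.compr₂_apply, LinearMap.compl₁₂_apply, LinearMap.compl₁₂_apply, cmap_single,
      cmap_single, cmap_single, cmap_single, cmul_single, cmul_single, cmap_single, map_smul,
      ← parZ_comm _ _ ι (fun x => (parity_ι x).symm),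
      ← parZ_comm _ _ Dual.incl (fun x => incl_parity x), LinearMap.comp_apply,
      retractFree_cut_node]
  exact LinearMap.congr_fun₂ this x y

/-- It suffices to compare `retractFree ∘ cut` on leaves and on single vertices with branches in the
Koszul dual (`dual_ext`), where both sides are explicit. -/
theorem koszulMap_cobar (x : Dual Q V) : koszulMap C f hf Q (cobar Q V x) =
    cmap B (cobar Q W) (dualMap C f hf Q x) := by
  have h := dual_ext (koszulMap C f hf Q ∘ₗ retractFree Q V ∘ₗ cut Q V)
    (cmap B (retractFree Q W ∘ₗ cut Q W) ∘ₗ treeMap C f hf Q) ?_ ?_ x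
  · have h' : koszulMap C f hf Q (retractFree Q V (cut Q V (Dual.incl x))) =
      cmap B (retractFree Q W ∘ₗ cut Q W) (treeMap C f hf Q (Dual.incl x)) := h
    rw [cobar_eq, map_neg, h', ← incl_dualMap]
    exact Finsupp.ext fun b => rfl
  · intro v
    rw [LinearMap.comp_apply, LinearMap.comp_apply, LinearMap.comp_apply, cut_leaf, map_zero,
      map_zero, treeMap_leaf]
    refine Finsupp.ext fun b => ?_
    have : retractFree Q W (cut Q W (Tree.leaf Q (f v b))) = 0 := by rw [cut_leaf, map_zero]
    exact this.symm
  · intro e p x _ y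
    rw [LinearMap.comp_apply, LinearMap.comp_apply, LinearMap.comp_apply, retractFree_cut_node,
      koszulMap_node, koszulMap_ι, koszulMap_ι, treeMap_node, ← incl_dualMap, ← incl_dualMap,
      cmul_retractFree_cut]

/-- The maps `P(P^¡(V)) → P(P^¡(W))` commute with the Koszul differential. -/
theorem koszulMap_koszulD (x : Free Q 0 (Dual Q V)) : koszulMap C f hf Q (koszulD Q V x) =
    cmap B (koszulD Q W) (koszulMap C f hf Q x) :=
  fmap_der C _ _ (cobar Q V) cobar_mem (cobar Q W) cobar_mem (koszulMap_cobar C f hf) x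

end DualFunctor

/-! ### Composing, specializing and summing coefficients. -/

section CoefficientRelations

variable {K : Type u} [Field K] {B : Type*} [AddCommMonoid B]

open Free

section diag

/-- The map `x ⊗ b ↦ χ b • x ⊗ b ⊗ b`. -/
def diag {N : Type w} [AddCommGroup N] [Module K N] (χ : B → K) :
    (B →₀ N) →ₗ[K] (B →₀ (B →₀ N)) :=
  Finsupp.lsum K fun b => χ b • (Finsupp.lsingle b ∘ₗ Finsupp.lsingle b)

variable {N : Type w} [AddCommGroup N] [Module K N] {P : Type w'} [AddCommGroup P] [Module K P]

theorem diag_single (χ : B → K) (b : B) (m : N) :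
    diag χ (Finsupp.single b m) = Finsupp.single b (Finsupp.single b (χ b • m)) := by
  simp [diag, Finsupp.smul_single]

theorem diag_apply (χ : B → K) (x : B →₀ N) (b : B) :
    diag χ x b = Finsupp.single b (χ b • x b) := by
  classical
  induction x using Finsupp.induction_linear with
  | zero => simp
  | add x y hx hy => rw [map_add, Finsupp.add_apply, hx, hy, Finsupp.add_apply, smul_add,
      Finsupp.single_add]
  | single b' m =>
    rw [diag_single, Finsupp.single_apply, Finsupp.single_apply]
    split_ifs with h
    · rw [h]
    · simp

theorem cmap_diag (χ : B → K) (g : N →ₗ[K] P) (x : B →₀ N) :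
    cmap B (cmap B g) (diag χ x) = diag χ (cmap B g x) := by
  refine Finsupp.ext fun b => ?_
  rw [cmap_apply, diag_apply, diag_apply, cmap_single, map_smul, cmap_apply]

/-- Compatibility of coefficients which makes `diag` multiplicative. -/
structure DiagCompat (C C' C'' : Coef K B) (χ : B → K) : Prop where
  deg' : ∀ b, C'.deg b = -C.deg b
  deg'' : ∀ b, C''.deg b = 0
  σ : ∀ b b', χ (b + b') * C''.σ b b' =
    χ b * χ b' * (C.σ b b' * C'.σ b b' * ksign K (C.deg b * C.deg b'))

theorem parZ_extPar_single (C : Coef K B) (par : N →ₗ[K] N) (n : ℤ) (b : B) (m : N) :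
    parZ (extPar C par) n (Finsupp.single b m) =
      Finsupp.single b (ksign K (n * C.deg b) • parZ par n m) := by
  by_cases h : Even n
  · simp [parZ, h, ksign_of_even (h.mul_right _)]
  · simp only [parZ, h, if_false, extPar_single]
    congr 2
    refine ksign_congr ?_
    obtain ⟨c, rfl⟩ := Int.not_even_iff_odd.1 h
    exact ⟨-(c * C.deg b), by ring⟩

variable {C C' C'' : Coef K B} {χ : B → K} (H : DiagCompat C C' C'' χ)
  {E : Type v} [AddCommGroup E] [Module K E] {par : N →ₗ[K] N}
  {μ : E →ₗ[K] N →ₗ[K] N →ₗ[K] N}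

include H in
-- Composing two maps with coefficients yields pairs of coefficients. On the diagonal the two
-- degrees are opposite, so the two parity twists of the second argument cancel, and the remaining
-- sign together with the structure constants is what `H.σ` prescribes.
theorem diag_cmul (hpar : ∀ x, par (par x) = x) (e : E) (x y : B →₀ N) :
    diag χ (cmul C'' par μ e x y) =
      cmul C (extPar C' par) (cmul C' par μ) e (diag χ x) (diag χ y) := by
  have : (cmul C'' par μ e).compr₂ (diag χ) =
      (cmul C (extPar C' par) (cmul C' par μ) e).compl₁₂ (diag χ) (diag χ) := by
    refine bilin_ext fun b m b' m' => ?_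
    have h0 : (0 : ℤ) = C''.deg b := (H.deg'' b).symm
    rw [LinearMap.compr₂_apply, LinearMap.compl₁₂_apply, diag_single, diag_single, cmul_single,
      cmul_single, parZ_extPar_single, cmul_single, diag_single, H.deg', H.deg', ← h0, parZ_zero,
      map_smul, map_smul, map_smul, parZ_neg_parZ par hpar, Finsupp.smul_single, map_smul,
      LinearMap.smul_apply]
    simp only [smul_smul]
    congr 3
    rw [mul_neg, ksign_neg]
    linear_combination H.σ b b'
  exact LinearMap.congr_fun₂ this x y

end diag

section Composition

variable {C C' C'' : Coef K B} {χ : B → K} (H : DiagCompat C C' C'' χ)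
  {Q : QuadData.{u, v} K} {s : ℤ} {V : GMod.{u, w} K} {U : GMod.{u, w'} K} {W : GMod.{u, w} K}
  {Ψ : V →ₗ[K] (B →₀ U)} {hΨ : ∀ i, ∀ x ∈ V.gr i, Ψ x ∈ extGr C U.gr i}
  {Φ : U →ₗ[K] (B →₀ W)} {hΦ : ∀ i, ∀ x ∈ U.gr i, Φ x ∈ extGr C' W.gr i}
  {F : V →ₗ[K] (B →₀ W)} {hF : ∀ i, ∀ x ∈ V.gr i, F x ∈ extGr C'' W.gr i}

include H in
-- Both sides are multiplicative, the right one by `diag_cmul`, and they agree on generators by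
-- hypothesis.
theorem fmap_comp (h : ∀ x, cmap B Φ (Ψ x) = diag χ (F x)) (x : Free Q s V) :
    cmap B (fmap C' Φ hΦ Q s) (fmap C Ψ hΨ Q s x) = diag χ (fmap C'' F hF Q s x) := by
  have := free_hom_ext (f := cmap B (fmap C' Φ hΦ Q s) ∘ₗ fmap C Ψ hΨ Q s)
    (g := diag χ ∘ₗ fmap C'' F hF Q s)
    (μ := cmul C (extPar C' (Free Q s W).parity) (cmul C' (Free Q s W).parity node)) ?_ ?_ ?_
  · exact LinearMap.congr_fun this x
  · intro e x y
    rw [LinearMap.comp_apply, fmap_node]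
    exact cmap_cmul C _ _ e (fmap_node C' Φ hΦ e) (fmap_parity C' Φ hΦ) _ _
  · intro e x y
    rw [LinearMap.comp_apply, fmap_node, diag_cmul H (Free Q s W).parity_parity]
    rfl
  · intro x
    rw [LinearMap.comp_apply, LinearMap.comp_apply, fmap_ι, fmap_ι, cmap_cmap, ← cmap_diag, ← h,
      cmap_cmap]
    congr 2
    exact LinearMap.ext fun y => fmap_ι C' Φ hΦ y

include H in
theorem dualMap_comp (h : ∀ x, cmap B Φ (Ψ x) = diag χ (F x)) (x : Dual Q V) :
    cmap B (dualMap C' Φ hΦ Q) (dualMap C Ψ hΨ Q x) = diag χ (dualMap C'' F hF Q x) := by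
  refine cmap_injective (cmap_injective Dual.incl_injective) ?_
  rw [cmap_diag, incl_dualMap, cmap_cmap]
  have h1 : cmap B Dual.incl ∘ₗ dualMap C' Φ hΦ Q = treeMap C' Φ hΦ Q ∘ₗ Dual.incl :=
    LinearMap.ext fun y => incl_dualMap C' Φ hΦ y
  rw [h1, ← cmap_cmap, incl_dualMap]
  exact fmap_comp (Q := Q.magma) H h _

include H in
theorem koszulMap_comp (h : ∀ x, cmap B Φ (Ψ x) = diag χ (F x)) (x : Free Q 0 (Dual Q V)) :
    cmap B (koszulMap C' Φ hΦ Q) (koszulMap C Ψ hΨ Q x) = diag χ (koszulMap C'' F hF Q x) :=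
  fmap_comp H (dualMap_comp H h) x

end Composition

section Spec

variable {B' : Type*} [AddCommMonoid B']

/-- Multiplication of an element of `N` by an element of the monoid algebra. -/
def tens (N : Type w) [AddCommGroup N] [Module K N] (p : AddMonoidAlgebra K B') :
    N →ₗ[K] (B' →₀ N) :=
  Finsupp.linearCombination K (fun b => Finsupp.lsingle b) p.coeff

variable {N : Type w} [AddCommGroup N] [Module K N] {P : Type w'} [AddCommGroup P] [Module K P]

theorem tens_add (p q : AddMonoidAlgebra K B') (m : N) :
    tens N (p + q) m = tens N p m + tens N q m := by
  rw [tens, AddMonoidAlgebra.coeff_add, map_add]; rfl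

theorem tens_single (b : B') (c : K) (m : N) :
    tens N (AddMonoidAlgebra.single b c) m = Finsupp.single b (c • m) := by
  simp [tens, Finsupp.smul_single]

theorem tens_zero (m : N) : tens N (0 : AddMonoidAlgebra K B') m = 0 := by
  simp [tens]

theorem tens_apply (p : AddMonoidAlgebra K B') (m : N) (b : B') :
    tens N p m b = p.coeff b • m := by
  classical
  induction p using AddMonoidAlgebra.induction_linear with
  | zero => simp [tens_zero]
  | add p q hp hq => rw [tens_add, Finsupp.add_apply, hp, hq, AddMonoidAlgebra.coeff_add,
      Finsupp.add_apply, add_smul]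
  | single b' c =>
    rw [tens_single, AddMonoidAlgebra.coeff_single, Finsupp.single_apply, Finsupp.single_apply]
    split_ifs <;> simp

/-- Change of coefficients along a multiplicative family. -/
def spec (c : B → AddMonoidAlgebra K B') : (B →₀ N) →ₗ[K] (B' →₀ N) :=
  Finsupp.lsum K fun b => tens N (c b)

theorem spec_single (c : B → AddMonoidAlgebra K B') (b : B) (m : N) :
    spec c (Finsupp.single b m) = tens N (c b) m := by
  simp [spec]

theorem cmap_spec (c : B → AddMonoidAlgebra K B') (g : N →ₗ[K] P) (x : B →₀ N) :
    cmap B' g (spec c x) = spec c (cmap B g x) := by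
  induction x using Finsupp.induction_linear with
  | zero => simp
  | add x y hx hy => simp only [map_add, hx, hy]
  | single b m =>
    rw [spec_single, cmap_single, spec_single]
    refine Finsupp.ext fun b' => ?_
    rw [cmap_apply, tens_apply, tens_apply, map_smul]

variable {E : Type v} [AddCommGroup E] [Module K E] {par : N →ₗ[K] N}
  {μ : E →ₗ[K] N →ₗ[K] N →ₗ[K] N}

theorem cmul_triv_single (e : E) (b b' : B) (m m' : N) :
    cmul (Coef.triv K B) par μ e (Finsupp.single b m) (Finsupp.single b' m') =
      Finsupp.single (b + b') (μ e m m') := by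
  rw [cmul_single, show (Coef.triv K B).deg b = 0 from rfl, parZ_zero,
    show (Coef.triv K B).σ b b' = 1 from rfl, one_smul]

theorem cmul_tens (e : E) (p q : AddMonoidAlgebra K B') (m m' : N) :
    cmul (Coef.triv K B') par μ e (tens N p m) (tens N q m') = tens N (p * q) (μ e m m') := by
  induction p using AddMonoidAlgebra.induction_linear with
  | zero => rw [zero_mul, tens_zero, tens_zero, map_zero, LinearMap.zero_apply]
  | add p p' hp hp' => rw [add_mul, tens_add, tens_add, map_add, LinearMap.add_apply, hp, hp']
  | single b c =>
    induction q using AddMonoidAlgebra.induction_linear with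
    | zero => rw [mul_zero, tens_zero, tens_zero, map_zero]
    | add p p' hp hp' => rw [mul_add, tens_add, tens_add, map_add, hp, hp']
    | single b' c' =>
      rw [tens_single, tens_single, cmul_triv_single, AddMonoidAlgebra.single_mul_single,
        tens_single, map_smul, map_smul, LinearMap.smul_apply, smul_smul, mul_comm]

/-- The coefficients are untwisted, so no sign intervenes and multiplicativity of the family `c` is
all that is needed. -/
theorem spec_cmul {c : B → AddMonoidAlgebra K B'} (hc : ∀ b b', c (b + b') = c b * c b') (e : E)
    (x y : B →₀ N) : spec c (cmul (Coef.triv K B) par μ e x y) =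
      cmul (Coef.triv K B') par μ e (spec c x) (spec c y) := by
  have : (cmul (Coef.triv K B) par μ e).compr₂ (spec c) =
      (cmul (Coef.triv K B') par μ e).compl₁₂ (spec c) (spec c) := by
    refine bilin_ext fun b m b' m' => ?_
    rw [LinearMap.compr₂_apply, LinearMap.compl₁₂_apply, cmul_triv_single, spec_single,
      spec_single, spec_single, cmul_tens, hc]
  exact LinearMap.congr_fun₂ this x y

variable {Q : QuadData.{u, v} K} {s : ℤ} {V : GMod.{u, w} K} {W : GMod.{u, w'} K}
  {ρ : V →ₗ[K] (B →₀ W)} {hρ : ∀ i, ∀ x ∈ V.gr i, ρ x ∈ extGr (Coef.triv K B) W.gr i}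
  {F : V →ₗ[K] (B' →₀ W)} {hF : ∀ i, ∀ x ∈ V.gr i, F x ∈ extGr (Coef.triv K B') W.gr i}
  {c : B → AddMonoidAlgebra K B'} (hc : ∀ b b', c (b + b') = c b * c b')

include hc in
theorem fmap_spec (h : ∀ x, F x = spec c (ρ x)) (x : Free Q s V) :
    fmap _ F hF Q s x = spec c (fmap _ ρ hρ Q s x) := by
  have := free_hom_ext (f := fmap _ F hF Q s) (g := spec c ∘ₗ fmap _ ρ hρ Q s)
    (μ := cmul (Coef.triv K B') (Free Q s W).parity node) (fmap_node _ F hF) ?_ ?_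
  · exact LinearMap.congr_fun this x
  · intro e x y
    rw [LinearMap.comp_apply, fmap_node, spec_cmul hc]
    rfl
  · intro x
    rw [LinearMap.comp_apply, fmap_ι, fmap_ι, h, cmap_spec]

include hc in
theorem dualMap_spec (h : ∀ x, F x = spec c (ρ x)) (x : Dual Q V) :
    dualMap _ F hF Q x = spec c (dualMap _ ρ hρ Q x) := by
  refine cmap_injective Dual.incl_injective ?_
  rw [cmap_spec, incl_dualMap, incl_dualMap]
  exact fmap_spec (Q := Q.magma) hc h _

include hc in
theorem koszulMap_spec (h : ∀ x, F x = spec c (ρ x)) (x : Free Q 0 (Dual Q V)) :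
    koszulMap _ F hF Q x = spec c (koszulMap _ ρ hρ Q x) :=
  fmap_spec hc (dualMap_spec hc h) x

end Spec

section Sum

/-- The augmentation `x ⊗ b ↦ x`. -/
def total (K : Type u) [Field K] (B : Type*) (N : Type w) [AddCommGroup N] [Module K N] : (B →₀ N) →ₗ[K] N :=
  Finsupp.lsum K fun _ => LinearMap.id

variable {N : Type w} [AddCommGroup N] [Module K N] {P : Type w'} [AddCommGroup P] [Module K P]

theorem total_single (b : B) (m : N) : total K B N (Finsupp.single b m) = m := by
  simp [total]

theorem total_eq (x : B →₀ N) : total K B N x = x.sum fun _ m => m := by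
  simp only [total, Finsupp.lsum_apply]; rfl

theorem map_total (g : N →ₗ[K] P) (x : B →₀ N) : g (total K B N x) = total K B P (cmap B g x) := by
  induction x using Finsupp.induction_linear with
  | zero => simp
  | add x y hx hy => simp only [map_add, hx, hy]
  | single b m => rw [total_single, cmap_single, total_single]

variable {Q : QuadData.{u, v} K} {s : ℤ} {V : GMod.{u, w} K}
  {ρ : V →ₗ[K] (B →₀ V)} {hρ : ∀ i, ∀ x ∈ V.gr i, ρ x ∈ extGr (Coef.triv K B) V.gr i}

theorem total_cmul {E : Type v} [AddCommGroup E] [Module K E] {par : N →ₗ[K] N}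
    {μ : E →ₗ[K] N →ₗ[K] N →ₗ[K] N} (e : E) (x y : B →₀ N) :
    total K B N (cmul (Coef.triv K B) par μ e x y) = μ e (total K B N x) (total K B N y) := by
  have : (cmul (Coef.triv K B) par μ e).compr₂ (total K B N) =
      (μ e).compl₁₂ (total K B N) (total K B N) := by
    refine bilin_ext fun b m b' m' => ?_
    rw [LinearMap.compr₂_apply, LinearMap.compl₁₂_apply, cmul_triv_single, total_single,
      total_single, total_single]
  exact LinearMap.congr_fun₂ this x y

/-- Setting all variables equal to one is multiplicative for untwisted coefficients, so the identity
spreads from generators to the free algebra. -/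
theorem fmap_total (h : ∀ x, total K B V (ρ x) = x) (x : Free Q s V) :
    total K B (Free Q s V) (fmap _ ρ hρ Q s x) = x := by
  have := free_hom_ext (f := total K B (Free Q s V) ∘ₗ fmap _ ρ hρ Q s) (g := LinearMap.id)
    (μ := node) ?_ (fun _ _ _ => rfl) ?_
  · exact LinearMap.congr_fun this x
  · intro e x y
    rw [LinearMap.comp_apply, fmap_node, total_cmul]
    rfl
  · intro x
    rw [LinearMap.comp_apply, fmap_ι, ← map_total, h]
    rfl

theorem dualMap_total (h : ∀ x, total K B V (ρ x) = x) (x : Dual Q V) :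
    total K B (Dual Q V) (dualMap _ ρ hρ Q x) = x := by
  refine Dual.incl_injective ?_
  rw [map_total, incl_dualMap]
  exact fmap_total (Q := Q.magma) h _

theorem koszulMap_total (h : ∀ x, total K B V (ρ x) = x) (x : Free Q 0 (Dual Q V)) :
    total K B (Free Q 0 (Dual Q V)) (koszulMap _ ρ hρ Q x) = x :=
  fmap_total (dualMap_total h) x

end Sum

end CoefficientRelations

/-! ### Polarization and restitution with graded commuting variables. -/

section Polarization

variable {K : Type u} [Field K]

open Free

/-- The projection onto the homogeneous component of degree `k`. -/
def GMod.comp (V : GMod.{u, w} K) (k : ℤ) : V →ₗ[K] V :=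
  V.glue fun i => if i = k then (V.gr i).subtype else 0

theorem GMod.comp_of_mem (V : GMod.{u, w} K) {i k : ℤ} {x : V} (hx : x ∈ V.gr i) :
    V.comp k x = if i = k then x else 0 := by
  rw [GMod.comp, V.glue_of_mem _ hx]; split_ifs <;> rfl

theorem GMod.comp_mem (V : GMod.{u, w} K) (k : ℤ) (x : V) : V.comp k x ∈ V.gr k := by
  induction x using V.induction_homog with
  | h i x hx =>
    rw [V.comp_of_mem hx]; split_ifs with h
    · exact h ▸ hx
    · exact zero_mem _
  | hadd x y hx hy => rw [map_add]; exact add_mem hx hy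

theorem GMod.comp_shift (V : GMod.{u, w} K) (f : V →ₗ[K] V)
    (hf : ∀ i, ∀ x ∈ V.gr i, f x ∈ V.gr (i - 1)) (k : ℤ) (x : V) :
    V.comp (k - 1) (f x) = f (V.comp k x) := by
  induction x using V.induction_homog with
  | h i x hx =>
    rw [V.comp_of_mem hx, V.comp_of_mem (hf i x hx)]
    by_cases h : i = k
    · simp [h]
    · simp [h]
  | hadd x y hx hy => simp only [map_add, hx, hy]

/-- Trees with homogeneous basis elements: a homogeneous element is a combination of basis
elements of its degree. -/
theorem GMod.gr_le_span (V : GMod.{u, w} K) {I : Type*} (β : Module.Basis I K V) (δ : I → ℤ)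
    (hβ : ∀ b, β b ∈ V.gr (δ b)) (k : ℤ) : V.gr k ≤ Submodule.span K (β '' {b | δ b = k}) := by
  intro x hx
  have h : V.comp k x = x := by rw [V.comp_of_mem hx, if_pos rfl]
  rw [← h, ← β.linearCombination_repr x, Finsupp.linearCombination_apply, Finsupp.sum, map_sum]
  refine Submodule.sum_mem _ fun b _ => ?_
  rw [map_smul, V.comp_of_mem (hβ b)]
  split_ifs with hb
  · exact Submodule.smul_mem _ _ (Submodule.subset_span ⟨b, hb, rfl⟩)
  · rw [smul_zero]; exact zero_mem _

theorem constr_mem_extGr {B : Type*} [AddCommMonoid B] {C : Coef K B} {V : GMod.{u, w} K}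
    {W : GMod.{u, w'} K} {I : Type*} (β : Module.Basis I K V) (δ : I → ℤ)
    (hβ : ∀ b, β b ∈ V.gr (δ b)) (g : I → (B →₀ W)) (hg : ∀ b, g b ∈ extGr C W.gr (δ b)) :
    ∀ i, ∀ x ∈ V.gr i, β.constr K g x ∈ extGr C W.gr i := by
  intro i x hx
  have hx' := V.gr_le_span β δ hβ i hx
  clear hx
  induction hx' using Submodule.span_induction with
  | mem x hx =>
    obtain ⟨b, rfl, rfl⟩ := hx
    rw [β.constr_basis]
    exact hg b
  | zero => rw [map_zero]; exact zero_mem _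
  | add x y _ _ hx hy => rw [map_add]; exact add_mem hx hy
  | smul c x _ hx => rw [map_smul]; exact Submodule.smul_mem _ _ hx

/-- The sign of the shuffle of odd and even letters. -/
def shuffleExp {N : ℕ} (d : Fin N → ℤ) (b b' : Fin N → ℕ) : ℤ :=
  ∑ i, ∑ j, if j < i then d i * d j * (b i * b' j) else 0

theorem shuffleExp_add_left {N : ℕ} (d : Fin N → ℤ) (a b c : Fin N → ℕ) :
    shuffleExp d (a + b) c = shuffleExp d a c + shuffleExp d b c := by
  simp only [shuffleExp, ← Finset.sum_add_distrib]
  refine Finset.sum_congr rfl fun i _ => Finset.sum_congr rfl fun j _ => ?_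
  split_ifs
  · simp only [Pi.add_apply]; push_cast; ring
  · ring

theorem shuffleExp_add_right {N : ℕ} (d : Fin N → ℤ) (a b c : Fin N → ℕ) :
    shuffleExp d a (b + c) = shuffleExp d a b + shuffleExp d a c := by
  simp only [shuffleExp, ← Finset.sum_add_distrib]
  refine Finset.sum_congr rfl fun i _ => Finset.sum_congr rfl fun j _ => ?_
  split_ifs
  · simp only [Pi.add_apply]; push_cast; ring
  · ring

/-- Every pair of distinct indices is counted in exactly one of the two sums. The diagonal terms
missing on the left vanish on the right, because no index occurs in both `a` and `b`. -/
theorem shuffleExp_swap {N : ℕ} (d : Fin N → ℤ) (a b : Fin N → ℕ) (h : ∀ i, a i + b i ≤ 1) :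
    shuffleExp d a b + shuffleExp d b a =
      (∑ i, d i * (a i : ℤ)) * ∑ i, d i * (b i : ℤ) := by
  rw [Finset.sum_mul_sum, shuffleExp, shuffleExp]
  conv_lhs => rw [add_comm]; enter [1]; rw [Finset.sum_comm]
  rw [← Finset.sum_add_distrib]
  refine Finset.sum_congr rfl fun i _ => ?_
  rw [← Finset.sum_add_distrib]
  refine Finset.sum_congr rfl fun j _ => ?_
  rcases lt_trichotomy i j with hij | hij | hij
  · rw [if_pos hij, if_neg hij.not_gt]; ring
  · subst hij
    rw [if_neg (lt_irrefl _)]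
    have := h i
    have h0 : a i = 0 ∨ b i = 0 := by omega
    rcases h0 with h0 | h0 <;> simp [h0]
  · rw [if_pos hij, if_neg hij.not_gt]; ring

/-- The graded commutative algebra on generators `θ_i` of degree `d i` with `θ_i² = 0`. -/
def signCoef (K : Type u) [Field K] {N : ℕ} (d : Fin N → ℤ) : Coef K (Fin N → ℕ) where
  deg :=
    { toFun := fun b => ∑ i, d i * (b i : ℤ)
      map_zero' := by simp
      map_add' := fun a b => by
        rw [← Finset.sum_add_distrib]
        exact Finset.sum_congr rfl fun i _ => by simp only [Pi.add_apply]; push_cast; ring }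
  σ a b := if ∀ i, a i + b i ≤ 1 then ksign K (shuffleExp d a b) else 0
  assoc a b c := by
    by_cases h : ∀ i, a i + b i + c i ≤ 1
    · rw [if_pos fun i => by have := h i; omega, if_pos (by intro i; exact h i),
        if_pos fun i => by have := h i; omega,
        if_pos (by intro i; have := h i; simp only [Pi.add_apply]; omega), ← ksign_add, ← ksign_add,
        shuffleExp_add_left, shuffleExp_add_right]
      congr 1; ring
    · have h1 : ¬∀ i, (a + b) i + c i ≤ 1 := h
      have h2 : ¬∀ i, a i + (b + c) i ≤ 1 := fun h' => h fun i => by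
        have := h' i; simp only [Pi.add_apply] at this; omega
      rw [if_neg h1, if_neg h2, mul_zero, mul_zero]
  comm a b := by
    by_cases h : ∀ i, a i + b i ≤ 1
    · rw [if_pos h, if_pos fun i => by have := h i; omega, ← ksign_add]
      refine ksign_congr ⟨-shuffleExp d b a, ?_⟩
      change shuffleExp d a b - ((∑ i, d i * (a i : ℤ)) * (∑ i, d i * (b i : ℤ)) + _) = _
      rw [← shuffleExp_swap d a b h]; ring
    · rw [if_neg h, if_neg fun h' => h fun i => by have := h' i; omega, mul_zero]

theorem signCoef_σ {N : ℕ} (d : Fin N → ℤ) (a b : Fin N → ℕ) : (signCoef K d).σ a b =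
    if ∀ i, a i + b i ≤ 1 then ksign K (shuffleExp d a b) else 0 := rfl

theorem signCoef_deg {N : ℕ} (d : Fin N → ℤ) (b : Fin N → ℕ) :
    (signCoef K d).deg b = ∑ i, d i * (b i : ℤ) := rfl

theorem signCoef_deg_single {N : ℕ} (d : Fin N → ℤ) (i : Fin N) :
    (signCoef K d).deg (Pi.single i 1) = d i := by
  rw [signCoef_deg, Finset.sum_eq_single i]
  · simp
  · intro j _ hj; simp [Pi.single_eq_of_ne hj]
  · simp

/-- The opposite graded commutative algebra, with degrees negated. -/
def Coef.op {B : Type*} [AddCommMonoid B] (C : Coef K B) : Coef K B where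
  deg := -C.deg
  σ a b := C.σ b a
  assoc a b c := by
    have := C.assoc c b a
    rw [add_comm a b, add_comm b c]
    linear_combination -this
  comm a b := by
    rw [AddMonoidHom.neg_apply, AddMonoidHom.neg_apply, neg_mul_neg, mul_comm (C.deg a)]
    exact C.comm b a

/-- The indicator of square free monomials. -/
def sqfree (K : Type u) [Field K] {N : ℕ} (b : Fin N → ℕ) : K := if ∀ i, b i ≤ 1 then 1 else 0

/-- The opposite structure constant differs from the original by the commutativity sign, and the
sign in `DiagCompat` cancels exactly that. What remains is the square of a sign on square free
products and zero elsewhere, which is what `sqfree` records. -/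
theorem diagCompat_signCoef {N : ℕ} (d : Fin N → ℤ) :
    DiagCompat (signCoef K d) (signCoef K d).op (Coef.triv K (Fin N → ℕ)) (sqfree K) where
  deg' _ := rfl
  deg'' _ := rfl
  σ a b := by
    have h1 : (signCoef K d).op.σ a b = (signCoef K d).σ b a := rfl
    have h2 : (signCoef K d).σ a b * (signCoef K d).op.σ a b *
        ksign K ((signCoef K d).deg a * (signCoef K d).deg b) =
        (signCoef K d).σ a b * (signCoef K d).σ a b := by
      rw [h1, mul_assoc]
      congr 1
      rw [(signCoef K d).comm a b, mul_comm]
    rw [h2, show (Coef.triv K (Fin N → ℕ)).σ a b = 1 from rfl, mul_one, sqfree, sqfree, sqfree,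
      signCoef_σ]
    by_cases h : ∀ i, a i + b i ≤ 1
    · have h' : ∀ i, (a + b) i ≤ 1 := h
      rw [if_pos h, ksign_sq, if_pos h', if_pos fun i => by have := h i; omega,
        if_pos fun i => by have := h i; omega, mul_one, mul_one]
    · have h' : ¬∀ i, (a + b) i ≤ 1 := h
      rw [if_neg h, if_neg h', mul_zero, mul_zero]

/-- Applied to `coact`, this makes the projections onto multidegrees idempotent. -/
theorem diagCompat_triv (B : Type*) [AddCommMonoid B] :
    DiagCompat (Coef.triv K B) (Coef.triv K B) (Coef.triv K B) 1 where
  deg' _ := rfl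
  deg'' _ := rfl
  σ _ _ := by simp [Coef.triv, ksign_zero]

section Basis

variable {V : GMod.{u, w} K} {I : Type w'} [DecidableEq I] (β : Module.Basis I K V) (δ : I → ℤ)
  (hβ : ∀ b, β b ∈ V.gr (δ b))

/-- The coaction which records the multidegree with respect to a basis. -/
def coact : V →ₗ[K] ((I →₀ ℕ) →₀ V) :=
  β.constr K fun b => Finsupp.single (Finsupp.single b 1) (β b)

theorem coact_basis (b : I) : coact β (β b) = Finsupp.single (Finsupp.single b 1) (β b) :=
  β.constr_basis ..

include hβ in
theorem coact_mem : ∀ i, ∀ x ∈ V.gr i, coact β x ∈ extGr (Coef.triv K (I →₀ ℕ)) V.gr i := by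
  refine constr_mem_extGr β δ hβ _ fun b => single_mem_extGr ?_
  rw [show (Coef.triv K (I →₀ ℕ)).deg (Finsupp.single b 1) = 0 from rfl, sub_zero]
  exact hβ b

theorem coact_coact (x : V) : cmap _ (coact β) (coact β x) = diag (1 : (I →₀ ℕ) → K) (coact β x) := by
  have : cmap _ (coact β) ∘ₗ coact β = diag (1 : (I →₀ ℕ) → K) ∘ₗ coact β := by
    refine β.ext fun b => ?_
    rw [LinearMap.comp_apply, LinearMap.comp_apply, coact_basis, cmap_single, coact_basis,
      diag_single, Pi.one_apply, one_smul]
  exact LinearMap.congr_fun this x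

theorem coact_total (x : V) : total K _ V (coact β x) = x := by
  have : total K _ V ∘ₗ coact β = LinearMap.id := by
    refine β.ext fun b => ?_
    rw [LinearMap.comp_apply, coact_basis, total_single, LinearMap.id_apply]
  exact LinearMap.congr_fun this x

variable {N : ℕ} (a : Fin N → I)

/-- The standard basis vectors. -/
def stdVec (K : Type u) [Field K] (N : ℕ) (i : Fin N) : std K N := (Pi.single i 1 : Fin N → K)

theorem stdVec_mem (i : Fin N) : stdVec K N i ∈ (std K N).gr 0 := by
  change _ ∈ (if (0 : ℤ) = 0 then (⊤ : Submodule K (Fin N → K)) else ⊥)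
  rw [if_pos rfl]; trivial

/-- Polarization of basis elements: `β b ↦ ∑_{a i = b} e_i ⊗ θ_i`. -/
def polar : V →ₗ[K] ((Fin N → ℕ) →₀ std K N) :=
  β.constr K fun b => ∑ i, if a i = b then
    Finsupp.single (Pi.single i 1) (stdVec K N i) else 0

theorem polar_basis (b : I) : polar β a (β b) = ∑ i, if a i = b then
    Finsupp.single (Pi.single i 1) (stdVec K N i) else 0 := β.constr_basis ..

include hβ in
theorem polar_mem : ∀ i, ∀ x ∈ V.gr i,
    polar β a x ∈ extGr (signCoef K (δ ∘ a)) (std K N).gr i := by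
  refine constr_mem_extGr β δ hβ _ fun b => Submodule.sum_mem _ fun i _ => ?_
  split_ifs with h
  · refine single_mem_extGr ?_
    rw [signCoef_deg_single, Function.comp_apply, h, sub_self]
    exact stdVec_mem i
  · exact zero_mem _

/-- Restitution: `e_i ↦ β (a i) ⊗ θ_i`. -/
def restit : std K N →ₗ[K] ((Fin N → ℕ) →₀ V) :=
  (Pi.basisFun K (Fin N)).constr K fun i => Finsupp.single (Pi.single i 1) (β (a i))

theorem restit_single (i : Fin N) : restit β a (stdVec K N i) =
    Finsupp.single (Pi.single i 1) (β (a i)) := by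
  have := (Pi.basisFun K (Fin N)).constr_basis K
    (fun i => Finsupp.single (Pi.single i 1 : Fin N → ℕ) (β (a i))) i
  rwa [Pi.basisFun_apply] at this

include hβ in
theorem restit_mem : ∀ i, ∀ x ∈ (std K N).gr i,
    restit β a x ∈ extGr (signCoef K (δ ∘ a)).op V.gr i := by
  refine constr_mem_extGr (V := std K N) (Pi.basisFun K (Fin N)) (fun _ => 0) (fun i => ?_) _
    fun i => single_mem_extGr ?_
  · have h : Pi.basisFun K (Fin N) i = Pi.single i 1 := Pi.basisFun_apply ..
    exact h ▸ stdVec_mem i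
  · rw [show (signCoef K (δ ∘ a)).op.deg (Pi.single i 1) =
      -(signCoef K (δ ∘ a)).deg (Pi.single i 1) from rfl, signCoef_deg_single, zero_sub, neg_neg]
    exact hβ (a i)

/-- The composite of polarization and restitution: `β b ↦ ∑_{a i = b} β b ⊗ t_i`. -/
def repol : V →ₗ[K] ((Fin N → ℕ) →₀ V) :=
  β.constr K fun b => ∑ i, if a i = b then Finsupp.single (Pi.single i 1) (β b) else 0

theorem repol_basis (b : I) : repol β a (β b) = ∑ i, if a i = b then
    Finsupp.single (Pi.single i 1) (β b) else 0 := β.constr_basis ..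

include hβ in
theorem repol_mem : ∀ i, ∀ x ∈ V.gr i,
    repol β a x ∈ extGr (Coef.triv K (Fin N → ℕ)) V.gr i := by
  refine constr_mem_extGr β δ hβ _ fun b => Submodule.sum_mem _ fun i _ => ?_
  split_ifs with h
  · refine single_mem_extGr ?_
    rw [show (Coef.triv K (Fin N → ℕ)).deg (Pi.single i 1) = 0 from rfl, sub_zero]
    exact hβ b
  · exact zero_mem _

theorem sqfree_single (i : Fin N) : sqfree K (Pi.single i 1 : Fin N → ℕ) = 1 := by
  rw [sqfree, if_pos]
  intro j
  rcases eq_or_ne j i with rfl | h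
  · simp
  · simp [Pi.single_eq_of_ne h]

/-- On generators only single variables occur; these are square free, so the scaling by `sqfree` is
invisible here. It matters only once the identity is extended to products. -/
theorem restit_polar (x : V) : cmap _ (restit β a) (polar β a x) =
    diag (sqfree K) (repol β a x) := by
  have : cmap _ (restit β a) ∘ₗ polar β a = diag (sqfree K) ∘ₗ repol β a := by
    refine β.ext fun b => ?_
    rw [LinearMap.comp_apply, LinearMap.comp_apply, polar_basis, repol_basis, map_sum, map_sum]
    refine Finset.sum_congr rfl fun i _ => ?_
    split_ifs with h
    · rw [cmap_single, restit_single, diag_single, sqfree_single, one_smul, h]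
    · rw [map_zero, map_zero]
  exact LinearMap.congr_fun this x

/-- The linear form `x_b ↦ ∑_{a i = b} t_i`. -/
def repolLin (K : Type u) [Field K] (a : Fin N → I) (b : I) :
    AddMonoidAlgebra K (Fin N → ℕ) :=
  ∑ i, if a i = b then AddMonoidAlgebra.single (Pi.single i 1) 1 else 0

/-- The algebra map `x_b ↦ ∑_{a i = b} t_i`. -/
def repolCoef (K : Type u) [Field K] (a : Fin N → I) (μ : I →₀ ℕ) :
    AddMonoidAlgebra K (Fin N → ℕ) :=
  μ.prod fun b n => repolLin K a b ^ n

theorem repolCoef_add (μ ν : I →₀ ℕ) :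
    repolCoef K a (μ + ν) = repolCoef K a μ * repolCoef K a ν :=
  Finsupp.prod_add_index' (fun _ => pow_zero _) (fun _ _ _ => pow_add _ _ _)

theorem repolCoef_single (b : I) : repolCoef K a (Finsupp.single b 1) = repolLin K a b := by
  rw [repolCoef, Finsupp.prod_single_index (h := fun b n => repolLin K a b ^ n) (pow_zero _),
    pow_one]

theorem repol_eq_spec (x : V) : repol β a x = spec (repolCoef K a) (coact β x) := by
  have : repol β a = spec (repolCoef K a) ∘ₗ coact β := by
    refine β.ext fun b => ?_
    rw [LinearMap.comp_apply, coact_basis, spec_single, repol_basis, repolCoef_single, repolLin]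
    refine Finsupp.ext fun c => ?_
    rw [tens_apply, AddMonoidAlgebra.coeff_sum, Finsupp.finsetSum_apply, Finsupp.finsetSum_apply,
      Finset.sum_smul]
    refine Finset.sum_congr rfl fun i _ => ?_
    split_ifs with h
    · rw [AddMonoidAlgebra.coeff_single, Finsupp.single_apply, Finsupp.single_apply]
      split_ifs <;> simp
    · simp
  exact LinearMap.congr_fun this x

/-- Expanding `∏_j ∑_{a i = a j} t_i`, the coefficient of `∏ t_i` counts the maps `p` of the index
set with `a ∘ p = a` that hit every index exactly once. The identity is one of them, so the
coefficient is a positive integer, nonzero in characteristic zero. -/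
theorem repolCoef_ne_zero [CharZero K] :
    (repolCoef K a (∑ j, Finsupp.single (a j) 1)).coeff 1 ≠ 0 := by
  have h1 : ∀ s : Finset (Fin N), repolCoef K a (∑ j ∈ s, Finsupp.single (a j) 1) =
      ∏ j ∈ s, repolLin K a (a j) := by
    intro s
    induction s using Finset.induction_on with
    | empty => simp [repolCoef]
    | insert j s hj ih =>
      rw [Finset.sum_insert hj, Finset.prod_insert hj, repolCoef_add, ih, repolCoef_single]
  have h2 : ∀ p : Fin N → Fin N, (∏ j, if a (p j) = a j then
      (AddMonoidAlgebra.single (Pi.single (p j) 1 : Fin N → ℕ) (1 : K)) else 0).coeff 1 =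
      if (∀ j, a (p j) = a j) ∧ ∑ j, (Pi.single (p j) 1 : Fin N → ℕ) = 1 then 1 else 0 := by
    intro p
    by_cases h : ∀ j, a (p j) = a j
    · have h3 : ∀ s : Finset (Fin N), (∏ j ∈ s, if a (p j) = a j then
          (AddMonoidAlgebra.single (Pi.single (p j) 1 : Fin N → ℕ) (1 : K)) else 0) =
          AddMonoidAlgebra.single (∑ j ∈ s, (Pi.single (p j) 1 : Fin N → ℕ)) 1 := by
        intro s
        induction s using Finset.induction_on with
        | empty => rfl
        | insert j s hj ih =>
          rw [Finset.prod_insert hj, Finset.sum_insert hj, ih, if_pos (h j),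
            AddMonoidAlgebra.single_mul_single, one_mul]
      rw [h3, AddMonoidAlgebra.coeff_single, Finsupp.single_apply]
      simp [h]
    · rw [if_neg fun h' => h h'.1]
      obtain ⟨j, hj⟩ := not_forall.1 h
      rw [Finset.prod_eq_zero (Finset.mem_univ j) (if_neg hj)]
      simp
  rw [h1]
  simp only [repolLin]
  rw [Finset.prod_univ_sum, AddMonoidAlgebra.coeff_sum, Finsupp.finsetSum_apply]
  simp only [h2]
  rw [Finset.sum_boole, Nat.cast_ne_zero]
  refine Finset.card_ne_zero_of_mem (a := id) ?_
  simp only [Finset.mem_filter, Fintype.piFinset_univ, Finset.mem_univ, true_and, id_eq,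
    implies_true]
  refine funext fun i => ?_
  rw [Finset.sum_apply, Finset.sum_eq_single i] <;> simp +contextual

end Basis

end Polarization

/-! ### Acyclicity of the Koszul complex in a fixed multidegree. -/

section Multilinear

variable {K : Type u} [Field K] {Q : QuadData.{u, v} K} {n : ℕ}

open Free

theorem TreeMonomial.parity_eq {S : Finset (Fin n)} {x : Tree Q (std K n)}
    (h : TreeMonomial Q n S x) : ∃ c : K, (Tree Q (std K n)).parity x = c • x := by
  induction h with
  | leaf i =>
    refine ⟨1, ?_⟩
    have h : (std K n).parity (stdVec K n i) = ksign K 0 • stdVec K n i :=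
      (std K n).parity_of_mem (stdVec_mem i)
    rw [ksign_zero, one_smul] at h
    have h' := parity_ι (Q := Q.magma) (s := 1) (stdVec K n i)
    rw [h] at h'
    exact h'.trans (one_smul K _).symm
  | node e S T h x y hx hy ihx ihy =>
    obtain ⟨a, ha⟩ := ihx
    obtain ⟨b, hb⟩ := ihy
    refine ⟨ksign K 1 * (a * b), ?_⟩
    have := parity_node (Q := Q.magma) (s := 1) e x y
    rw [ha, hb, map_smul, map_smul, LinearMap.smul_apply, smul_smul, smul_smul] at this
    rw [mul_comm a b, ← mul_assoc]
    rwa [mul_assoc] at this ⊢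

theorem parity_mem_span_treeMonomial {S : Finset (Fin n)} {x : Tree Q (std K n)}
    (hx : x ∈ Submodule.span K {x | TreeMonomial Q n S x}) :
    (Tree Q (std K n)).parity x ∈ Submodule.span K {x | TreeMonomial Q n S x} := by
  induction hx using Submodule.span_induction with
  | mem x hx =>
    obtain ⟨c, hc⟩ := TreeMonomial.parity_eq hx
    rw [hc]
    exact Submodule.smul_mem _ _ (Submodule.subset_span hx)
  | zero => rw [map_zero]; exact zero_mem _
  | add x y _ _ hx hy => rw [map_add]; exact add_mem hx hy
  | smul c x _ hx => rw [map_smul]; exact Submodule.smul_mem _ _ hx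

theorem parity_mem_dualArity {S : Finset (Fin n)} {x : Dual Q (std K n)}
    (hx : x ∈ dualArity Q n S) : (Dual Q (std K n)).parity x ∈ dualArity Q n S := by
  have := parity_mem_span_treeMonomial hx
  rwa [← incl_parity] at this

theorem KoszulMonomial.parity {S : Finset (Fin n)} {x : Free Q 0 (Dual Q (std K n))}
    (h : KoszulMonomial Q n S x) :
    KoszulMonomial Q n S ((Free Q 0 (Dual Q (std K n))).parity x) := by
  induction h with
  | gen S c hc => rw [parity_ι]; exact .gen _ _ (parity_mem_dualArity hc)
  | node e S T h x y hx hy ihx ihy =>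
    rw [parity_node, ksign_zero, one_smul]; exact .node e S T h _ _ ihx ihy

theorem parity_mem_span_koszulMonomial {S : Finset (Fin n)} {x : Free Q 0 (Dual Q (std K n))}
    (hx : x ∈ Submodule.span K {x | KoszulMonomial Q n S x}) :
    (Free Q 0 (Dual Q (std K n))).parity x ∈ Submodule.span K {x | KoszulMonomial Q n S x} := by
  induction hx using Submodule.span_induction with
  | mem x hx => exact Submodule.subset_span hx.parity
  | zero => rw [map_zero]; exact zero_mem _
  | add x y _ _ hx hy => rw [map_add]; exact add_mem hx hy
  | smul c x _ hx => rw [map_smul]; exact Submodule.smul_mem _ _ hx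

theorem parZ_mem_submodule {N : Type w} [AddCommGroup N] [Module K N] {par : N →ₗ[K] N}
    {S : Submodule K N} (h : ∀ x ∈ S, par x ∈ S) (m : ℤ) {x : N} (hx : x ∈ S) :
    parZ par m x ∈ S := by
  rw [parZ]; split_ifs
  · exact hx
  · exact h x hx

/-- A family of subspaces spanned by multilinear products is closed under bilinear operations. -/
theorem map₂_mem_span {N : Type w} [AddCommGroup N] [Module K N] (f : N →ₗ[K] N →ₗ[K] N)
    {X Y Z : Set N} (h : ∀ x ∈ X, ∀ y ∈ Y, f x y ∈ Submodule.span K Z) {x y : N}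
    (hx : x ∈ Submodule.span K X) (hy : y ∈ Submodule.span K Y) : f x y ∈ Submodule.span K Z := by
  have h1 : Submodule.map₂ f (Submodule.span K X) (Submodule.span K Y) ≤ Submodule.span K Z := by
    rw [Submodule.map₂_span_span, Submodule.span_le]
    rintro _ ⟨x, hx, y, hy, rfl⟩
    exact h x hx y hy
  exact h1 (Submodule.apply_mem_map₂ _ hx hy)

/-- The support of a multidegree. -/
def msupp (b : Fin n → ℕ) : Finset (Fin n) := Finset.univ.filter fun i => b i ≠ 0

theorem msupp_single (i : Fin n) : msupp (Pi.single i 1) = {i} := by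
  ext j
  rcases eq_or_ne j i with rfl | h
  · simp [msupp]
  · simp [msupp, h]

theorem msupp_one : msupp (1 : Fin n → ℕ) = Finset.univ := by ext j; simp [msupp]

theorem msupp_add (b b' : Fin n → ℕ) : msupp (b + b') = msupp b ∪ msupp b' := by
  ext j; simp [msupp]; tauto

theorem disjoint_msupp {b b' : Fin n → ℕ} (h : ∀ i, b i + b' i ≤ 1) :
    Disjoint (msupp b) (msupp b') := by
  rw [Finset.disjoint_left]
  intro i h1 h2
  simp only [msupp, Finset.mem_filter, Finset.mem_univ, true_and] at h1 h2
  have := h i; omega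

theorem signCoef_σ_ne_zero {d : Fin n → ℤ} {b b' : Fin n → ℕ} (h : (signCoef K d).σ b b' ≠ 0) :
    ∀ i, b i + b' i ≤ 1 := by
  by_contra h'
  exact h (by rw [signCoef_σ, if_neg h'])

variable {V : GMod.{u, w} K} {I : Type w'} [DecidableEq I] (β : Module.Basis I K V) (δ : I → ℤ)
  (hβ : ∀ b, β b ∈ V.gr (δ b)) (a : Fin n → I)

/-- Since `θ_i² = 0`, a product of polarized letters survives only when no index is repeated. Its
coefficients are therefore multilinear in the basis vectors named by the monomial. -/
theorem treeMap_polar_mem (x : Tree Q V) (b : Fin n → ℕ) :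
    treeMap _ (polar β a) (polar_mem β δ hβ a) Q x b ∈
      Submodule.span K {x | TreeMonomial Q n (msupp b) x} := by
  induction x using Free.induction_on generalizing b with
  | hι i x hx =>
    rw [show Free.ι x = Tree.leaf Q x from rfl, treeMap_leaf, cmap_apply]
    clear hx
    have hx : x ∈ Submodule.span K (Set.range β) := by rw [β.span_eq]; trivial
    induction hx using Submodule.span_induction with
    | mem x hx =>
      obtain ⟨j, rfl⟩ := hx
      rw [polar_basis, Finsupp.finsetSum_apply, map_sum]
      refine Submodule.sum_mem _ fun i _ => ?_
      split_ifs with h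
      · rw [Finsupp.single_apply]
        split_ifs with h'
        · rw [← h', msupp_single]; exact Submodule.subset_span (.leaf i)
        · rw [map_zero]; exact zero_mem _
      · rw [Finsupp.zero_apply, map_zero]; exact zero_mem _
    | zero => rw [map_zero, Finsupp.zero_apply, map_zero]; exact zero_mem _
    | add x y _ _ hx hy => rw [map_add, Finsupp.add_apply, map_add]; exact add_mem hx hy
    | smul c x _ hx => rw [map_smul, Finsupp.smul_apply, map_smul]; exact Submodule.smul_mem _ _ hx
  | hnode e i j x _ y _ hx hy =>
    have : Free.node e x y = Tree.node Q e x y := rfl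
    rw [this, treeMap_node]
    refine cmul_mem _ _ _ (fun b => Submodule.span K {x | TreeMonomial Q n (msupp b) x})
      (fun b => Submodule.span K {x | TreeMonomial Q n (msupp b) x})
      (fun b => Submodule.span K {x | TreeMonomial Q n (msupp b) x}) e ?_ hx hy b
    intro b b' hσ m hm m' hm'
    refine map₂_mem_span (Tree.node Q e) ?_ hm
      (parZ_mem_submodule (fun x => parity_mem_span_treeMonomial) _ hm')
    intro x hx y hy
    rw [msupp_add]
    exact Submodule.subset_span (TreeMonomial.node (Q := Q) e _ _
      (disjoint_msupp (signCoef_σ_ne_zero hσ)) x y hx hy)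
  | hadd x y hx hy => rw [map_add, Finsupp.add_apply]; exact add_mem (hx b) (hy b)
  | hsmul c x hx => rw [map_smul, Finsupp.smul_apply]; exact Submodule.smul_mem _ _ (hx b)

theorem dualMap_polar_mem (x : Dual Q V) (b : Fin n → ℕ) :
    dualMap _ (polar β a) (polar_mem β δ hβ a) Q x b ∈ dualArity Q n (msupp b) := by
  have := treeMap_polar_mem β δ hβ a (Dual.incl x) b
  rwa [← incl_dualMap] at this

theorem koszulMap_polar_mem (x : Free Q 0 (Dual Q V)) (b : Fin n → ℕ) :
    koszulMap _ (polar β a) (polar_mem β δ hβ a) Q x b ∈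
      Submodule.span K {x | KoszulMonomial Q n (msupp b) x} := by
  induction x using Free.induction_on generalizing b with
  | hι i x hx =>
    rw [koszulMap_ι, cmap_apply]
    exact Submodule.subset_span (.gen _ _ (dualMap_polar_mem β δ hβ a x b))
  | hnode e i j x _ y _ hx hy =>
    rw [koszulMap_node]
    refine cmul_mem _ _ _ (fun b => Submodule.span K {x | KoszulMonomial Q n (msupp b) x})
      (fun b => Submodule.span K {x | KoszulMonomial Q n (msupp b) x})
      (fun b => Submodule.span K {x | KoszulMonomial Q n (msupp b) x}) e ?_ hx hy b
    intro b b' hσ m hm m' hm'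
    refine map₂_mem_span (Free.node e) ?_ hm
      (parZ_mem_submodule (fun x => parity_mem_span_koszulMonomial) _ hm')
    intro x hx y hy
    rw [msupp_add]
    exact Submodule.subset_span (.node e _ _ (disjoint_msupp (signCoef_σ_ne_zero hσ)) x y hx hy)
  | hadd x y hx hy => rw [map_add, Finsupp.add_apply]; exact add_mem (hx b) (hy b)
  | hsmul c x hx => rw [map_smul, Finsupp.smul_apply]; exact Submodule.smul_mem _ _ (hx b)

theorem exists_ordering (μ : I →₀ ℕ) :
    ∃ a : Fin μ.degree → I, μ = ∑ j, Finsupp.single (a j) 1 := by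
  suffices h : ∃ n, ∃ a : Fin n → I, n = μ.degree ∧ μ = ∑ j, Finsupp.single (a j) 1 by
    obtain ⟨n, a, rfl, h⟩ := h
    exact ⟨a, h⟩
  induction μ using Finsupp.induction_linear with
  | zero => exact ⟨0, Fin.elim0, by simp, by simp⟩
  | add μ ν hμ hν =>
    obtain ⟨m, a, hm, ha⟩ := hμ
    obtain ⟨n, b, hn, hb⟩ := hν
    refine ⟨m + n, Fin.append a b, by rw [map_add, hm, hn], ?_⟩
    rw [Fin.sum_univ_add]
    simp only [Fin.append_left, Fin.append_right]
    rw [← ha, ← hb]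
  | single i n => exact ⟨n, fun _ => i, by simp, by simp⟩

/-- Splitting an element of the Koszul complex of a free algebra into multidegrees. -/
abbrev multi (Q : QuadData.{u, v} K) :
    Free Q 0 (Dual Q V) →ₗ[K] ((I →₀ ℕ) →₀ Free Q 0 (Dual Q V)) :=
  koszulMap (Coef.triv K (I →₀ ℕ)) (coact β) (coact_mem β δ hβ) Q

theorem multi_multi (x : Free Q 0 (Dual Q V)) (μ : I →₀ ℕ) :
    multi β δ hβ Q (multi β δ hβ Q x μ) = Finsupp.single μ (multi β δ hβ Q x μ) := by
  have := DFunLike.congr_fun (koszulMap_comp (Q := Q) (diagCompat_triv (K := K) (I →₀ ℕ))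
    (hΦ := coact_mem β δ hβ) (hΨ := coact_mem β δ hβ) (hF := coact_mem β δ hβ)
    (coact_coact β) x) μ
  rw [cmap_apply, diag_apply, Pi.one_apply, one_smul] at this
  exact this

theorem multi_mem {k : ℤ} {x : Free Q 0 (Dual Q V)} (hx : x ∈ (Free Q 0 (Dual Q V)).gr k)
    (μ : I →₀ ℕ) : multi β δ hβ Q x μ ∈ (Free Q 0 (Dual Q V)).gr k := by
  have := mem_extGr.1 (koszulMap_mem _ _ (coact_mem β δ hβ) hx) μ
  rwa [show (Coef.triv K (I →₀ ℕ)).deg μ = 0 from rfl, sub_zero] at this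

theorem multi_koszulD (x : Free Q 0 (Dual Q V)) (μ : I →₀ ℕ) :
    multi β δ hβ Q (koszulD Q V x) μ = koszulD Q V (multi β δ hβ Q x μ) := by
  rw [multi, koszulMap_koszulD, cmap_apply]

theorem multi_total (x : Free Q 0 (Dual Q V)) : total K _ _ (multi β δ hβ Q x) = x :=
  koszulMap_total (coact_total β) x

/-- In multidegrees of total degree at least two, the Koszul complex of `V` is acyclic. -/
theorem exists_koszulD_eq [CharZero K] (hQ : Q.IsKoszul) {μ : I →₀ ℕ} (hμ : 2 ≤ μ.degree) {k : ℤ}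
    {z : Free Q 0 (Dual Q V)} (hk : z ∈ (Free Q 0 (Dual Q V)).gr k)
    (hz : multi β δ hβ Q z = Finsupp.single μ z) (hd : koszulD Q V z = 0) :
    ∃ y ∈ (Free Q 0 (Dual Q V)).gr (k + 1), multi β δ hβ Q y = Finsupp.single μ y ∧
      koszulD Q V y = z := by
  -- The Koszul differential respects degree and multidegree, so any preimage may be replaced by its
  -- component of degree `k + 1` and multidegree `μ`.
  suffices h : ∃ y, koszulD Q V y = z by
    obtain ⟨y, hy⟩ := h
    refine ⟨multi β δ hβ Q ((Free Q 0 (Dual Q V)).comp (k + 1) y) μ,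
      multi_mem β δ hβ (GMod.comp_mem _ _ _) μ, multi_multi β δ hβ _ μ, ?_⟩
    rw [← multi_koszulD, ← GMod.comp_shift _ (koszulD Q V) (fun i x hx => der_mem _ _ hx), hy,
      add_sub_cancel_right, GMod.comp_of_mem _ hk, if_pos rfl, hz, Finsupp.single_eq_same]
  obtain ⟨a, ha⟩ := exists_ordering μ
  -- The coefficient of the full monomial `∏ θ_i` in the polarization of `z` is multilinear, and by
  -- naturality it is a cycle, so the Koszul hypothesis applies in arity `μ.degree`.
  obtain ⟨h, -, hh⟩ := hQ _ hμ
    (koszulMap _ (polar β a) (polar_mem β δ hβ a) Q z 1)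
    (by
      have := koszulMap_polar_mem (Q := Q) β δ hβ a z 1
      rwa [msupp_one] at this)
    (by rw [← cmap_apply, ← koszulMap_koszulD, hd, map_zero, Finsupp.zero_apply])
  -- Restitution of the polarization is a scalar multiple of `z`, the scalar being the coefficient
  -- of the full monomial in `repolCoef K a μ`; hence the restitution of `h` bounds that multiple.
  have h1 := DFunLike.congr_fun (DFunLike.congr_fun (koszulMap_comp (Q := Q)
    (diagCompat_signCoef (δ ∘ a)) (hΦ := restit_mem β δ hβ a) (hΨ := polar_mem β δ hβ a)
    (hF := repol_mem β δ hβ a) (restit_polar β a) z) 1) 1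
  rw [cmap_apply, diag_apply, Finsupp.single_eq_same, show sqfree K (1 : Fin μ.degree → ℕ) = 1 from if_pos fun _ => le_rfl, one_smul,
    koszulMap_spec (hρ := coact_mem β δ hβ) (repolCoef_add a) (repol_eq_spec β a),
    show koszulMap (Coef.triv K (I →₀ ℕ)) (coact β) (coact_mem β δ hβ) Q z = _ from hz,
    spec_single, tens_apply, ← hh, koszulMap_koszulD, cmap_apply] at h1
  have hne : (repolCoef K a μ).coeff 1 ≠ 0 := by
    have := repolCoef_ne_zero (K := K) a
    rwa [← ha] at this
  refine ⟨((repolCoef K a μ).coeff 1)⁻¹ • koszulMap _ (restit β a) (restit_mem β δ hβ a) Q h 1, ?_⟩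
  rw [map_smul, h1, smul_smul, inv_mul_cancel₀ hne, one_smul]

end Multilinear

/-! ### Supports of multidegrees and the number of leaves. -/

section Supports

variable {K : Type u} [Field K]

open Free Finsupp

theorem cmul_supported {B : Type*} [AddCommMonoid B] {C : Coef K B} {E : Type v} [AddCommGroup E]
    [Module K E] {N : Type w} [AddCommGroup N] [Module K N] {par : N →ₗ[K] N}
    {μ : E →ₗ[K] N →ₗ[K] N →ₗ[K] N} {S T U : Set B} (h : ∀ b ∈ S, ∀ b' ∈ T, b + b' ∈ U) (e : E)
    {x y : B →₀ N} (hx : x ∈ supported N K S) (hy : y ∈ supported N K T) :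
    cmul C par μ e x y ∈ supported N K U := by
  classical
  rw [mem_supported'] at hx hy ⊢
  intro b hb
  -- A support condition is encoded as the family of subspaces equal to everything on the set and to
  -- zero off it.
  have := cmul_mem C par μ (fun b => if b ∈ S then ⊤ else ⊥) (fun b => if b ∈ T then ⊤ else ⊥)
    (fun b => if b ∈ U then ⊤ else ⊥) e ?_ (x := x) (y := y) ?_ ?_ b
  · simpa [hb] using this
  · intro b b' _ m hm m' hm'
    by_cases h1 : b ∈ S
    · by_cases h2 : b' ∈ T
      · simp [h b h1 b' h2]
      · simp only [h2, if_false, Submodule.mem_bot] at hm'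
        simp [hm']
    · simp only [h1, if_false, Submodule.mem_bot] at hm
      simp [hm]
  · intro b
    by_cases h' : b ∈ S <;> simp only [h', if_true, if_false]
    · trivial
    · rw [hx b h']; exact zero_mem _
  · intro b
    by_cases h' : b ∈ T <;> simp only [h', if_true, if_false]
    · trivial
    · rw [hy b h']; exact zero_mem _

theorem cmap_supported {B : Type*} {N : Type*} {P : Type*} [AddCommGroup N] [Module K N]
    [AddCommGroup P] [Module K P] (g : N →ₗ[K] P) {S : Set B} {x : B →₀ N}
    (hx : x ∈ supported N K S) : cmap B g x ∈ supported P K S := by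
  rw [mem_supported'] at hx ⊢
  intro b hb
  rw [cmap_apply, hx b hb, map_zero]

theorem supported_of_cmap {B : Type*} {N : Type*} {P : Type*} [AddCommGroup N] [Module K N]
    [AddCommGroup P] [Module K P] {g : N →ₗ[K] P} (hg : Function.Injective g) {S : Set B}
    {x : B →₀ N} (hx : cmap B g x ∈ supported P K S) : x ∈ supported N K S := by
  rw [mem_supported'] at hx ⊢
  intro b hb
  exact hg (by rw [← cmap_apply, hx b hb, map_zero])

theorem extPar_supported {B : Type*} [AddCommMonoid B] {C : Coef K B} {N : Type w}
    [AddCommGroup N] [Module K N] (par : N →ₗ[K] N) {S : Set B} {x : B →₀ N}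
    (hx : x ∈ supported N K S) : extPar C par x ∈ supported N K S := by
  rw [← Finsupp.sum_single x, Finsupp.sum, map_sum]
  refine Submodule.sum_mem _ fun b hb => ?_
  rw [extPar_single]
  exact single_mem_supported K _ (hx hb)

/-- The number of leaves of a tree. -/
def Term.leaves {E : Type v} {V : GMod.{u, w} K} : Term E V → ℕ
  | .leaf _ _ => 1
  | .node _ l r => leaves l + leaves r

theorem Term.one_le_leaves {E : Type v} {V : GMod.{u, w} K} (t : Term E V) : 1 ≤ t.leaves := by
  induction t with
  | leaf i x => exact le_rfl
  | node e l r hl hr => exact hl.trans (Nat.le_add_right _ _)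

/-- If each generator of degree `i` has weight `i + 1`, a tree with `ℓ` leaves of degrees `i_j` has
weight `∑ i_j + ℓ`, while its own degree is `∑ i_j + s(ℓ - 1)`. For `s = 1` the weight is the degree
plus one, so the hypothesis reproduces itself on the Koszul dual; for `s = 0` it is the degree plus
the number of leaves. -/
theorem fmap_mk_supported {Q : QuadData.{u, v} K} {s : ℤ} {V : GMod.{u, w} K}
    {W : GMod.{u, w'} K} {I : Type*} {q : I → ℤ} {f : V →ₗ[K] ((I →₀ ℕ) →₀ W)}
    {C : Coef K (I →₀ ℕ)} (hf : ∀ i, ∀ x ∈ V.gr i, f x ∈ extGr C W.gr i)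
    (h : ∀ i, ∀ x ∈ V.gr i, f x ∈ supported W K {μ | weight q μ = i + 1 ∧ 1 ≤ μ.degree})
    (t : Term Q.E V) : fmap C f hf Q s (mk t) ∈ supported (Free Q s W) K
      {μ | weight q μ = t.deg s + t.leaves - s * (t.leaves - 1) ∧ t.leaves ≤ μ.degree} := by
  induction t with
  | leaf i x =>
    rw [← ι_of_mem x.2, fmap_ι]
    refine cmap_supported _ (supported_mono ?_ (h i x x.2))
    rintro μ ⟨h1, h2⟩
    exact ⟨by rw [h1]; simp [Term.deg, Term.leaves], h2⟩
  | node e l r hl hr =>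
    rw [← node_mk, fmap_node]
    refine cmul_supported ?_ e hl hr
    rintro μ ⟨h1, h2⟩ ν ⟨h3, h4⟩
    refine ⟨?_, ?_⟩
    · rw [map_add, h1, h3]; simp only [Term.deg, Term.leaves]; push_cast; ring
    · rw [map_add]; exact Nat.add_le_add h2 h4

section Basis

variable {Q : QuadData.{u, v} K} {V : GMod.{u, w} K} {I : Type w'} [DecidableEq I]
  (β : Module.Basis I K V) (δ : I → ℤ) (hβ : ∀ b, β b ∈ V.gr (δ b))

theorem coact_mem_supported {S : Set I} {x : V} (hx : x ∈ Submodule.span K (β '' S)) :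
    coact β x ∈ supported V K ((fun b => single b 1) '' S) := by
  induction hx using Submodule.span_induction with
  | mem x hx =>
    obtain ⟨b, hb, rfl⟩ := hx
    rw [coact_basis]
    exact single_mem_supported K _ ⟨b, hb, rfl⟩
  | zero => rw [map_zero]; exact zero_mem _
  | add x y _ _ hx hy => rw [map_add]; exact add_mem hx hy
  | smul c x _ hx => rw [map_smul]; exact Submodule.smul_mem _ _ hx

/-- The weight of a multidegree: each letter contributes the degree of its suspension. -/
abbrev susp : (I →₀ ℕ) →+ ℤ := weight fun b => δ b + 1

include hβ in
theorem coact_supported : ∀ i, ∀ x ∈ V.gr i, coact β x ∈ supported V K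
    {μ | susp δ μ = i + 1 ∧ 1 ≤ μ.degree} := by
  intro i x hx
  refine supported_mono ?_ (coact_mem_supported β (V.gr_le_span β δ hβ i hx))
  rintro _ ⟨b, rfl, rfl⟩
  constructor
  · simp [susp, weight_single]
  · simp

theorem dualMap_supported : ∀ i, ∀ x ∈ (Dual Q V).gr i,
    dualMap (Coef.triv K (I →₀ ℕ)) (coact β) (coact_mem β δ hβ) Q x ∈
      supported (Dual Q V) K {μ | susp δ μ = i + 1 ∧ 1 ≤ μ.degree} := by
  intro i x hx
  refine supported_of_cmap Dual.incl_injective ?_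
  rw [incl_dualMap]
  have hx' := dualPart_le_gr i (Dual.mem_gr.1 hx)
  refine Free.gr_induction (p := fun y _ => treeMap (Coef.triv K (I →₀ ℕ)) (coact β)
    (coact_mem β δ hβ) Q y ∈ supported (Tree Q V) K {μ | susp δ μ = i + 1 ∧ 1 ≤ μ.degree})
    ?_ ?_ ?_ ?_ hx'
  · intro t ht
    refine supported_mono ?_ (fmap_mk_supported (Q := Q.magma) (s := 1) (coact_mem β δ hβ)
      (coact_supported β δ hβ) t)
    rintro μ ⟨h1, h2⟩
    exact ⟨by rw [susp, h1, ht]; ring, t.one_le_leaves.trans h2⟩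
  · rw [map_zero]; exact zero_mem _
  · intro x y _ _ hx hy; rw [map_add]; exact add_mem hx hy
  · intro c x _ hx; rw [map_smul]; exact Submodule.smul_mem _ _ hx

/-- In a fixed degree the number of generators from `P^¡(A)` is thus a function of the multidegree,
namely the suspended degree minus the degree. This makes the operadic filtration of the resolution
visible on multidegrees. Each generator contains at least one letter, which gives the second
condition. -/
theorem multi_mk_supported (t : Term Q.E (Dual Q V)) :
    multi β δ hβ Q (mk t) ∈ supported (Free Q 0 (Dual Q V)) K
      {μ | susp δ μ = t.deg 0 + t.leaves ∧ t.leaves ≤ μ.degree} := by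
  refine supported_mono ?_ (fmap_mk_supported (s := 0) (dualMap_mem _ _ (coact_mem β δ hβ))
    (dualMap_supported β δ hβ) t)
  rintro μ ⟨h1, h2⟩
  exact ⟨by rw [susp, h1]; ring, h2⟩

theorem multi_injective : Function.Injective (multi β δ hβ Q) := by
  intro x y h
  rw [← multi_total β δ hβ x, h, multi_total]

end Basis

/-! ### The operadic filtration of the resolution in terms of multidegrees. -/

section OperadicFiltration

variable {Q : QuadData.{u, v} K} (A : DGAlg.{u, v, w} Q)

/-- The part of the free algebra spanned by trees with at least `n` leaves. -/
def leafFilt (n : ℕ) (V : GMod.{u, w} K) : Submodule K (Free Q 0 V) :=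
  Submodule.span K {x | ∃ t : Term Q.E V, n ≤ t.leaves ∧ mk t = x}

/-- The operadic filtration of the bar-cobar resolution. -/
def barCobarFilt (n : ℕ) : Submodule K (Free Q 0 (Dual Q A.toGMod)) := (barCobar A).opFilt n

/-- In a free algebra a composite of operations on `n` arguments expands into trees with at least
`n` leaves, since each argument contributes at least one. -/
theorem opFilt_le_leafFilt (n : ℕ) :
    barCobarFilt A n ≤ leafFilt (Q := Q) n (Dual Q A.toGMod) := by
  refine Submodule.span_le.2 fun a (ha : (barCobar A).IsMonomial n a) => ?_
  change a ∈ leafFilt (Q := Q) n (Dual Q A.toGMod)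
  induction ha with
  | one a =>
    obtain ⟨f, hf⟩ := (relations Q 0 (Dual Q A.toGMod)).mkQ_surjective a
    rw [← hf]
    clear hf
    induction f using Finsupp.induction_linear with
    | zero => rw [map_zero]; exact zero_mem _
    | add a b ha hb => rw [map_add]; exact add_mem ha hb
    | single t c =>
      rw [mkQ_single]
      exact Submodule.smul_mem (leafFilt (Q := Q) 1 (Dual Q A.toGMod)) c
        (Submodule.subset_span ⟨t, t.one_le_leaves, rfl⟩)
  | node e m n a b ha hb iha ihb =>
    refine map₂_mem_span (N := Free Q 0 (Dual Q A.toGMod)) (node e) ?_ iha ihb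
    rintro _ ⟨t, ht, rfl⟩ _ ⟨t', ht', rfl⟩
    rw [node_mk]
    exact Submodule.subset_span ⟨Term.node e t t', Nat.add_le_add ht ht', rfl⟩

theorem mk_mem_opFilt (t : Term Q.E (Dual Q A.toGMod)) {n : ℕ} (h1 : 1 ≤ n) (h2 : n ≤ t.leaves) :
    mk t ∈ barCobarFilt A n := by
  refine DGAlg.opFilt_anti h1 h2 (Submodule.subset_span ?_)
  clear h1 h2
  induction t with
  | leaf i x => exact .one _
  | node e l r hl hr => rw [← node_mk]; exact .node e _ _ _ _ hl hr

theorem mem_span_of_mem_opFilt {n : ℕ} {k : ℤ} {x : Free Q 0 (Dual Q A.toGMod)}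
    (hx : x ∈ barCobarFilt A n) (hk : x ∈ (Free Q 0 (Dual Q A.toGMod)).gr k) :
    x ∈ Submodule.span K {x : Free Q 0 (Dual Q A.toGMod) |
      ∃ t : Term Q.E (Dual Q A.toGMod), (n ≤ t.leaves ∧ t.deg 0 = k) ∧ mk t = x} := by
  have h : (Free Q 0 (Dual Q A.toGMod)).comp k x = x := by rw [GMod.comp_of_mem _ hk, if_pos rfl]
  rw [← h]
  have hx' := opFilt_le_leafFilt A n hx
  clear hx hk h
  induction hx' using Submodule.span_induction with
  | mem x hx =>
    obtain ⟨t, ht, rfl⟩ := hx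
    rw [GMod.comp_of_mem _ (mk_mem t)]
    split_ifs with h
    · exact Submodule.subset_span ⟨t, ⟨ht, h⟩, rfl⟩
    · exact zero_mem _
  | zero => rw [map_zero]; exact zero_mem _
  | add x y _ _ hx hy => rw [map_add]; exact add_mem hx hy
  | smul c x _ hx => rw [map_smul]; exact Submodule.smul_mem _ _ hx

variable {A} {I : Type w'} [DecidableEq I] (β : Module.Basis I K A.toGMod) (δ : I → ℤ)
  (hβ : ∀ b, β b ∈ A.gr (δ b))

theorem multi_supported_of_mem_opFilt {n : ℕ} {k : ℤ} {x : Free Q 0 (Dual Q A.toGMod)}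
    (hx : x ∈ barCobarFilt A n) (hk : x ∈ (Free Q 0 (Dual Q A.toGMod)).gr k) :
    multi β δ hβ Q x ∈ supported _ K
      {μ | k + n ≤ susp δ μ ∧ susp δ μ ≤ k + μ.degree} := by
  have h := mem_span_of_mem_opFilt A hx hk
  clear hx hk
  induction h using Submodule.span_induction with
  | mem x hx =>
    obtain ⟨t, ⟨ht, rfl⟩, rfl⟩ := hx
    refine supported_mono ?_ (multi_mk_supported β δ hβ t)
    rintro μ ⟨h1, h2⟩
    exact ⟨by rw [h1]; omega, by rw [h1]; omega⟩
  | zero => rw [map_zero]; exact zero_mem _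
  | add x y _ _ hx hy => rw [map_add]; exact add_mem hx hy
  | smul c x _ hx => rw [map_smul]; exact Submodule.smul_mem _ _ hx

/-- Split `x` into trees with fewer than `n` leaves and trees with at least `n`. Their suspended
degrees lie on opposite sides of `k + n`, so the support condition leaves no room for the first
part. -/
theorem mem_opFilt_of_multi_supported {n : ℕ} (hn : 1 ≤ n) {k : ℤ}
    {x : Free Q 0 (Dual Q A.toGMod)} (hk : x ∈ (Free Q 0 (Dual Q A.toGMod)).gr k)
    (hx : multi β δ hβ Q x ∈ supported _ K {μ | k + n ≤ susp δ μ}) :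
    x ∈ barCobarFilt A n := by
  have h : ∃ y z, x = y + z ∧ multi β δ hβ Q y ∈ supported _ K {μ | susp δ μ < k + n} ∧
      z ∈ barCobarFilt A n ∧ multi β δ hβ Q z ∈ supported _ K {μ | k + n ≤ susp δ μ} := by
    clear hx
    refine Free.gr_induction (p := fun x _ => ∃ y z, x = y + z ∧
      multi β δ hβ Q y ∈ supported _ K {μ | susp δ μ < k + n} ∧
      z ∈ barCobarFilt A n ∧ multi β δ hβ Q z ∈ supported _ K {μ | k + n ≤ susp δ μ})
      ?_ ?_ ?_ ?_ hk
    · intro t ht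
      have h := multi_mk_supported β δ hβ t
      rcases lt_or_ge t.leaves n with h1 | h1
      · refine ⟨mk t, 0, (add_zero _).symm, supported_mono ?_ h, zero_mem _, ?_⟩
        · rintro μ ⟨h2, -⟩
          rw [Set.mem_ofPred_eq, h2]; omega
        · rw [map_zero]; exact zero_mem _
      · refine ⟨0, mk t, (zero_add _).symm, ?_, mk_mem_opFilt A t hn h1, supported_mono ?_ h⟩
        · rw [map_zero]; exact zero_mem _
        · rintro μ ⟨h2, -⟩
          rw [Set.mem_ofPred_eq, h2]; omega
    · exact ⟨0, 0, (add_zero _).symm, by rw [map_zero]; exact zero_mem _, zero_mem _,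
        by rw [map_zero]; exact zero_mem _⟩
    · rintro _ _ - - ⟨y, z, rfl, h1, h2, h3⟩ ⟨y', z', rfl, h1', h2', h3'⟩
      exact ⟨y + y', z + z', add_add_add_comm .., by rw [map_add]; exact add_mem h1 h1',
        add_mem h2 h2', by rw [map_add]; exact add_mem h3 h3'⟩
    · rintro c _ - ⟨y, z, rfl, h1, h2, h3⟩
      exact ⟨c • y, c • z, smul_add .., by rw [map_smul]; exact Submodule.smul_mem _ _ h1,
        Submodule.smul_mem _ _ h2, by rw [map_smul]; exact Submodule.smul_mem _ _ h3⟩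
  obtain ⟨y, z, rfl, h1, h2, h3⟩ := h
  have h4 : multi β δ hβ Q y = 0 := by
    rw [map_add] at hx
    have h5 := sub_mem hx h3
    rw [add_sub_cancel_right] at h5
    have h6 : multi β δ hβ Q y ∈ supported _ K ({μ | susp δ μ < k + n} ∩ {μ | k + n ≤ susp δ μ}) := by
      rw [supported_inter]; exact ⟨h1, h5⟩
    refine Finsupp.ext fun μ => (mem_supported' K _).1 h6 μ ?_
    rintro ⟨h7, h8⟩
    rw [Set.mem_ofPred_eq] at h7 h8
    exact absurd h7 (not_lt.2 h8)
  have h5 : y = 0 := multi_injective β δ hβ (by rw [h4, map_zero])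
  rw [h5, zero_add]
  exact h2

end OperadicFiltration

/-! ### Effect of the bar differential on suspended degree and weight. -/

section BarWeight

variable {Q : QuadData.{u, v} K}

/-- A homogeneous basis adapted to the operadic filtration. -/
structure DGAlg.AdaptedBasis (A : DGAlg.{u, v, w} Q) (I : Type w') where
  basis : Module.Basis I K A.toGMod
  deg : I → ℤ
  wt : I → ℕ
  mem_gr : ∀ b, basis b ∈ A.gr (deg b)
  one_le : ∀ b, 1 ≤ wt b
  mem_opFilt : ∀ b, basis b ∈ A.opFilt (wt b)
  span : ∀ p j, 1 ≤ p → ∀ x ∈ A.opFilt p, x ∈ A.gr j →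
    x ∈ Submodule.span K (basis '' {b | p ≤ wt b ∧ deg b = j})

variable {A : DGAlg.{u, v, w} Q} {I : Type w'} [DecidableEq I] (β : A.AdaptedBasis I)

/-- The multidegrees which may occur in the bar differential of an element of multidegree `μ`. -/
def DGAlg.AdaptedBasis.below (μ : I →₀ ℕ) : Set (I →₀ ℕ) :=
  {ν | susp β.deg ν = susp β.deg μ - 1 ∧ weight β.wt μ ≤ weight β.wt ν}

/-- Trees decorated by basis elements, with their multidegrees. -/
inductive BasisTree : (I →₀ ℕ) → Tree Q A.toGMod → Prop
  | leaf (b : I) : BasisTree (single b 1) (Tree.leaf Q (β.basis b))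
  | node (e : Q.E) (μ ν : I →₀ ℕ) (x y : Tree Q A.toGMod) (hx : BasisTree μ x)
      (hy : BasisTree ν y) : BasisTree (μ + ν) (Tree.node Q e x y)

/-- Products of homogeneous elements of the Koszul dual coalgebra, with their multidegrees. -/
inductive BasisProduct : (I →₀ ℕ) → Free Q 0 (Dual Q A.toGMod) → Prop
  | gen (μ : I →₀ ℕ) (c : Dual Q A.toGMod)
      (hc : Dual.incl c ∈ Submodule.span K {x | BasisTree β μ x}) : BasisProduct μ (ι c)
  | node (e : Q.E) (μ ν : I →₀ ℕ) (x y : Free Q 0 (Dual Q A.toGMod)) (hx : BasisProduct μ x)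
      (hy : BasisProduct ν y) : BasisProduct (μ + ν) (Free.node e x y)

/-- The splitting of tree tensors into multidegrees. -/
abbrev DGAlg.AdaptedBasis.multiTree : Tree Q A.toGMod →ₗ[K] ((I →₀ ℕ) →₀ Tree Q A.toGMod) :=
  treeMap (Coef.triv K (I →₀ ℕ)) (coact β.basis) (coact_mem β.basis β.deg β.mem_gr) Q

theorem multiTree_mem (x : Tree Q A.toGMod) (μ : I →₀ ℕ) :
    β.multiTree x μ ∈ Submodule.span K {x | BasisTree β μ x} := by
  induction x using Free.induction_on generalizing μ with
  | hι i x hx =>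
    rw [show Free.ι x = Tree.leaf Q x from rfl, treeMap_leaf, cmap_apply]
    clear hx
    have hx : x ∈ Submodule.span K (Set.range β.basis) := by rw [β.basis.span_eq]; trivial
    induction hx using Submodule.span_induction with
    | mem x hx =>
      obtain ⟨j, rfl⟩ := hx
      rw [coact_basis, Finsupp.single_apply]
      split_ifs with h
      · rw [← h]; exact Submodule.subset_span (.leaf j)
      · rw [map_zero]; exact zero_mem _
    | zero => rw [map_zero, Finsupp.zero_apply, map_zero]; exact zero_mem _
    | add x y _ _ hx hy => rw [map_add, Finsupp.add_apply, map_add]; exact add_mem hx hy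
    | smul c x _ hx => rw [map_smul, Finsupp.smul_apply, map_smul]; exact Submodule.smul_mem _ _ hx
  | hnode e i j x _ y _ hx hy =>
    have : Free.node e x y = Tree.node Q e x y := rfl
    rw [this, treeMap_node]
    refine cmul_mem _ _ _ (fun μ => Submodule.span K {x | BasisTree β μ x})
      (fun μ => Submodule.span K {x | BasisTree β μ x})
      (fun μ => Submodule.span K {x | BasisTree β μ x}) e ?_ hx hy μ
    intro μ ν hσ m hm m' hm'
    rw [show (Coef.triv K (I →₀ ℕ)).deg μ = 0 from rfl, parZ_zero]
    refine map₂_mem_span (Tree.node Q e) ?_ hm hm'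
    intro x hx y hy
    exact Submodule.subset_span (BasisTree.node (Q := Q) e _ _ x y hx hy)
  | hadd x y hx hy => rw [map_add, Finsupp.add_apply]; exact add_mem (hx μ) (hy μ)
  | hsmul c x hx => rw [map_smul, Finsupp.smul_apply]; exact Submodule.smul_mem _ _ (hx μ)

theorem multi_mem_span (x : Free Q 0 (Dual Q A.toGMod)) (μ : I →₀ ℕ) :
    multi β.basis β.deg β.mem_gr Q x μ ∈ Submodule.span K {x | BasisProduct β μ x} := by
  induction x using Free.induction_on generalizing μ with
  | hι i x hx =>
    rw [koszulMap_ι, cmap_apply]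
    refine Submodule.subset_span (.gen _ _ ?_)
    have := multiTree_mem β (Dual.incl x) μ
    rwa [← incl_dualMap] at this
  | hnode e i j x _ y _ hx hy =>
    rw [koszulMap_node]
    refine cmul_mem _ _ _ (fun μ => Submodule.span K {x | BasisProduct β μ x})
      (fun μ => Submodule.span K {x | BasisProduct β μ x})
      (fun μ => Submodule.span K {x | BasisProduct β μ x}) e ?_ hx hy μ
    intro μ ν hσ m hm m' hm'
    rw [show (Coef.triv K (I →₀ ℕ)).deg μ = 0 from rfl, parZ_zero]
    refine map₂_mem_span (Free.node e) ?_ hm hm'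
    intro x hx y hy
    exact Submodule.subset_span (.node e _ _ x y hx hy)
  | hadd x y hx hy => rw [map_add, Finsupp.add_apply]; exact add_mem (hx μ) (hy μ)
  | hsmul c x hx => rw [map_smul, Finsupp.smul_apply]; exact Submodule.smul_mem _ _ (hx μ)

theorem BasisTree.supported {μ : I →₀ ℕ} {x : Tree Q A.toGMod} (h : BasisTree β μ x) :
    β.multiTree x ∈ Finsupp.supported _ K {μ} := by
  induction h with
  | leaf b =>
    rw [treeMap_leaf, coact_basis, cmap_single]
    exact single_mem_supported K _ rfl
  | node e μ ν x y hx hy ihx ihy =>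
    rw [treeMap_node]
    refine cmul_supported ?_ e ihx ihy
    rintro _ rfl _ rfl
    rfl

theorem BasisTree.proj_mem {μ : I →₀ ℕ} {x : Tree Q A.toGMod} (h : BasisTree β μ x) :
    proj A.toGMod Q x ∈ A.opFilt (weight β.wt μ) ∧
      proj A.toGMod Q x ∈ A.gr (susp β.deg μ - 1) ∧ 1 ≤ weight β.wt μ := by
  induction h with
  | leaf b =>
    rw [proj_leaf, weight_single, weight_single, one_smul, one_smul, add_sub_cancel_right]
    exact ⟨β.mem_opFilt b, β.mem_gr b, β.one_le b⟩
  | node e μ ν x y hx hy ihx ihy =>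
    rw [proj_node]
    exact ⟨zero_mem _, zero_mem _, by rw [map_add]; omega⟩

/-- This is the reason for using adapted bases: an element of `F^p A` expands in letters of weight
at least `p`, without cancellation between letters of lower weight. -/
theorem coact_adapted {x : A} {p : ℕ} (hp : 1 ≤ p) {j : ℤ} (h1 : x ∈ A.opFilt p)
    (h2 : x ∈ A.gr j) : coact β.basis x ∈ supported A.toGMod K
      {ν | susp β.deg ν = j + 1 ∧ p ≤ weight β.wt ν} := by
  refine supported_mono ?_ (coact_mem_supported β.basis (β.span p j hp x h1 h2))
  rintro _ ⟨b, ⟨h3, rfl⟩, rfl⟩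
  constructor
  · simp [susp, weight_single]
  · simpa [weight_single] using h3

/-- The internal differential lowers the degree of one letter by one and keeps its filtration level.
Contracting two leaves replaces two suspensions by one, so the suspended degree again drops by one,
and the weight does not drop because `F^p · F^q ⊆ F^{p+q}`. -/
theorem BasisTree.treeD_supported {μ : I →₀ ℕ} {x : Tree Q A.toGMod} (h : BasisTree β μ x) :
    β.multiTree (treeD A x) ∈ Finsupp.supported _ K (β.below μ) := by
  induction h with
  | leaf b =>
    rw [treeD_leaf, treeMap_leaf]
    refine cmap_supported _ (supported_mono ?_ (coact_adapted β (β.one_le b)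
      (DGAlg.d_mem_opFilt (β.mem_opFilt b)) (A.d_mem _ _ (β.mem_gr b))))
    rintro ν ⟨h1, h2⟩
    refine ⟨?_, ?_⟩
    · rw [h1, weight_single]; simp
    · rw [weight_single, one_smul]; exact h2
  | node e μ ν x y hx hy ihx ihy =>
    rw [treeD_node, map_add, map_sub, map_neg, treeMap_node, treeMap_node, treeMap_leaf]
    refine add_mem (sub_mem (neg_mem ?_) ?_) (cmap_supported _ ?_)
    · refine cmul_supported ?_ e ihx hy.supported
      rintro a ⟨h1, h2⟩ _ rfl
      exact ⟨by rw [map_add, map_add, h1]; ring, by rw [map_add, map_add]; omega⟩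
    · refine cmul_supported ?_ e (S := {μ}) ?_ ihy
      · rintro _ rfl a ⟨h1, h2⟩
        exact ⟨by rw [map_add, map_add, h1]; ring, by rw [map_add, map_add]; omega⟩
      · exact (fmap_parity (Q := Q.magma) (s := 1) _ _ (coact_mem β.basis β.deg β.mem_gr) x).symm ▸
          extPar_supported _ hx.supported
    · obtain ⟨h1, h2, h3⟩ := hx.proj_mem
      obtain ⟨h4, h5, h6⟩ := hy.proj_mem
      refine supported_mono ?_ (coact_adapted β (by omega) (DGAlg.μ_mem_opFilt e h1 h4)
        (A.isAlg.mem e _ _ _ h2 _ h5))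
      rintro a ⟨h7, h8⟩
      exact ⟨by rw [h7, map_add]; ring, by rw [map_add]; exact h8⟩

theorem BasisProduct.supported {μ : I →₀ ℕ} {x : Free Q 0 (Dual Q A.toGMod)}
    (h : BasisProduct β μ x) :
    multi β.basis β.deg β.mem_gr Q x ∈ Finsupp.supported _ K {μ} := by
  induction h with
  | gen μ c hc =>
    rw [koszulMap_ι]
    refine cmap_supported _ (supported_of_cmap Dual.incl_injective ?_)
    rw [incl_dualMap]
    generalize Dual.incl c = y at hc
    induction hc using Submodule.span_induction with
    | mem x hx => exact hx.supported
    | zero => rw [map_zero]; exact zero_mem _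
    | add x y _ _ hx hy => rw [map_add]; exact add_mem hx hy
    | smul c x _ hx => rw [map_smul]; exact Submodule.smul_mem _ _ hx
  | node e μ ν x y hx hy ihx ihy =>
    rw [koszulMap_node]
    refine cmul_supported ?_ e ihx ihy
    rintro _ rfl _ rfl
    rfl

theorem BasisProduct.barFree_supported {μ : I →₀ ℕ} {x : Free Q 0 (Dual Q A.toGMod)}
    (h : BasisProduct β μ x) :
    multi β.basis β.deg β.mem_gr Q (barFree A x) ∈ Finsupp.supported _ K (β.below μ) := by
  induction h with
  | gen μ c hc =>
    rw [barFree, der_ι, LinearMap.comp_apply, koszulMap_ι]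
    refine cmap_supported _ (supported_of_cmap Dual.incl_injective ?_)
    rw [incl_dualMap, incl_barD]
    generalize Dual.incl c = y at hc
    induction hc using Submodule.span_induction with
    | mem x hx => exact hx.treeD_supported
    | zero => rw [map_zero, map_zero]; exact zero_mem _
    | add x y _ _ hx hy => rw [map_add, map_add]; exact add_mem hx hy
    | smul c x _ hx => rw [map_smul, map_smul]; exact Submodule.smul_mem _ _ hx
  | node e μ ν x y hx hy ihx ihy =>
    rw [barFree, der_node, map_add, koszulMap_node, koszulMap_node]
    refine add_mem ?_ ?_
    · refine cmul_supported ?_ e ihx hy.supported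
      rintro a ⟨h1, h2⟩ _ rfl
      exact ⟨by rw [map_add, map_add, h1]; ring, by rw [map_add, map_add]; omega⟩
    · refine cmul_supported ?_ e (S := {μ}) ?_ ihy
      · rintro _ rfl a ⟨h1, h2⟩
        exact ⟨by rw [map_add, map_add, h1]; ring, by rw [map_add, map_add]; omega⟩
      · rw [koszulMap, fmap_parity]
        exact extPar_supported _ hx.supported

/-- An element is the sum of its multidegree components, each spanned by products of homogeneous
pieces, for which the bound has been checked. -/
theorem barFree_supported {S T : Set (I →₀ ℕ)} (h : ∀ μ ∈ S, β.below μ ⊆ T)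
    {x : Free Q 0 (Dual Q A.toGMod)}
    (hx : multi β.basis β.deg β.mem_gr Q x ∈ Finsupp.supported _ K S) :
    multi β.basis β.deg β.mem_gr Q (barFree A x) ∈ Finsupp.supported _ K T := by
  rw [← multi_total β.basis β.deg β.mem_gr x, total_eq, Finsupp.sum, map_sum, map_sum]
  refine Submodule.sum_mem _ fun μ hμ => supported_mono (h μ (hx hμ)) ?_
  have hm := multi_mem_span β x μ
  generalize multi β.basis β.deg β.mem_gr Q x μ = y at hm
  induction hm using Submodule.span_induction with
  | mem x hx => exact hx.barFree_supported
  | zero => rw [map_zero, map_zero]; exact zero_mem _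
  | add x y _ _ hx hy => rw [map_add, map_add]; exact add_mem hx hy
  | smul c x _ hx => rw [map_smul, map_smul]; exact Submodule.smul_mem _ _ hx

end BarWeight

end Supports

/-! ### An elementwise criterion for quasi-isomorphisms. -/

section QuasiIsomorphisms

variable {K : Type u} [Field K]

open CategoryTheory

/-- Over a field every test object has a basis, so the lifting criteria for injectivity and
surjectivity on homology can be met by choosing lifts of basis vectors, with the identity as
covering. -/
theorem quasiIso_of_elements {X Y : ChainComplex (ModuleCat.{w} K) ℤ} (φ : X ⟶ Y)
    (hinj : ∀ k (x : X.X (k + 1)) (y : Y.X (k + 1 + 1)), X.d (k + 1) k x = 0 →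
      φ.f (k + 1) x = Y.d (k + 1 + 1) (k + 1) y → ∃ x', x = X.d (k + 1 + 1) (k + 1) x')
    (hsurj : ∀ k (y : Y.X (k + 1)), Y.d (k + 1) k y = 0 →
      ∃ x, X.d (k + 1) k x = 0 ∧ ∃ y', y = φ.f (k + 1) x + Y.d (k + 1 + 1) (k + 1) y') :
    QuasiIso φ := by
  refine ⟨fun j => ?_⟩
  -- Degrees are shifted so that both differentials involved go from some `i + 1` to `i`, the only
  -- form in which they are described.
  obtain ⟨k, rfl⟩ : ∃ k, j = k + 1 := ⟨j - 1, by ring⟩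
  rw [quasiIsoAt_iff_isIso_homologyMap]
  have hp : (ComplexShape.down ℤ).prev (k + 1) = k + 1 + 1 := by simp
  have hn : (ComplexShape.down ℤ).next (k + 1) = k := by simp
  have h1 : Mono (HomologicalComplex.homologyMap φ (k + 1)) := by
    rw [HomologicalComplex.mono_homologyMap_iff_up_to_refinements φ _ _ _ hp hn]
    intro A x hx y hy
    let b := Module.Basis.ofVectorSpace K A
    have h (i) : ∃ x', x (b i) = X.d (k + 1 + 1) (k + 1) x' := by
      refine hinj k _ (y (b i)) ?_ ?_
      · exact congrArg (fun f => f.hom (b i)) hx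
      · exact congrArg (fun f => f.hom (b i)) hy
    choose c hc using h
    refine ⟨A, 𝟙 A, inferInstance, ModuleCat.ofHom (b.constr K c), ?_⟩
    rw [Category.id_comp]
    refine ModuleCat.hom_ext (b.ext fun i => ?_)
    rw [hc i, ModuleCat.hom_comp, LinearMap.comp_apply, ModuleCat.hom_ofHom, b.constr_basis]
  have h2 : Epi (HomologicalComplex.homologyMap φ (k + 1)) := by
    rw [HomologicalComplex.epi_homologyMap_iff_up_to_refinements φ _ _ _ hp hn]
    intro A y hy
    let b := Module.Basis.ofVectorSpace K A
    have h (i) := hsurj k (y (b i)) (congrArg (fun f => f.hom (b i)) hy)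
    choose c hc c' hc' using h
    refine ⟨A, 𝟙 A, inferInstance, ModuleCat.ofHom (b.constr K c), ?_,
      ModuleCat.ofHom (b.constr K c'), ?_⟩
    · refine ModuleCat.hom_ext (b.ext fun i => ?_)
      rw [ModuleCat.hom_comp, LinearMap.comp_apply, ModuleCat.hom_ofHom, b.constr_basis, hc]
      rfl
    · rw [Category.id_comp]
      refine ModuleCat.hom_ext (b.ext fun i => ?_)
      rw [hc' i, ModuleCat.hom_add, LinearMap.add_apply, ModuleCat.hom_comp, ModuleCat.hom_comp,
        LinearMap.comp_apply, LinearMap.comp_apply, ModuleCat.hom_ofHom, ModuleCat.hom_ofHom,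
        b.constr_basis, b.constr_basis]
  exact isIso_of_mono_of_epi _

end QuasiIsomorphisms

/-! ### Pro-zero homology of the filtration implies completeness. -/

section ProZero

variable {K : Type u} [Field K] {Q : QuadData.{u, v} K} (B : DGAlg.{u, v, w} Q)

open CategoryTheory

/-- The homology of the pieces of the operadic filtration is pro-zero. -/
def DGAlg.ProAcyclic : Prop := ∀ k n, 1 ≤ n → ∃ n', 1 ≤ n' ∧ ∀ z ∈ B.opFilt n', z ∈ B.gr k → B.d z = 0 →
  ∃ y ∈ B.opFilt n, y ∈ B.gr (k + 1) ∧ B.d y = z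

variable {B}

theorem DGAlg.ProAcyclic.exists_index (h : B.ProAcyclic) (k : ℤ) (n : ℕ) :
    ∃ m, n ≤ m ∧ ∀ p, m ≤ p → ∀ z ∈ B.filtPart p k, B.d z = 0 →
      ∃ y ∈ B.filtPart n (k + 1), B.dPart k y = z := by
  -- The subspace `filtPart n` is level `n + 1` of the operadic filtration. Taking the maximum with
  -- `n` makes the resulting index at least `n`, as the comparison of representatives requires.
  obtain ⟨n', hpos, hn'⟩ := h k (n + 1) (by omega)
  refine ⟨max n n', le_max_left _ _, fun p hp z hz hd => ?_⟩
  obtain ⟨y, h1, h2, h3⟩ := hn' z.1 (DGAlg.opFilt_anti hpos (by omega) hz) z.2 hd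
  exact ⟨⟨y, h2⟩, h1, Subtype.ext h3⟩

theorem mk_eq_of_le {k : ℤ} (c : B.completionPart k) {m n : ℕ} (h : m ≤ n) {x : B.gr k}
    (hx : Submodule.Quotient.mk x = c.1 n) : Submodule.Quotient.mk x = c.1 m := by
  induction n, h using Nat.le_induction with
  | base => exact hx
  | succ n h ih =>
    refine ih ?_
    rw [← c.2 n, ← hx]
    rfl

theorem dCompletion_mk {k : ℤ} (c : B.completionPart (k + 1)) {n : ℕ} {x : B.gr (k + 1)}
    (hx : Submodule.Quotient.mk x = c.1 n) :
    (B.dCompletion k c).1 n = Submodule.Quotient.mk (B.dPart k x) := by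
  change B.dQuot n k (c.1 n) = _
  rw [← hx]
  rfl

/-- Injectivity on homology: subtracting the boundary of a representative of `y` at a deep level
moves `x` into that level without changing that it is a cycle, and such cycles bound. -/
theorem DGAlg.ProAcyclic.exists_preimage (h : B.ProAcyclic) (k : ℤ) (x : B.gr (k + 1))
    (y : B.completionPart (k + 1 + 1)) (hx : B.dPart k x = 0)
    (hxy : B.toCompletionPart (k + 1) x = B.dCompletion (k + 1) y) :
    ∃ x', x = B.dPart (k + 1) x' := by
  obtain ⟨m, -, hm⟩ := h.exists_index (k + 1) 0
  obtain ⟨y0, hy0⟩ := Submodule.Quotient.mk_surjective _ (y.1 m)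
  have h1 : x - B.dPart (k + 1) y0 ∈ B.filtPart m (k + 1) := by
    rw [← Submodule.Quotient.eq, ← dCompletion_mk y hy0, ← hxy]
    rfl
  obtain ⟨y1, -, hy1⟩ := hm m le_rfl _ h1 (congrArg Subtype.val
    (show B.dPart k (x - B.dPart (k + 1) y0) = 0 by rw [map_sub, hx, B.dPart_dPart, sub_zero]))
  exact ⟨y1 + y0, by rw [map_add, hy1, sub_add_cancel]⟩

/-- Lift `c` at a level much deeper than `n`. The differential of the lift is a cycle in that level,
hence the differential of an element of level `n`, and subtracting the latter corrects the lift
without altering it modulo level `n`. -/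
theorem DGAlg.ProAcyclic.exists_cycle (h : B.ProAcyclic) (k : ℤ) (c : B.completionPart (k + 1))
    (hc : B.dCompletion k c = 0) (n : ℕ) :
    ∃ x, B.dPart k x = 0 ∧ Submodule.Quotient.mk x = c.1 n := by
  obtain ⟨m, hnm, hm⟩ := h.exists_index k n
  obtain ⟨r, hr⟩ := Submodule.Quotient.mk_surjective _ (c.1 m)
  have h1 : B.dPart k r ∈ B.filtPart m k := by
    rw [← Submodule.Quotient.mk_eq_zero, ← dCompletion_mk c hr, hc]
    rfl
  obtain ⟨z, hz, hzr⟩ := hm m le_rfl _ h1 (B.d_d r)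
  refine ⟨r - z, by rw [map_sub, hzr, sub_self], ?_⟩
  rw [← mk_eq_of_le c hnm hr, Submodule.Quotient.eq, sub_sub_cancel_left]
  exact neg_mem hz

/-- Surjectivity on homology: represent `c` by a genuine cycle at every level. Along a sufficiently
fast sequence of levels, consecutive cycles differ by the differential of some `y n` of level `n`,
so the sum of the `y n` converges in the completion, and its differential is the difference between
`c` and the first cycle. -/
theorem DGAlg.ProAcyclic.exists_lift (h : B.ProAcyclic) (k : ℤ) (c : B.completionPart (k + 1))
    (hc : B.dCompletion k c = 0) : ∃ x, B.dPart k x = 0 ∧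
      ∃ e, c = B.toCompletionPart (k + 1) x + B.dCompletion (k + 1) e := by
  choose X hX hXc using h.exists_cycle k c hc
  choose g hg hg' using h.exists_index (k + 1)
  -- Partial sums of the required indices dominate each of them and are nondecreasing.
  let M : ℕ → ℕ := fun n => ∑ j ∈ Finset.range (n + 1), g j
  have hM1 : ∀ n, g n ≤ M n := fun n =>
    Finset.single_le_sum (f := g) (fun _ _ => Nat.zero_le _) (Finset.self_mem_range_succ n)
  have hM2 : ∀ n, M n ≤ M (n + 1) := fun n => by
    change M n ≤ ∑ j ∈ Finset.range (n + 1 + 1), g j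
    rw [Finset.sum_range_succ]; exact Nat.le_add_right _ _
  have h1 : ∀ n, X (M (n + 1)) - X (M n) ∈ B.filtPart (M n) (k + 1) := fun n => by
    rw [← Submodule.Quotient.eq, hXc, mk_eq_of_le c (hM2 n) (hXc _)]
  have h2 : ∀ n, B.dPart k (X (M (n + 1)) - X (M n)) = 0 := fun n => by
    rw [map_sub, hX, hX, sub_zero]
  choose y hy hyd using fun n => hg' n (M n) (hM1 n) _ (h1 n) (congrArg Subtype.val (h2 n))
  let e : B.completionPart (k + 1 + 1) :=
    ⟨fun n => Submodule.Quotient.mk (∑ i ∈ Finset.range (n + 1), y i), fun n => by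
      change Submodule.Quotient.mk (∑ i ∈ Finset.range (n + 1 + 1), y i) = _
      rw [Submodule.Quotient.eq, Finset.sum_range_succ, add_sub_cancel_left]
      exact B.filtPart_anti n _ (hy (n + 1))⟩
  have h3 : ∀ n, B.dPart (k + 1) (∑ i ∈ Finset.range (n + 1), y i) =
      X (M (n + 1)) - X (M 0) := fun n => by
    rw [map_sum, Finset.sum_congr rfl fun i _ => hyd i,
      Finset.sum_range_sub (fun i => X (M i)) (n + 1)]
  refine ⟨X (M 0), hX _, e, Subtype.ext (funext fun n => ?_)⟩
  have h4 := dCompletion_mk e (n := n) (x := ∑ i ∈ Finset.range (n + 1), y i) rfl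
  have h5 : (B.toCompletionPart (k + 1) (X (M 0)) + B.dCompletion (k + 1) e).1 n =
      Submodule.Quotient.mk (X (M 0)) + (B.dCompletion (k + 1) e).1 n := rfl
  rw [h5, h4, h3, ← Submodule.Quotient.mk_add, add_sub_cancel]
  exact (mk_eq_of_le c ((Nat.le_succ n).trans ((hg _).trans (hM1 _))) (hXc _)).symm

/-- If the homology of the operadic filtration is pro-zero, then `B → B^` is a quasi-isomorphism. -/
theorem DGAlg.ProAcyclic.quasiIso (h : B.ProAcyclic) : QuasiIso B.toCompletion := by
  refine quasiIso_of_elements _ ?_ ?_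
  · intro k x y hx hxy
    rw [B.complex_d] at hx ⊢
    rw [B.completion_d] at hxy
    exact h.exists_preimage k x y hx hxy
  · intro k y hy
    rw [B.completion_d] at hy ⊢
    rw [B.complex_d]
    exact h.exists_lift k y hy

end ProZero

/-! ### Bases adapted to the operadic filtration. -/

section AdaptedBases

variable {K : Type u} [Field K]

/-- A finite descending flag of subspaces has an adapted basis. -/
theorem exists_adapted {W : Type w} [AddCommGroup W] [Module K W] (F : ℕ → Submodule K W)
    (hF : Antitone F) {c : ℕ} (hc : F c = ⊥) :
    ∃ s : Set W, LinearIndepOn K id s ∧ ∀ q, F q ≤ Submodule.span K (s ∩ F q) := by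
  -- The basis is built from the smallest subspace upwards: stage `m` gives a basis of `F (c - m)`
  -- adapted to all the subspaces inside it, and the next stage extends it.
  suffices h : ∀ m, ∃ s ⊆ (F (c - m) : Set W), LinearIndepOn K id s ∧
      ∀ q, c - m ≤ q → F q ≤ Submodule.span K (s ∩ F q) by
    obtain ⟨s, -, h1, h2⟩ := h c
    exact ⟨s, h1, fun q => h2 q (by omega)⟩
  intro m
  induction m with
  | zero =>
    refine ⟨∅, Set.empty_subset _, linearIndependent_empty_type, fun q hq => ?_⟩
    exact (hF hq).trans (by rw [Nat.sub_zero, hc]; exact bot_le)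
  | succ m ih =>
    obtain ⟨s, h1, h2, h3⟩ := ih
    obtain ⟨t, h4, h5, h6, h7⟩ := exists_linearIndepOn_id_extension h2
      (h1.trans (hF (show c - (m + 1) ≤ c - m by omega)))
    refine ⟨t, h4, h7, fun q hq => ?_⟩
    rcases Nat.eq_or_lt_of_le hq with rfl | hq
    · rw [Set.inter_eq_left.2 h4]; exact h6
    · exact (h3 q (by omega)).trans (Submodule.span_mono (Set.inter_subset_inter_left _ h5))

variable {Q : QuadData.{u, v} K} {A : DGAlg.{u, v, w} Q}

theorem opFilt_one : A.opFilt 1 = ⊤ :=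
  eq_top_iff.2 fun a _ => Submodule.subset_span (.one a)

/-- Nilpotence makes the filtration of each `A_j` a finite flag; adapted bases of the `A_j` are then
put together over all `j`. -/
theorem DGAlg.IsNilpotent.exists_adaptedBasis (h : A.IsNilpotent) :
    ∃ I : Type w, Nonempty (A.AdaptedBasis I) := by
  have h1 : ∀ j, ∃ c, A.filtPart c j = ⊥ := fun j => by
    obtain ⟨n, hn, h⟩ := h j
    refine ⟨n, (Submodule.eq_bot_iff _).2 fun x hx => Subtype.ext (h _ ?_ x.2)⟩
    exact DGAlg.opFilt_anti hn (Nat.le_succ n) hx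
  choose c hc using h1
  have hanti : ∀ j, Antitone fun n => A.filtPart n j := fun j =>
    antitone_nat_of_succ_le fun n => A.filtPart_anti n j
  choose s hs hs' using fun j => exists_adapted (fun n => A.filtPart n j) (hanti j) (hc j)
  have htop : ∀ j, A.filtPart 0 j = ⊤ := fun j => by
    rw [DGAlg.filtPart, zero_add, opFilt_one, Submodule.comap_top]
  let b : ∀ j, Module.Basis (s j) K (A.gr j) := fun j => Module.Basis.mk (hs j) (by
    have := hs' j 0
    simp only [htop] at this
    refine this.trans (Submodule.span_mono ?_)
    rintro x ⟨hx, -⟩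
    exact ⟨⟨x, hx⟩, rfl⟩)
  have hb : ∀ i : Σ j, s j, A.internal.collectedBasis b i = (i.2.1 : A) := fun i => by
    rw [DirectSum.IsInternal.collectedBasis_coe]
    exact congrArg Subtype.val (Module.Basis.mk_apply _ _ _)
  classical
  refine ⟨Σ j, s j, ⟨{
    basis := A.internal.collectedBasis b
    deg := fun i => i.1
    -- The weight is the last level containing the vector; the `+ 1` is the shift between `filtPart`
    -- and `opFilt`. The search can stop at `c i.1`, where the filtration is already zero.
    wt := fun i => Nat.findGreatest (fun p => i.2.1 ∈ A.filtPart p i.1) (c i.1) + 1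
    mem_gr := fun i => by rw [hb]; exact i.2.1.2
    one_le := fun i => Nat.le_add_left _ _
    mem_opFilt := fun i => by
      rw [hb]
      exact Nat.findGreatest_spec (P := fun p => i.2.1 ∈ A.filtPart p i.1) (Nat.zero_le _)
        (by rw [htop]; trivial)
    span := ?_ }⟩⟩
  intro p j hp x hx hj
  obtain ⟨p, rfl⟩ : ∃ p', p = p' + 1 := ⟨p - 1, by omega⟩
  have h2 : (⟨x, hj⟩ : A.gr j) ∈ A.filtPart p j := hx
  have h3 := Submodule.mem_map_of_mem (f := (A.gr j).subtype) (hs' j p h2)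
  rw [Submodule.map_span] at h3
  refine Submodule.span_mono ?_ h3
  rintro _ ⟨y, ⟨hy, hyp⟩, rfl⟩
  refine ⟨⟨j, y, hy⟩, ⟨?_, rfl⟩, hb _⟩
  refine Nat.succ_le_succ (Nat.le_findGreatest ?_ hyp)
  by_contra hlt
  have h4 : y ∈ A.filtPart (c j) j := hanti j (le_of_not_ge hlt) hyp
  rw [hc, Submodule.mem_bot] at h4
  exact (hs j).ne_zero hy h4

theorem DGAlg.AdaptedBasis.exists_bound {I : Type w'} (β : A.AdaptedBasis I)
    (h : A.IsNilpotent) : ∃ c : ℤ → ℕ, ∀ i, β.wt i ≤ c (β.deg i) := by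
  choose n hn h using h
  refine ⟨n, fun i => ?_⟩
  by_contra hlt
  exact β.basis.ne_zero i (h _ _ (DGAlg.opFilt_anti (hn _) (le_of_not_ge hlt) (β.mem_opFilt i))
    (β.mem_gr i))

end AdaptedBases

/-! ### Pro-acyclicity for nonnegative nilpotent algebras. -/

section Nilpotent

variable {K : Type u} [Field K] {Q : QuadData.{u, v} K} {A : DGAlg.{u, v, w} Q} {I : Type w'}
  [DecidableEq I] (β : A.AdaptedBasis I)

open Free Finsupp

/-- Since degrees are nonnegative, every letter contributes at least one to the suspended degree. A
bound on the latter therefore limits both the number of letters and the degree of each, and letters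
of bounded degree have bounded weight. -/
theorem exists_weight_bound {δ : I → ℤ} {wt : I → ℕ} (hδ : ∀ i, 0 ≤ δ i) {c : ℤ → ℕ}
    (hc : ∀ i, wt i ≤ c (δ i)) (N : ℤ) :
    ∃ C, ∀ μ : I →₀ ℕ, susp δ μ ≤ N → weight wt μ ≤ C := by
  refine ⟨N.toNat * ∑ j ∈ Finset.range (N.toNat + 1), c j, fun μ hμ => ?_⟩
  rw [susp, weight_apply, Finsupp.sum] at hμ
  have h1 : ∀ i ∈ μ.support, (0 : ℤ) ≤ μ i • (δ i + 1) := fun i _ =>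
    nsmul_nonneg (by have := hδ i; omega) _
  have h2 : ∀ i ∈ μ.support, wt i ≤ ∑ j ∈ Finset.range (N.toNat + 1), c j := by
    intro i hi
    have h3 := (Finset.single_le_sum h1 hi).trans hμ
    have h4 : 1 ≤ μ i := Nat.one_le_iff_ne_zero.2 (mem_support_iff.1 hi)
    have h5 := hδ i
    have h6 : δ i + 1 ≤ N := by
      refine le_trans ?_ h3
      rw [nsmul_eq_mul]
      have : (1 : ℤ) ≤ (μ i : ℤ) := by exact_mod_cast h4
      nlinarith
    refine (hc i).trans ?_
    have h7 : c (δ i) = c ((δ i).toNat : ℤ) := by rw [Int.toNat_of_nonneg h5]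
    rw [h7]
    exact Finset.single_le_sum (f := fun j : ℕ => c j) (fun _ _ => Nat.zero_le _)
      (Finset.mem_range.2 (by omega))
  have h8 : ∑ i ∈ μ.support, μ i ≤ N.toNat := by
    have : ((∑ i ∈ μ.support, μ i : ℕ) : ℤ) ≤ N := by
      refine le_trans ?_ hμ
      push_cast
      refine Finset.sum_le_sum fun i _ => ?_
      rw [nsmul_eq_mul]
      have := hδ i
      have h9 : (0 : ℤ) ≤ μ i := Int.natCast_nonneg _
      nlinarith
    omega
  rw [weight_apply, Finsupp.sum]
  calc ∑ i ∈ μ.support, μ i • wt i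
      ≤ ∑ i ∈ μ.support, μ i * ∑ j ∈ Finset.range (N.toNat + 1), c j :=
        Finset.sum_le_sum fun i hi => Nat.mul_le_mul_left _ (h2 i hi)
    _ ≤ _ := by rw [← Finset.sum_mul]; exact Nat.mul_le_mul_right _ h8

variable [CharZero K]

/-- One step of the descending induction: the part of top multidegree of a cycle is killed by a
boundary. -/
theorem exists_step (hQ : Q.IsKoszul) {k : ℤ} {M W : ℕ} (hM : 1 ≤ M)
    {z : Free Q 0 (Dual Q A.toGMod)} (hk : z ∈ (Free Q 0 (Dual Q A.toGMod)).gr k)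
    (hd : der (twist A) (twist_mem A) z = 0) {n : ℕ} (hn : n ≤ M)
    (hz : multi β.basis β.deg β.mem_gr Q z ∈ supported _ K {μ | k + n ≤ susp β.deg μ ∧
      susp β.deg μ ≤ k + (M + 1 : ℕ) ∧ susp β.deg μ ≤ k + μ.degree ∧ W ≤ weight β.wt μ}) :
    ∃ y ∈ (Free Q 0 (Dual Q A.toGMod)).gr (k + 1),
      multi β.basis β.deg β.mem_gr Q y ∈ supported _ K {μ | k + 1 + n ≤ susp β.deg μ} ∧
      multi β.basis β.deg β.mem_gr Q (z - der (twist A) (twist_mem A) y) ∈ supported _ K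
        {μ | k + n ≤ susp β.deg μ ∧ susp β.deg μ ≤ k + M ∧ W ≤ weight β.wt μ} := by
  classical
  set ρ := multi β.basis β.deg β.mem_gr Q with hρ
  -- The bar part of `d z` lies strictly below the top suspended degree `k + M + 1`; hence the top
  -- components of the cycle `z` are cycles for the Koszul differential alone.
  have hbar : ρ (barFree A z) ∈ supported _ K {μ | susp β.deg μ ≤ k + M} := by
    refine barFree_supported β ?_ hz
    rintro μ ⟨-, h, -⟩ ν ⟨h', -⟩
    rw [Set.mem_ofPred_eq, h']
    push_cast at h
    omega
  let s := (ρ z).support.filter fun μ => susp β.deg μ = k + (M + 1 : ℕ)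
  have hs : ∀ μ ∈ s, ∃ y ∈ (Free Q 0 (Dual Q A.toGMod)).gr (k + 1),
      ρ y = single μ y ∧ koszulD Q A.toGMod y = ρ z μ := by
    intro μ hμ
    obtain ⟨hμ1, hμ2⟩ := Finset.mem_filter.1 hμ
    obtain ⟨h1, h2, h3, h4⟩ := hz hμ1
    refine exists_koszulD_eq β.basis β.deg β.mem_gr hQ ?_ (multi_mem _ _ _ hk μ)
      (multi_multi _ _ _ z μ) ?_
    -- A top component has at least `M + 1 ≥ 2` letters, the range in which the Koszul complex is
    -- acyclic.
    · rw [hμ2] at h3; push_cast at h3; omega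
    · rw [← multi_koszulD]
      have h5 := hd
      rw [der_twist, add_comm, add_eq_zero_iff_eq_neg] at h5
      rw [h5, map_neg, Finsupp.neg_apply, neg_eq_zero]
      refine (mem_supported' K _).1 hbar μ ?_
      rw [Set.mem_ofPred_eq, hμ2]
      push_cast
      omega
  choose! y hy1 hy2 hy3 using hs
  have hsum : ρ (∑ μ ∈ s, y μ) ∈ supported _ K
      {μ | susp β.deg μ = k + (M + 1 : ℕ) ∧ W ≤ weight β.wt μ} := by
    rw [map_sum]
    refine Submodule.sum_mem _ fun μ hμ => ?_
    rw [hy2 μ hμ]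
    obtain ⟨hμ1, hμ2⟩ := Finset.mem_filter.1 hμ
    exact single_mem_supported K _ ⟨hμ2, (hz hμ1).2.2.2⟩
  refine ⟨∑ μ ∈ s, y μ, Submodule.sum_mem _ hy1, supported_mono ?_ hsum, ?_⟩
  · rintro μ ⟨h, -⟩
    rw [Set.mem_ofPred_eq, h]
    push_cast
    omega
  · rw [der_twist, add_comm (barFree A _), ← sub_sub, map_sub]
    refine sub_mem ?_ ?_
    · have h1 : ρ (z - koszulD Q A.toGMod (∑ μ ∈ s, y μ)) =
          (ρ z).filter fun μ => ¬susp β.deg μ = k + (M + 1 : ℕ) := by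
        rw [map_sum, Finset.sum_congr rfl hy3, map_sub, map_sum,
          Finset.sum_congr rfl fun μ _ => multi_multi β.basis β.deg β.mem_gr z μ, sub_eq_iff_eq_add]
        refine (Finsupp.filter_add_filter_not (ρ z)
          (fun μ => ¬susp β.deg μ = k + (M + 1 : ℕ))).symm.trans ?_
        congr 1
        refine Finsupp.ext fun ν => ?_
        rw [Finsupp.finsetSum_apply, Finsupp.filter_apply]
        simp only [Finsupp.single_apply, not_not]
        rw [Finset.sum_ite_eq' s ν]
        by_cases h : susp β.deg ν = k + (M + 1 : ℕ)
        · rw [if_pos h]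
          split_ifs with h'
          · rfl
          · by_contra h''
            exact h' (Finset.mem_filter.2 ⟨mem_support_iff.2 h'', h⟩)
        · rw [if_neg h, if_neg fun h' : ν ∈ s => h (Finset.mem_filter.1 h').2]
      rw [h1]
      intro μ hμ
      rw [Finset.mem_coe, Finsupp.support_filter, Finset.mem_filter] at hμ
      obtain ⟨h2, h3⟩ := hμ
      obtain ⟨h4, h5, -, h6⟩ := hz h2
      refine ⟨h4, ?_, h6⟩
      push_cast at h5 h3
      omega
    -- The bar part of the boundary sits one step below the top, and it keeps the lower bound on the
    -- weight.
    · refine barFree_supported β ?_ hsum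
      rintro μ ⟨h1, h2⟩ ν ⟨h3, h4⟩
      refine ⟨?_, ?_, h2.trans h4⟩ <;> rw [h3, h1] <;> push_cast <;> omega

/-- A cycle of high weight is the boundary of an element of the filtration. -/
theorem exists_boundary (hQ : Q.IsKoszul) {k : ℤ} {n W : ℕ} (hn : 1 ≤ n)
    (hW : ∀ μ, susp β.deg μ ≤ k + n → weight β.wt μ < W) (M : ℕ) :
    ∀ z ∈ (Free Q 0 (Dual Q A.toGMod)).gr k, der (twist A) (twist_mem A) z = 0 →
      z ∈ barCobarFilt A n →
      multi β.basis β.deg β.mem_gr Q z ∈ supported _ K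
        {μ | k + n ≤ susp β.deg μ ∧ susp β.deg μ ≤ k + (n + M : ℕ) ∧ W ≤ weight β.wt μ} →
      ∃ y ∈ barCobarFilt A n, y ∈ (Free Q 0 (Dual Q A.toGMod)).gr (k + 1) ∧
        der (twist A) (twist_mem A) y = z := by
  induction M with
  | zero =>
    intro z hk hd hf hz
    have : z = 0 := by
      refine multi_injective β.basis β.deg β.mem_gr ?_
      rw [map_zero]
      refine Finsupp.ext fun μ => (mem_supported' K _).1 hz μ ?_
      rintro ⟨-, h1, h2⟩
      exact absurd (hW μ h1) (not_lt.2 h2)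
    exact ⟨0, zero_mem _, zero_mem _, by rw [map_zero, this]⟩
  | succ M ih =>
    intro z hk hd hf hz
    have hz' := multi_supported_of_mem_opFilt β.basis β.deg β.mem_gr hf hk
    obtain ⟨y, hy1, hy2, hy3⟩ := exists_step β hQ (M := n + M) (W := W) (by omega) hk hd
      (n := n) (by omega) (z := z) (by
        intro μ hμ
        obtain ⟨h1, h2, h3⟩ := hz hμ
        exact ⟨h1, h2, (hz' hμ).2, h3⟩)
    have hyf := mem_opFilt_of_multi_supported β.basis β.deg β.mem_gr hn hy1 hy2
    have hdy : der (twist A) (twist_mem A) y ∈ (Free Q 0 (Dual Q A.toGMod)).gr k := by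
      have := der_mem (twist A) (twist_mem A) hy1
      rwa [add_sub_cancel_right] at this
    have hdyf : der (twist A) (twist_mem A) y ∈ barCobarFilt A n :=
      DGAlg.d_mem_opFilt (A := barCobar A) hyf
    obtain ⟨y', h1, h2, h3⟩ := ih (z - der (twist A) (twist_mem A) y) (sub_mem hk hdy)
      (by rw [map_sub, hd, der_der_eq_zero _ _ (twist_twist A), sub_zero]) (sub_mem hf hdyf) hy3
    exact ⟨y' + y, add_mem h1 hyf, add_mem h2 hy1, by rw [map_add, h3, sub_add_cancel]⟩

/-- Let `C` bound the weights in suspended degree at most `k + n`. Components of an element of level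
`C + 1` have at least `C + 1` letters, each of weight at least one, so their weight exceeds `C` and
the descent ends at zero. -/
theorem proAcyclic_barCobar (hQ : Q.IsKoszul) (h0 : A.IsNonneg) (hA : A.IsNilpotent) :
    (barCobar A).ProAcyclic := by
  classical
  intro k n hn
  obtain ⟨I, ⟨β⟩⟩ := hA.exists_adaptedBasis
  obtain ⟨c, hc⟩ := β.exists_bound hA
  have hδ : ∀ i, 0 ≤ β.deg i := fun i => by
    by_contra h
    have := β.mem_gr i
    rw [h0 _ (not_le.1 h), Submodule.mem_bot] at this
    exact β.basis.ne_zero i this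
  obtain ⟨C, hC⟩ := exists_weight_bound hδ hc (k + n)
  -- Level `C + 1` forces the weight above `C`; level `n` keeps the cycle inside the piece of the
  -- filtration where it is to bound.
  refine ⟨max n (C + 1), hn.trans (le_max_left _ _), fun z hz hk hd => ?_⟩
  change Free Q 0 (Dual Q A.toGMod) at z
  have hz' := multi_supported_of_mem_opFilt (β := β.basis) (δ := β.deg) (hβ := β.mem_gr) hz hk
  obtain ⟨M, hM⟩ : ∃ M : ℕ, ∀ μ ∈ (multi β.basis β.deg β.mem_gr Q z).support,
      susp β.deg μ ≤ k + (n + M : ℕ) := by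
    obtain ⟨b, hb⟩ := ((multi β.basis β.deg β.mem_gr Q z).support.image (susp β.deg)).bddAbove
    refine ⟨(b - k).toNat, fun μ hμ => ?_⟩
    have := hb (Finset.mem_coe.2 (Finset.mem_image_of_mem _ hμ))
    push_cast
    omega
  refine exists_boundary β hQ hn (W := C + 1) (fun μ hμ => Nat.lt_succ_of_le (hC μ hμ)) M z hk hd
    (DGAlg.opFilt_anti hn (le_max_left _ _) hz) ?_
  intro μ hμ
  obtain ⟨h1, h2⟩ := hz' hμ
  refine ⟨by push_cast at h1; omega, hM μ hμ, ?_⟩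
  have h3 : μ.degree ≤ weight β.wt μ := by
    rw [weight_apply, degree_apply, Finsupp.sum]
    exact Finset.sum_le_sum fun i _ => Nat.le_mul_of_pos_right _ (β.one_le i)
  push_cast at h1
  omega

end Nilpotent

/-! ### Algebras in strictly positive or strictly negative degrees. -/

section OneSided

variable {K : Type u} [Field K] {Q : QuadData.{u, v} K}

open Free

theorem mk_eq_zero_or_leaves_le {V : GMod.{u, w} K} (hV : V.IsStrictlyPositive) {s : ℤ}
    (hs : 0 ≤ s) (t : Term Q.E V) : (mk t : Free Q s V) = 0 ∨ (t.leaves : ℤ) ≤ t.deg s := by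
  induction t with
  | leaf i x =>
    rcases le_or_gt i 0 with h | h
    · left
      have hx : x = 0 := Subtype.ext ((Submodule.mem_bot K).1 ((hV i h).le x.2))
      rw [hx]
      exact map_zero (Free.leaf (Q := Q) (s := s) i)
    · right; simp only [Term.leaves, Term.deg]; omega
  | node e l r hl hr =>
    rcases hl with hl | hl
    · left; rw [← node_mk, hl, map_zero, LinearMap.zero_apply]
    rcases hr with hr | hr
    · left; rw [← node_mk, hr, map_zero]
    right
    simp only [Term.leaves, Term.deg]
    push_cast
    omega

/-- With `m` leaves of degree at most `-1` and `m - 1` vertices of degree `s`, the degree is at most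
`s(m - 1) - m`. For `s = 1` this is `-1`, so the Koszul dual stays strictly negative; for `s = 0` it
is `-m`. -/
theorem mk_eq_zero_or_deg_le {V : GMod.{u, w} K} (hV : V.IsStrictlyNegative) {s : ℤ}
    (t : Term Q.E V) : (mk t : Free Q s V) = 0 ∨ t.deg s ≤ s * (t.leaves - 1) - t.leaves := by
  induction t with
  | leaf i x =>
    rcases le_or_gt 0 i with h | h
    · left
      have hx : x = 0 := Subtype.ext ((Submodule.mem_bot K).1 ((hV i h).le x.2))
      rw [hx]
      exact map_zero (Free.leaf (Q := Q) (s := s) i)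
    · right; simp only [Term.leaves, Term.deg]; push_cast; omega
  | node e l r hl hr =>
    rcases hl with hl | hl
    · left; rw [← node_mk, hl, map_zero, LinearMap.zero_apply]
    rcases hr with hr | hr
    · left; rw [← node_mk, hr, map_zero]
    right
    simp only [Term.leaves, Term.deg]
    push_cast
    linarith

theorem Dual.gr_eq_bot {V : GMod.{u, w} K} {i : ℤ}
    (h : ∀ t : Term Q.E V, t.deg 1 = i → (mk t : Tree Q V) = 0) : (Dual Q V).gr i = ⊥ := by
  refine (Submodule.eq_bot_iff _).2 fun x hx => Dual.incl_injective ?_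
  rw [map_zero]
  exact gr_induction (p := fun y _ => y = (0 : Tree Q V)) h rfl
    (fun x y _ _ hx hy => by rw [hx, hy, add_zero]) (fun c x _ hx => by rw [hx, smul_zero])
    (dualPart_le_gr i (Dual.mem_gr.1 hx))

theorem Dual.isStrictlyPositive {V : GMod.{u, w} K} (hV : V.IsStrictlyPositive) :
    (Dual Q V).IsStrictlyPositive := fun i hi => Dual.gr_eq_bot fun t ht =>
  (mk_eq_zero_or_leaves_le (Q := Q.magma) hV zero_le_one t).resolve_right fun h => by
    have := t.one_le_leaves
    have h' : t.deg 1 = i := ht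
    omega

theorem Dual.isStrictlyNegative {V : GMod.{u, w} K} (hV : V.IsStrictlyNegative) :
    (Dual Q V).IsStrictlyNegative := fun i hi => Dual.gr_eq_bot fun t ht =>
  (mk_eq_zero_or_deg_le (Q := Q.magma) hV t).resolve_right fun h => by
    have h' : t.deg 1 = i := ht
    omega

variable {A : DGAlg.{u, v, w} Q}

/-- The hypothesis makes a deep level of the filtration vanish in degree `k`, so the only cycle to
bound is zero. -/
theorem proAcyclic_of_mk_eq_zero (h : ∀ k : ℤ, ∃ n : ℕ, ∀ t : Term Q.E (Dual Q A.toGMod),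
    n ≤ t.leaves → t.deg 0 = k → (mk t : Free Q 0 (Dual Q A.toGMod)) = 0) :
    (barCobar A).ProAcyclic := by
  intro k n hn
  obtain ⟨m, hm⟩ := h k
  refine ⟨max n m, hn.trans (le_max_left _ _), fun z hz hk hd => ⟨0, zero_mem _, zero_mem _, ?_⟩⟩
  have hz' := mem_span_of_mem_opFilt A hz hk
  rw [map_zero]
  symm
  clear hd hz hk
  change Free Q 0 (Dual Q A.toGMod) at z
  refine (Submodule.mem_bot K).1 (Submodule.span_le.2 ?_ hz')
  rintro _ ⟨t, ⟨h1, h2⟩, rfl⟩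
  exact (Submodule.mem_bot K).2 (hm t ((le_max_right _ _).trans h1) h2)

theorem proAcyclic_of_isStrictlyPositive (hA : A.IsStrictlyPositive) :
    (barCobar A).ProAcyclic := proAcyclic_of_mk_eq_zero fun k => ⟨k.toNat + 1, fun t h1 h2 =>
  (mk_eq_zero_or_leaves_le (Dual.isStrictlyPositive hA) le_rfl t).resolve_right fun h => by omega⟩

theorem proAcyclic_of_isStrictlyNegative (hA : A.IsStrictlyNegative) :
    (barCobar A).ProAcyclic := proAcyclic_of_mk_eq_zero fun k => ⟨(-k).toNat + 1, fun t h1 h2 =>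
  (mk_eq_zero_or_deg_le (Dual.isStrictlyNegative hA) t).resolve_right fun h => by omega⟩

/-- Homotopy completeness over a Koszul operad. -/
theorem homotopyComplete [CharZero K] (hQ : Q.IsKoszul) (hA : (A.IsNonneg ∧ A.IsNilpotent) ∨
    A.IsStrictlyPositive ∨ A.IsStrictlyNegative) : A.HomotopyComplete := by
  refine DGAlg.ProAcyclic.quasiIso ?_
  rcases hA with ⟨h1, h2⟩ | h | h
  · exact proAcyclic_barCobar hQ h1 h2
  · exact proAcyclic_of_isStrictlyPositive h
  · exact proAcyclic_of_isStrictlyNegative h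

end OneSided

/-! ### Signs and sums attached to splittings of finite sets. -/

section Splittings

variable {K : Type u} [Field K] {n : ℕ}

/-- The number of inversions between two sets of letters. -/
def inversions (S T : Finset (Fin n)) : ℤ := ∑ i ∈ S, ∑ j ∈ T, if j < i then 1 else 0

theorem inversions_union_left {S T : Finset (Fin n)} (h : Disjoint S T) (U : Finset (Fin n)) :
    inversions (S ∪ T) U = inversions S U + inversions T U := Finset.sum_union h

theorem inversions_union_right {S T : Finset (Fin n)} (h : Disjoint S T) (U : Finset (Fin n)) :
    inversions U (S ∪ T) = inversions U S + inversions U T := by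
  rw [inversions, inversions, inversions, ← Finset.sum_add_distrib]
  exact Finset.sum_congr rfl fun i _ => Finset.sum_union h

theorem inversions_swap {S T : Finset (Fin n)} (h : Disjoint S T) :
    inversions S T + inversions T S = S.card * T.card := by
  rw [inversions, inversions, Finset.sum_comm (s := T), ← Finset.sum_add_distrib,
    ← nsmul_eq_mul, ← Finset.sum_const]
  refine Finset.sum_congr rfl fun i hi => ?_
  rw [← Finset.sum_add_distrib, Finset.card_eq_sum_ones, Nat.cast_sum]
  refine Finset.sum_congr rfl fun j hj => ?_
  have hij : i ≠ j := fun h' => Finset.disjoint_left.1 h hi (h' ▸ hj)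
  rcases lt_or_gt_of_ne hij with h' | h'
  · rw [if_neg h'.not_gt, if_pos h']; rfl
  · rw [if_pos h', if_neg h'.not_gt]; rfl

/-- The structure constants of the Koszul dual of the Lie operad. -/
def eps (K : Type u) [Field K] (S T : Finset (Fin n)) : K :=
  ksign K (S.card * (T.card - 1) + inversions S T)

theorem eps_mul_self (S T : Finset (Fin n)) : eps K S T * eps K S T = 1 := ksign_sq _

/-- This sign is opposite to the antisymmetry of a bracket of elements of degrees `|S| - 1` and `|T|
- 1`, so that `eps K S T` times the bracket of the letters `S` and `T` is symmetric in `S` and `T`.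
-/
theorem eps_symm {S T : Finset (Fin n)} (h : Disjoint S T) :
    eps K S T = -(ksign K ((S.card - 1 : ℤ) * (T.card - 1)) * eps K T S) := by
  have h1 := inversions_swap h
  rw [← neg_one_mul, ← ksign_one, eps, eps, ← ksign_add, ← ksign_add]
  refine ksign_congr ⟨T.card - 1 - inversions T S, ?_⟩
  linear_combination h1

/-- This cocycle identity is what makes the differential of a letter square to zero, and what makes
the unwanted terms of the contracting homotopy cancel. -/
theorem eps_assoc {X Y Z : Finset (Fin n)} (h1 : Disjoint X Y)
    (h3 : Disjoint Y Z) : eps K (X ∪ Y) Z * eps K X Y =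
      -(ksign K (X.card - 1) * (eps K X (Y ∪ Z) * eps K Y Z)) := by
  rw [← neg_one_mul, ← ksign_one, eps, eps, eps, eps, ← ksign_add, ← ksign_add, ← ksign_add,
    ← ksign_add, inversions_union_left h1, inversions_union_right h3,
    Finset.card_union_of_disjoint h1, Finset.card_union_of_disjoint h3]
  refine ksign_congr ⟨-X.card, ?_⟩
  push_cast
  ring

/-- The proper nonempty subsets. -/
def splits (S : Finset (Fin n)) : Finset (Finset (Fin n)) :=
  S.powerset.filter fun A => A.Nonempty ∧ (S \ A).Nonempty

theorem mem_splits {S A : Finset (Fin n)} :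
    A ∈ splits S ↔ A ⊆ S ∧ A.Nonempty ∧ (S \ A).Nonempty := by
  rw [splits, Finset.mem_filter, Finset.mem_powerset]

theorem sdiff_mem_splits {S A : Finset (Fin n)} (h : A ∈ splits S) : S \ A ∈ splits S := by
  obtain ⟨h1, h2, h3⟩ := mem_splits.1 h
  exact mem_splits.2 ⟨Finset.sdiff_subset, h3, by rwa [Finset.sdiff_sdiff_eq_self h1]⟩

theorem card_lt_of_mem_splits {S A : Finset (Fin n)} (h : A ∈ splits S) : A.card < S.card := by
  obtain ⟨h1, h2, h3⟩ := mem_splits.1 h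
  have := Finset.card_sdiff_add_card_eq_card h1
  have := h3.card_pos
  omega

theorem splits_eq_empty {S : Finset (Fin n)} (h : S.card ≤ 1) : splits S = ∅ := by
  refine Finset.eq_empty_of_forall_notMem fun A hA => ?_
  have h1 := (mem_splits.1 hA).2.1.card_pos
  have h2 := card_lt_of_mem_splits hA
  omega

/-- The proper nonempty subsets containing `x0`. -/
def splitsAt (x0 : Fin n) (S : Finset (Fin n)) : Finset (Finset (Fin n)) :=
  (splits S).filter fun A => x0 ∈ A

variable {M : Type w} [AddCommGroup M]

theorem sum_splits_swap (S : Finset (Fin n)) (f : Finset (Fin n) → Finset (Fin n) → M) :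
    ∑ A ∈ splits S, f A (S \ A) = ∑ A ∈ splits S, f (S \ A) A := by
  refine Finset.sum_bij' (fun A _ => S \ A) (fun A _ => S \ A) (fun A => sdiff_mem_splits)
    (fun A => sdiff_mem_splits) ?_ ?_ ?_ <;> intro A hA <;>
    rw [Finset.sdiff_sdiff_eq_self (mem_splits.1 hA).1]

/-- Of a block and its complement exactly one contains `x0`. A symmetric sum over all splittings is
thus twice the sum over those whose first block contains `x0`, which accounts for the factors `2⁻¹`
elsewhere. -/
theorem sum_splits_fold {x0 : Fin n} {S : Finset (Fin n)} (hx : x0 ∈ S)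
    (f : Finset (Fin n) → Finset (Fin n) → M) (hf : ∀ A ∈ splits S, f A (S \ A) = f (S \ A) A) :
    ∑ A ∈ splits S, f A (S \ A) =
      ∑ A ∈ splitsAt x0 S, f A (S \ A) + ∑ A ∈ splitsAt x0 S, f A (S \ A) := by
  rw [← Finset.sum_filter_add_sum_filter_not (splits S) (fun A => x0 ∈ A)]
  congr 1
  refine Finset.sum_bij' (fun A _ => S \ A) (fun A _ => S \ A) ?_ ?_ ?_ ?_ ?_ <;> intro A hA <;>
    obtain ⟨h1, h2⟩ := Finset.mem_filter.1 hA
  · exact Finset.mem_filter.2 ⟨sdiff_mem_splits h1, Finset.mem_sdiff.2 ⟨hx, h2⟩⟩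
  · exact Finset.mem_filter.2 ⟨sdiff_mem_splits h1, fun h => (Finset.mem_sdiff.1 h).2 h2⟩
  · exact Finset.sdiff_sdiff_eq_self (mem_splits.1 h1).1
  · exact Finset.sdiff_sdiff_eq_self (mem_splits.1 h1).1
  · rw [hf A h1, Finset.sdiff_sdiff_eq_self (mem_splits.1 h1).1]

/-- Both sides run over the ordered partitions of `S` into three nonempty blocks `X`, `Y`, `Z` with
`x0 ∈ X`. -/
theorem sum_splits_assoc (x0 : Fin n) (S : Finset (Fin n))
    (f : Finset (Fin n) → Finset (Fin n) → Finset (Fin n) → M) :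
    ∑ A ∈ splitsAt x0 S, ∑ X ∈ splitsAt x0 A, f X (A \ X) (S \ A) =
      ∑ X ∈ splitsAt x0 S, ∑ Y ∈ splits (S \ X), f X Y ((S \ X) \ Y) := by
  rw [Finset.sum_sigma', Finset.sum_sigma']
  refine Finset.sum_bij' (fun p _ => ⟨p.2, p.1 \ p.2⟩) (fun p _ => ⟨p.1 ∪ p.2, p.1⟩) ?_ ?_ ?_ ?_ ?_
  · rintro ⟨A, X⟩ h
    simp only [Finset.mem_sigma, splitsAt, Finset.mem_filter, mem_splits] at h ⊢
    obtain ⟨⟨⟨h1, h2, h3⟩, h4⟩, ⟨h5, h6, h7⟩, h8⟩ := h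
    have h9 : (S \ X) \ (A \ X) = S \ A := by
      ext i; simp only [Finset.mem_sdiff]; have := @h5 i; tauto
    refine ⟨⟨⟨h5.trans h1, h6, ?_⟩, h8⟩, Finset.sdiff_subset_sdiff h1 le_rfl, h7, by rwa [h9]⟩
    exact h3.mono (Finset.sdiff_subset_sdiff le_rfl h5)
  · rintro ⟨X, Y⟩ h
    simp only [Finset.mem_sigma, splitsAt, Finset.mem_filter, mem_splits] at h ⊢
    obtain ⟨⟨⟨h1, h2, h3⟩, h4⟩, h5, h6, h7⟩ := h
    have h8 : S \ (X ∪ Y) = (S \ X) \ Y := by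
      ext i; simp only [Finset.mem_sdiff, Finset.mem_union]; tauto
    have h9 : (X ∪ Y) \ X = Y := by
      ext i; simp only [Finset.mem_sdiff, Finset.mem_union]
      have := @h5 i; simp only [Finset.mem_sdiff] at this; tauto
    refine ⟨⟨⟨Finset.union_subset h1 (h5.trans Finset.sdiff_subset), ?_, by rwa [h8]⟩, ?_⟩,
      ⟨Finset.subset_union_left, h2, by rwa [h9]⟩, h4⟩
    · exact h2.mono Finset.subset_union_left
    · exact Finset.mem_union_left _ h4
  · rintro ⟨A, X⟩ h
    simp only [Finset.mem_sigma, splitsAt, Finset.mem_filter, mem_splits] at h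
    simp only [Finset.union_sdiff_of_subset h.2.1.1]
  · rintro ⟨X, Y⟩ h
    simp only [Finset.mem_sigma, splitsAt, Finset.mem_filter, mem_splits] at h
    have h9 : (X ∪ Y) \ X = Y := by
      ext i; simp only [Finset.mem_sdiff, Finset.mem_union]
      have := @h.2.1 i; simp only [Finset.mem_sdiff] at this; tauto
    simp only [h9]
  · rintro ⟨A, X⟩ h
    simp only [Finset.mem_sigma, splitsAt, Finset.mem_filter, mem_splits] at h
    have h9 : (S \ X) \ (A \ X) = S \ A := by
      ext i; simp only [Finset.mem_sdiff]; have := @h.2.1.1 i; tauto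
    simp only [h9]

end Splittings

/-! ### Left normed brackets: differential and contracting homotopy. -/

section Words

variable {K : Type u} [Field K] {n : ℕ}

open Finsupp

/-- A left normed bracket: its innermost letter, and the list of the other ones, from the outermost
one to the innermost one. -/
abbrev LieWord (n : ℕ) : Type := Finset (Fin n) × List (Finset (Fin n))

/-- The degree of a left normed bracket; a letter `S` has degree `|S| - 1`. -/
def wdeg (A : Finset (Fin n)) : List (Finset (Fin n)) → ℤ
  | [] => A.card - 1
  | S :: r => wdeg A r + (S.card - 1)

/-- Bracketing with a further letter. -/
def wcons (K : Type u) [Field K] (S : Finset (Fin n)) : (LieWord n →₀ K) →ₗ[K] (LieWord n →₀ K) :=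
  lmapDomain K K fun w => (w.1, S :: w.2)

theorem wcons_single (S A : Finset (Fin n)) (r : List (Finset (Fin n))) (c : K) :
    wcons K S (single (A, r) c) = single (A, S :: r) c := by
  simp [wcons]

/-- Bracketing with the differential of a letter. -/
def wsplit (K : Type u) [Field K] (S : Finset (Fin n)) : (LieWord n →₀ K) →ₗ[K] (LieWord n →₀ K) :=
  ∑ Y ∈ splits S, eps K Y (S \ Y) • (wcons K (S \ Y) ∘ₗ wcons K Y)

theorem wsplit_single (S A : Finset (Fin n)) (r : List (Finset (Fin n))) :
    wsplit K S (single (A, r) 1) =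
      ∑ Y ∈ splits S, single (A, (S \ Y) :: Y :: r) (eps K Y (S \ Y)) := by
  rw [wsplit, LinearMap.sum_apply]
  refine Finset.sum_congr rfl fun Y _ => ?_
  rw [LinearMap.smul_apply, LinearMap.comp_apply, wcons_single, wcons_single, smul_single,
    smul_eq_mul, mul_one]

variable (K) (x0 : Fin n)

/-- The Koszul differential of left normed brackets. -/
def dWord (A : Finset (Fin n)) : List (Finset (Fin n)) → (LieWord n →₀ K)
  | [] => ∑ X ∈ splitsAt x0 A, single (X, [A \ X]) (eps K X (A \ X))
  | S :: r => wcons K S (dWord A r) + ksign K (wdeg A r) • wsplit K S (single (A, r) 1)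

/-- The contracting homotopy. -/
def hWord (A : Finset (Fin n)) : List (Finset (Fin n)) → (LieWord n →₀ K)
  | [] => 0
  | [B] => if A = {x0} then single (insert x0 B, []) (eps K {x0} B) else 0
  | S :: T :: r => wcons K S (hWord A (T :: r))

def dW : (LieWord n →₀ K) →ₗ[K] (LieWord n →₀ K) := linearCombination K fun w => dWord K x0 w.1 w.2

def hW : (LieWord n →₀ K) →ₗ[K] (LieWord n →₀ K) := linearCombination K fun w => hWord K x0 w.1 w.2

/-- Left normed brackets which use every element of `S` exactly once, with `x0` in the innermost
letter. -/
inductive GoodWord : Finset (Fin n) → LieWord n → Prop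
  | base (A : Finset (Fin n)) (h : x0 ∈ A) : GoodWord A (A, [])
  | cons (S A B : Finset (Fin n)) (r : List (Finset (Fin n))) (hB : B.Nonempty)
      (hd : Disjoint S B) (h : GoodWord S (A, r)) : GoodWord (S ∪ B) (A, B :: r)

/-- The span of the good words. -/
abbrev goodW (S : Finset (Fin n)) : Submodule K (LieWord n →₀ K) :=
  supported K K {w | GoodWord x0 S w}

variable {K x0}

theorem dW_single (A : Finset (Fin n)) (r : List (Finset (Fin n))) (c : K) :
    dW K x0 (single (A, r) c) = c • dWord K x0 A r := by
  rw [dW, linearCombination_single]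

theorem hW_single (A : Finset (Fin n)) (r : List (Finset (Fin n))) (c : K) :
    hW K x0 (single (A, r) c) = c • hWord K x0 A r := by
  rw [hW, linearCombination_single]

/-- Linear maps which agree on words in a set agree on the span of this set. -/
theorem eqOn_supported {J : Type*} {N : Type*} [AddCommGroup N] [Module K N]
    {f g : (J →₀ K) →ₗ[K] N} {s : Set J} (h : ∀ w ∈ s, f (single w 1) = g (single w 1))
    {x : J →₀ K} (hx : x ∈ supported K K s) : f x = g x := by
  rw [supported_eq_span_single] at hx
  refine LinearMap.eqOn_span (f := f) (g := g) ?_ hx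
  rintro _ ⟨w, hw, rfl⟩
  exact h w hw

theorem map_supported_le {J : Type*} {N : Type*} [AddCommGroup N] [Module K N]
    {f : (J →₀ K) →ₗ[K] N} {s : Set J} {P : Submodule K N} (h : ∀ w ∈ s, f (single w 1) ∈ P)
    {x : J →₀ K} (hx : x ∈ supported K K s) : f x ∈ P := by
  rw [supported_eq_span_single] at hx
  have h' : Submodule.span K ((fun i => single i (1 : K)) '' s) ≤ P.comap f := by
    rw [Submodule.span_le]
    rintro _ ⟨w, hw, rfl⟩
    exact h w hw
  exact h' hx

theorem wcons_mem {s t : Set (LieWord n)} {S : Finset (Fin n)}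
    (h : ∀ w ∈ s, ((w.1, S :: w.2) : LieWord n) ∈ t) {x : LieWord n →₀ K}
    (hx : x ∈ supported K K s) : wcons K S x ∈ supported K K t :=
  map_supported_le (fun w hw => by
    rw [wcons_single]; exact single_mem_supported K _ (h w hw)) hx

theorem GoodWord.mem {S : Finset (Fin n)} {w : LieWord n} (h : GoodWord x0 S w) :
    x0 ∈ w.1 ∧ w.1 ⊆ S := by
  induction h with
  | base A h => exact ⟨h, le_rfl⟩
  | cons S A B r hB hd h ih => exact ⟨ih.1, ih.2.trans Finset.subset_union_left⟩

theorem GoodWord.cons_split {S A B Y : Finset (Fin n)} {r : List (Finset (Fin n))}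
    (h : GoodWord x0 S (A, r)) (hd : Disjoint S B) (hY : Y ∈ splits B) :
    GoodWord x0 (S ∪ B) (A, (B \ Y) :: Y :: r) := by
  obtain ⟨h1, h2, h3⟩ := mem_splits.1 hY
  have h4 : S ∪ B = S ∪ Y ∪ (B \ Y) := by
    rw [Finset.union_assoc, Finset.union_sdiff_of_subset h1]
  rw [h4]
  refine .cons _ _ _ _ h3 ?_ (.cons _ _ _ _ h2 (hd.mono_right h1) h)
  exact Finset.disjoint_union_left.2 ⟨hd.mono_right Finset.sdiff_subset, Finset.disjoint_sdiff⟩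

theorem GoodWord.pair {A X : Finset (Fin n)} (hX : X ∈ splitsAt x0 A) :
    GoodWord x0 A (X, [A \ X]) := by
  obtain ⟨h1, h2⟩ := Finset.mem_filter.1 hX
  obtain ⟨h3, h4, h5⟩ := mem_splits.1 h1
  have := GoodWord.cons X X (A \ X) [] h5 Finset.disjoint_sdiff (.base X h2)
  rwa [Finset.union_sdiff_of_subset h3] at this

theorem GoodWord.dWord_mem {S : Finset (Fin n)} {w : LieWord n} (h : GoodWord x0 S w) :
    dWord K x0 w.1 w.2 ∈ goodW K x0 S := by
  induction h with
  | base A h =>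
    exact Submodule.sum_mem _ fun X hX => single_mem_supported K _ (.pair hX)
  | cons S A B r hB hd h ih =>
    refine add_mem (wcons_mem (fun w hw => .cons _ _ _ _ hB hd hw) ih)
      (Submodule.smul_mem _ _ ?_)
    rw [wsplit_single]
    exact Submodule.sum_mem _ fun Y hY => single_mem_supported K _ (h.cons_split hd hY)

theorem dW_mem {S : Finset (Fin n)} {x : LieWord n →₀ K} (hx : x ∈ goodW K x0 S) :
    dW K x0 x ∈ goodW K x0 S :=
  map_supported_le (fun w hw => by
    rw [dW_single, one_smul]; exact GoodWord.dWord_mem hw) hx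

theorem GoodWord.of_cons {S A B : Finset (Fin n)} {r : List (Finset (Fin n))}
    (h : GoodWord x0 S (A, B :: r)) :
    ∃ S', S = S' ∪ B ∧ B.Nonempty ∧ Disjoint S' B ∧ GoodWord x0 S' (A, r) := by
  cases h with
  | cons S A B r hB hd h => exact ⟨S, rfl, hB, hd, h⟩

theorem GoodWord.of_nil {S A : Finset (Fin n)} (h : GoodWord x0 S (A, [])) : x0 ∈ A ∧ S = A := by
  cases h with
  | base A h => exact ⟨h, rfl⟩

theorem GoodWord.two_le_card {S A B : Finset (Fin n)} {r : List (Finset (Fin n))}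
    (h : GoodWord x0 S (A, B :: r)) : 2 ≤ S.card := by
  obtain ⟨S', rfl, hB, hd, h⟩ := h.of_cons
  rw [Finset.card_union_of_disjoint hd]
  have := hB.card_pos
  have := Finset.card_pos.2 ⟨x0, h.mem.2 h.mem.1⟩
  omega

theorem hWord_mem (A : Finset (Fin n)) (r : List (Finset (Fin n))) :
    ∀ S, GoodWord x0 S (A, r) → hWord K x0 A r ∈
      supported K K {w | GoodWord x0 S w ∧ wdeg w.1 w.2 = wdeg A r + 1} := by
  induction r with
  | nil => intro S _; exact zero_mem _
  | cons B r ih =>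
    intro S h
    obtain ⟨S', rfl, hB, hd, h'⟩ := h.of_cons
    rcases r with - | ⟨T, r⟩
    · obtain ⟨h1, rfl⟩ := h'.of_nil
      simp only [hWord]
      split_ifs with h2
      · refine single_mem_supported K _ ?_
        have hx : x0 ∉ B := fun h => Finset.disjoint_left.1 hd h1 h
        refine ⟨?_, ?_⟩
        · rw [h2, ← Finset.insert_eq]
          exact .base _ (Finset.mem_insert_self _ _)
        · simp only [wdeg, Finset.card_insert_of_notMem hx, h2, Finset.card_singleton]
          push_cast
          ring
      · exact zero_mem _
    · refine wcons_mem ?_ (ih S' h')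
      rintro w ⟨h1, h2⟩
      refine ⟨.cons _ _ _ _ hB hd h1, ?_⟩
      simp only [wdeg] at h2 ⊢
      rw [h2]
      ring

theorem hW_mem {S : Finset (Fin n)} {x : LieWord n →₀ K} (hx : x ∈ goodW K x0 S) :
    hW K x0 x ∈ goodW K x0 S :=
  map_supported_le (fun w hw => by
    rw [hW_single, one_smul]
    exact supported_mono (fun _ h => h.1) (hWord_mem w.1 w.2 S hw)) hx

theorem dW_wcons (S : Finset (Fin n)) {k : ℤ} {x : LieWord n →₀ K}
    (hx : x ∈ supported K K {w | wdeg w.1 w.2 = k}) :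
    dW K x0 (wcons K S x) = wcons K S (dW K x0 x) + ksign K k • wsplit K S x := by
  refine eqOn_supported (f := dW K x0 ∘ₗ wcons K S)
    (g := wcons K S ∘ₗ dW K x0 + ksign K k • wsplit K S) ?_ hx
  rintro ⟨A, r⟩ rfl
  rw [LinearMap.comp_apply, wcons_single, dW_single, one_smul, LinearMap.add_apply,
    LinearMap.comp_apply, dW_single, one_smul]
  rfl

/-- The homotopy looks only at the two innermost letters, so it commutes with adding outer ones as
soon as a second letter is present. -/
theorem hW_wcons (S : Finset (Fin n)) {x : LieWord n →₀ K}
    (hx : x ∈ supported K K {w | w.2 ≠ []}) :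
    hW K x0 (wcons K S x) = wcons K S (hW K x0 x) := by
  refine eqOn_supported (f := hW K x0 ∘ₗ wcons K S) (g := wcons K S ∘ₗ hW K x0) ?_ hx
  rintro ⟨A, r⟩ hr
  obtain ⟨T, r, rfl⟩ := List.exists_cons_of_ne_nil hr
  rw [LinearMap.comp_apply, wcons_single, hW_single, one_smul, LinearMap.comp_apply, hW_single,
    one_smul]
  rfl

theorem hW_wsplit (S : Finset (Fin n)) {x : LieWord n →₀ K}
    (hx : x ∈ supported K K {w | w.2 ≠ []}) :
    hW K x0 (wsplit K S x) = wsplit K S (hW K x0 x) := by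
  rw [wsplit, LinearMap.sum_apply, LinearMap.sum_apply, map_sum]
  refine Finset.sum_congr rfl fun Y _ => ?_
  rw [LinearMap.smul_apply, LinearMap.smul_apply, map_smul, LinearMap.comp_apply,
    LinearMap.comp_apply, hW_wcons, hW_wcons _ hx]
  exact wcons_mem (fun w hw => by simp) hx

theorem dWord_mem_ne_nil (A : Finset (Fin n)) (r : List (Finset (Fin n))) :
    dWord K x0 A r ∈ supported K K {w | w.2 ≠ []} := by
  induction r with
  | nil => exact Submodule.sum_mem _ fun X _ => single_mem_supported K _ (by simp)
  | cons S r ih =>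
    refine add_mem (wcons_mem (fun w hw => by simp) ih) (Submodule.smul_mem _ _ ?_)
    rw [wsplit_single]
    exact Submodule.sum_mem _ fun Y _ => single_mem_supported K _ (by simp)

theorem singleton_mem_splitsAt {A : Finset (Fin n)} (hA : x0 ∈ A) (h2 : 2 ≤ A.card) :
    {x0} ∈ splitsAt x0 A := by
  refine Finset.mem_filter.2 ⟨mem_splits.2 ⟨Finset.singleton_subset_iff.2 hA,
    Finset.singleton_nonempty _, ?_⟩, Finset.mem_singleton_self _⟩
  rw [← Finset.card_pos, Finset.card_sdiff_of_subset (Finset.singleton_subset_iff.2 hA),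
    Finset.card_singleton]
  omega

/-- Among the splittings of `A` the homotopy sees only the one that isolates `x0`, and it merges the
two blocks back; the sign occurs twice. -/
theorem hW_dWord_nil {A : Finset (Fin n)} (hA : x0 ∈ A) (h2 : 2 ≤ A.card) :
    hW K x0 (dWord K x0 A []) = single (A, []) 1 := by
  rw [dWord, map_sum, Finset.sum_eq_single {x0}]
  · rw [hW_single, hWord, if_pos rfl, smul_single, smul_eq_mul, eps_mul_self, Finset.insert_eq,
      Finset.union_sdiff_of_subset (Finset.singleton_subset_iff.2 hA)]
  · intro X _ hX
    rw [hW_single, hWord, if_neg hX, smul_zero]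
  · intro h
    exact absurd (singleton_mem_splitsAt hA h2) h

/-- A first block containing `x0` is either `{x0}` or `x0` together with a proper nonempty part of
`B`. -/
theorem sum_splitsAt_insert {M : Type w} [AddCommGroup M] {B : Finset (Fin n)} (hB : B.Nonempty)
    (hx : x0 ∉ B) (f : Finset (Fin n) → Finset (Fin n) → M) :
    ∑ X ∈ splitsAt x0 (insert x0 B), f X (insert x0 B \ X) =
      f {x0} B + ∑ Y ∈ splits B, f (insert x0 Y) (B \ Y) := by
  have hmem : {x0} ∈ splitsAt x0 (insert x0 B) := by
    refine singleton_mem_splitsAt (Finset.mem_insert_self _ _) ?_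
    rw [Finset.card_insert_of_notMem hx]
    have := hB.card_pos
    omega
  rw [← Finset.add_sum_erase _ _ hmem]
  congr 1
  · congr 1
    ext i
    simp only [Finset.mem_sdiff, Finset.mem_insert, Finset.mem_singleton]
    have : i = x0 → i ∉ B := fun h => h ▸ hx
    tauto
  · symm
    refine Finset.sum_bij' (fun Y _ => insert x0 Y) (fun X _ => X.erase x0) ?_ ?_ ?_ ?_ ?_
    · intro Y hY
      obtain ⟨h1, h2, h3⟩ := mem_splits.1 hY
      have hxY : x0 ∉ Y := fun h => hx (h1 h)
      refine Finset.mem_erase.2 ⟨?_, Finset.mem_filter.2 ⟨mem_splits.2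
        ⟨Finset.insert_subset_insert _ h1, Finset.insert_nonempty _ _, ?_⟩,
        Finset.mem_insert_self _ _⟩⟩
      · intro h
        obtain ⟨y, hy⟩ := h2
        have := Finset.mem_singleton.1 (h ▸ Finset.mem_insert_of_mem hy)
        exact hxY (this ▸ hy)
      · obtain ⟨z, hz⟩ := h3
        refine ⟨z, ?_⟩
        simp only [Finset.mem_sdiff, Finset.mem_insert] at hz ⊢
        have : z ≠ x0 := fun h => hx (h ▸ hz.1)
        tauto
    · intro X hX
      obtain ⟨h1, h2⟩ := Finset.mem_erase.1 hX
      obtain ⟨h3, h4⟩ := Finset.mem_filter.1 h2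
      obtain ⟨h5, h6, h7⟩ := mem_splits.1 h3
      refine mem_splits.2 ⟨?_, ?_, ?_⟩
      · intro i hi
        obtain ⟨h8, h9⟩ := Finset.mem_erase.1 hi
        exact (Finset.mem_insert.1 (h5 h9)).resolve_left h8
      · rw [Finset.nonempty_iff_ne_empty]
        intro h
        exact h1 (by rw [← Finset.insert_erase h4, h]; rfl)
      · obtain ⟨z, hz⟩ := h7
        refine ⟨z, ?_⟩
        simp only [Finset.mem_sdiff, Finset.mem_insert, Finset.mem_erase] at hz ⊢
        have : z ≠ x0 := fun h => hz.2 (h ▸ h4)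
        tauto
    · intro Y hY
      exact Finset.erase_insert fun h => hx ((mem_splits.1 hY).1 h)
    · intro X hX
      exact Finset.insert_erase (Finset.mem_filter.1 (Finset.mem_erase.1 hX).2).2
    · intro Y hY
      congr 1
      ext i
      simp only [Finset.mem_sdiff, Finset.mem_insert]
      have : i = x0 → i ∉ B := fun h => h ▸ hx
      tauto

/-- If `A` has other elements than `x0`, the homotopy kills the word and everything obtained by
splitting `B`, and the word is recovered from splitting `A`. If `A = {x0}`, the word is merged and
split again: isolating `x0` returns it, and the other splittings cancel against those of `B` by
`eps_assoc`. -/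
theorem homotopy_pair {A B : Finset (Fin n)} (hA : x0 ∈ A) (hB : B.Nonempty) (hd : Disjoint A B) :
    dW K x0 (hWord K x0 A [B]) + hW K x0 (dWord K x0 A [B]) = single (A, [B]) 1 := by
  rw [dWord, map_add, map_smul, hW_wcons B (dWord_mem_ne_nil A []), wsplit_single, map_sum]
  have h1 : ∀ Y, hW K x0 (single (A, [B \ Y, Y]) (eps K Y (B \ Y))) =
      eps K Y (B \ Y) • wcons K (B \ Y) (hWord K x0 A [Y]) := fun Y => by
    rw [hW_single]; rfl
  simp only [h1]
  by_cases h : A = {x0}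
  · subst h
    have hx : x0 ∉ B := Finset.disjoint_singleton_left.1 hd
    have h2 : dWord K x0 {x0} [] = 0 := by
      rw [dWord, splitsAt, splits_eq_empty (by simp)]; rfl
    simp only [hWord, if_true, wcons_single, smul_single, smul_eq_mul, h2, map_zero, zero_add,
      wdeg, Finset.card_singleton, Nat.cast_one, sub_self, ksign_zero, one_smul]
    rw [dW_single, dWord, sum_splitsAt_insert hB hx
      (fun X Y => single ((X, [Y]) : LieWord n) (eps K X Y)), smul_add, smul_single, smul_eq_mul,
      eps_mul_self, add_assoc, Finset.smul_sum, ← Finset.sum_add_distrib, Finset.sum_eq_zero,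
      add_zero]
    intro Y hY
    obtain ⟨h3, h4, h5⟩ := mem_splits.1 hY
    rw [smul_single, smul_eq_mul, ← single_add, single_eq_zero]
    have h6 := eps_assoc (K := K) (X := {x0}) (Y := Y) (Z := B \ Y) (hd.mono_right h3)
      Finset.disjoint_sdiff
    rw [Finset.card_singleton, Nat.cast_one, sub_self, ksign_zero, one_mul,
      Finset.union_sdiff_of_subset h3, ← Finset.insert_eq] at h6
    have h7 := eps_mul_self (K := K) {x0} B
    have h8 := eps_mul_self (K := K) {x0} Y
    linear_combination (eps K {x0} B * eps K {x0} Y) * h6 -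
      eps K {x0} B * eps K (insert x0 Y) (B \ Y) * h8 - eps K Y (B \ Y) * eps K {x0} Y * h7
  · have h2 : 2 ≤ A.card := by
      by_contra h3
      refine h (Finset.eq_singleton_iff_unique_mem.2 ⟨hA, fun y hy => ?_⟩)
      exact Finset.card_le_one.1 (by omega) y hy x0 hA
    simp only [hWord, if_neg h, map_zero, smul_zero, Finset.sum_const_zero, add_zero, zero_add]
    rw [hW_dWord_nil hA h2, wcons_single]

/-- Outer letters are added by induction. The terms splitting the new letter appear in `d h` and in
`h d` with opposite signs, because the homotopy raises the degree by one, so they cancel. -/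
theorem homotopy_word (A : Finset (Fin n)) (r : List (Finset (Fin n))) :
    ∀ S, GoodWord x0 S (A, r) → 2 ≤ S.card →
      dW K x0 (hWord K x0 A r) + hW K x0 (dWord K x0 A r) = single (A, r) 1 := by
  induction r with
  | nil =>
    intro S h hS
    obtain ⟨h1, rfl⟩ := h.of_nil
    rw [hWord, map_zero, zero_add, hW_dWord_nil h1 hS]
  | cons B r ih =>
    intro S h hS
    obtain ⟨S', rfl, hB, hd, h'⟩ := h.of_cons
    rcases r with - | ⟨T, r⟩
    · obtain ⟨h1, rfl⟩ := h'.of_nil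
      exact homotopy_pair h1 hB hd
    · have h1 := ih S' h' h'.two_le_card
      have h2 := supported_mono (fun _ h => h.2) (hWord_mem (K := K) A (T :: r) S' h')
      have h3 : single ((A, T :: r) : LieWord n) (1 : K) ∈ supported K K {w | w.2 ≠ []} :=
        single_mem_supported K _ (by simp)
      have h4 : hW K x0 (single ((A, T :: r) : LieWord n) (1 : K)) = hWord K x0 A (T :: r) := by
        rw [hW_single, one_smul]
      have h5 : hWord K x0 A (B :: T :: r) = wcons K B (hWord K x0 A (T :: r)) := rfl
      have h6 : dWord K x0 A (B :: T :: r) = wcons K B (dWord K x0 A (T :: r)) +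
        ksign K (wdeg A (T :: r)) • wsplit K B (single (A, T :: r) 1) := rfl
      rw [h5, h6, dW_wcons B h2, map_add, map_smul, hW_wcons B (dWord_mem_ne_nil A _),
        hW_wsplit B h3, h4, ksign_add, ksign_one, mul_neg_one, neg_smul, ← wcons_single, ← h1,
        map_add]
      abel

/-- The complex of good words is contractible. -/
theorem homotopy {S : Finset (Fin n)} (hS : 2 ≤ S.card) {x : LieWord n →₀ K}
    (hx : x ∈ goodW K x0 S) : dW K x0 (hW K x0 x) + hW K x0 (dW K x0 x) = x := by
  refine eqOn_supported (f := dW K x0 ∘ₗ hW K x0 + hW K x0 ∘ₗ dW K x0) (g := LinearMap.id) ?_ hx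
  intro w hw
  rw [LinearMap.add_apply, LinearMap.comp_apply, LinearMap.comp_apply, hW_single, dW_single,
    one_smul, one_smul]
  exact homotopy_word w.1 w.2 S hw hS

end Words

/-! ### Families of letters in a graded Lie algebra with a derivation. -/

section LieFamily

variable {K : Type u} [Field K] {n : ℕ} {N : Type w} [AddCommGroup N] [Module K N]

open Finsupp

section Graded

variable {gr : ℤ → Submodule K N} {μ : (lieData K).E →ₗ[K] N →ₗ[K] N →ₗ[K] N}

theorem IsAlg.lie_antisymm (h : IsAlg (lieData K) 0 gr μ) {i j : ℤ} {x y : N} (hx : x ∈ gr i)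
    (hy : y ∈ gr j) : μ (1 : K) x y = -(ksign K (i * j) • μ (1 : K) y x) := by
  have h1 := h.symm (1 : K) i j x hx y hy
  have h2 : (lieData K).τ (1 : K) = -(1 : K) := rfl
  rw [h2, map_neg, LinearMap.neg_apply, LinearMap.neg_apply] at h1
  rw [← h1, neg_neg]

theorem IsAlg.lie_mem (h : IsAlg (lieData K) 0 gr μ) {i j : ℤ} {x y : N} (hx : x ∈ gr i)
    (hy : y ∈ gr j) : μ (1 : K) x y ∈ gr (i + j) := by
  have := h.mem (1 : K) i j x hx y hy
  rwa [zero_add] at this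

theorem IsAlg.lie_jacobi (h : IsAlg (lieData K) 0 gr μ) {i j k : ℤ} {x y z : N} (hx : x ∈ gr i)
    (hy : y ∈ gr j) (hz : z ∈ gr k) : μ (1 : K) x (μ (1 : K) y z) =
      μ (1 : K) (μ (1 : K) x y) z - ksign K (j * k) • μ (1 : K) (μ (1 : K) x z) y := by
  have h1 := h.rel (fun _ => (1 : K) ⊗ₜ[K] (1 : K)) (Submodule.mem_span_singleton_self _) i j k
    x hx y hy z hz
  have h2 : ∀ x y z : N, tri μ x y z ((1 : K) ⊗ₜ[K] (1 : K)) = μ (1 : K) (μ (1 : K) x y) z :=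
    fun x y z => tri_tmul μ x y z (1 : K) (1 : K)
  have h3 := h.lie_antisymm hx (h.lie_mem hy hz)
  have h4 := h.lie_antisymm hz hx
  rw [h2 x y z, h2 y z x, h2 z x y, h4, map_neg, map_smul, LinearMap.neg_apply,
    LinearMap.smul_apply, smul_neg, smul_smul] at h1
  have s : ksign K (k * (i + j)) * ksign K (k * i) = ksign K (j * k) := by
    rw [← ksign_add]; exact ksign_congr ⟨k * i, by ring⟩
  rw [s] at h1
  rw [h3, eq_neg_of_add_eq_zero_left (a := ksign K (i * (j + k)) • μ (1 : K) (μ (1 : K) y z) x)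
    (b := μ (1 : K) (μ (1 : K) x y) z - ksign K (j * k) • μ (1 : K) (μ (1 : K) x z) y)
    (by rw [← h1]; abel), neg_neg]

end Graded

/-- A family of elements, indexed by the finite sets of letters, of a graded Lie algebra with a
derivation `D`, where `D` acts as the differential of the Koszul complex of the Lie operad. -/
structure IsLieFamily (gr : ℤ → Submodule K N) (μ : (lieData K).E →ₗ[K] N →ₗ[K] N →ₗ[K] N)
    (D : N →ₗ[K] N) (g : Finset (Fin n) → N) : Prop where
  isAlg : IsAlg (lieData K) 0 gr μ
  mem : ∀ S, g S ∈ gr (S.card - 1)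
  leibniz : ∀ i, ∀ x ∈ gr i, ∀ y,
    D (μ (1 : K) x y) = μ (1 : K) (D x) y + ksign K i • μ (1 : K) x (D y)
  map_g : ∀ S, D (g S) =
    (2⁻¹ : K) • ∑ A ∈ splits S, eps K A (S \ A) • μ (1 : K) (g A) (g (S \ A))

/-- The value of a left normed bracket. -/
def brWord (μ : (lieData K).E →ₗ[K] N →ₗ[K] N →ₗ[K] N) (g : Finset (Fin n) → N)
    (A : Finset (Fin n)) : List (Finset (Fin n)) → N
  | [] => g A
  | S :: r => μ (1 : K) (brWord μ g A r) (g S)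

/-- The values of linear combinations of left normed brackets. -/
def br (μ : (lieData K).E →ₗ[K] N →ₗ[K] N →ₗ[K] N) (g : Finset (Fin n) → N) :
    (LieWord n →₀ K) →ₗ[K] N := linearCombination K fun w => brWord μ g w.1 w.2

theorem br_single (μ : (lieData K).E →ₗ[K] N →ₗ[K] N →ₗ[K] N) (g : Finset (Fin n) → N)
    (A : Finset (Fin n)) (r : List (Finset (Fin n))) (c : K) :
    br μ g (single (A, r) c) = c • brWord μ g A r := linearCombination_single ..

theorem br_wcons (μ : (lieData K).E →ₗ[K] N →ₗ[K] N →ₗ[K] N) (g : Finset (Fin n) → N)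
    (S : Finset (Fin n)) (x : LieWord n →₀ K) :
    br μ g (wcons K S x) = μ (1 : K) (br μ g x) (g S) := by
  have h : br μ g ∘ₗ wcons K S = (μ (1 : K)).flip (g S) ∘ₗ br μ g := by
    refine Finsupp.lhom_ext fun w c => ?_
    rw [LinearMap.comp_apply, LinearMap.comp_apply, wcons_single, br_single, LinearMap.flip_apply,
      br_single, map_smul, LinearMap.smul_apply]
    rfl
  exact LinearMap.congr_fun h x

/-- The differential of a left normed bracket of length one has square zero. -/
theorem dW_dWord_nil (x0 : Fin n) (S : Finset (Fin n)) : dW K x0 (dWord K x0 S []) = 0 := by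
  have h1 : ∀ A, dW K x0 (single (A, [S \ A]) (eps K A (S \ A))) =
      ∑ X ∈ splitsAt x0 A, single (X, [S \ A, A \ X]) (eps K A (S \ A) * eps K X (A \ X)) +
      ∑ Y ∈ splits (S \ A), single (A, [(S \ A) \ Y, Y])
        (eps K A (S \ A) * (ksign K (A.card - 1) * eps K Y ((S \ A) \ Y))) := by
    intro A
    rw [dW_single, dWord, dWord, map_sum, wsplit_single, smul_add, Finset.smul_sum,
      Finset.smul_sum, Finset.smul_sum]
    congr 1
    · exact Finset.sum_congr rfl fun X _ => by rw [wcons_single, smul_single, smul_eq_mul]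
    · exact Finset.sum_congr rfl fun X _ => by
        rw [smul_single, smul_single, smul_eq_mul, smul_eq_mul]; rfl
  have h2 : ∑ A ∈ splitsAt x0 S, ∑ X ∈ splitsAt x0 A,
      single ((X, [S \ A, A \ X]) : LieWord n) (eps K A (S \ A) * eps K X (A \ X)) =
      ∑ A ∈ splitsAt x0 S, ∑ X ∈ splitsAt x0 A, (fun X Y Z => single ((X, [Z, Y]) : LieWord n)
        (eps K (X ∪ Y) Z * eps K X Y)) X (A \ X) (S \ A) := by
    refine Finset.sum_congr rfl fun A _ => Finset.sum_congr rfl fun X hX => ?_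
    have := (mem_splits.1 (Finset.mem_filter.1 hX).1).1
    simp only [Finset.union_sdiff_of_subset this]
  rw [dWord, map_sum, Finset.sum_congr rfl fun A _ => h1 A, Finset.sum_add_distrib, h2,
    sum_splits_assoc x0 S (fun X Y Z => single ((X, [Z, Y]) : LieWord n)
      (eps K (X ∪ Y) Z * eps K X Y)), ← Finset.sum_add_distrib]
  -- For each ordered partition into three blocks, the term splitting the first letter and the term
  -- splitting the second give the same word; `eps_assoc` makes their coefficients opposite.
  refine Finset.sum_eq_zero fun X hX => ?_
  rw [← Finset.sum_add_distrib]
  refine Finset.sum_eq_zero fun Y hY => ?_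
  have h3 := (mem_splits.1 hY).1
  have h4 := eps_assoc (K := K) (X := X) (Y := Y) (Z := (S \ X) \ Y)
    (Finset.disjoint_sdiff.mono_right h3) Finset.disjoint_sdiff
  rw [Finset.union_sdiff_of_subset h3] at h4
  rw [← single_add, single_eq_zero, h4]
  ring

namespace IsLieFamily

variable [CharZero K] {gr : ℤ → Submodule K N} {μ : (lieData K).E →ₗ[K] N →ₗ[K] N →ₗ[K] N}
  {D : N →ₗ[K] N} {g : Finset (Fin n) → N} (h : IsLieFamily gr μ D g) {x0 : Fin n}

include h

theorem brWord_mem (A : Finset (Fin n)) (r : List (Finset (Fin n))) :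
    brWord μ g A r ∈ gr (wdeg A r) := by
  induction r with
  | nil => exact h.mem A
  | cons S r ih => exact h.isAlg.lie_mem ih (h.mem S)

theorem eps_smul_swap {X Y : Finset (Fin n)} (hd : Disjoint X Y) :
    eps K X Y • μ (1 : K) (g X) (g Y) = eps K Y X • μ (1 : K) (g Y) (g X) := by
  rw [h.isAlg.lie_antisymm (h.mem X) (h.mem Y), eps_symm hd, neg_smul, smul_neg, neg_neg,
    smul_smul, mul_right_comm, ksign_sq, one_mul]

/-- The two orders of a splitting contribute equally, so the half sum over all splittings folds to a
sum over those with `x0` in the first block. -/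
theorem map_g_of_mem {A : Finset (Fin n)} (hA : x0 ∈ A) :
    D (g A) = ∑ X ∈ splitsAt x0 A, eps K X (A \ X) • μ (1 : K) (g X) (g (A \ X)) := by
  rw [h.map_g, sum_splits_fold hA (fun X Y => eps K X Y • μ (1 : K) (g X) (g Y))
    fun X _ => h.eps_smul_swap Finset.disjoint_sdiff, ← two_smul K, smul_smul,
    inv_mul_cancel₀ two_ne_zero, one_smul]

/-- The Jacobi identity expresses a bracket with `[g Y, g Z]` by two left normed brackets. By
`eps_symm` the second is the first with `Y` and `Z` exchanged, so over all splittings they add up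
and absorb the factor `2⁻¹`. -/
theorem bracket_map_g {i : ℤ} {w : N} (hw : w ∈ gr i) (S : Finset (Fin n)) :
    μ (1 : K) w (D (g S)) = ∑ Y ∈ splits S, eps K Y (S \ Y) •
      μ (1 : K) (μ (1 : K) w (g Y)) (g (S \ Y)) := by
  have h1 : ∀ Y ∈ splits S, eps K Y (S \ Y) • μ (1 : K) w (μ (1 : K) (g Y) (g (S \ Y))) =
      eps K Y (S \ Y) • μ (1 : K) (μ (1 : K) w (g Y)) (g (S \ Y)) +
      eps K (S \ Y) Y • μ (1 : K) (μ (1 : K) w (g (S \ Y))) (g Y) := by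
    intro Y _
    rw [h.isAlg.lie_jacobi hw (h.mem Y) (h.mem (S \ Y)), smul_sub, smul_smul,
      eps_symm (K := K) (S := S \ Y) (T := Y) Finset.sdiff_disjoint, neg_smul, sub_eq_add_neg,
      mul_comm (eps K Y (S \ Y)), mul_comm ((Y.card : ℤ) - 1)]
  rw [h.map_g, map_smul, map_sum]
  simp only [map_smul]
  rw [Finset.sum_congr rfl h1, Finset.sum_add_distrib,
    ← sum_splits_swap S fun X Y => eps K X Y • μ (1 : K) (μ (1 : K) w (g X)) (g Y),
    ← two_smul K, smul_smul, inv_mul_cancel₀ two_ne_zero, one_smul]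

/-- This justifies the formula for `dWord`: the bracket evaluation is a chain map from words to the
given Lie algebra. -/
theorem map_brWord {A : Finset (Fin n)} (hA : x0 ∈ A) (r : List (Finset (Fin n))) :
    D (brWord μ g A r) = br μ g (dWord K x0 A r) := by
  induction r with
  | nil =>
    rw [brWord, h.map_g_of_mem hA, dWord, map_sum]
    exact Finset.sum_congr rfl fun X _ => by rw [br_single]; rfl
  | cons S r ih =>
    rw [brWord, h.leibniz _ _ (h.brWord_mem A r), ih, dWord, map_add, br_wcons, map_smul,
      wsplit_single, map_sum, h.bracket_map_g (h.brWord_mem A r)]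
    congr 2
    exact Finset.sum_congr rfl fun X _ => by rw [br_single]; rfl

theorem map_br {S : Finset (Fin n)} {x : LieWord n →₀ K} (hx : x ∈ goodW K x0 S) :
    D (br μ g x) = br μ g (dW K x0 x) := by
  refine eqOn_supported (f := D ∘ₗ br μ g) (g := br μ g ∘ₗ dW K x0) ?_ hx
  rintro ⟨A, r⟩ hw
  rw [LinearMap.comp_apply, LinearMap.comp_apply, br_single, one_smul, dW_single, one_smul]
  exact h.map_brWord (GoodWord.mem hw).1 r

/-- Transported to words, the claim is the vanishing of the squared differential on a single letter
containing some chosen `x0`; the empty letter has no splitting. -/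
theorem map_map_g (S : Finset (Fin n)) : D (D (g S)) = 0 := by
  rcases S.eq_empty_or_nonempty with rfl | ⟨x0, hx⟩
  · rw [h.map_g, splits_eq_empty (by simp), Finset.sum_empty, smul_zero, map_zero]
  · have h1 := h.map_brWord hx []
    rw [brWord] at h1
    rw [h1, h.map_br (x0 := x0) (S := S) (GoodWord.dWord_mem (.base S hx)), dW_dWord_nil, map_zero]

end IsLieFamily

end LieFamily

/-! ### Explicit elements of the Koszul dual of the Lie operad. -/

section LieDual

variable (K : Type u) [Field K] {n : ℕ}

open Free

/-- The generator of the multilinear part of the Koszul dual of the Lie operad, as a sum of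
trees. -/
def lieTree (S : Finset (Fin n)) : Tree (lieData K) (std K n) :=
  (if S.card = 1 then ∑ i ∈ S, Tree.leaf (lieData K) (stdVec K n i) else 0) +
  (2⁻¹ : K) • ∑ A ∈ (splits S).attach, eps K A.1 (S \ A.1) •
    Tree.node (lieData K) (1 : K) (lieTree A.1) (lieTree (S \ A.1))
termination_by S.card
decreasing_by
  · exact card_lt_of_mem_splits A.2
  · exact card_lt_of_mem_splits (sdiff_mem_splits A.2)

theorem lieTree_singleton (i : Fin n) :
    lieTree K {i} = Tree.leaf (lieData K) (stdVec K n i) := by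
  have h : (splits ({i} : Finset (Fin n))) = ∅ := splits_eq_empty (by simp)
  rw [lieTree, if_pos (Finset.card_singleton i), Finset.sum_singleton,
    Finset.sum_attach (splits {i}) (fun A => eps K A ({i} \ A) •
    Tree.node (lieData K) (1 : K) (lieTree K A) (lieTree K ({i} \ A))), h, Finset.sum_empty,
    smul_zero, add_zero]

theorem lieTree_of_card_ne {S : Finset (Fin n)} (hS : S.card ≠ 1) : lieTree K S =
    (2⁻¹ : K) • ∑ A ∈ splits S, eps K A (S \ A) •
      Tree.node (lieData K) (1 : K) (lieTree K A) (lieTree K (S \ A)) := by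
  rw [lieTree, if_neg hS, zero_add,
    Finset.sum_attach (splits S) (fun A => eps K A (S \ A) •
    Tree.node (lieData K) (1 : K) (lieTree K A) (lieTree K (S \ A)))]

/-- Induction for the elements `lieTree`. -/
theorem lieTree_induction {p : Finset (Fin n) → Tree (lieData K) (std K n) → Prop}
    (h1 : ∀ i, p {i} (Tree.leaf (lieData K) (stdVec K n i)))
    (h2 : ∀ S : Finset (Fin n), S.card ≠ 1 → (∀ A ∈ splits S, p A (lieTree K A)) →
      p S (lieTree K S)) (S : Finset (Fin n)) : p S (lieTree K S) := by
  induction hm : S.card using Nat.strong_induction_on generalizing S with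
  | h m ih =>
    subst hm
    by_cases hS : S.card = 1
    · obtain ⟨i, rfl⟩ := Finset.card_eq_one.1 hS
      rw [lieTree_singleton]
      exact h1 i
    · exact h2 S hS fun A hA => ih _ (card_lt_of_mem_splits hA) A rfl

theorem card_splits_degree {S A : Finset (Fin n)} (hA : A ∈ splits S) :
    1 + ((A.card : ℤ) - 1) + (((S \ A).card : ℤ) - 1) = S.card - 1 := by
  have := Finset.card_sdiff_add_card_eq_card (mem_splits.1 hA).1
  omega

theorem lieTree_mem_gr (S : Finset (Fin n)) :
    lieTree K S ∈ (Tree (lieData K) (std K n)).gr (S.card - 1) := by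
  refine lieTree_induction K (p := fun S t => t ∈ (Tree (lieData K) (std K n)).gr (S.card - 1))
    (fun i => ?_) (fun S hS ih => ?_) S
  · rw [Finset.card_singleton, Nat.cast_one, sub_self]
    exact ι_mem (stdVec_mem i)
  · rw [lieTree_of_card_ne K hS]
    refine Submodule.smul_mem _ _ (Submodule.sum_mem _ fun A hA => Submodule.smul_mem _ _ ?_)
    rw [← card_splits_degree hA]
    exact node_mem (Q := (lieData K).magma) _ (ih A hA) (ih _ (sdiff_mem_splits hA))

theorem lieTree_mem_span (S : Finset (Fin n)) :
    lieTree K S ∈ Submodule.span K {x | TreeMonomial (lieData K) n S x} := by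
  refine lieTree_induction K
    (p := fun S t => t ∈ Submodule.span K {x | TreeMonomial (lieData K) n S x})
    (fun i => Submodule.subset_span (.leaf i)) (fun S hS ih => ?_) S
  rw [lieTree_of_card_ne K hS]
  refine Submodule.smul_mem _ _ (Submodule.sum_mem _ fun A hA => Submodule.smul_mem _ _ ?_)
  have h := map₂_mem_span (f := Tree.node (lieData K) (V := std K n) (1 : K))
    (Z := {x | TreeMonomial (lieData K) n S x}) (fun x hx y hy => ?_) (ih A hA)
    (ih _ (sdiff_mem_splits hA))
  · exact h
  · have := TreeMonomial.node (Q := lieData K) (n := n) (1 : K) A (S \ A) Finset.disjoint_sdiff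
      x y hx hy
    rw [Finset.union_sdiff_of_subset (mem_splits.1 hA).1] at this
    exact Submodule.subset_span this

theorem cut_lieTree (S : Finset (Fin n)) : cut (lieData K) (std K n) (lieTree K S) =
    (2⁻¹ : K) • ∑ A ∈ splits S, eps K A (S \ A) •
      Free.node (Q := lieData K) (1 : K) (ι (lieTree K A)) (ι (lieTree K (S \ A))) := by
  by_cases hS : S.card = 1
  · obtain ⟨i, rfl⟩ := Finset.card_eq_one.1 hS
    rw [lieTree_singleton, cut_leaf, splits_eq_empty (by simp), Finset.sum_empty, smul_zero]
  · conv_lhs => rw [lieTree_of_card_ne K hS]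
    rw [map_smul, map_sum]
    congr 1
    exact Finset.sum_congr rfl fun A _ => by rw [map_smul, cut_node]

/-- On generators `cutTwice` is the square of this derivation, so `map_map_g` shows that the trees
satisfy the quadratic condition defining the Koszul dual. -/
theorem isLieFamily_lieTree : IsLieFamily (n := n) (Free (lieData K) 0 (Tree (lieData K) (std K n))).gr
    Free.node (der (cut (lieData K) (std K n)) (cut_mem _)) (fun S => ι (lieTree K S)) where
  isAlg := Free.isAlg
  mem S := ι_mem (lieTree_mem_gr K S)
  leibniz i x hx y := by
    rw [der_node, (Free (lieData K) 0 (Tree (lieData K) (std K n))).parity_of_mem hx, map_smul,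
      LinearMap.smul_apply]
  map_g S := by rw [der_ι, cut_lieTree]

variable [CharZero K]

theorem cutTwice_lieTree (S : Finset (Fin n)) :
    cutTwice (lieData K) (std K n) (lieTree K S) = 0 := by
  have := (isLieFamily_lieTree (n := n) K).map_map_g S
  rwa [der_ι] at this

theorem lieTree_mem_dualPart (S : Finset (Fin n)) :
    lieTree K S ∈ dualPart (lieData K) (std K n) (S.card - 1) := by
  refine lieTree_induction K (p := fun S t => t ∈ dualPart (lieData K) (std K n) (S.card - 1))
    (fun i => ?_) (fun S hS ih => ?_) S
  · rw [Finset.card_singleton, Nat.cast_one, sub_self]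
    exact leaf_mem_dualPart (stdVec_mem i)
  · refine nodeSpan_inf_le _ ⟨?_, cutTwice_lieTree K S⟩
    rw [lieTree_of_card_ne K hS]
    refine Submodule.smul_mem _ _ (Submodule.sum_mem _ fun A hA => Submodule.smul_mem _ _ ?_)
    exact Submodule.subset_span ⟨_, _, _, _, ih A hA, _, ih _ (sdiff_mem_splits hA),
      card_splits_degree hA, rfl⟩

/-- The generator of the multilinear part of the Koszul dual of the Lie operad. -/
def lieDual (S : Finset (Fin n)) : Dual (lieData K) (std K n) :=
  ⟨lieTree K S, mem_dualTotal (lieTree_mem_dualPart K S)⟩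

theorem incl_lieDual (S : Finset (Fin n)) : Dual.incl (lieDual K S) = lieTree K S := rfl

theorem lieDual_mem_gr (S : Finset (Fin n)) :
    lieDual K S ∈ (Dual (lieData K) (std K n)).gr (S.card - 1) := lieTree_mem_dualPart K S

theorem lieDual_mem_dualArity (S : Finset (Fin n)) :
    lieDual K S ∈ dualArity (lieData K) n S := lieTree_mem_span K S

theorem cobar_lieDual (S : Finset (Fin n)) : cobar (lieData K) (std K n) (lieDual K S) =
    -((2⁻¹ : K) • ∑ A ∈ splits S, eps K A (S \ A) •
      Free.node (Q := lieData K) (1 : K) (ι (lieDual K A)) (ι (lieDual K (S \ A)))) := by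
  by_cases hS : S.card = 1
  · obtain ⟨i, rfl⟩ := Finset.card_eq_one.1 hS
    rw [cobar_leaf _ _ (lieTree_singleton K i), splits_eq_empty (by simp), Finset.sum_empty,
      smul_zero, neg_zero]
  · rw [cobar_eq, incl_lieDual, lieTree_of_card_ne K hS, map_smul, map_smul, map_sum, map_sum]
    congr 2
    refine Finset.sum_congr rfl fun A _ => ?_
    rw [map_smul, map_smul, ← incl_lieDual, ← incl_lieDual, retractFree_cut_node]

/-- The sign in front of `koszulD` offsets the one in the definition of `cobar`. -/
theorem isLieFamily_lieDual :
    IsLieFamily (n := n) (Free (lieData K) 0 (Dual (lieData K) (std K n))).gr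
      Free.node (-koszulD (lieData K) (std K n)) (fun S => ι (lieDual K S)) where
  isAlg := Free.isAlg
  mem S := ι_mem (lieDual_mem_gr K S)
  leibniz i x hx y := by
    rw [LinearMap.neg_apply, LinearMap.neg_apply, LinearMap.neg_apply, koszulD, der_node,
      (Free (lieData K) 0 (Dual (lieData K) (std K n))).parity_of_mem hx, map_smul,
      LinearMap.smul_apply, map_neg, map_neg, LinearMap.neg_apply, smul_neg, neg_add]
  map_g S := by rw [LinearMap.neg_apply, koszulD, der_ι, cobar_lieDual, neg_neg]

end LieDual

/-! ### Bilinear maps given on basis elements. -/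

section Bilinear

variable (K : Type u) [Field K] {J : Type v} {N : Type w} [AddCommGroup N] [Module K N]

open Finsupp

/-- The bilinear extension of a map given on basis elements. -/
def bilin (f : J → J → N) : (J →₀ K) →ₗ[K] (J →₀ K) →ₗ[K] N :=
  linearCombination K fun a => linearCombination K (f a)

variable {K}

theorem bilin_single (f : J → J → N) (a b : J) (c d : K) :
    bilin K f (single a c) (single b d) = (c * d) • f a b := by
  rw [bilin, linearCombination_single, LinearMap.smul_apply, linearCombination_single, smul_smul]

theorem eqOn_supported₂ {f g : (J →₀ K) →ₗ[K] (J →₀ K) →ₗ[K] N} {s t : Set J}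
    (h : ∀ a ∈ s, ∀ b ∈ t, f (single a 1) (single b 1) = g (single a 1) (single b 1))
    {x y : J →₀ K} (hx : x ∈ supported K K s) (hy : y ∈ supported K K t) : f x y = g x y := by
  refine eqOn_supported (f := f.flip y) (g := g.flip y) (fun a ha => ?_) hx
  exact eqOn_supported (f := f (single a 1)) (g := g (single a 1)) (fun b hb => h a ha b hb) hy

theorem bilin_mem {f : J → J → N} {P : Submodule K N} {s t : Set J}
    (h : ∀ a ∈ s, ∀ b ∈ t, f a b ∈ P) {x y : J →₀ K} (hx : x ∈ supported K K s)
    (hy : y ∈ supported K K t) : bilin K f x y ∈ P := by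
  refine map_supported_le (f := (bilin K f).flip y) (fun a ha => ?_) hx
  refine map_supported_le (f := bilin K f (single a 1)) (fun b hb => ?_) hy
  rw [bilin_single, one_mul, one_smul]
  exact h a ha b hb

end Bilinear

/-! ### Nonvanishing of the elements of the Koszul dual. -/

section Letters

variable (K : Type u) [Field K] (n : ℕ)

open Finsupp Free

/-- The product of letters in the Koszul dual of the Lie operad. -/
def letterMul : (lieData K).magma.E →ₗ[K] (Finset (Fin n) →₀ K) →ₗ[K] (Finset (Fin n) →₀ K) →ₗ[K]
    (Finset (Fin n) →₀ K) :=
  LinearMap.toSpanSingleton K _ (bilin K fun S T => if Disjoint S T then single (S ∪ T) (eps K S T)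
    else 0)

/-- A letter `S` has degree `|S| - 1`. -/
def letterGr (k : ℤ) : Submodule K (Finset (Fin n) →₀ K) :=
  supported K K {S | (S.card : ℤ) - 1 = k}

variable {K n}

theorem letterMul_apply (e : K) (x y : Finset (Fin n) →₀ K) : letterMul K n e x y =
    e • bilin K (fun S T => if Disjoint S T then single (S ∪ T) (eps K S T) else 0) x y := rfl

theorem letterMul_isAlg : IsAlg (lieData K).magma 1 (letterGr K n) (letterMul K n) := by
  refine isAlg_magma ?_ ?_
  · intro e i j x hx y hy
    rw [letterMul_apply]
    refine Submodule.smul_mem _ _ (bilin_mem ?_ hx hy)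
    rintro S rfl T rfl
    split_ifs with h
    · refine single_mem_supported K _ ?_
      rw [Set.mem_ofPred_eq, Finset.card_union_of_disjoint h]
      push_cast
      ring
    · exact zero_mem _
  · intro e i j x hx y hy
    have h1 : (lieData K).magma.τ e = (-e : K) := rfl
    rw [h1, letterMul_apply, letterMul_apply]
    set B := bilin K (fun S T : Finset (Fin n) => if Disjoint S T then single (S ∪ T) (eps K S T)
      else 0)
    have h2 : B x y = ((-ksign K (i * j)) • B.flip) x y := by
      refine eqOn_supported₂ ?_ hx hy
      rintro S rfl T rfl
      rw [LinearMap.smul_apply, LinearMap.smul_apply,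
        LinearMap.flip_apply, bilin_single, bilin_single, one_mul, one_smul, one_smul, neg_smul]
      by_cases h : Disjoint S T
      · rw [if_pos h, if_pos h.symm, Finset.union_comm T S, smul_single, ← single_neg, eps_symm h]
        rfl
      · rw [if_neg h, if_neg fun h' => h h'.symm, smul_zero, neg_zero]
    rw [h2, LinearMap.smul_apply, LinearMap.smul_apply, LinearMap.flip_apply, smul_smul, smul_smul,
      neg_mul_neg, mul_comm]

/-- Basis vectors are letters. -/
def letterVec : std K n →ₗ[K] (Finset (Fin n) →₀ K) :=
  (Pi.basisFun K (Fin n)).constr K fun i => single {i} (1 : K)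

theorem letterVec_stdVec (i : Fin n) : letterVec (stdVec K n i) = single {i} (1 : K) := by
  have := (Pi.basisFun K (Fin n)).constr_basis K
    (fun i => single ({i} : Finset (Fin n)) (1 : K)) i
  rwa [Pi.basisFun_apply] at this

theorem letterVec_mem : ∀ i, ∀ x ∈ (std K n).gr i, letterVec x ∈ letterGr K n i := by
  intro i x hx
  by_cases hi : i = 0
  · subst hi
    have h : letterVec x ∈ LinearMap.range (letterVec (K := K) (n := n)) := ⟨x, rfl⟩
    have h' : LinearMap.range (letterVec (K := K) (n := n)) =
      Submodule.span K (Set.range fun i => single ({i} : Finset (Fin n)) (1 : K)) :=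
      (Pi.basisFun K (Fin n)).constr_range K
    rw [h'] at h
    refine (Submodule.span_le.2 ?_) h
    rintro _ ⟨i, rfl⟩
    exact single_mem_supported K _ (by simp)
  · have h : x ∈ (if i = 0 then (⊤ : Submodule K (Fin n → K)) else ⊥) := hx
    rw [if_neg hi] at h
    have h' : x = (0 : std K n) := (Submodule.mem_bot K).1 h
    rw [h', map_zero]
    exact zero_mem _

/-- The evaluation of trees in letters. -/
def letterEval : Tree (lieData K) (std K n) →ₗ[K] (Finset (Fin n) →₀ K) :=
  lift letterMul_isAlg letterVec letterVec_mem

/-- Each splitting contributes `eps² = 1` times a product of positive rationals, so by induction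
nothing cancels. In characteristic zero this shows that `lieTree K S` is nonzero for nonempty `S`.
-/
theorem letterEval_lieTree [CharZero K] (S : Finset (Fin n)) : S.Nonempty →
    ∃ q : ℚ, 0 < q ∧ letterEval (lieTree K S) = single S (q : K) := by
  refine lieTree_induction K (p := fun S t => S.Nonempty → ∃ q : ℚ, 0 < q ∧
    letterEval t = single S (q : K)) (fun i _ => ?_) (fun S hS ih hne => ?_) S
  · refine ⟨1, one_pos, ?_⟩
    rw [Rat.cast_one, ← letterVec_stdVec]
    exact lift_ι ..
  · have h1 : ∀ A : {A // A ∈ splits S}, ∃ q : ℚ, 0 < q ∧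
        letterEval (lieTree K A.1) = single A.1 (q : K) := fun A => ih A.1 A.2 (mem_splits.1 A.2).2.1
    choose q hq hq' using h1
    refine ⟨2⁻¹ * ∑ A ∈ (splits S).attach, q A * q ⟨S \ A.1, sdiff_mem_splits A.2⟩, ?_, ?_⟩
    · refine mul_pos (by norm_num) (Finset.sum_pos (fun A _ => mul_pos (hq _) (hq _)) ?_)
      obtain ⟨i, hi⟩ := hne
      have h2 : 2 ≤ S.card := by
        have := Finset.card_pos.2 ⟨i, hi⟩
        omega
      exact ⟨⟨{i}, (Finset.mem_filter.1 (singleton_mem_splitsAt hi h2)).1⟩, Finset.mem_attach _ _⟩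
    · rw [lieTree_of_card_ne K hS, ← Finset.sum_attach, map_smul, map_sum, Rat.cast_mul,
        Rat.cast_sum, ← smul_eq_mul, ← smul_single, Rat.cast_inv, Rat.cast_ofNat]
      congr 1
      refine Eq.trans ?_ (map_sum (Finsupp.lsingle (R := K) S) _ _).symm
      refine Finset.sum_congr rfl fun A _ => ?_
      have h3 : letterEval (Tree.node (lieData K) (1 : K) (lieTree K A.1) (lieTree K (S \ A.1))) =
        letterMul K n (1 : K) (letterEval (lieTree K A.1)) (letterEval (lieTree K (S \ A.1))) :=
        lift_node ..
      rw [map_smul, h3, letterMul_apply, one_smul, hq' A, hq' ⟨_, sdiff_mem_splits A.2⟩,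
        bilin_single, if_pos Finset.disjoint_sdiff,
        Finset.union_sdiff_of_subset (mem_splits.1 A.2).1, smul_single, smul_single, smul_eq_mul,
        smul_eq_mul, mul_comm, mul_assoc, eps_mul_self, mul_one, Rat.cast_mul]
      rfl

theorem letterEval_mem {i : ℤ} {x : Tree (lieData K) (std K n)}
    (hx : x ∈ (Tree (lieData K) (std K n)).gr i) : letterEval x ∈ letterGr K n i :=
  lift_mem letterMul_isAlg _ letterVec_mem hx

end Letters

/-! ### Independence of left normed brackets via associative words. -/

section Commutator

variable (K : Type u) [Field K] (n : ℕ)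

open Finsupp Free

/-- The degree of a word. -/
def listDeg (l : List (Finset (Fin n))) : ℤ := (l.map fun S => (S.card : ℤ) - 1).sum

/-- Concatenation. -/
def cat : (List (Finset (Fin n)) →₀ K) →ₗ[K] (List (Finset (Fin n)) →₀ K) →ₗ[K]
    (List (Finset (Fin n)) →₀ K) := bilin K fun l l' => single (l ++ l') 1

/-- The graded commutator of words. -/
def commutator : (List (Finset (Fin n)) →₀ K) →ₗ[K] (List (Finset (Fin n)) →₀ K) →ₗ[K]
    (List (Finset (Fin n)) →₀ K) :=
  bilin K fun l l' => single (l ++ l') 1 - single (l' ++ l) (ksign K (listDeg n l * listDeg n l'))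

/-- Words of degree `k`. -/
def listGr (k : ℤ) : Submodule K (List (Finset (Fin n)) →₀ K) := supported K K {l | listDeg n l = k}

variable {K n}

theorem listDeg_append (l l' : List (Finset (Fin n))) :
    listDeg n (l ++ l') = listDeg n l + listDeg n l' := by
  rw [listDeg, List.map_append, List.sum_append]; rfl

theorem cat_single (l l' : List (Finset (Fin n))) (c d : K) :
    cat K n (single l c) (single l' d) = single (l ++ l') (c * d) := by
  rw [cat, bilin_single, smul_single, smul_eq_mul, mul_one]

theorem cat_assoc (x y z : List (Finset (Fin n)) →₀ K) :
    cat K n (cat K n x y) z = cat K n x (cat K n y z) := by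
  induction x using Finsupp.induction_linear with
  | zero => simp
  | add x x' hx hx' => simp only [map_add, LinearMap.add_apply, hx, hx']
  | single a c =>
    induction y using Finsupp.induction_linear with
    | zero => simp
    | add x x' hx hx' => simp only [map_add, LinearMap.add_apply, hx, hx']
    | single b d =>
      induction z using Finsupp.induction_linear with
      | zero => simp
      | add x x' hx hx' => simp only [map_add, hx, hx']
      | single e f => simp only [cat_single, List.append_assoc, mul_assoc]

theorem cat_mem {i j : ℤ} {x y : List (Finset (Fin n)) →₀ K} (hx : x ∈ listGr K n i)
    (hy : y ∈ listGr K n j) : cat K n x y ∈ listGr K n (i + j) := by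
  refine bilin_mem ?_ hx hy
  rintro l rfl l' rfl
  exact single_mem_supported K _ (listDeg_append l l')

theorem commutator_of_mem {i j : ℤ} {x y : List (Finset (Fin n)) →₀ K} (hx : x ∈ listGr K n i)
    (hy : y ∈ listGr K n j) :
    commutator K n x y = cat K n x y - ksign K (i * j) • cat K n y x := by
  rw [sub_eq_add_neg, ← neg_smul]
  refine eqOn_supported₂ (g := cat K n + (-ksign K (i * j)) • (cat K n).flip) ?_ hx hy
  rintro l rfl l' rfl
  rw [commutator, bilin_single, LinearMap.add_apply, LinearMap.add_apply, LinearMap.smul_apply,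
    LinearMap.smul_apply, neg_smul, ← sub_eq_add_neg, LinearMap.flip_apply, cat_single, cat_single, one_mul, one_smul,
    smul_single, smul_eq_mul, mul_one]

theorem commutator_mem {i j : ℤ} {x y : List (Finset (Fin n)) →₀ K} (hx : x ∈ listGr K n i)
    (hy : y ∈ listGr K n j) : commutator K n x y ∈ listGr K n (i + j) := by
  rw [commutator_of_mem hx hy]
  exact sub_mem (cat_mem hx hy) (Submodule.smul_mem _ _ (add_comm j i ▸ cat_mem hy hx))

/-- Words form a graded Lie algebra under the commutator. -/
theorem commutator_isAlg : IsAlg (lieData K) 0 (listGr K n)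
    (LinearMap.toSpanSingleton K _ (commutator K n)) := by
  have h1 : ∀ (e : K) (x y : List (Finset (Fin n)) →₀ K),
    LinearMap.toSpanSingleton K _ (commutator K n) e x y = e • commutator K n x y :=
    fun _ _ _ => rfl
  refine ⟨?_, ?_, ?_⟩
  · intro e i j x hx y hy
    rw [zero_add]
    exact Submodule.smul_mem _ (e : K) (commutator_mem hx hy)
  · intro e i j x hx y hy
    have h : (-e : K) • commutator K n x y = ksign K (i * j) • (e : K) • commutator K n y x := by
      rw [commutator_of_mem hx hy, commutator_of_mem hy hx, smul_comm _ (e : K), mul_comm j i,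
        smul_sub (ksign K (i * j)), smul_smul, ksign_sq, one_smul, neg_smul, ← smul_neg, neg_sub]
    exact h
  · intro r hr i j k x hx y hy z hz
    obtain ⟨c, rfl⟩ := Submodule.mem_span_singleton.1 hr
    have h2 : ∀ x y z : List (Finset (Fin n)) →₀ K, tri (E := K)
        (LinearMap.toSpanSingleton K _ (commutator K n)) x y z (c • (1 ⊗ₜ[K] 1)) =
        c • commutator K n (commutator K n x y) z := by
      intro x y z
      rw [map_smul, tri_tmul, h1, h1, one_smul, one_smul]
    have h3 : commutator K n (commutator K n x y) z
        + ksign K (i * (j + k)) • commutator K n (commutator K n y z) x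
        + ksign K (k * (i + j)) • commutator K n (commutator K n z x) y = 0 := by
      rw [commutator_of_mem (commutator_mem hx hy) hz, commutator_of_mem (commutator_mem hy hz) hx,
        commutator_of_mem (commutator_mem hz hx) hy, commutator_of_mem hx hy,
        commutator_of_mem hy hz, commutator_of_mem hz hx]
      simp only [add_mul, mul_add, ksign_add, mul_comm j i, mul_comm k i, mul_comm k j, map_sub,
        map_smul, LinearMap.sub_apply, LinearMap.smul_apply, cat_assoc]
      rcases ksign_eq (K := K) (i * j) with h | h <;> rcases ksign_eq (K := K) (i * k) with h' | h'
        <;> rcases ksign_eq (K := K) (j * k) with h'' | h'' <;> rw [h, h', h''] <;>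
        simp only [mul_neg, mul_one, neg_neg, one_smul, neg_smul] <;> abel
    have h4 : c • commutator K n (commutator K n x y) z
        + ksign K (i * (j + k)) • c • commutator K n (commutator K n y z) x
        + ksign K (k * (i + j)) • c • commutator K n (commutator K n z x) y = 0 := by
      rw [smul_comm _ c, smul_comm _ c, ← smul_add, ← smul_add, h3, smul_zero]
    rw [← h2, ← h2, ← h2] at h4
    exact h4

/-- The words of length one associated to an element of the Koszul dual. -/
def dualLetters : Dual (lieData K) (std K n) →ₗ[K] (List (Finset (Fin n)) →₀ K) :=
  lmapDomain K K (fun S => [S]) ∘ₗ letterEval ∘ₗ Dual.incl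

theorem dualLetters_mem : ∀ i, ∀ x ∈ (Dual (lieData K) (std K n)).gr i,
    dualLetters x ∈ listGr K n i := by
  intro i x hx
  refine map_supported_le (f := lmapDomain K K (fun S : Finset (Fin n) => [S])) (fun S hS => ?_)
    (letterEval_mem (dualPart_le_gr i hx))
  rw [lmapDomain_apply, mapDomain_single]
  refine single_mem_supported K _ ?_
  rw [Set.mem_ofPred_eq] at hS
  rw [Set.mem_ofPred_eq, listDeg, List.map_singleton, List.sum_singleton, hS]

/-- The evaluation of the Koszul complex in words. -/
def wordEval : Free (lieData K) 0 (Dual (lieData K) (std K n)) →ₗ[K]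
    (List (Finset (Fin n)) →₀ K) := lift commutator_isAlg dualLetters dualLetters_mem

variable [CharZero K]

theorem wordEval_lieDual {S : Finset (Fin n)} (hS : S.Nonempty) :
    ∃ q : K, q ≠ 0 ∧ wordEval (ι (lieDual K S)) = single [S] q := by
  obtain ⟨q, h1, h2⟩ := letterEval_lieTree (K := K) S hS
  refine ⟨q, Rat.cast_ne_zero.2 h1.ne', ?_⟩
  have h3 : wordEval (ι (lieDual K S)) = dualLetters (lieDual K S) := lift_ι ..
  rw [h3, dualLetters, LinearMap.comp_apply, LinearMap.comp_apply, incl_lieDual, h2,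
    lmapDomain_apply, mapDomain_single]

/-- The values of left normed brackets in the Koszul complex. -/
abbrev lieBr (K : Type u) [Field K] [CharZero K] (n : ℕ) :
    (LieWord n →₀ K) →ₗ[K] Free (lieData K) 0 (Dual (lieData K) (std K n)) :=
  br Free.node fun S => ι (lieDual K S)

/-- Words which do not begin with a letter containing `x0`. -/
abbrev junk (K : Type u) [Field K] {n : ℕ} (x0 : Fin n) :
    Submodule K (List (Finset (Fin n)) →₀ K) :=
  supported K K {l | ∃ S r, l = S :: r ∧ x0 ∉ S}

/-- Expanding the iterated commutator, the innermost letter comes first only in the term where every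
further letter is appended on the right. In all other terms some outer letter comes first, and outer
letters miss `x0`. -/
theorem wordEval_brWord {x0 : Fin n} {S : Finset (Fin n)} {w : LieWord n} (hw : GoodWord x0 S w) :
    ∃ q : K, q ≠ 0 ∧ wordEval (brWord Free.node (fun S => ι (lieDual K S)) w.1 w.2) -
      single (w.1 :: w.2.reverse) q ∈ junk K x0 := by
  induction hw with
  | base A h =>
    obtain ⟨q, h1, h2⟩ := wordEval_lieDual (K := K) ⟨x0, h⟩
    refine ⟨q, h1, ?_⟩
    rw [brWord, h2, List.reverse_nil, sub_self]
    exact zero_mem _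
  | cons S A B r hB hd h ih =>
    obtain ⟨q, h1, h2⟩ := ih
    obtain ⟨p, h3, h4⟩ := wordEval_lieDual (K := K) hB
    have hx0 : x0 ∉ B := fun h' => Finset.disjoint_left.1 hd (h.mem.2 h.mem.1) h'
    refine ⟨q * p, mul_ne_zero h1 h3, ?_⟩
    set x := brWord Free.node (fun S => ι (lieDual K S)) A r with hx
    have h5 : wordEval (brWord Free.node (fun S => ι (lieDual K S)) A (B :: r)) =
        commutator K n (wordEval x) (wordEval (ι (lieDual K B))) :=
      (lift_node ..).trans (one_smul K _)
    have h6 : wordEval x ∈ listGr K n (wdeg A r) :=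
      lift_mem commutator_isAlg _ dualLetters_mem ((isLieFamily_lieDual K).brWord_mem A r)
    have h7 : wordEval (ι (lieDual K B)) ∈ listGr K n (B.card - 1) :=
      lift_mem commutator_isAlg _ dualLetters_mem (ι_mem (lieDual_mem_gr K B))
    rw [h5, commutator_of_mem h6 h7, h4, List.reverse_cons]
    have h8 : cat K n (wordEval x) (single [B] p) - single (A :: (r.reverse ++ [B])) (q * p) =
        cat K n (wordEval x - single (A :: r.reverse) q) (single [B] p) := by
      rw [map_sub, LinearMap.sub_apply, cat_single]; rfl
    rw [sub_right_comm, h8]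
    refine sub_mem ?_ (Submodule.smul_mem _ _ ?_)
    · refine bilin_mem (t := {[B]}) ?_ h2 (single_mem_supported K _ rfl)
      rintro _ ⟨S, r', rfl, hS⟩ _ rfl
      exact single_mem_supported K _ ⟨S, r' ++ [B], rfl, hS⟩
    · refine bilin_mem (s := {[B]}) (t := Set.univ) ?_ (single_mem_supported K _ rfl) (by
        rw [supported_univ]; trivial)
      rintro _ rfl l _
      exact single_mem_supported K _ ⟨B, l, rfl, hx0⟩

/-- Good words are linearly independent in the Koszul complex. -/
theorem br_injOn {x0 : Fin n} {S : Finset (Fin n)} {x : LieWord n →₀ K} (hx : x ∈ goodW K x0 S)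
    (h : lieBr K n x = 0) : x = 0 := by
  ext w
  by_cases hw : GoodWord x0 S w
  · obtain ⟨q, hq, hq'⟩ := wordEval_brWord (K := K) hw
    -- The coefficient of the leading word of `w` reads off the coefficient of `w` in `x`, up to a
    -- nonzero factor: words beginning with a letter that misses `x0` do not interfere, and distinct
    -- good words have distinct leading words.
    have key : lapply (R := K) (M := K) (w.1 :: w.2.reverse)
        (wordEval (lieBr K n x)) = q • lapply (R := K) (M := K) w x := by
      refine eqOn_supported (f := lapply (R := K) (M := K) (w.1 :: w.2.reverse) ∘ₗ wordEval ∘ₗ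
        lieBr K n) (g := q • lapply (R := K) (M := K) w) ?_ hx
      intro v hv
      have h0 : ∀ y ∈ junk K x0, y (w.1 :: w.2.reverse) = 0 := by
        intro y hy
        by_contra hne
        obtain ⟨T, r, h1, h2⟩ := hy (mem_support_iff.2 hne)
        exact h2 ((List.cons.inj h1).1 ▸ hw.mem.1)
      obtain ⟨p, hp, hp'⟩ := wordEval_brWord (K := K) hv
      have h1 := h0 _ hp'
      rw [Finsupp.sub_apply, sub_eq_zero] at h1
      rw [LinearMap.comp_apply, LinearMap.comp_apply, br_single, one_smul, lapply_apply, h1,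
        LinearMap.smul_apply, lapply_apply, smul_eq_mul]
      by_cases hvw : v = w
      · subst hvw
        have h2 := h0 _ hq'
        rw [Finsupp.sub_apply, sub_eq_zero, h1] at h2
        rw [h2, single_eq_same, single_eq_same, mul_one]
      · rw [single_eq_of_ne, single_eq_of_ne, mul_zero]
        · exact fun h => hvw h.symm
        · intro h
          obtain ⟨h2, h3⟩ := List.cons.inj h
          exact hvw (Prod.ext h2.symm (List.reverse_injective h3.symm))
    rw [h, map_zero, map_zero] at key
    exact (mul_eq_zero.1 key.symm).resolve_left hq
  · by_contra hne
    exact hw (hx (mem_support_iff.2 hne))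

end Commutator

/-! ### Multilinear elements of the Koszul dual as sums of trees. -/

section MultilinearPart

variable {K : Type u} [Field K] {Q : QuadData.{u, v} K} {n : ℕ}

open Free Finsupp

theorem std_gr_eq_bot {i : ℤ} (hi : i ≠ 0) {x : std K n} (hx : x ∈ (std K n).gr i) : x = 0 := by
  have h : x ∈ (if i = 0 then (⊤ : Submodule K (Fin n → K)) else ⊥) := hx
  rw [if_neg hi] at h
  exact (Submodule.mem_bot K).1 h

theorem TreeMonomial.nonempty {S : Finset (Fin n)} {x : Tree Q (std K n)}
    (h : TreeMonomial Q n S x) : S.Nonempty := by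
  induction h with
  | leaf i => exact Finset.singleton_nonempty i
  | node e S T h x y hx hy ihx ihy => exact ihx.mono Finset.subset_union_left

theorem TreeMonomial.mem_gr {S : Finset (Fin n)} {x : Tree Q (std K n)}
    (h : TreeMonomial Q n S x) : x ∈ (Tree Q (std K n)).gr (S.card - 1) := by
  induction h with
  | leaf i =>
    rw [Finset.card_singleton, Nat.cast_one, sub_self]
    exact ι_mem (stdVec_mem i)
  | node e S T h x y hx hy ihx ihy =>
    have h1 : ((S ∪ T).card : ℤ) - 1 = 1 + (S.card - 1) + (T.card - 1) := by
      rw [Finset.card_union_of_disjoint h]; push_cast; ring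
    rw [h1]
    exact node_mem (Q := Q.magma) e ihx ihy

theorem mem_gr_of_mem_dualArity {S : Finset (Fin n)} {c : Dual Q (std K n)}
    (hc : c ∈ dualArity Q n S) : c ∈ (Dual Q (std K n)).gr (S.card - 1) := by
  have h : Dual.incl c ∈ (Tree Q (std K n)).gr (S.card - 1) :=
    (Submodule.span_le.2 fun x hx => TreeMonomial.mem_gr hx) hc
  have := Dual.retraction_mem _ _ h
  rwa [Dual.retraction_incl] at this

theorem dualArity_empty {c : Dual Q (std K n)} (hc : c ∈ dualArity Q n ∅) : c = 0 := by
  have h : Dual.incl c ∈ (⊥ : Submodule K (Tree Q (std K n))) :=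
    (Submodule.span_le.2 fun x hx => absurd (TreeMonomial.nonempty hx) Finset.not_nonempty_empty) hc
  exact Dual.incl_injective (((Submodule.mem_bot K).1 h).trans (map_zero _).symm)

theorem KoszulMonomial.exists_mem_gr {S : Finset (Fin n)} {x : Free Q 0 (Dual Q (std K n))}
    (h : KoszulMonomial Q n S x) : ∃ k, x ∈ (Free Q 0 (Dual Q (std K n))).gr k := by
  induction h with
  | gen S c hc => exact ⟨_, ι_mem (mem_gr_of_mem_dualArity hc)⟩
  | node e S T h x y hx hy ihx ihy =>
    obtain ⟨i, hi⟩ := ihx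
    obtain ⟨j, hj⟩ := ihy
    exact ⟨_, node_mem e hi hj⟩

theorem stdBasis_mem : ∀ i : Fin n, (Pi.basisFun K (Fin n) : Module.Basis (Fin n) K (std K n)) i ∈
    (std K n).gr ((fun _ => 0) i) := by
  intro i
  have h := Pi.basisFun_apply K (Fin n) i
  exact h ▸ stdVec_mem i

/-- The splitting of trees into square free multidegrees. -/
def treeMulti (Q : QuadData.{u, v} K) (n : ℕ) :
    Tree Q (std K n) →ₗ[K] ((Fin n → ℕ) →₀ Tree Q (std K n)) :=
  treeMap _ (polar (V := std K n) (Pi.basisFun K (Fin n)) id)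
    (polar_mem _ (fun _ => 0) stdBasis_mem id) Q

theorem treeMulti_node (e : Q.E) (x y : Tree Q (std K n)) :
    treeMulti Q n (Tree.node Q e x y) = cmul (signCoef K fun _ => 0) (Tree Q (std K n)).parity
      (Tree.node Q) e (treeMulti Q n x) (treeMulti Q n y) := treeMap_node ..

/-- The multidegree of a set of letters. -/
def setDeg (S : Finset (Fin n)) : Fin n → ℕ := fun i => if i ∈ S then 1 else 0

theorem msupp_setDeg (S : Finset (Fin n)) : msupp (setDeg S) = S := by
  ext i; simp [msupp, setDeg]

theorem signCoef_zero_deg (b : Fin n → ℕ) : (signCoef K (N := n) fun _ => 0).deg b = 0 := by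
  rw [signCoef_deg]
  exact Finset.sum_eq_zero fun i _ => zero_mul _

theorem treeMulti_of_mem {S : Finset (Fin n)} {x : Tree Q (std K n)}
    (hx : x ∈ Submodule.span K {x | TreeMonomial Q n S x}) :
    treeMulti Q n x = single (setDeg S) x := by
  refine LinearMap.eqOn_span (f := treeMulti Q n) (g := lsingle (setDeg S)) ?_ hx
  clear hx
  intro x hx
  change treeMulti Q n x = single (setDeg S) x
  induction hx with
  | leaf i =>
    have h1 : polar (V := std K n) (Pi.basisFun K (Fin n)) id (stdVec K n i) =
        single (Pi.single i 1) (stdVec K n i) := by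
      have h2 := polar_basis (V := std K n) (Pi.basisFun K (Fin n)) id i
      have h3 := Pi.basisFun_apply K (Fin n) i
      have h4 : polar (V := std K n) (Pi.basisFun K (Fin n)) id (stdVec K n i) = _ :=
        (congrArg _ h3.symm).trans h2
      refine (h4.trans (Finset.sum_eq_single i (fun j _ hj => if_neg hj)
        (fun h => absurd (Finset.mem_univ i) h))).trans (if_pos rfl)
    have h5 : setDeg {i} = Pi.single i 1 := by
      funext j
      simp [setDeg, Pi.single_apply]
    have h6 : treeMulti Q n (Tree.leaf Q (stdVec K n i)) = cmap _ (Tree.leaf Q)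
        (polar (V := std K n) (Pi.basisFun K (Fin n)) id (stdVec K n i)) := treeMap_leaf ..
    have h7 : treeMulti Q n (Tree.leaf Q (stdVec K n i)) =
        single (setDeg {i}) (Tree.leaf Q (stdVec K n i)) := by
      rw [h6, h1, h5, cmap_single]
    exact h7
  | node e S T h x y hx hy ihx ihy =>
    rw [treeMulti_node, ihx, ihy, cmul_single, signCoef_zero_deg, parZ_zero]
    have h1 : setDeg S + setDeg T = setDeg (S ∪ T) := by
      funext i
      have : i ∈ S → i ∉ T := fun h' => Finset.disjoint_left.1 h h'
      by_cases h1 : i ∈ S <;> by_cases h2 : i ∈ T <;> simp_all [setDeg]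
    have h2 : (signCoef K (N := n) fun _ => 0).σ (setDeg S) (setDeg T) = 1 := by
      rw [signCoef_σ, if_pos]
      · have : shuffleExp (fun _ => 0) (setDeg S) (setDeg T) = 0 := by simp [shuffleExp]
        rw [this, ksign_zero]
      · intro i
        have : i ∈ S → i ∉ T := fun h' => Finset.disjoint_left.1 h h'
        by_cases h1 : i ∈ S <;> by_cases h2 : i ∈ T <;> simp_all [setDeg]
    rw [h1, h2, one_smul]

/-- The splitting of a tree with subtrees in the Koszul dual. -/
theorem treeMulti_node_mem {S : Finset (Fin n)} {U : Submodule K (Tree Q (std K n))} (e : Q.E)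
    (h : ∀ A B, Disjoint A B → A ∪ B = S → ∀ a ∈ dualArity Q n A, ∀ b ∈ dualArity Q n B,
      Tree.node Q e (Dual.incl a) (Dual.incl b) ∈ U) (x y : Dual Q (std K n)) :
    treeMulti Q n (Tree.node Q e (Dual.incl x) (Dual.incl y)) (setDeg S) ∈ U := by
  rw [treeMulti_node]
  have h1 : ∀ (x : Dual Q (std K n)) b, treeMulti Q n (Dual.incl x) b ∈
      (dualArity Q n (msupp b)).map Dual.incl := by
    intro x b
    refine ⟨_, dualMap_polar_mem (V := std K n) _ (fun _ => 0) stdBasis_mem id x b, ?_⟩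
    exact DFunLike.congr_fun (incl_dualMap _ _ _ x) b
  have := cmul_mem (signCoef K fun _ => 0) (Tree Q (std K n)).parity (Tree.node Q)
    (fun b => (dualArity Q n (msupp b)).map Dual.incl)
    (fun b => (dualArity Q n (msupp b)).map Dual.incl)
    (fun b => ⨅ _ : msupp b = S, U) e ?_ (h1 x) (h1 y) (setDeg S)
  · exact (Submodule.mem_iInf _).1 this (msupp_setDeg S)
  · rintro b b' hσ _ ⟨c, hc, rfl⟩ _ ⟨c', hc', rfl⟩
    rw [Submodule.mem_iInf]
    intro hb
    rw [signCoef_zero_deg, parZ_zero]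
    exact h _ _ (disjoint_msupp (signCoef_σ_ne_zero hσ)) (by rw [← msupp_add, hb]) c hc c' hc'

/-- Multilinear elements of the Koszul dual of positive degree are sums of trees with multilinear
subtrees in the Koszul dual. -/
theorem incl_mem_of_mem_dualArity {S : Finset (Fin n)} (hS : 2 ≤ S.card)
    {U : Submodule K (Tree Q (std K n))}
    (h : ∀ e A B, Disjoint A B → A ∪ B = S → ∀ a ∈ dualArity Q n A, ∀ b ∈ dualArity Q n B,
      Tree.node Q e (Dual.incl a) (Dual.incl b) ∈ U) {c : Dual Q (std K n)}
    (hc : c ∈ dualArity Q n S) : Dual.incl c ∈ U := by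
  -- A multilinear element equals its own component of multidegree `S`. Applied to any expression of
  -- it by trees with branches in the Koszul dual, this projection makes the branches multilinear
  -- while keeping them in the Koszul dual.
  have h1 : Dual.incl c = treeMulti Q n (Dual.incl c) (setDeg S) := by
    rw [treeMulti_of_mem hc, single_eq_same]
  obtain ⟨_, ⟨v, hv, rfl⟩, t, ⟨ht, -⟩, hsum⟩ :=
    Submodule.mem_sup.1 (dualPart_le _ (Dual.mem_gr.1 (mem_gr_of_mem_dualArity hc)))
  -- The leaf part vanishes for degree reasons, as `|S| - 1 ≥ 1` and the generators have degree
  -- zero.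
  rw [std_gr_eq_bot (by omega) hv, map_zero, zero_add] at hsum
  rw [h1, ← hsum]
  clear hsum
  induction ht using Submodule.span_induction with
  | mem t ht =>
    obtain ⟨e, p, q, x, hx, y, hy, _, rfl⟩ := ht
    obtain ⟨x', _, rfl⟩ := Dual.exists_incl hx
    obtain ⟨y', _, rfl⟩ := Dual.exists_incl hy
    exact treeMulti_node_mem e (h e) x' y'
  | zero => rw [map_zero, Finsupp.zero_apply]; exact zero_mem _
  | add t t' _ _ h1 h2 => rw [map_add, Finsupp.add_apply]; exact add_mem h1 h2
  | smul c t _ h1 => rw [map_smul, Finsupp.smul_apply]; exact Submodule.smul_mem _ _ h1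

end MultilinearPart

/-! ### The multilinear Koszul dual of the Lie operad is one-dimensional. -/

section LieUniqueness

variable {K : Type u} [Field K] [CharZero K] {n : ℕ}

open Free Finsupp

variable (K) in
/-- The trees with two letters corresponding to brackets of length two. -/
def pairTree : (LieWord n →₀ K) →ₗ[K] Tree (lieData K) (std K n) :=
  linearCombination K fun w => match w.2 with
    | [B] => Tree.node (lieData K) (1 : K) (lieTree K w.1) (lieTree K B)
    | _ => 0

theorem pairTree_single (A B : Finset (Fin n)) (c : K) : pairTree K (single (A, [B]) c) =
    c • Tree.node (lieData K) (1 : K) (lieTree K A) (lieTree K B) := by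
  rw [pairTree, linearCombination_single]

/-- Brackets of length two with letters a partition of `S`. -/
abbrev pairW (K : Type u) [Field K] {n : ℕ} (x0 : Fin n) (S : Finset (Fin n)) :
    Submodule K (LieWord n →₀ K) :=
  supported K K {w | ∃ A ∈ splitsAt x0 S, w = (A, [S \ A])}

theorem pairW_le (x0 : Fin n) (S : Finset (Fin n)) : pairW K x0 S ≤ goodW K x0 S :=
  supported_mono (by rintro _ ⟨A, hA, rfl⟩; exact .pair hA)

theorem eps_smul_node_swap {A B : Finset (Fin n)} (hd : Disjoint A B) :
    eps K A B • Tree.node (lieData K) (1 : K) (lieTree K A) (lieTree K B) =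
      eps K B A • Tree.node (lieData K) (1 : K) (lieTree K B) (lieTree K A) := by
  have h1 := node_symm (Q := (lieData K).magma) (1 : K) (lieTree_mem_gr K A) (lieTree_mem_gr K B)
  have h2 : (lieData K).magma.τ (1 : K) = -(1 : K) := rfl
  rw [h2, map_neg, LinearMap.neg_apply, LinearMap.neg_apply] at h1
  have h3 : -Tree.node (lieData K) (1 : K) (lieTree K A) (lieTree K B) =
    ksign K ((A.card - 1) * (B.card - 1)) • Tree.node (lieData K) (1 : K) (lieTree K B)
      (lieTree K A) := h1
  rw [eps_symm hd, neg_smul, ← smul_neg, h3, smul_smul, mul_right_comm, ksign_sq, one_mul]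

theorem pairTree_dWord {x0 : Fin n} {S : Finset (Fin n)} (hS : S.card ≠ 1) (hx : x0 ∈ S) :
    pairTree K (dWord K x0 S []) = lieTree K S := by
  rw [lieTree_of_card_ne K hS, sum_splits_fold hx (fun A B => eps K A B •
    Tree.node (lieData K) (1 : K) (lieTree K A) (lieTree K B))
    fun A _ => eps_smul_node_swap Finset.disjoint_sdiff, ← two_smul K, smul_smul,
    inv_mul_cancel₀ two_ne_zero, one_smul, dWord, map_sum]
  exact Finset.sum_congr rfl fun A _ => pairTree_single ..

theorem retractFree_cut_pairTree {x0 : Fin n} {S : Finset (Fin n)} {x : LieWord n →₀ K}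
    (hx : x ∈ pairW K x0 S) : retractFree (lieData K) (std K n)
      (cut (lieData K) (std K n) (pairTree K x)) = lieBr K n x := by
  refine eqOn_supported (f := retractFree (lieData K) (std K n) ∘ₗ cut (lieData K) (std K n) ∘ₗ
    pairTree K) (g := lieBr K n) ?_ hx
  rintro _ ⟨A, _, rfl⟩
  rw [LinearMap.comp_apply, LinearMap.comp_apply, pairTree_single, one_smul, br_single, one_smul,
    ← incl_lieDual, ← incl_lieDual, retractFree_cut_node]
  rfl

theorem hW_mem_span {x0 : Fin n} {S : Finset (Fin n)} {x : LieWord n →₀ K}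
    (hx : x ∈ pairW K x0 S) : hW K x0 x ∈ Submodule.span K {single ((S, []) : LieWord n) (1 : K)} := by
  refine map_supported_le ?_ hx
  rintro _ ⟨A, hA, rfl⟩
  rw [hW_single, one_smul, hWord]
  split_ifs with h
  · subst h
    rw [Finset.insert_eq, Finset.union_sdiff_of_subset (mem_splits.1 (Finset.mem_filter.1 hA).1).1]
    refine Submodule.mem_span_singleton.2 ⟨eps K {x0} (S \ {x0}), ?_⟩
    rw [smul_single, smul_eq_mul, mul_one]
  · exact zero_mem _

/-- By induction, `c` is a sum of trees on two known elements, encoded by a combination `w` of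
brackets of length two. Since the Koszul differential squares to zero and good words are
independent, `w` is a cycle, hence `w = d h w`. But `h w` is a multiple of the single letter `S`,
and the differential of that letter encodes `lieTree K S`. -/
theorem dualArity_lie_aux {S : Finset (Fin n)} (hS : 2 ≤ S.card)
    (ih : ∀ A ∈ splits S, dualArity (lieData K) n A ≤ Submodule.span K {lieDual K A})
    {c : Dual (lieData K) (std K n)} (hc : c ∈ dualArity (lieData K) n S) :
    c ∈ Submodule.span K {lieDual K S} := by
  obtain ⟨x0, hx0⟩ : S.Nonempty := Finset.card_pos.1 (by omega)
  obtain ⟨w, hw, hwc⟩ : Dual.incl c ∈ (pairW K x0 S).map (pairTree K) := by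
    refine incl_mem_of_mem_dualArity hS (fun e A B hd hAB a ha b hb => ?_) hc
    rcases A.eq_empty_or_nonempty with rfl | hA
    · rw [dualArity_empty ha, map_zero, map_zero, LinearMap.zero_apply]; exact zero_mem _
    rcases B.eq_empty_or_nonempty with rfl | hB
    · rw [dualArity_empty hb, map_zero, map_zero]; exact zero_mem _
    have h1 : S \ A = B := by
      rw [← hAB, Finset.union_sdiff_left, Finset.sdiff_eq_self_of_disjoint hd.symm]
    have h1' : S \ B = A := by
      rw [← hAB, Finset.union_sdiff_right, Finset.sdiff_eq_self_of_disjoint hd]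
    have hAS : A ∈ splits S :=
      mem_splits.2 ⟨hAB ▸ Finset.subset_union_left, hA, by rwa [h1]⟩
    have hBS : B ∈ splits S := h1 ▸ sdiff_mem_splits hAS
    obtain ⟨p, rfl⟩ := Submodule.mem_span_singleton.1 (ih A hAS ha)
    obtain ⟨q, rfl⟩ := Submodule.mem_span_singleton.1 (ih B hBS hb)
    have h2 : Tree.node (lieData K) e = (e : K) • Tree.node (lieData K) (V := std K n) (1 : K) := by
      rw [← map_smul]
      exact congrArg _ (mul_one (e : K)).symm
    rw [h2, map_smul, map_smul, map_smul, LinearMap.smul_apply, LinearMap.smul_apply, map_smul]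
    refine Submodule.smul_mem _ _ (Submodule.smul_mem _ _ (Submodule.smul_mem _ _ ?_))
    rw [incl_lieDual, incl_lieDual]
    have h3 : x0 ∈ A ∨ x0 ∈ B := Finset.mem_union.1 (hAB ▸ hx0)
    rcases h3 with h3 | h3
    · refine ⟨single (A, [S \ A]) 1, single_mem_supported K _
        ⟨A, Finset.mem_filter.2 ⟨hAS, h3⟩, rfl⟩, ?_⟩
      rw [pairTree_single, one_smul, h1]
    -- When `x0` lies in the second branch, the branches are exchanged; both signs `eps` appear
    -- because the symmetric expression is `eps` times the vertex.
    · have h4 : Tree.node (lieData K) (1 : K) (lieTree K A) (lieTree K B) = (eps K A B * eps K B A) •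
          Tree.node (lieData K) (1 : K) (lieTree K B) (lieTree K A) := by
        rw [mul_smul, ← eps_smul_node_swap hd, smul_smul, eps_mul_self, one_smul]
      rw [h4]
      refine ⟨single (B, [S \ B]) (eps K A B * eps K B A), single_mem_supported K _
        ⟨B, Finset.mem_filter.2 ⟨hBS, h3⟩, rfl⟩, ?_⟩
      rw [pairTree_single, h1']
  -- The differential of the generator `c` is minus its cut into two branches, that is, minus the
  -- brackets recorded by `w`.
  have h1 : -koszulD (lieData K) (std K n) (ι c) = lieBr K n w := by
    rw [koszulD, der_ι, cobar_eq, neg_neg, ← hwc, retractFree_cut_pairTree hw]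
  have h2 := (isLieFamily_lieDual K).map_br (pairW_le x0 S hw)
  have h3 : lieBr K n (dW K x0 w) = 0 := by
    refine h2.symm.trans ?_
    change -koszulD (lieData K) (std K n) (lieBr K n w) = 0
    rw [← h1, map_neg, neg_neg, koszulD_koszulD]
  have h4 := homotopy hS (pairW_le x0 S hw)
  rw [br_injOn (dW_mem (pairW_le x0 S hw)) h3, map_zero, add_zero] at h4
  obtain ⟨a, ha⟩ := Submodule.mem_span_singleton.1 (hW_mem_span hw)
  rw [← ha, map_smul, dW_single, one_smul] at h4
  refine Submodule.mem_span_singleton.2 ⟨a, Dual.incl_injective ?_⟩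
  rw [map_smul, incl_lieDual, ← pairTree_dWord (by omega) hx0, ← map_smul, h4, hwc]

/-- The multilinear parts of the Koszul dual of the Lie operad are one-dimensional. -/
theorem dualArity_lie_le (S : Finset (Fin n)) :
    dualArity (lieData K) n S ≤ Submodule.span K {lieDual K S} := by
  induction hm : S.card using Nat.strong_induction_on generalizing S with
  | h m ih =>
    subst hm
    intro c hc
    rcases Nat.lt_or_ge S.card 2 with h | h
    · rcases S.eq_empty_or_nonempty with rfl | hne
      · rw [dualArity_empty hc]; exact zero_mem _
      · obtain ⟨i, rfl⟩ := Finset.card_eq_one.1 (show S.card = 1 by have := hne.card_pos; omega)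
        have h1 : Dual.incl c ∈ Submodule.span K {lieTree K {i}} := by
          refine (Submodule.span_le.2 ?_) hc
          intro x hx
          refine Submodule.subset_span ?_
          rw [lieTree_singleton]
          clear h ih hne hc
          -- The singleton is replaced by a variable so that induction on monomials applies; a
          -- vertex is impossible, as it would need two disjoint nonempty sets of leaves.
          obtain ⟨S, hS⟩ : ∃ S, S = ({i} : Finset (Fin n)) := ⟨_, rfl⟩
          rw [← hS] at hx
          induction hx with
          | leaf j => rw [Finset.singleton_injective hS]; rfl
          | node e S T h x y hx hy =>
            exfalso
            have h1 := hx.nonempty.card_pos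
            have h2 := hy.nonempty.card_pos
            have h3 := congrArg Finset.card hS
            rw [Finset.card_union_of_disjoint h, Finset.card_singleton] at h3
            omega
        obtain ⟨a, ha⟩ := Submodule.mem_span_singleton.1 h1
        exact Submodule.mem_span_singleton.2 ⟨a, Dual.incl_injective (by
          rw [map_smul, incl_lieDual, ha])⟩
    · exact dualArity_lie_aux h (fun A hA => ih _ (card_lt_of_mem_splits hA) A rfl) hc

end LieUniqueness

/-! ### The Lie operad is Koszul. -/

section LieKoszul

variable {K : Type u} [Field K] [CharZero K] {n : ℕ}

open Free Finsupp

theorem node_eq_smul {V : GMod.{u, w} K} (e : K) (x y : Free (lieData K) 0 V) :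
    Free.node (Q := lieData K) e x y = e • Free.node (Q := lieData K) (1 : K) x y := by
  have h : Free.node (Q := lieData K) (s := 0) (V := V) e =
      e • Free.node (Q := lieData K) (1 : K) := by
    rw [← map_smul]
    exact congrArg _ (mul_one e).symm
  rw [h, LinearMap.smul_apply, LinearMap.smul_apply]

/-- In this form of the Jacobi identity the sign involves only `y` and `z`, so it extends by
linearity to inhomogeneous `x`. -/
theorem node_jacobi {V : GMod.{u, w} K} (x : Free (lieData K) 0 V) {j k : ℤ}
    {y z : Free (lieData K) 0 V} (hy : y ∈ (Free (lieData K) 0 V).gr j)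
    (hz : z ∈ (Free (lieData K) 0 V).gr k) :
    Free.node (Q := lieData K) (1 : K) x (Free.node (Q := lieData K) (1 : K) y z) =
      Free.node (Q := lieData K) (1 : K) (Free.node (Q := lieData K) (1 : K) x y) z -
      ksign K (j * k) •
        Free.node (Q := lieData K) (1 : K) (Free.node (Q := lieData K) (1 : K) x z) y := by
  induction x using (Free (lieData K) 0 V).induction_homog with
  | h i x hx => exact (isAlg (Q := lieData K) (s := 0) (V := V)).lie_jacobi hx hy hz
  | hadd x x' h h' =>
    simp only [map_add, LinearMap.add_apply, smul_add, h, h']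
    abel

/-- Bracketing a left normed bracket with a monomial. -/
theorem node_br_mem {x0 : Fin n} {T : Finset (Fin n)}
    {y : Free (lieData K) 0 (Dual (lieData K) (std K n))} (hy : KoszulMonomial (lieData K) n T y) :
    ∀ S, Disjoint S T → ∀ z ∈ (goodW K x0 S).map (lieBr K n),
      Free.node (Q := lieData K) (1 : K) z y ∈ (goodW K x0 (S ∪ T)).map (lieBr K n) := by
  induction hy with
  | gen T c hc =>
    rintro S hd _ ⟨w, hw, rfl⟩
    rcases T.eq_empty_or_nonempty with rfl | hT
    · rw [dualArity_empty hc, map_zero, map_zero]; exact zero_mem _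
    obtain ⟨a, rfl⟩ := Submodule.mem_span_singleton.1 (dualArity_lie_le T hc)
    rw [map_smul, map_smul]
    refine Submodule.smul_mem _ _ ⟨wcons K T w, wcons_mem (fun w hw => ?_) hw, br_wcons ..⟩
    exact .cons _ _ _ _ hT hd hw
  | node e T T' h y y' hy hy' ih ih' =>
    intro S hd z hz
    obtain ⟨j, hj⟩ := hy.exists_mem_gr
    obtain ⟨k, hk⟩ := hy'.exists_mem_gr
    obtain ⟨h1, h2⟩ := Finset.disjoint_union_right.1 hd
    -- Jacobi unrolls a bracket on the right into successive brackets with its two factors, to which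
    -- the induction hypotheses apply in either order.
    rw [node_eq_smul e y y', map_smul, node_jacobi z hj hk]
    refine Submodule.smul_mem _ _ (sub_mem ?_ (Submodule.smul_mem _ _ ?_))
    · rw [← Finset.union_assoc]
      exact ih' _ (Finset.disjoint_union_left.2 ⟨h2, h⟩) _ (ih S h1 z hz)
    · rw [Finset.union_comm T T', ← Finset.union_assoc]
      exact ih _ (Finset.disjoint_union_left.2 ⟨h1, h.symm⟩) _ (ih' S h2 z hz)

/-- Antisymmetry moves the factor containing `x0` to the left; that factor is a combination of left
normed brackets by induction, and `node_br_mem` absorbs the other one. -/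
theorem KoszulMonomial.mem_br {x0 : Fin n} {S : Finset (Fin n)}
    {x : Free (lieData K) 0 (Dual (lieData K) (std K n))} (hx : KoszulMonomial (lieData K) n S x)
    (h0 : x0 ∈ S) : x ∈ (goodW K x0 S).map (lieBr K n) := by
  induction hx with
  | gen S c hc =>
    obtain ⟨a, rfl⟩ := Submodule.mem_span_singleton.1 (dualArity_lie_le S hc)
    refine ⟨single (S, []) a, single_mem_supported K _ (.base S h0), ?_⟩
    rw [br_single, map_smul]
    rfl
  | node e S T h x y hx hy ihx ihy =>
    rw [node_eq_smul]
    refine Submodule.smul_mem _ _ ?_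
    rcases Finset.mem_union.1 h0 with h0 | h0
    · exact node_br_mem hy S h x (ihx h0)
    · obtain ⟨i, hi⟩ := hx.exists_mem_gr
      obtain ⟨j, hj⟩ := hy.exists_mem_gr
      rw [(isAlg (Q := lieData K)).lie_antisymm hi hj, Finset.union_comm]
      exact neg_mem (Submodule.smul_mem _ _ (node_br_mem hx T h.symm y (ihy h0)))

theorem GoodWord.koszulMonomial {x0 : Fin n} {S : Finset (Fin n)} {w : LieWord n}
    (hw : GoodWord x0 S w) : KoszulMonomial (lieData K) n S
      (brWord Free.node (fun S => ι (lieDual K S)) w.1 w.2) := by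
  induction hw with
  | base A h => exact .gen _ _ (lieDual_mem_dualArity K A)
  | cons S A B r hB hd h ih =>
    exact .node (Q := lieData K) (1 : K) S B hd _ _ ih (.gen _ _ (lieDual_mem_dualArity K B))

/-- The Lie operad is Koszul. -/
theorem isKoszul_lieData : (lieData K).IsKoszul := by
  intro n hn x hx hd
  let x0 : Fin n := ⟨0, by omega⟩
  have hcard : 2 ≤ (Finset.univ : Finset (Fin n)).card := by rwa [Finset.card_univ, Fintype.card_fin]
  -- Every multilinear element is a combination of good words for the chosen letter, so the problem
  -- moves to the contractible complex of words.
  obtain ⟨w, hw, rfl⟩ : x ∈ (goodW K x0 Finset.univ).map (lieBr K n) :=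
    (Submodule.span_le.2 fun y hy => KoszulMonomial.mem_br hy (Finset.mem_univ x0)) hx
  have hD : ∀ w ∈ goodW K x0 Finset.univ,
      -koszulD (lieData K) (std K n) (lieBr K n w) = lieBr K n (dW K x0 w) :=
    fun w hw => (isLieFamily_lieDual K).map_br hw
  have h1 := hD w hw
  rw [hd, neg_zero] at h1
  have h2 := homotopy hcard hw
  -- Independence of good words turns the cycle condition in the Koszul complex into one on words,
  -- and the homotopy then exhibits `w` as a boundary.
  rw [br_injOn (dW_mem hw) h1.symm, map_zero, add_zero] at h2
  have h3 : hW K x0 w ∈ goodW K x0 Finset.univ := hW_mem hw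
  refine ⟨-lieBr K n (hW K x0 w), neg_mem ?_, ?_⟩
  · exact map_supported_le (fun v hv => by
      rw [br_single, one_smul]
      exact Submodule.subset_span (GoodWord.koszulMonomial hv)) h3
  · rw [map_neg, hD _ h3, h2]

end LieKoszul

/-! ### The lower central series and the operadic filtration. -/

namespace DGLie

variable {K : Type u} [Field K] {g : DGLie.{u, w} K}

theorem parity_bracket (x y : g) : g.parity (g.bracket x y) =
    g.bracket (g.parity x) (g.parity y) := by
  have h := g.toDGAlg.parity_μ (1 : K) x y
  have h1 : ∀ x y : g, g.toDGAlg.μ (1 : K) x y = g.bracket x y :=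
    fun x y => one_smul K (g.bracket x y)
  exact (congrArg _ (h1 x y)).symm.trans (h.trans (h1 _ _))

theorem bracket_mem_lcs_succ {m : ℕ} (x : g) {y : g} (hy : y ∈ g.lcs m) :
    g.bracket x y ∈ g.lcs (m + 1) := Submodule.subset_span ⟨x, y, hy, rfl⟩

theorem parity_mem_lcs {m : ℕ} {x : g} (hx : x ∈ g.lcs m) : g.parity x ∈ g.lcs m := by
  induction m generalizing x with
  | zero => trivial
  | succ m ih =>
    have h : g.lcs (m + 1) ≤ (g.lcs (m + 1)).comap g.parity := by
      refine Submodule.span_le.2 ?_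
      rintro _ ⟨x, y, hy, rfl⟩
      have h1 : g.parity (g.bracket x y) ∈ g.lcs (m + 1) := by
        rw [parity_bracket]; exact bracket_mem_lcs_succ _ (ih hy)
      exact h1
    exact h hx

theorem bracket_bracket {i : ℤ} {u : g} (hu : u ∈ g.gr i) (v y : g) :
    g.bracket (g.bracket u v) y = g.bracket u (g.bracket v y) -
      g.bracket (parZ g.parity i v) (g.bracket u y) := by
  induction v using g.toGMod.induction_homog with
  | h j v hv =>
    rw [g.jacobi i j u hu v hv, parZ_of_mem g.parity (fun _ _ => g.parity_of_mem) i j hv, map_smul,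
      LinearMap.smul_apply, add_sub_cancel_right]
  | hadd v v' h h' =>
    simp only [map_add, LinearMap.add_apply, h, h']
    abel

/-- This is `[L^p, L^q] ⊆ L^{p+q}`, by induction on the left index through the Jacobi identity; the
extra `+ 1` comes from `lcs n` being `L^{n+1}`. -/
theorem bracket_mem_lcs {p : ℕ} : ∀ {q : ℕ} {x y : g}, x ∈ g.lcs p → y ∈ g.lcs q →
    g.bracket x y ∈ g.lcs (p + q + 1) := by
  induction p with
  | zero => intro q x y _ hy; rw [zero_add]; exact bracket_mem_lcs_succ x hy
  | succ p ih =>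
    intro q x y hx hy
    have h : g.lcs (p + 1) ≤ (g.lcs (p + 1 + q + 1)).comap (g.bracket.flip y) := by
      refine Submodule.span_le.2 ?_
      rintro _ ⟨u, v, hv, rfl⟩
      have h1 : g.bracket (g.bracket u v) y ∈ g.lcs (p + 1 + q + 1) := by
        induction u using g.toGMod.induction_homog with
        | h i u hu =>
          rw [bracket_bracket hu]
          refine sub_mem ?_ ?_
          · have := bracket_mem_lcs_succ u (ih hv hy)
            rwa [show p + 1 + q + 1 = p + q + 1 + 1 by omega]
          · have := ih (parZ_mem_submodule (fun _ => parity_mem_lcs) i hv)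
              (bracket_mem_lcs_succ u hy)
            rwa [show p + 1 + q + 1 = p + (q + 1) + 1 by omega]
        | hadd u u' h h' =>
          rw [map_add, LinearMap.add_apply, map_add, LinearMap.add_apply]
          exact add_mem h h'
      exact h1
    exact h hx

/-- The operadic filtration allows arbitrary bracketings, the lower central series only nested ones;
`bracket_mem_lcs` puts the former inside the latter. Nilpotence in the sense of the lower central
series thus implies operadic nilpotence. -/
theorem opFilt_le_lcs (m : ℕ) {x : g} (hx : x ∈ g.toDGAlg.opFilt (m + 1)) : x ∈ g.lcs m := by
  let L : ℕ → Submodule K g.toDGAlg := g.lcs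
  have key : ∀ {k : ℕ} {a : g.toDGAlg}, g.toDGAlg.IsMonomial k a → ∀ m, k = m + 1 → a ∈ L m := by
    intro k a h
    induction h with
    | one a =>
      intro m hm
      obtain rfl : m = 0 := by omega
      trivial
    | node e k l a b ha hb iha ihb =>
      intro m hm
      have h1 := ha.pos
      have h2 := hb.pos
      have h3 := bracket_mem_lcs (iha (k - 1) (by omega)) (ihb (l - 1) (by omega))
      rw [show k - 1 + (l - 1) + 1 = m by omega] at h3
      exact Submodule.smul_mem _ (e : K) h3
  exact (Submodule.span_le.2 fun a ha => key ha m rfl : _ ≤ L m) hx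

theorem IsNilpotent.toDGAlg (h : g.IsNilpotent) : g.toDGAlg.IsNilpotent := by
  intro k
  obtain ⟨m, hm⟩ := h k
  exact ⟨m + 1, by omega, fun a ha => hm a (opFilt_le_lcs m ha)⟩

end DGLie

theorem DGLie.homotopyComplete {K : Type u} [Field K] [CharZero K] (g : DGLie.{u, w} K)
    (hg : (g.IsNilpotent ∧ g.IsNonneg) ∨ g.IsStrictlyNegative) : g.HomotopyComplete := by
  refine Koszul.homotopyComplete isKoszul_lieData ?_
  rcases hg with ⟨h1, h2⟩ | h
  · exact Or.inl ⟨h2, h1.toDGAlg⟩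
  · exact Or.inr (Or.inr h)

end Koszul

end

theorem mainTheorem4 {K : Type u} [Field K] [CharZero K] :
    (∀ Q : Koszul.QuadData.{u, v} K, Q.IsKoszul → ∀ A : Koszul.DGAlg.{u, v, w} Q,
      ((A.IsNonneg ∧ A.IsNilpotent) ∨ A.IsStrictlyPositive ∨ A.IsStrictlyNegative) →
        A.HomotopyComplete) ∧
    (∀ g : Koszul.DGLie.{u, w} K,
      ((g.IsNilpotent ∧ g.IsNonneg) ∨ g.IsStrictlyNegative) → g.HomotopyComplete) := by
  exact ⟨fun Q hQ A hA => Koszul.homotopyComplete hQ hA, fun g hg => g.homotopyComplete hg⟩
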